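/- All graphs are finite, simple, undirected and unweighted. For a connected graph $H$, let $W(H)=\sum_{\{u,v\}\subseteq V(H)} d_H(u,v)$ be its Wiener index, where $d_H$ is the shortest-path distance in $H$. Given a connected graph $G$ on $n\ge 1$ vertices and a set $Q\subseteq V(G)$, a connector for $Q$ in $G$ is a connected subgraph of $G$ that contains $Q$; the problem Min Wiener Connector asks for a connector for $Q$ in $G$ with smallest Wiener index among all connectors (given by its vertex set $S$, standing for the induced subgraph $G[S]$). Theorem. Min Wiener Connector can be solved exactly in polynomial time when $|Q|=O(1)$. That is, there are a function $f:\mathbb{N}\to\mathbb{N}$ and a single algorithm (a program for a random access machine with unit-cost addition and subtraction and without multiplication, which is given the adjacency matrix of $G$ and the indicator vector of $Q$) that, for every connected graph $G$ on $n$ vertices and every $Q\subseteq V(G)$, halts after at most $\max(n,2)^{f(|Q|)}$ steps (so at most $n^{f(|Q|)}$ steps if $n\ge 2$) and outputs a vertex set $S$ such that $G[S]$ is a connector for $Q$ in $G$ of smallest Wiener index. -/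

import Mathlib

namespace MinWiener

/-! ### Connectors and the Wiener index -/

open Classical in
/-- The Wiener index of a finite graph: the sum of the shortest-path distances over all unordered
pairs of vertices (a pair `{u, u}` contributes `0`). -/
noncomputable def wienerIndex {V : Type*} [Fintype V] (G : SimpleGraph V) : ℕ :=
  ∑ e : Sym2 V, Sym2.lift ⟨fun u v => G.dist u v, fun _ _ => SimpleGraph.dist_comm⟩ e

open Classical in
/-- The Wiener index of a subgraph `H` of a finite graph, with distances measured inside `H`. -/
noncomputable def subgraphWienerIndex {V : Type*} [Fintype V] {G : SimpleGraph V}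
    (H : G.Subgraph) : ℕ :=
  wienerIndex H.coe

/-- A connector for `Q` in `G`: a connected (not necessarily induced) subgraph of `G`
that contains `Q`. -/
def IsConnector {V : Type*} {G : SimpleGraph V} (Q : Finset V) (H : G.Subgraph) : Prop :=
  (Q : Set V) ⊆ H.verts ∧ H.Connected

/-- `H` is a connector for `Q` of smallest Wiener index among all connectors. -/
def IsMinWienerConnector {V : Type*} [Fintype V] {G : SimpleGraph V} (Q : Finset V)
    (H : G.Subgraph) : Prop :=
  IsConnector Q H ∧
    ∀ H' : G.Subgraph, IsConnector Q H' → subgraphWienerIndex H ≤ subgraphWienerIndex H'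

/-! ### Random access machine -/

/-- A state of the machine: registers and an addressable memory, both holding natural numbers. -/
structure State where
  reg : ℕ → ℕ
  mem : ℕ → ℕ

/-- Replace the content of register `r` by `x`. -/
def State.setReg (s : State) (r x : ℕ) : State :=
  { s with reg := Function.update s.reg r x }

/-- Replace the content of memory cell `a` by `x`. -/
def State.setMem (s : State) (a x : ℕ) : State :=
  { s with mem := Function.update s.mem a x }

/-- Structured programs for a random access machine with addition and truncated subtraction
(and no multiplication). The arguments named `r`, `a`, `b` are register numbers. -/
inductive Prog where
  /-- do nothing -/
  | skip : Prog
  /-- `reg r := c` -/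
  | const (r c : ℕ) : Prog
  /-- `reg r := reg a + reg b` -/
  | add (r a b : ℕ) : Prog
  /-- `reg r := reg a - reg b`, which is `0` if `reg a < reg b` -/
  | sub (r a b : ℕ) : Prog
  /-- `reg r := mem (reg a)` -/
  | load (r a : ℕ) : Prog
  /-- `mem (reg a) := reg b` -/
  | store (a b : ℕ) : Prog
  /-- run `p`, then `q` -/
  | seq (p q : Prog) : Prog
  /-- if `reg r ≠ 0` then run `p`, else run `q` -/
  | ite (r : ℕ) (p q : Prog) : Prog
  /-- as long as `reg r ≠ 0`, run `p` -/
  | loop (r : ℕ) (p : Prog) : Prog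

/-- `Runs p s t s'`: started in state `s`, the program `p` halts after exactly `t` steps in state
`s'`. Each elementary instruction and each evaluation of a test costs one step. -/
inductive Runs : Prog → State → ℕ → State → Prop where
  | skip (s : State) : Runs Prog.skip s 1 s
  | const (s : State) (r c : ℕ) : Runs (Prog.const r c) s 1 (s.setReg r c)
  | add (s : State) (r a b : ℕ) : Runs (Prog.add r a b) s 1 (s.setReg r (s.reg a + s.reg b))
  | sub (s : State) (r a b : ℕ) : Runs (Prog.sub r a b) s 1 (s.setReg r (s.reg a - s.reg b))
  | load (s : State) (r a : ℕ) : Runs (Prog.load r a) s 1 (s.setReg r (s.mem (s.reg a)))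
  | store (s : State) (a b : ℕ) : Runs (Prog.store a b) s 1 (s.setMem (s.reg a) (s.reg b))
  | seq {p q : Prog} {s₁ s₂ s₃ : State} {t₁ t₂ : ℕ} (hp : Runs p s₁ t₁ s₂)
      (hq : Runs q s₂ t₂ s₃) : Runs (Prog.seq p q) s₁ (t₁ + t₂) s₃
  | ite_true {r : ℕ} {p q : Prog} {s s' : State} {t : ℕ} (hr : s.reg r ≠ 0)
      (hp : Runs p s t s') : Runs (Prog.ite r p q) s (t + 1) s'
  | ite_false {r : ℕ} {p q : Prog} {s s' : State} {t : ℕ} (hr : s.reg r = 0)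
      (hq : Runs q s t s') : Runs (Prog.ite r p q) s (t + 1) s'
  | loop_done {r : ℕ} {p : Prog} {s : State} (hr : s.reg r = 0) : Runs (Prog.loop r p) s 1 s
  | loop_step {r : ℕ} {p : Prog} {s₁ s₂ s₃ : State} {t₁ t₂ : ℕ} (hr : s₁.reg r ≠ 0)
      (hp : Runs p s₁ t₁ s₂) (hl : Runs (Prog.loop r p) s₂ t₂ s₃) :
      Runs (Prog.loop r p) s₁ (t₁ + t₂ + 1) s₃

/-! ### Input and output of the algorithm -/

open Classical in
/-- The initial state for the input `(G, Q)`, where `G` is a graph on `{0, …, n - 1}`. All registers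
are `0`. Memory cell `0` holds `n`, the cells `1, …, n` hold the indicator vector of `Q`, the next
`n * n` cells hold the adjacency matrix of `G` row by row, and all other cells are `0`. -/
noncomputable def inputState {n : ℕ} (G : SimpleGraph (Fin n)) (Q : Finset (Fin n)) : State where
  reg := fun _ => 0
  mem := fun a =>
    if a = 0 then n
    else if (∃ i ∈ Q, a = 1 + (i : ℕ)) ∨
        (∃ i j : Fin n, G.Adj i j ∧ a = 1 + n + n * (i : ℕ) + (j : ℕ)) then 1
    else 0

/-- The state `s` presents the vertex set `S` as output: the memory cells `1, …, n` hold the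
indicator vector of `S`. -/
def IsOutput {n : ℕ} (s : State) (S : Finset (Fin n)) : Prop :=
  ∀ i : Fin n, s.mem (1 + (i : ℕ)) = if i ∈ S then 1 else 0

end MinWiener

/-! Let S be an optimal vertex set, H = G[S], k = |Q|, and let D be the largest distance in H
between two vertices of Q. The heart of the matter is a structural fact: H has at most 2^(O(k))
vertices of degree at least 3 (`exists_card_hubs_le`). Let B consist of these vertices and Q. Every
component of H - B has at most two edges to B, and folding it onto a fixed shortest path of G
between the ends of these edges is a surjection that increases no distance. So some union of at most
|B|^2 fixed shortest paths of G is optimal too (`exists_fold`, `exists_optimal_union`), and it is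
found by trying all choices of N = 2^(O(k)) pairs of end vertices.

Of optimality only one consequence is used: H is lean, that is, deleting vertices outside of Q
cannot lower the sum of distances if the rest stays connected. Every vertex has distance sum at
least D^2/4, and a comparison with the shortest paths from one required vertex to the others gives
|H| = O(k^2 D). If deleting Z stretches distances outside of a part I by at most x and all distances
by at most y, then |Z| D^2/4 is at most |H|^2 x + 2 |I| |H| y. For |I| small compared with D this is
`Tight`: a set whose removal can be bypassed cheaply is small. Leanness also makes balls of radius r
= D/2^j have size r times a polynomial in j and k (`IsLean.card_ball_le`). Hence, for j of order k,
each of them lies in a tight part with a polynomial number p of boundary vertices, and an average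
over the balls reduces the claim to a polynomial bound for the branching vertices of one tight part
(`card_branch_le_of_tight`).

A tight part I is decomposed into paths, called units. Heavy units are pieces of canonical shortest
paths between boundary vertices of I; what they do not cover is irrelevant for distances outside of
I. The rest is covered by ears, the light units. An ear runs through a largest uncovered component,
of size ξ; by tightness this component has two neighbours a, b that are at distance at least M ξ off
the component. They are not connected by light units and two heavy units (`not_reachable_zone`):
otherwise there is a long cycle with few light vertices, about half of which lies on one heavy unit,
and a large piece of this half could be bypassed cheaply along the other half. So every ear joins a
new pair of heavy units, and quadratically many ears suffice. Once everything is covered, a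
branching vertex has a neighbour on another unit, and the links between two given units span only a
short stretch (`UnitSystem.hullLe`); counting over pairs of units gives the bound.

The search is written in a small loop language in which the number of rounds of each loop is a
parameter fixed beforehand. Its running time is read off the syntax, and it is compiled to the
random access machine. -/

namespace MinWiener

/-! ### Walks that avoid a vertex set -/

section Basics
variable {V : Type*}

/-- The graph `H` without the edges that touch `Z`. -/
def avoid (H : SimpleGraph V) (Z : Set V) : SimpleGraph V where
  Adj u v := H.Adj u v ∧ u ∉ Z ∧ v ∉ Z
  symm := ⟨fun _ _ h => ⟨h.1.symm, h.2.2, h.2.1⟩⟩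
  loopless := ⟨fun _ h => H.irrefl h.1⟩

/-- There is a walk of length at most `l` from `u` to `v` in `H` without the vertices of `Z`. -/
def Near (H : SimpleGraph V) (Z : Set V) (l : ℕ) (u v : V) : Prop :=
  ∃ p : (avoid H Z).Walk u v, p.length ≤ l

variable {H : SimpleGraph V} {Z Z' : Set V} {l l' : ℕ} {u v w : V}

theorem Near.refl (H : SimpleGraph V) (Z : Set V) (l : ℕ) (u : V) : Near H Z l u u :=
  ⟨.nil, by simp⟩

theorem Near.symm (h : Near H Z l u v) : Near H Z l v u := by
  obtain ⟨p, hp⟩ := h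
  exact ⟨p.reverse, by simpa using hp⟩

theorem Near.trans (h : Near H Z l u v) (h' : Near H Z l' v w) : Near H Z (l + l') u w := by
  obtain ⟨p, hp⟩ := h
  obtain ⟨q, hq⟩ := h'
  exact ⟨p.append q, by rw [SimpleGraph.Walk.length_append]; omega⟩

theorem Near.mono (h : Near H Z l u v) (hl : l ≤ l') : Near H Z l' u v := by
  obtain ⟨p, hp⟩ := h
  exact ⟨p, hp.trans hl⟩

theorem avoid_anti (hZ : Z' ⊆ Z) : avoid H Z ≤ avoid H Z' :=
  fun _ _ h => ⟨h.1, fun h' => h.2.1 (hZ h'), fun h' => h.2.2 (hZ h')⟩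

theorem avoid_le (H : SimpleGraph V) (Z : Set V) : avoid H Z ≤ H := fun _ _ h => h.1

theorem Near.anti (h : Near H Z l u v) (hZ : Z' ⊆ Z) : Near H Z' l u v := by
  obtain ⟨p, hp⟩ := h
  exact ⟨p.mapLe (avoid_anti hZ), by simpa using hp⟩

theorem Near.of_adj (h : H.Adj u v) (hu : u ∉ Z) (hv : v ∉ Z) : Near H Z 1 u v := by
  have h' : (avoid H Z).Adj u v := ⟨h, hu, hv⟩
  exact ⟨h'.toWalk, by simp⟩

theorem Near.dist_le (h : Near H Z l u v) : H.dist u v ≤ l := by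
  obtain ⟨p, hp⟩ := h
  exact (SimpleGraph.dist_le (p.mapLe (avoid_le H Z))).trans (by simpa using hp)

theorem Near.dist_avoid_le (h : Near H Z l u v) : (avoid H Z).dist u v ≤ l := by
  obtain ⟨p, hp⟩ := h
  exact (SimpleGraph.dist_le p).trans hp

theorem Near.reachable (h : Near H Z l u v) : (avoid H Z).Reachable u v := by
  obtain ⟨p, -⟩ := h
  exact ⟨p⟩

theorem near_of_reachable (h : (avoid H Z).Reachable u v) :
    Near H Z ((avoid H Z).dist u v) u v := by
  obtain ⟨p, hp⟩ := h.exists_walk_length_eq_dist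
  exact ⟨p, hp.le⟩

theorem Near.notMem_left (h : Near H Z l u v) (huv : u ≠ v) : u ∉ Z := by
  obtain ⟨p, -⟩ := h
  cases p with
  | nil => exact absurd rfl huv
  | cons h' _ => exact h'.2.1

theorem Near.notMem_right (h : Near H Z l u v) (huv : u ≠ v) : v ∉ Z :=
  h.symm.notMem_left huv.symm

theorem Near.eq_of_zero (h : Near H Z 0 u v) : u = v := by
  obtain ⟨p, hp⟩ := h
  exact SimpleGraph.Walk.eq_of_length_eq_zero (p := p) (by omega)

theorem near_of_seq (f : ℕ → V) (n : ℕ) (hadj : ∀ i < n, H.Adj (f i) (f (i + 1)))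
    (hZ : ∀ i ≤ n, f i ∉ Z) : Near H Z n (f 0) (f n) := by
  induction n with
  | zero => exact Near.refl _ _ _ _
  | succ n ih =>
    refine (ih (fun i hi => hadj i (by omega)) (fun i hi => hZ i (by omega))).trans ?_
    exact Near.of_adj (hadj n (by omega)) (hZ n (by omega)) (hZ _ le_rfl)

theorem dist_triangle_of_reachable (h : H.Reachable u v) (h' : H.Reachable v w) :
    H.dist u w ≤ H.dist u v + H.dist v w := by
  obtain ⟨p, hp⟩ := h.exists_walk_length_eq_dist
  obtain ⟨q, hq⟩ := h'.exists_walk_length_eq_dist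
  rw [← hp, ← hq, ← SimpleGraph.Walk.length_append]
  exact SimpleGraph.dist_le _

/-- Shortest paths as sequences of vertices. -/
theorem exists_geodesic (h : H.Reachable u v) :
    ∃ f : ℕ → V, f 0 = u ∧ f (H.dist u v) = v ∧
      (∀ i < H.dist u v, H.Adj (f i) (f (i + 1))) ∧
      (∀ i ≤ H.dist u v, H.Reachable u (f i) ∧ H.dist u (f i) = i ∧
        H.dist (f i) v = H.dist u v - i) := by
  obtain ⟨p, hp⟩ := h.exists_walk_length_eq_dist
  have hadj : ∀ i < H.dist u v, H.Adj (p.getVert i) (p.getVert (i + 1)) := fun i hi =>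
    p.adj_getVert_succ (hp.symm ▸ hi)
  refine ⟨p.getVert, by simp, by rw [← hp]; simp, hadj, fun i hi => ?_⟩
  have h1 : H.Reachable u (p.getVert i) := ⟨p.take i⟩
  have h2 : H.dist u (p.getVert i) ≤ i := by
    have := SimpleGraph.dist_le (p.take i)
    rw [SimpleGraph.Walk.take_length] at this
    omega
  have h3 : H.dist (p.getVert i) v ≤ H.dist u v - i := by
    have := SimpleGraph.dist_le (p.drop i)
    rw [SimpleGraph.Walk.drop_length] at this
    omega
  have h4 := dist_triangle_of_reachable h1 ⟨p.drop i⟩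
  exact ⟨h1, by omega, by omega⟩

theorem near_empty_of_connected (hH : H.Connected) (u v : V) : Near H ∅ (H.dist u v) u v := by
  obtain ⟨p, hp⟩ := hH.exists_walk_length_eq_dist u v
  have hle : H ≤ avoid H ∅ := fun a b h => ⟨h, by simp, by simp⟩
  exact ⟨p.mapLe hle, by simp [hp]⟩

/-- A vertex outside of `Z` with a neighbour in `Z`. -/
def Bd (H : SimpleGraph V) (Z : Set V) (a : V) : Prop := a ∉ Z ∧ ∃ z ∈ Z, H.Adj a z

/-- Cut the walk after its last visit to `Z`: the vertex `b` reached there is on the boundary, and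
the step into `b` is the 1 that is saved. -/
theorem last_exit (p : H.Walk u v) (hv : v ∉ Z) :
    (u ∉ Z ∧ Near H Z p.length u v) ∨ ∃ b j, Bd H Z b ∧ Near H Z j b v ∧ j + 1 ≤ p.length := by
  induction p with
  | nil => exact .inl ⟨hv, Near.refl _ _ _ _⟩
  | @cons u w v h p ih =>
    rcases ih hv with ⟨hw, hn⟩ | ⟨b, j, hb, hj, hl⟩
    · by_cases hu : u ∈ Z
      · exact .inr ⟨w, p.length, ⟨hw, u, hu, h.symm⟩, hn, by simp⟩
      · refine .inl ⟨hu, ?_⟩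
        have := (Near.of_adj h hu hw).trans hn
        exact this.mono (by simp; omega)
    · exact .inr ⟨b, j, hb, hj, by simp; omega⟩

/-- Cut the walk before its first visit to `Z` and after its last one. The step into `Z` and the
step out of it are dropped, which saves 2. -/
theorem first_last_exit (p : H.Walk u v) (hu : u ∉ Z) (hv : v ∉ Z) :
    Near H Z p.length u v ∨ ∃ a b i j, Bd H Z a ∧ Bd H Z b ∧ Near H Z i u a ∧ Near H Z j b v ∧
      i + j + 2 ≤ p.length := by
  induction p with
  | nil => exact .inl (Near.refl _ _ _ _)
  | @cons u w v h p ih =>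
    by_cases hw : w ∈ Z
    · rcases last_exit p hv with ⟨hw', -⟩ | ⟨b, j, hb, hj, hl⟩
      · exact absurd hw hw'
      · exact .inr ⟨u, b, 0, j, ⟨hu, w, hw, h⟩, hb, Near.refl _ _ _ _, hj, by simp; omega⟩
    · rcases ih hw hv with hn | ⟨a, b, i, j, ha, hb, hi, hj, hl⟩
      · exact .inl (((Near.of_adj h hu hw).trans hn).mono (by simp; omega))
      · exact .inr ⟨a, b, 1 + i, j, ha, hb, (Near.of_adj h hu hw).trans hi, hj, by simp; omega⟩

/-- If the boundary vertices of `Z` are pairwise close off `Z`, then removing `Z` has small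
additive distortion. -/
theorem near_of_boundary (hH : H.Connected) {L : ℕ}
    (hL : ∀ a b, Bd H Z a → Bd H Z b → Near H Z L a b) (hu : u ∉ Z) (hv : v ∉ Z) :
    Near H Z (H.dist u v + L) u v := by
  obtain ⟨p, hp⟩ := hH.exists_walk_length_eq_dist u v
  rcases first_last_exit p hu hv with h | ⟨a, b, i, j, ha, hb, hi, hj, hl⟩
  · exact h.mono (by omega)
  · exact ((hi.trans (hL a b ha hb)).trans hj).mono (by omega)

theorem near_of_boundary_center (c : V) {L : ℕ}
    (hL : ∀ a, Bd H Z a → Near H Z L a c) (a b : V) (ha : Bd H Z a) (hb : Bd H Z b) :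
    Near H Z (2 * L) a b :=
  ((hL a ha).trans (hL b hb).symm).mono (by omega)

/-! ### Links -/

/-- There is a walk of length at most `l` from `x` to `y` with all inner vertices in `R`. -/
def LinkLe (H : SimpleGraph V) (R : Set V) (l : ℕ) (x y : V) : Prop :=
  (H.Adj x y ∧ 1 ≤ l) ∨ ∃ r ∈ R, ∃ r' ∈ R, ∃ i, H.Adj x r ∧ H.Adj r' y ∧ Near H Rᶜ i r r' ∧ i + 2 ≤ l

variable {R R' : Set V} {x y : V}

theorem LinkLe.symm (h : LinkLe H R l x y) : LinkLe H R l y x := by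
  rcases h with ⟨h, hl⟩ | ⟨r, hr, r', hr', i, h1, h2, h3, h4⟩
  · exact .inl ⟨h.symm, hl⟩
  · exact .inr ⟨r', hr', r, hr, i, h2.symm, h1.symm, h3.symm, h4⟩

theorem LinkLe.mono (h : LinkLe H R l x y) (hl : l ≤ l') : LinkLe H R l' x y := by
  rcases h with ⟨h, hl⟩ | ⟨r, hr, r', hr', i, h1, h2, h3, h4⟩
  · exact .inl ⟨h, by omega⟩
  · exact .inr ⟨r, hr, r', hr', i, h1, h2, h3, by omega⟩

theorem LinkLe.mono_set (h : LinkLe H R l x y) (hR : R ⊆ R') : LinkLe H R' l x y := by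
  rcases h with ⟨h, hl⟩ | ⟨r, hr, r', hr', i, h1, h2, h3, h4⟩
  · exact .inl ⟨h, hl⟩
  · exact .inr ⟨r, hR hr, r', hR hr', i, h1, h2, h3.anti (Set.compl_subset_compl.2 hR), h4⟩

theorem LinkLe.near (h : LinkLe H R l x y) (hx : x ∉ Z) (hy : y ∉ Z) (hR : ∀ r ∈ R, r ∉ Z) :
    Near H Z l x y := by
  rcases h with ⟨h, hl⟩ | ⟨r, hr, r', hr', i, h1, h2, h3, h4⟩
  · exact (Near.of_adj h hx hy).mono hl
  · refine (((Near.of_adj h1 hx (hR r hr)).trans (h3.anti ?_)).trans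
      (Near.of_adj h2 (hR r' hr') hy)).mono (by omega)
    exact fun z hz hzR => hR z hzR hz

theorem LinkLe.dist_le (h : LinkLe H R l x y) : H.dist x y ≤ l :=
  (h.near (Z := ∅) (by simp) (by simp) (by simp)).dist_le

/-! ### Components of `H[R]` -/

open Classical in
/-- The vertex set of the component of `r` in the subgraph of `H` induced by `R`. -/
noncomputable def comp [Fintype V] (H : SimpleGraph V) (R : Set V) (r : V) : Finset V :=
  Finset.univ.filter fun r' => (avoid H Rᶜ).Reachable r r'

section comp
variable [Fintype V] {r r' s : V}

theorem mem_comp : r' ∈ comp H R r ↔ (avoid H Rᶜ).Reachable r r' := by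
  simp [comp]

theorem self_mem_comp : r ∈ comp H R r := mem_comp.2 .rfl

theorem comp_subset (hr : r ∈ R) (h : r' ∈ comp H R r) : r' ∈ R := by
  by_cases hrr : r = r'
  · exact hrr ▸ hr
  · have := (near_of_reachable (mem_comp.1 h)).notMem_right hrr
    simpa using this

/-- A path inside the component repeats no vertex, so its length is less than the size of the
component. -/
theorem comp_near (h : r' ∈ comp H R r) (h' : s ∈ comp H R r) :
    Near H Rᶜ ((comp H R r).card - 1) r' s := by
  classical
  have h1 := mem_comp.1 h
  have h2 : (avoid H Rᶜ).Reachable r' s := h1.symm.trans (mem_comp.1 h')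
  obtain ⟨p, hp⟩ := h2.exists_isPath
  refine ⟨p, ?_⟩
  have hsub : p.support.toFinset ⊆ comp H R r := by
    intro x hx
    rw [List.mem_toFinset] at hx
    exact mem_comp.2 (h1.trans ⟨p.takeUntil x hx⟩)
  have h3 := Finset.card_le_card hsub
  rw [List.toFinset_card_of_nodup hp.support_nodup, SimpleGraph.Walk.length_support] at h3
  omega

theorem mem_comp_of_adj (h : r' ∈ comp H R r) (hr' : r' ∈ R) (hs : s ∈ R) (ha : H.Adj r' s) :
    s ∈ comp H R r := by
  refine mem_comp.2 ((mem_comp.1 h).trans ?_)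
  exact SimpleGraph.Adj.reachable ⟨ha, by simpa using hr', by simpa using hs⟩

theorem comp_linkLe (hr : r ∈ R) (h : r' ∈ comp H R r) (h' : s ∈ comp H R r)
    (hx : H.Adj x r') (hy : H.Adj s y) : LinkLe H R ((comp H R r).card + 1) x y := by
  have h0 : 0 < (comp H R r).card := Finset.card_pos.2 ⟨r', h⟩
  exact .inr ⟨r', comp_subset hr h, s, comp_subset hr h', _, hx, hy, comp_near h h', by omega⟩

theorem comp_eq_of_mem (h : r' ∈ comp H R r) : comp H R r' = comp H R r := by
  ext s
  rw [mem_comp, mem_comp]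
  exact ⟨fun hs => (mem_comp.1 h).trans hs, fun hs => (mem_comp.1 h).symm.trans hs⟩

end comp

end Basics
end MinWiener

/-! ### Unit systems in a tight part -/

namespace MinWiener

section Systems
variable {V κ : Type*}

/-- A partition of a part `C` of the vertices into paths ("units"); `C` contains the boundary of
`I`. Units labelled by `Sum.inl` are heavy: they carry the shortest paths between vertices outside
of `I`. -/
structure UnitSystem (H : SimpleGraph V) (I : Finset V) (κ : Type*) where
  C : Finset V
  unit : V → κ ⊕ ℕ
  pos : V → ℕ
  bd_mem : ∀ a, Bd H I a → a ∈ C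
  singleton : ∀ x ∈ C, x ∉ I → ∀ y ∈ C, unit y = unit x → y = x
  inj : ∀ x ∈ C, ∀ y ∈ C, unit x = unit y → pos x = pos y → x = y
  step : ∀ x ∈ C, ∀ y ∈ C, unit x = unit y → pos x < pos y →
    ∃ z ∈ C, unit z = unit x ∧ pos z = pos x + 1 ∧ H.Adj x z
  -- Units are geodesic with respect to the uncovered part: no shortcut through it beats the way
  -- along the unit.
  link : ∀ x ∈ C, ∀ y ∈ C, unit x = unit y → ∀ l, LinkLe H {v | v ∈ I ∧ v ∉ C} l x y →
    pos y ≤ pos x + l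
  heavy_geodesic : ∀ x ∈ C, ∀ y ∈ C, unit x = unit y → (unit x).isLeft →
    pos y ≤ pos x + H.dist x y
  -- The point is that an outer shortest path that needs some vertex of `Z` can be taken to contain
  -- the whole stretch from `x` to `y`, so a detour that exceeds this stretch by `d` lengthens the
  -- path by `d` only.
  heavy_detour : ∀ x ∈ C, ∀ y ∈ C, unit x = unit y → (unit x).isLeft → pos x ≤ pos y →
    ∀ Z : Finset V, (∀ z ∈ Z, z ∈ C ∧ unit z = unit x ∧ pos x < pos z ∧ pos z < pos y) →
    ∀ d, Near H Z (pos y - pos x + d) x y → ∀ u v, u ∉ I → v ∉ I → Near H Z (H.dist u v + d) u v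
  -- Heavy units alone realise the distances between vertices outside of `I`; deleting anything else
  -- there costs nothing.
  light_free : ∀ Z : Finset V, Z ⊆ I → (∀ z ∈ Z, z ∈ C → (unit z).isRight) →
    ∀ u v, u ∉ I → v ∉ I → Near H Z (H.dist u v) u v

/-- Removing `Z ⊆ I` with additive distortion `x` outside of `I` and `y` everywhere is only
possible if `M |Z| ≤ M K x + y`. -/
def Tight (H : SimpleGraph V) (I : Finset V) (M K : ℕ) : Prop :=
  ∀ Z : Finset V, Z ⊆ I → ∀ x y, (∀ u v, u ∉ I → v ∉ I → Near H Z (H.dist u v + x) u v) →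
    (∀ u v, u ∉ Z → v ∉ Z → Near H Z (H.dist u v + y) u v) → M * Z.card ≤ M * K * x + y

theorem exists_large_fiber {α : Type*} (A : Finset α) (f : α → ℕ) (n : ℕ) (hf : ∀ a ∈ A, f a ≤ n) :
    ∃ k, A.card ≤ (n + 1) * (A.filter fun a => f a = k).card := by
  by_contra! hcon
  have h1 : A.card = ∑ k ∈ Finset.range (n + 1), (A.filter fun a => f a = k).card :=
    Finset.card_eq_sum_card_fiberwise fun a ha => by
      simpa [Nat.lt_succ_iff] using hf a (by simpa using ha)
  have h2 : (n + 1) * A.card = ∑ k ∈ Finset.range (n + 1),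
      (n + 1) * (A.filter fun a => f a = k).card := by
    rw [← Finset.mul_sum, ← h1]
  have h3 : ∑ k ∈ Finset.range (n + 1), (n + 1) * (A.filter fun a => f a = k).card <
      ∑ _k ∈ Finset.range (n + 1), A.card :=
    Finset.sum_lt_sum_of_nonempty ⟨0, by simp⟩ fun k _ => hcon k
  simp at h3
  omega

/-- The number of elements of `T` below `i`. -/
def countBelow (T : Finset ℕ) (i : ℕ) : ℕ := (T.filter (· < i)).card

theorem countBelow_le (T : Finset ℕ) (i : ℕ) : countBelow T i ≤ T.card :=
  Finset.card_filter_le _ _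

theorem countBelow_mono (T : Finset ℕ) {i j : ℕ} (h : i ≤ j) : countBelow T i ≤ countBelow T j :=
  Finset.card_le_card fun t ht => by
    simp only [Finset.mem_filter] at ht ⊢
    exact ⟨ht.1, by omega⟩

theorem countBelow_lt {T : Finset ℕ} {i j t : ℕ} (ht : t ∈ T) (hi : i ≤ t) (hj : t < j) :
    countBelow T i < countBelow T j := by
  apply Finset.card_lt_card
  refine Finset.ssubset_iff_of_subset ?_ |>.2 ⟨t, by simp [ht, hj], by simp [hi]⟩
  intro t ht
  simp only [Finset.mem_filter] at ht ⊢
  exact ⟨ht.1, by omega⟩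

theorem countBelow_succ {T : Finset ℕ} {i : ℕ} (h : i ∉ T) :
    countBelow T (i + 1) = countBelow T i := by
  unfold countBelow
  congr 1
  ext t
  simp only [Finset.mem_filter, and_congr_right_iff]
  intro ht
  have : t ≠ i := fun h' => h (h' ▸ ht)
  omega

namespace UnitSystem
variable {H : SimpleGraph V} {I : Finset V} (S : UnitSystem H I κ)

/-- The vertices of `I` that are not covered. -/
def R : Set V := {v | v ∈ I ∧ v ∉ S.C}

open Classical in
/-- The labels in use. -/
noncomputable def units : Finset (κ ⊕ ℕ) := S.C.image S.unit

theorem unit_mem {x : V} (hx : x ∈ S.C) : S.unit x ∈ S.units := by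
  classical
  exact Finset.mem_image_of_mem _ hx

/-- Iterating `step`: the positions in use on a unit form an interval. -/
theorem exists_pos {x y : V} (hx : x ∈ S.C) (hy : y ∈ S.C) (hxy : S.unit x = S.unit y) {i : ℕ}
    (hi : S.pos x ≤ i) (hi' : i ≤ S.pos y) : ∃ z ∈ S.C, S.unit z = S.unit x ∧ S.pos z = i := by
  induction i, hi using Nat.le_induction with
  | base => exact ⟨x, hx, rfl, rfl⟩
  | succ i hi ih =>
    obtain ⟨z, hz, hzu, hzp⟩ := ih (by omega)
    obtain ⟨w, hw, hwu, hwp, -⟩ := S.step z hz y hy (hzu.trans hxy) (by omega)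
    exact ⟨w, hw, hwu.trans hzu, by omega⟩

theorem unit_near {Z : Set V} (n : ℕ) {x y : V} (hx : x ∈ S.C) (hy : y ∈ S.C)
    (hxy : S.unit x = S.unit y) (hle : S.pos y = S.pos x + n)
    (hZ : ∀ z ∈ S.C, S.unit z = S.unit x → S.pos x ≤ S.pos z → S.pos z ≤ S.pos y → z ∉ Z) :
    Near H Z n x y := by
  induction n generalizing x with
  | zero => rw [S.inj x hx y hy hxy (by omega)]; exact Near.refl _ _ _ _
  | succ n ih =>
    obtain ⟨z, hz, hzu, hzp, hadj⟩ := S.step x hx y hy hxy (by omega)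
    have h1 := ih hz (hzu.trans hxy) (by omega)
      (fun w hw hwu h1 h2 => hZ w hw (hwu.trans hzu) (by omega) h2)
    have h2 : Near H Z 1 x z := Near.of_adj hadj (hZ x hx rfl le_rfl (by omega))
      (hZ z hz hzu (by omega) (by omega))
    exact (h2.trans h1).mono (by omega)

theorem unit_near' {Z : Set V} {n : ℕ} {x y : V} (hx : x ∈ S.C) (hy : y ∈ S.C)
    (hxy : S.unit x = S.unit y) (h1 : S.pos y ≤ S.pos x + n) (h2 : S.pos x ≤ S.pos y + n)
    (hZ : ∀ z ∈ S.C, S.unit z = S.unit x → (S.pos x ≤ S.pos z ∧ S.pos z ≤ S.pos y ∨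
      S.pos y ≤ S.pos z ∧ S.pos z ≤ S.pos x) → z ∉ Z) :
    Near H Z n x y := by
  rcases le_total (S.pos x) (S.pos y) with h | h
  · exact (S.unit_near (S.pos y - S.pos x) hx hy hxy (by omega)
      fun z hz hzu h3 h4 => hZ z hz hzu (.inl ⟨h3, h4⟩)).mono (by omega)
  · exact (S.unit_near (S.pos x - S.pos y) hy hx hxy.symm (by omega)
      fun z hz hzu h3 h4 => hZ z hz (hzu.trans hxy.symm) (.inr ⟨h3, h4⟩)).symm.mono (by omega)

/-- `C` contains the whole boundary of `I`, so `I` can only be left through `C`. -/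
theorem adj_mem {x y : V} (hx : x ∈ I) (h : H.Adj x y) : y ∈ S.C ∨ y ∈ S.R := by
  by_cases hy : y ∈ S.C
  · exact .inl hy
  · by_cases hyI : y ∈ I
    · exact .inr ⟨hyI, hy⟩
    · exact absurd (S.bd_mem y ⟨by simpa using hyI, x, by simpa using hx, h.symm⟩) hy

theorem link_self {x y : V} (hx : x ∈ S.C) (hy : y ∈ S.C) (hxy : S.unit x = S.unit y) {l : ℕ}
    (h : LinkLe H S.R l x y) : S.pos y ≤ S.pos x + l ∧ S.pos x ≤ S.pos y + l :=
  ⟨S.link x hx y hy hxy l h, S.link y hy x hx hxy.symm l h.symm⟩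

/-- Two vertices of one unit that are linked to vertices of one other unit. -/
def Hull (l : ℕ) (x₀ x₁ y₀ y₁ : V) : Prop :=
  x₀ ∈ S.C ∧ x₁ ∈ S.C ∧ y₀ ∈ S.C ∧ y₁ ∈ S.C ∧ S.unit x₁ = S.unit x₀ ∧ S.unit y₁ = S.unit y₀ ∧
    S.unit y₀ ≠ S.unit x₀ ∧ LinkLe H S.R l x₀ y₀ ∧ LinkLe H S.R l x₁ y₁

variable {S} in
theorem Hull.swap {l : ℕ} {x₀ x₁ y₀ y₁ : V} (h : S.Hull l x₀ x₁ y₀ y₁) :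
    S.Hull l y₀ y₁ x₀ x₁ := by
  obtain ⟨h1, h2, h3, h4, h5, h6, h7, h8, h9⟩ := h
  exact ⟨h3, h4, h1, h2, h6, h5, h7.symm, h8.symm, h9.symm⟩

variable {S} in
theorem Hull.rev {l : ℕ} {x₀ x₁ y₀ y₁ : V} (h : S.Hull l x₀ x₁ y₀ y₁) :
    S.Hull l x₁ x₀ y₁ y₀ := by
  obtain ⟨h1, h2, h3, h4, h5, h6, h7, h8, h9⟩ := h
  exact ⟨h2, h1, h4, h3, h5.symm, h6.symm, by rwa [h6, h5], h9, h8⟩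

/-- All hulls have length at most `h`. -/
def HullLe (l h : ℕ) : Prop := ∀ x₀ x₁ y₀ y₁, S.Hull l x₀ x₁ y₀ y₁ → S.pos x₁ ≤ S.pos x₀ + h

open Classical in
/-- The positions on unit `s` of vertices that are linked to unit `c`. -/
noncomputable def linkPos (l : ℕ) (s c : κ ⊕ ℕ) : Finset ℕ :=
  (S.C.filter fun x => S.unit x = s ∧ ∃ y ∈ S.C, S.unit y = c ∧ LinkLe H S.R l x y).image S.pos

theorem mem_linkPos {l : ℕ} {s c : κ ⊕ ℕ} {i : ℕ} : i ∈ S.linkPos l s c ↔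
    ∃ x ∈ S.C, S.unit x = s ∧ (∃ y ∈ S.C, S.unit y = c ∧ LinkLe H S.R l x y) ∧ S.pos x = i := by
  classical
  simp [linkPos, and_assoc]

open Classical in
/-- The first and last positions on unit `s` of links to the other units. -/
noncomputable def cuts (l : ℕ) (s : κ ⊕ ℕ) : Finset ℕ :=
  (S.units.filter (· ≠ s)).biUnion fun c => {sInf (S.linkPos l s c : Set ℕ), (S.linkPos l s c).sup id}

theorem card_cuts (l : ℕ) (s : κ ⊕ ℕ) : (S.cuts l s).card ≤ 2 * S.units.card := by
  classical
  unfold cuts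
  refine (Finset.card_biUnion_le_card_mul _ _ 2 fun c _ => Finset.card_le_two).trans ?_
  have := Finset.card_filter_le S.units (· ≠ s)
  omega

/-- A linked vertex of a unit lies between the first and the last link, which are cuts. -/
theorem exists_cuts {l : ℕ} {x y : V} (hx : x ∈ S.C) (hy : y ∈ S.C)
    (hxy : S.unit y ≠ S.unit x) (h : LinkLe H S.R l x y) :
    ∃ x₀ x₁ y₀ y₁, S.Hull l x₀ x₁ y₀ y₁ ∧ S.unit x₀ = S.unit x ∧ S.unit y₀ = S.unit y ∧
      S.pos x₀ ≤ S.pos x ∧ S.pos x ≤ S.pos x₁ ∧ S.pos x₀ ∈ S.cuts l (S.unit x) ∧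
      S.pos x₁ ∈ S.cuts l (S.unit x) ∧ ∀ x' ∈ S.C, ∀ y' ∈ S.C, S.unit x' = S.unit x →
      S.unit y' = S.unit y → LinkLe H S.R l x' y' → S.pos x₀ ≤ S.pos x' ∧ S.pos x' ≤ S.pos x₁ := by
  classical
  have hmem : S.pos x ∈ S.linkPos l (S.unit x) (S.unit y) :=
    S.mem_linkPos.2 ⟨x, hx, rfl, ⟨y, hy, rfl, h⟩, rfl⟩
  have h0 : sInf (S.linkPos l (S.unit x) (S.unit y) : Set ℕ) ∈ S.linkPos l (S.unit x) (S.unit y) :=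
    Nat.sInf_mem (s := (S.linkPos l (S.unit x) (S.unit y) : Set ℕ)) ⟨_, hmem⟩
  have h1 : (S.linkPos l (S.unit x) (S.unit y)).sup id ∈ S.linkPos l (S.unit x) (S.unit y) := by
    obtain ⟨b, hb, hb'⟩ := Finset.exists_mem_eq_sup _ ⟨_, hmem⟩ id
    rw [hb']; exact hb
  have hc : ∀ i ∈ ({sInf (S.linkPos l (S.unit x) (S.unit y) : Set ℕ),
      (S.linkPos l (S.unit x) (S.unit y)).sup id} : Finset ℕ), i ∈ S.cuts l (S.unit x) := fun i hi =>
    Finset.mem_biUnion.2 ⟨S.unit y, by simp [S.unit_mem hy, hxy], hi⟩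
  have hle : ∀ i ∈ S.linkPos l (S.unit x) (S.unit y),
      sInf (S.linkPos l (S.unit x) (S.unit y) : Set ℕ) ≤ i ∧
      i ≤ (S.linkPos l (S.unit x) (S.unit y)).sup id := fun i hi =>
    ⟨Nat.sInf_le hi, Finset.le_sup (f := id) hi⟩
  obtain ⟨x₀, hx₀, hu₀, ⟨y₀, hy₀, hv₀, hl₀⟩, hp₀⟩ := S.mem_linkPos.1 h0
  obtain ⟨x₁, hx₁, hu₁, ⟨y₁, hy₁, hv₁, hl₁⟩, hp₁⟩ := S.mem_linkPos.1 h1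
  refine ⟨x₀, x₁, y₀, y₁, ⟨hx₀, hx₁, hy₀, hy₁, by rw [hu₁, hu₀], by rw [hv₁, hv₀],
    by rwa [hv₀, hu₀], hl₀, hl₁⟩, hu₀, hv₀, ?_, ?_, ?_, ?_, ?_⟩
  · rw [hp₀]; exact (hle _ hmem).1
  · rw [hp₁]; exact (hle _ hmem).2
  · rw [hp₀]; exact hc _ (by simp)
  · rw [hp₁]; exact hc _ (by simp)
  · intro x' hx' y' hy' hux huy hl
    have := hle _ (S.mem_linkPos.2 ⟨x', hx', hux, ⟨y', hy', huy, hl⟩, rfl⟩)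
    omega

open Classical in
/-- The vertices of unit `s` between two consecutive cuts. -/
noncomputable def block (l : ℕ) (s : κ ⊕ ℕ) (k : ℕ) : Finset V :=
  S.C.filter fun x => S.unit x = s ∧ S.pos x ∉ S.cuts l s ∧ countBelow (S.cuts l s) (S.pos x) = k

theorem mem_block {l : ℕ} {s : κ ⊕ ℕ} {k : ℕ} {x : V} : x ∈ S.block l s k ↔ x ∈ S.C ∧
    S.unit x = s ∧ S.pos x ∉ S.cuts l s ∧ countBelow (S.cuts l s) (S.pos x) = k := by
  simp [block]

theorem block_no_cut {l : ℕ} {s : κ ⊕ ℕ} {k : ℕ} {x y : V} (hx : x ∈ S.block l s k)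
    (hy : y ∈ S.block l s k) {i : ℕ} (hi : i ∈ S.cuts l s) (h1 : S.pos x ≤ i) :
    S.pos y < i := by
  rw [mem_block] at hx hy
  by_contra! h2
  rcases h2.lt_or_eq with h2 | h2
  · have := countBelow_lt hi h1 h2
    omega
  · exact hy.2.2.1 (h2 ▸ hi)

theorem block_no_cut' {l : ℕ} {s : κ ⊕ ℕ} {k : ℕ} {x y : V} (hx : x ∈ S.block l s k)
    (hy : y ∈ S.block l s k) {i : ℕ} (hi : i ∈ S.cuts l s) (h1 : i ≤ S.pos x) :
    i < S.pos y := by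
  by_contra! h2
  have := S.block_no_cut hy hx hi h2
  omega

/-- A neighbour of a block on its unit lies at a cut. -/
theorem block_adj_unit {l : ℕ} {s : κ ⊕ ℕ} {k : ℕ} {x a : V} (hx : x ∈ S.block l s k)
    (ha : a ∈ S.C) (hau : S.unit a = s) (hak : a ∉ S.block l s k) (h : H.Adj a x) :
    S.pos a ∈ S.cuts l s ∧ (S.pos a + 1 = S.pos x ∨ S.pos a = S.pos x + 1) := by
  have hx' := S.mem_block.1 hx
  have h1 := S.link_self ha hx'.1 (hau.trans hx'.2.1.symm) (l := 1) (.inl ⟨h, le_rfl⟩)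
  have h2 : S.pos a ≠ S.pos x := fun he =>
    hak (S.inj a ha x hx'.1 (hau.trans hx'.2.1.symm) he ▸ hx)
  have h3 : S.pos a + 1 = S.pos x ∨ S.pos a = S.pos x + 1 := by omega
  refine ⟨?_, h3⟩
  by_contra hc
  apply hak
  rw [mem_block]
  refine ⟨ha, hau, hc, ?_⟩
  rw [← hx'.2.2.2]
  rcases h3 with h3 | h3
  · rw [← h3, countBelow_succ hc]
  · rw [h3, countBelow_succ hx'.2.2.1]

/-- Every component of the uncovered part has neighbours on two units. -/
theorem exists_other_unit [Fintype V] (hH : H.Connected) {M K : ℕ} (hT : Tight H I M K)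
    (hM : 3 ≤ M) {r : V} (hr : r ∈ S.R) (s : κ ⊕ ℕ) :
    ∃ r' ∈ comp H S.R r, ∃ b ∈ S.C, S.unit b ≠ s ∧ H.Adj b r' := by
  classical
  by_contra! hcon
  set Z := comp H S.R r with hZ
  have hZR : ∀ z ∈ Z, z ∈ S.R := fun z hz => comp_subset hr hz
  have hZC : ∀ z ∈ S.C, z ∉ (Z : Set V) := fun z hz hz' => (hZR z (by simpa using hz')).2 hz
  have hbd : ∀ a, Bd H Z a → a ∈ S.C ∧ S.unit a = s ∧ ∃ z ∈ Z, H.Adj a z := by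
    rintro a ⟨ha, z, hz, hadj⟩
    have hz' : z ∈ Z := by simpa using hz
    rcases S.adj_mem (hZR z hz').1 hadj.symm with haC | haR
    · refine ⟨haC, ?_, z, hz', hadj⟩
      by_contra hs
      exact hcon z hz' a haC hs hadj
    · exact absurd (mem_comp_of_adj hz' (hZR z hz') haR hadj.symm) (by simpa using ha)
  have hL : ∀ a b, Bd H Z a → Bd H Z b → Near H Z (Z.card + 1) a b := by
    intro a b ha hb
    obtain ⟨haC, has, z, hz, haz⟩ := hbd a ha
    obtain ⟨hbC, hbs, w, hw, hbw⟩ := hbd b hb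
    have hlink := comp_linkLe hr hz hw haz hbw.symm
    have h := S.link_self haC hbC (has.trans hbs.symm) hlink
    exact S.unit_near' haC hbC (has.trans hbs.symm) h.1 h.2 fun x hx _ _ => hZC x hx
  -- If all neighbours of the component `Z` were on one unit, this unit would replace the ways
  -- through `Z` up to an error `|Z| + 1`, with no error outside of `I`. Tightness gives `M |Z| ≤
  -- |Z| + 1`, impossible for `M ≥ 3`.
  have h := hT Z (fun z hz => (hZR z hz).1) 0 (Z.card + 1)
    (fun u v hu hv => S.light_free Z (fun z hz => (hZR z hz).1)
      (fun z hz hzC => absurd hzC (hZR z hz).2) u v hu hv)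
    (fun u v hu hv => near_of_boundary hH hL (by simpa using hu) (by simpa using hv))
  have h0 : 0 < Z.card := Finset.card_pos.2 ⟨r, self_mem_comp⟩
  have h1 : 3 * Z.card ≤ M * Z.card := Nat.mul_le_mul_right _ hM
  omega

/-- A neighbour of a vertex `z` of a unit, not on this unit, leads to a link of `z` to another
unit. -/
theorem exists_link_of_adj [Fintype V] (hH : H.Connected) {M K : ℕ} (hT : Tight H I M K)
    (hM : 3 ≤ M) {ξ : ℕ} (hξ : ∀ r ∈ S.R, (comp H S.R r).card ≤ ξ) {Z : Set V} (hZ : ∀ z ∈ Z, z ∈ S.C)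
    {z a : V} (hzI : z ∈ I) (ha : H.Adj z a)
    (hau : a ∈ S.C → S.unit a ≠ S.unit z) (hZu : ∀ z' ∈ Z, S.unit z' = S.unit z) :
    ∃ b ∈ S.C, S.unit b ≠ S.unit z ∧ LinkLe H S.R (ξ + 1) z b ∧ Near H Z ξ a b := by
  by_cases haC : a ∈ S.C
  · exact ⟨a, haC, hau haC, .inl ⟨ha, by omega⟩, Near.refl _ _ _ _⟩
  · have haR : a ∈ S.R := (S.adj_mem hzI ha).resolve_left haC
    obtain ⟨r', hr', b, hb, hbu, hbr⟩ := S.exists_other_unit hH hT hM haR (S.unit z)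
    have hc := hξ a haR
    refine ⟨b, hb, hbu, (comp_linkLe haR self_mem_comp hr' ha hbr.symm).mono (by omega), ?_⟩
    have hZR : Z ⊆ S.Rᶜ := fun z hz hz' => hz'.2 (hZ z hz)
    have h1 := (comp_near (H := H) (self_mem_comp (R := S.R) (r := a)) hr').anti hZR
    have h0 : 0 < (comp H S.R a).card := Finset.card_pos.2 ⟨a, self_mem_comp⟩
    have h2 : Near H Z 1 r' b := Near.of_adj hbr.symm (fun h => hZR h (comp_subset haR hr'))
      (fun h => hbu (hZu b h))
    exact (h1.trans h2).mono (by omega)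

end UnitSystem
end Systems
end MinWiener

/-! ### The lengths of hulls -/

namespace MinWiener
namespace UnitSystem
variable {V κ : Type*} [Fintype V] {H : SimpleGraph V} {I : Finset V} (S : UnitSystem H I κ)

/-- Delete the part `e` of one block inside of a longest hull. From `x₀` one still gets to `x₁`
along the other unit, where the hull is no longer than `h`, with two links of length `ξ + 1`;
compared with the stretch of length `h` this loses only `2 (ξ + 1)`, which is the distortion outside
of `I`. Every neighbour of `e` reaches `x₀` within `2h + 2ξ + 2`, and twice this number bounds the
distortion everywhere. -/
theorem hull_removal (hH : H.Connected) {M K : ℕ} (hT : Tight H I M K) (hM : 3 ≤ M)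
    {ξ : ℕ} (hξ : ∀ r ∈ S.R, (comp H S.R r).card ≤ ξ) {x₀ x₁ y₀ y₁ : V}
    (hh : S.Hull (ξ + 1) x₀ x₁ y₀ y₁) {h : ℕ} (hpos : S.pos x₁ = S.pos x₀ + h)
    (hmax : S.HullLe (ξ + 1) h) (hI : ∀ x ∈ S.C, S.unit x = S.unit x₀ → x ∈ I)
    (k : ℕ) (e : Finset V) (he : ∀ x, x ∈ e ↔ x ∈ S.block (ξ + 1) (S.unit x₀) k ∧
      S.pos x₀ < S.pos x ∧ S.pos x < S.pos x₁) :
    M * e.card ≤ M * K * (2 * (ξ + 1)) + (4 * h + 4 * ξ + 4) := by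
  obtain ⟨hx₀, hx₁, hy₀, hy₁, hux, huy, hne, hl₀, hl₁⟩ := hh
  have heC : ∀ z ∈ (e : Set V), z ∈ S.C := fun z hz =>
    (S.mem_block.1 ((he z).1 (by simpa using hz)).1).1
  have heu : ∀ z ∈ (e : Set V), S.unit z = S.unit x₀ := fun z hz =>
    (S.mem_block.1 ((he z).1 (by simpa using hz)).1).2.1
  have heI : ∀ z ∈ (e : Set V), z ∈ I := fun z hz => hI z (heC z hz) (heu z hz)
  have hRe : ∀ r ∈ S.R, r ∉ (e : Set V) := fun r hr hre => hr.2 (heC r hre)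
  have hue : ∀ z, S.unit z ≠ S.unit x₀ → z ∉ (e : Set V) := fun z hz hze => hz (heu z hze)
  have hx₀e : x₀ ∉ (e : Set V) := fun h' => by have := (he x₀).1 (by simpa using h'); omega
  have hx₁e : x₁ ∉ (e : Set V) := fun h' => by have := (he x₁).1 (by simpa using h'); omega
  have hy : Near H e h y₀ y₁ := by
    have h1 := hmax _ _ _ _ (Hull.swap ⟨hx₀, hx₁, hy₀, hy₁, hux, huy, hne, hl₀, hl₁⟩)
    have h2 := hmax _ _ _ _ (Hull.swap ⟨hx₀, hx₁, hy₀, hy₁, hux, huy, hne, hl₀, hl₁⟩).rev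
    exact S.unit_near' hy₀ hy₁ huy.symm h1 h2 fun z _ hzu _ => hue z (by rw [hzu]; exact hne)
  have hxx : Near H e (h + 2 * (ξ + 1)) x₀ x₁ :=
    (((hl₀.near hx₀e (hue _ hne) hRe).trans hy).trans
      (hl₁.symm.near (hue _ (by rw [huy]; exact hne)) hx₁e hRe)).mono (by omega)
  have hbd : ∀ a, Bd H e a → Near H e (2 * h + 2 * ξ + 2) a x₀ := by
    rintro a ⟨hae, z, hze, haz⟩
    have hze' := (he z).1 (by simpa using hze)
    have hzC := heC z hze
    have hzu := heu z hze
    by_cases hau : a ∈ S.C ∧ S.unit a = S.unit x₀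
    · obtain ⟨haC, hau⟩ := hau
      have hpd := S.link_self haC hzC (hau.trans hzu.symm) (l := 1) (.inl ⟨haz, le_rfl⟩)
      have hne' : ∀ w ∈ e, S.pos a < S.pos z → S.pos w ≤ S.pos a → False := by
        intro w hwe h1 h2
        have hw' := (he w).1 hwe
        by_cases hab : a ∈ S.block (ξ + 1) (S.unit x₀) k
        · exact hae (by simpa using (he a).2 ⟨hab, by omega, by omega⟩)
        · have hcut := (S.block_adj_unit hze'.1 haC hau hab haz).1
          have := S.block_no_cut hw'.1 hze'.1 hcut h2
          omega
      have hne'' : ∀ w ∈ e, S.pos z < S.pos a → S.pos a ≤ S.pos w → False := by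
        intro w hwe h1 h2
        have hw' := (he w).1 hwe
        by_cases hab : a ∈ S.block (ξ + 1) (S.unit x₀) k
        · exact hae (by simpa using (he a).2 ⟨hab, by omega, by omega⟩)
        · have hcut := (S.block_adj_unit hze'.1 haC hau hab haz).1
          have := S.block_no_cut' hw'.1 hze'.1 hcut h2
          omega
      rcases lt_trichotomy (S.pos a) (S.pos z) with hlt | heq | hgt
      · refine (S.unit_near (S.pos a - S.pos x₀) hx₀ haC hau.symm (by omega)
          fun w _ _ _ h2 hwe => hne' w (by simpa using hwe) hlt h2).symm.mono (by omega)
      · exact absurd (S.inj a haC z hzC (hau.trans hzu.symm) heq ▸ hze) hae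
      · have h1 : Near H e (S.pos x₁ - S.pos a) a x₁ :=
          S.unit_near (S.pos x₁ - S.pos a) haC hx₁ (hau.trans hux.symm) (by omega)
            fun w _ _ h2 _ hwe => hne'' w (by simpa using hwe) hgt h2
        exact (h1.trans hxx.symm).mono (by omega)
    · obtain ⟨b, hbC, hbu, hlb, hab⟩ := S.exists_link_of_adj hH hT hM hξ heC (heI z hze) haz.symm
        (fun haC hu => hau ⟨haC, hu.trans hzu⟩) (fun z' hz' => (heu z' hz').trans hzu.symm)
      -- The first vertex `f` of this unit with a link to the unit of `b` is a cut, so it precedes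
      -- the whole block and survives. The way back to `x₀` runs from `b` along its unit to `yf`,
      -- over the link to `f`, and along the unit of `x₀`.
      obtain ⟨f, g, yf, yg, hull, hfu, hyfu, hfz, -, hfc, -, -⟩ := S.exists_cuts hzC hbC hbu hlb
      obtain ⟨hfC, -, hyfC, -, -, -, -, hlf, -⟩ := hull
      have hf_lt : ∀ w ∈ e, S.pos f < S.pos w := fun w hw =>
        S.block_no_cut' hze'.1 ((he w).1 hw).1 (by rw [← hzu]; exact hfc) hfz
      have hfe : f ∉ (e : Set V) := fun h' => by have := hf_lt f (by simpa using h'); omega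
      have hyfe : yf ∉ (e : Set V) := hue _ (by rw [hyfu, ← hzu]; exact hbu)
      have hull' : S.Hull (ξ + 1) f z yf b :=
        ⟨hfC, hzC, hyfC, hbC, hfu.symm, hyfu.symm, by rw [hyfu, hfu]; exact hbu, hlf, hlb⟩
      have h1 := hmax _ _ _ _ hull'
      have h2 := hmax _ _ _ _ hull'.swap
      have h3 := hmax _ _ _ _ hull'.swap.rev
      have h4 : Near H e h b yf := S.unit_near' hbC hyfC hyfu.symm h3 h2
        fun w _ hwu _ => hue w (by rw [hwu, ← hzu]; exact hbu)
      have h5 : Near H e h f x₀ := S.unit_near' hfC hx₀ (hfu.trans hzu) (by omega) (by omega)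
        fun w _ _ hw hwe => by
          have h6 := hf_lt w (by simpa using hwe)
          have h7 := (he w).1 (by simpa using hwe)
          omega
      exact (((hab.trans h4).trans (hlf.symm.near hyfe hfe hRe)).trans h5).mono (by omega)
  refine (hT e (fun z hz => heI z (by simpa using hz)) (2 * (ξ + 1)) (2 * (2 * h + 2 * ξ + 2))
    ?_ ?_).trans (by omega)
  · intro u v hu hv
    by_cases hleft : (S.unit x₀).isLeft
    · refine S.heavy_detour x₀ hx₀ x₁ hx₁ hux.symm hleft (by omega) e ?_ _ ?_ u v hu hv
      · intro z hz
        have := (he z).1 hz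
        exact ⟨heC z (by simpa using hz), heu z (by simpa using hz), this.2.1, this.2.2⟩
      · rw [show S.pos x₁ - S.pos x₀ = h by omega]
        exact hxx
    · refine (S.light_free e (fun z hz => heI z (by simpa using hz)) ?_ u v hu hv).mono (by omega)
      intro z hz _
      rw [heu z (by simpa using hz)]
      simpa using hleft
  · intro u v hu hv
    exact near_of_boundary hH (near_of_boundary_center x₀ hbd) (by simpa using hu)
      (by simpa using hv)

/-- The bound on the lengths of hulls. -/
def hullBound (K U ξ : ℕ) : ℕ := 7 * K * (2 * U + 1) * (ξ + 1)

/-- Take a longest hull, of length `h`. Its `h - 1` inner positions, except for at most `2U` cuts,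
are spread over `2U + 1` blocks, so some block contains a fraction of about `1 / (2U + 1)` of them.
Its removal bounds this fraction by a multiple of `K (ξ + 1)` plus a multiple of `h / M`, and the
latter is absorbed since `M` is large. -/
theorem hullLe (hH : H.Connected) {M K : ℕ} (hT : Tight H I M K) (hK : 1 ≤ K)
    (hM : 8 * (2 * S.units.card + 1) ≤ M)
    {ξ : ℕ} (hξ : ∀ r ∈ S.R, (comp H S.R r).card ≤ ξ) :
    S.HullLe (ξ + 1) (hullBound K S.units.card ξ) := by
  classical
  intro a₀ a₁ b₀ b₁ hab
  let P : Finset (V × V × V × V) :=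
    Finset.univ.filter fun q => S.Hull (ξ + 1) q.1 q.2.1 q.2.2.1 q.2.2.2
  obtain ⟨⟨x₀, x₁, y₀, y₁⟩, hmem, hmax⟩ := Finset.exists_max_image P
    (fun q => S.pos q.2.1 - S.pos q.1) ⟨(a₀, a₁, b₀, b₁), by simp [P, hab]⟩
  have hh : S.Hull (ξ + 1) x₀ x₁ y₀ y₁ := by simpa [P] using hmem
  set U := S.units.card with hU
  set h := S.pos x₁ - S.pos x₀ with hdef
  have hmax' : S.HullLe (ξ + 1) h := by
    intro c₀ c₁ d₀ d₁ hc
    have := hmax (c₀, c₁, d₀, d₁) (by simp [P, hc])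
    simp only at this
    omega
  have hab' := hmax' _ _ _ _ hab
  suffices hle : h ≤ hullBound K U ξ by omega
  by_contra! hgt
  have hbpos : 7 ≤ hullBound K U ξ := by
    unfold hullBound
    have : 1 ≤ K * ((2 * U + 1) * (ξ + 1)) := Nat.mul_pos hK (by positivity)
    nlinarith
  obtain ⟨hx₀, hx₁, hy₀, hy₁, hux, huy, hne, hl₀, hl₁⟩ := id hh
  -- A vertex of the unit outside of `I` is alone on its unit, which makes `h = 0`.
  have hI : ∀ x ∈ S.C, S.unit x = S.unit x₀ → x ∈ I := by
    intro x hx hxu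
    by_contra hxI
    have h1 := S.singleton x hx hxI x₀ hx₀ hxu.symm
    have h2 := S.singleton x hx hxI x₁ hx₁ (hux.trans hxu.symm)
    have : h = 0 := by rw [hdef, h1, h2]; omega
    omega
  let T := S.cuts (ξ + 1) (S.unit x₀)
  let A : Finset V := S.C.filter fun x => S.unit x = S.unit x₀ ∧ S.pos x₀ < S.pos x ∧
    S.pos x < S.pos x₁ ∧ S.pos x ∉ T
  have hcardT : T.card ≤ 2 * U := S.card_cuts _ _
  have hAcard : h - 1 ≤ A.card + 2 * U := by
    have hsub : Finset.Ioo (S.pos x₀) (S.pos x₁) ⊆ A.image S.pos ∪ T := by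
      intro i hi
      rw [Finset.mem_Ioo] at hi
      obtain ⟨z, hz, hzu, hzp⟩ := S.exists_pos hx₀ hx₁ hux.symm hi.1.le hi.2.le
      rw [Finset.mem_union]
      by_cases hiT : i ∈ T
      · exact .inr hiT
      · exact .inl (Finset.mem_image.2 ⟨z, by simp [A, hz, hzu, hzp, hi, hiT], hzp⟩)
    have h1 := Finset.card_le_card hsub
    rw [Nat.card_Ioo] at h1
    have h2 := Finset.card_union_le (A.image S.pos) T
    have h3 := Finset.card_image_le (s := A) (f := S.pos)
    omega
  obtain ⟨k, hk⟩ := exists_large_fiber A (fun x => countBelow T (S.pos x)) (2 * U)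
    fun a _ => (countBelow_le _ _).trans hcardT
  set e := A.filter fun x => countBelow T (S.pos x) = k with he
  have hrem := S.hull_removal hH hT (by omega) hξ hh (h := h) (by omega) hmax' hI k e (by
    intro x
    simp only [he, A, Finset.mem_filter, S.mem_block, T]
    tauto)
  unfold hullBound at hgt
  have hE : h ≤ (2 * U + 1) * e.card + 2 * U + 1 := by omega
  obtain ⟨N, hN⟩ : ∃ N, N = 2 * U + 1 := ⟨_, rfl⟩
  rw [← hN] at hM hgt
  have hE' : h ≤ N * e.card + N := by rw [hN]; omega
  have h1 : M * h ≤ N * (M * e.card) + N * M := by nlinarith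
  have h2 : N * (M * e.card) ≤ N * (M * K * (2 * (ξ + 1)) + (4 * h + 4 * ξ + 4)) :=
    Nat.mul_le_mul_left _ hrem
  -- This makes the contribution `4 N h` of the distortion at most `M h / 2`, to be moved to the
  -- other side.
  have h3 : 8 * N * (h + ξ + 1) ≤ M * (h + ξ + 1) := Nat.mul_le_mul_right _ hM
  have h4 : 2 * (M * h) ≤ 4 * (N * M * K * (ξ + 1)) + M * (h + ξ + 1) + 2 * (N * M) := by
    nlinarith
  have h5 : M * h ≤ M * (4 * (N * K * (ξ + 1)) + (ξ + 1) + 2 * N) := by nlinarith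
  have h6 : h ≤ 4 * (N * K * (ξ + 1)) + (ξ + 1) + 2 * N :=
    Nat.le_of_mul_le_mul_left h5 (by omega)
  have h7 : ξ + 1 ≤ N * K * (ξ + 1) := Nat.le_mul_of_pos_left _ (Nat.mul_pos (by omega) hK)
  have h8 : N ≤ N * K * (ξ + 1) := by
    rw [mul_assoc]
    exact Nat.le_mul_of_pos_right _ (Nat.mul_pos hK (by omega))
  have h9 : 7 * K * N * (ξ + 1) = 7 * (N * K * (ξ + 1)) := by ring
  omega

end UnitSystem
end MinWiener

/-! ### Blocks without links and chains through them -/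

namespace MinWiener
namespace UnitSystem
variable {V κ : Type*} {H : SimpleGraph V} {I : Finset V} (S : UnitSystem H I κ)

theorem block_convex {l : ℕ} {s : κ ⊕ ℕ} {k : ℕ} {x y w : V} (hx : x ∈ S.block l s k)
    (hy : y ∈ S.block l s k) (hw : w ∈ S.C) (hwu : S.unit w = s) (h1 : S.pos x ≤ S.pos w)
    (h2 : S.pos w ≤ S.pos y) : w ∈ S.block l s k := by
  have hx' := S.mem_block.1 hx
  have hy' := S.mem_block.1 hy
  refine S.mem_block.2 ⟨hw, hwu, fun hc => ?_, ?_⟩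
  · have := S.block_no_cut hx hy hc h1
    omega
  · have h3 := countBelow_mono (S.cuts l s) h1
    have h4 := countBelow_mono (S.cuts l s) h2
    omega

/-- No vertex of the block is linked to another unit. -/
def FreeBlock (l : ℕ) (s : κ ⊕ ℕ) (k : ℕ) : Prop :=
  ∀ x ∈ S.block l s k, ∀ y ∈ S.C, S.unit y ≠ s → ¬ LinkLe H S.R l x y

/-- A linked vertex of the block lies in the hull of the two units. The ends of this hull are cuts,
so the whole block lies strictly between them. -/
theorem card_block_of_not_free {l : ℕ} {s : κ ⊕ ℕ} {k h : ℕ} (hh : S.HullLe l h)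
    (hf : ¬ S.FreeBlock l s k) : (S.block l s k).card ≤ h := by
  classical
  unfold FreeBlock at hf
  push Not at hf
  obtain ⟨x, hx, y, hy, hyu, hl⟩ := hf
  have hx' := S.mem_block.1 hx
  obtain ⟨x₀, x₁, y₀, y₁, hull, hu0, -, hle0, hle1, hc0, hc1, -⟩ :=
    S.exists_cuts hx'.1 hy (by rw [hx'.2.1]; exact hyu) hl
  rw [hx'.2.1] at hc0 hc1
  have hpos := hh _ _ _ _ hull
  have hsub : (S.block l s k).image S.pos ⊆ Finset.Ioo (S.pos x₀) (S.pos x₁) := by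
    intro i hi
    obtain ⟨z, hz, rfl⟩ := Finset.mem_image.1 hi
    exact Finset.mem_Ioo.2 ⟨S.block_no_cut' hx hz hc0 hle0, S.block_no_cut hx hz hc1 hle1⟩
  have h1 := Finset.card_le_card hsub
  rw [Finset.card_image_of_injOn, Nat.card_Ioo] at h1
  · omega
  · intro z hz w hw hzw
    have hz' := S.mem_block.1 (by simpa using hz)
    have hw' := S.mem_block.1 (by simpa using hw)
    exact S.inj z hz'.1 w hw'.1 (hz'.2.1.trans hw'.2.1.symm) hzw

-- At most `2U` elements of `X` sit at cuts, and the others are distributed over `2U + 1` blocks.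
open Classical in
theorem card_le_of_blocks (l : ℕ) (s : κ ⊕ ℕ) (X : Finset V)
    (hX : ∀ x ∈ X, x ∈ S.C ∧ S.unit x = s) :
    ∃ k, X.card ≤ 2 * S.units.card + (2 * S.units.card + 1) *
      (X.filter fun x => x ∈ S.block l s k).card := by
  classical
  have hc := S.card_cuts l s
  obtain ⟨k, hk⟩ := exists_large_fiber (X.filter fun x => S.pos x ∉ S.cuts l s)
    (fun x => countBelow (S.cuts l s) (S.pos x)) (2 * S.units.card)
    fun a _ => (countBelow_le _ _).trans hc
  refine ⟨k, ?_⟩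
  have h1 : (X.filter fun x => S.pos x ∈ S.cuts l s).card ≤ (S.cuts l s).card := by
    refine Finset.card_le_card_of_injOn S.pos (fun x hx => by
      have := Finset.mem_filter.1 (Finset.mem_coe.1 hx); exact this.2) ?_
    intro z hz w hw hzw
    have hz' := hX z (Finset.mem_filter.1 (Finset.mem_coe.1 hz)).1
    have hw' := hX w (Finset.mem_filter.1 (Finset.mem_coe.1 hw)).1
    exact S.inj z hz'.1 w hw'.1 (hz'.2.trans hw'.2.symm) hzw
  have h2 := Finset.card_filter_add_card_filter_not (s := X) (fun x => S.pos x ∈ S.cuts l s)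
  have h3 : (X.filter fun x => S.pos x ∉ S.cuts l s).filter
      (fun x => countBelow (S.cuts l s) (S.pos x) = k) = X.filter fun x => x ∈ S.block l s k := by
    ext x
    simp only [Finset.mem_filter, S.mem_block]
    constructor
    · rintro ⟨⟨h4, h5⟩, h6⟩
      exact ⟨h4, (hX x h4).1, (hX x h4).2, h5, h6⟩
    · rintro ⟨h4, -, -, h5, h6⟩
      exact ⟨⟨h4, h5⟩, h6⟩
  rw [h3] at hk
  omega

/-- A path in the covered part between two linked vertices which are themselves linked to other
units. -/
structure Chain (l n : ℕ) (f : ℕ → V) : Prop where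
  inj : ∀ i ≤ n, ∀ j ≤ n, f i = f j → i = j
  adj : ∀ i < n, H.Adj (f i) (f (i + 1))
  mem : ∀ i ≤ n, f i ∈ S.C
  link_left : ∃ y ∈ S.C, S.unit y ≠ S.unit (f 0) ∧ LinkLe H S.R l (f 0) y
  link_right : ∃ y ∈ S.C, S.unit y ≠ S.unit (f n) ∧ LinkLe H S.R l (f n) y
  link : LinkLe H S.R l (f 0) (f n)
  one_le : 1 ≤ l

theorem Near.of_seq_segment {Z : Set V} {f : ℕ → V} {i n : ℕ}
    (hadj : ∀ j, i ≤ j → j < i + n → H.Adj (f j) (f (j + 1)))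
    (hZ : ∀ j, i ≤ j → j ≤ i + n → f j ∉ Z) : Near H Z n (f i) (f (i + n)) := by
  have := near_of_seq (H := H) (Z := Z) (fun j => f (i + j)) n
    (fun j hj => by have := hadj (i + j) (by omega) (by omega); rwa [add_assoc] at this)
    (fun j hj => hZ (i + j) (by omega) (by omega))
  simpa using this

section chain
variable {S} {l n : ℕ} {f : ℕ → V} (hc : S.Chain l n f) {s : κ ⊕ ℕ} {k : ℕ}
  (hfree : S.FreeBlock l s k)
include hc hfree

theorem Chain.not_mem_left : f 0 ∉ S.block l s k := by
  intro h
  obtain ⟨y, hy, hyu, hl⟩ := hc.link_left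
  exact hfree _ h y hy (by rwa [(S.mem_block.1 h).2.1] at hyu) hl

theorem Chain.not_mem_right : f n ∉ S.block l s k := by
  intro h
  obtain ⟨y, hy, hyu, hl⟩ := hc.link_right
  exact hfree _ h y hy (by rwa [(S.mem_block.1 h).2.1] at hyu) hl

/-- A vertex of the block outside of `I` would be a whole unit, hence equal to `f i`. The vertex
before it on the chain is then on another unit, and this adjacency is a link that a free block does
not have. -/
theorem Chain.block_subset {i : ℕ} (hi : i ≤ n) (hfi : f i ∈ S.block l s k) :
    S.block l s k ⊆ I := by
  intro x hx
  by_contra hxI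
  have hx' := S.mem_block.1 hx
  have hfi' := S.mem_block.1 hfi
  have heq : f i = x := S.singleton x hx'.1 hxI _ hfi'.1 (hfi'.2.1.trans hx'.2.1.symm)
  have h0 : i ≠ 0 := fun h => hc.not_mem_left hfree (h ▸ hfi)
  obtain ⟨j, rfl⟩ : ∃ j, i = j + 1 := ⟨i - 1, by omega⟩
  have hadj := hc.adj j (by omega)
  have hjC := hc.mem j (by omega)
  by_cases hu : S.unit (f j) = s
  · have := S.singleton x hx'.1 hxI _ hjC (hu.trans hx'.2.1.symm)
    rw [heq, this] at hadj
    exact H.irrefl hadj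
  · exact hfree _ hfi _ hjC hu (.inl ⟨hadj.symm, hc.one_le⟩)

/-- A free block has neighbours on its own unit only, next to its two extremities, so its boundary
has at most two vertices. They are the vertices at which the chain first enters and finally leaves
the block, and they are connected off the block by the rest of the chain, closed by the link between
its ends. -/
theorem Chain.block_distortion [Fintype V] (hH : H.Connected) {M K ξ : ℕ} (hT : Tight H I M K)
    (hM : 3 ≤ M) (hξ : ∀ r ∈ S.R, (comp H S.R r).card ≤ ξ) (hl : l = ξ + 1) {i : ℕ} (hi : i ≤ n)
    (hfi : f i ∈ S.block l s k) {u v : V} (hu : u ∉ S.block l s k) (hv : v ∉ S.block l s k) :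
    Near H (S.block l s k) (H.dist u v + (n + l)) u v := by
  classical
  set e := S.block l s k with he
  have heI := hc.block_subset hfree hi hfi
  have hRe : ∀ r ∈ S.R, r ∉ (e : Set V) := fun r hr hre => hr.2 (S.mem_block.1 hre).1
  have hbd : ∀ d, Bd H e d → ∃ x ∈ e, d ∈ S.C ∧ S.unit d = s ∧ S.pos d ∈ S.cuts l s ∧
      (S.pos d + 1 = S.pos x ∨ S.pos d = S.pos x + 1) := by
    rintro d ⟨hde, x, hx, hdx⟩
    have hx : x ∈ e := by simpa using hx
    have hx' := S.mem_block.1 hx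
    have hde : d ∉ e := by simpa using hde
    by_cases hd : d ∈ S.C ∧ S.unit d = s
    · have := S.block_adj_unit hx hd.1 hd.2 hde hdx
      exact ⟨x, hx, hd.1, hd.2, this⟩
    · obtain ⟨b, hb, hbu, hlb, -⟩ := S.exists_link_of_adj hH hT hM hξ (Z := ∅) (by simp)
        (heI hx) hdx.symm (fun h1 h2 => hd ⟨h1, h2.trans hx'.2.1⟩) (by simp)
      exact absurd (hl ▸ hlb) (hfree x hx b hb (by rwa [hx'.2.1] at hbu))
  have huniq : ∀ d d' d'', Bd H e d → Bd H e d' → Bd H e d'' → d = d' ∨ d = d'' ∨ d' = d'' := by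
    intro d d' d'' hd hd' hd''
    obtain ⟨x, hx, hdC, hdu, hdc, hdx⟩ := hbd d hd
    obtain ⟨x', hx', hdC', hdu', hdc', hdx'⟩ := hbd d' hd'
    obtain ⟨x'', hx'', hdC'', hdu'', hdc'', hdx''⟩ := hbd d'' hd''
    -- A cut lies on one side of the whole block. Together with adjacency this leaves two possible
    -- positions for a boundary vertex, so two of any three coincide.
    have key : ∀ {x x' : V} {i : ℕ}, x ∈ e → x' ∈ e → i ∈ S.cuts l s →
        (S.pos x ≤ i ∧ S.pos x' < i) ∨ (i < S.pos x ∧ i < S.pos x') := by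
      intro x x' i hx hx' hi
      rcases le_or_gt (S.pos x) i with h | h
      · exact .inl ⟨h, S.block_no_cut hx hx' hi h⟩
      · exact .inr ⟨h, S.block_no_cut' hx hx' hi h.le⟩
    have k1 := key hx hx' hdc
    have k2 := key hx hx'' hdc
    have k3 := key hx' hx hdc'
    have k4 := key hx' hx'' hdc'
    have k5 := key hx'' hx hdc''
    have k6 := key hx'' hx' hdc''
    have : S.pos d = S.pos d' ∨ S.pos d = S.pos d'' ∨ S.pos d' = S.pos d'' := by omega
    rcases this with h | h | h
    · exact .inl (S.inj d hdC d' hdC' (hdu.trans hdu'.symm) h)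
    · exact .inr (.inl (S.inj d hdC d'' hdC'' (hdu.trans hdu''.symm) h))
    · exact .inr (.inr (S.inj d' hdC' d'' hdC'' (hdu'.trans hdu''.symm) h))
  -- the first and the last vertex of the chain in the block
  let J := (Finset.range (n + 1)).filter fun j => f j ∈ e
  have hJ : J.Nonempty := ⟨i, by simp [J, hfi]; omega⟩
  obtain ⟨i₁, hi₁, hmin⟩ := J.exists_min_image id hJ
  obtain ⟨i₂, hi₂, hmax⟩ := J.exists_max_image id hJ
  simp only [J, Finset.mem_filter, Finset.mem_range, id] at hi₁ hi₂ hmin hmax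
  have h12 : i₁ ≤ i₂ := hmin i₂ hi₂
  have h0 : i₁ ≠ 0 := fun h => hc.not_mem_left hfree (h ▸ hi₁.2)
  have hn : i₂ ≠ n := fun h => hc.not_mem_right hfree (h ▸ hi₂.2)
  obtain ⟨j, rfl⟩ : ∃ j, i₁ = j + 1 := ⟨i₁ - 1, by omega⟩
  have hpe : f j ∉ (e : Set V) := fun h => by
    have := hmin j ⟨by omega, by simpa using h⟩
    omega
  have hqe : f (i₂ + 1) ∉ (e : Set V) := fun h => by
    have := hmax (i₂ + 1) ⟨by omega, by simpa using h⟩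
    omega
  have hp : Bd H e (f j) := ⟨hpe, _, by simpa using hi₁.2, hc.adj j (by omega)⟩
  have hq : Bd H e (f (i₂ + 1)) := ⟨hqe, _, by simpa using hi₂.2, (hc.adj i₂ (by omega)).symm⟩
  have hpq : f j ≠ f (i₂ + 1) := fun h => by
    have := hc.inj j (by omega) (i₂ + 1) (by omega) h
    omega
  have n1 : Near H e j (f 0) (f j) := by
    have := Near.of_seq_segment (H := H) (Z := (e : Set V)) (f := f) (i := 0) (n := j)
      (fun i _ hi => hc.adj i (by omega)) (fun i _ hi h => by
        have := hmin i ⟨by omega, by simpa using h⟩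
        omega)
    simpa using this
  have n2 : Near H e (n - (i₂ + 1)) (f (i₂ + 1)) (f n) := by
    have := Near.of_seq_segment (H := H) (Z := (e : Set V)) (f := f) (i := i₂ + 1)
      (n := n - (i₂ + 1))
      (fun i _ hi => hc.adj i (by omega)) (fun i h1 hi h => by
        have := hmax i ⟨by omega, by simpa using h⟩
        omega)
    rwa [show i₂ + 1 + (n - (i₂ + 1)) = n by omega] at this
  have n3 : Near H e l (f 0) (f n) := hc.link.near (by simpa using hc.not_mem_left hfree)
    (by simpa using hc.not_mem_right hfree) hRe
  have n4 : Near H e (n + l) (f j) (f (i₂ + 1)) :=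
    ((n1.symm.trans n3).trans n2.symm).mono (by omega)
  refine near_of_boundary hH (fun a b ha hb => ?_) (by simpa using hu) (by simpa using hv)
  rcases huniq a _ _ ha hp hq with h1 | h1 | h1
  · rcases huniq b _ _ hb hp hq with h2 | h2 | h2
    · rw [h1, h2]; exact Near.refl _ _ _ _
    · rw [h1, h2]; exact n4
    · exact absurd h2 hpq
  · rcases huniq b _ _ hb hp hq with h2 | h2 | h2
    · rw [h1, h2]; exact n4.symm
    · rw [h1, h2]; exact Near.refl _ _ _ _
    · exact absurd h2 hpq
  · exact absurd h1 hpq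

end chain
end UnitSystem
end MinWiener

/-! ### Removal of a block of a heavy unit on a long cycle -/

namespace MinWiener
namespace UnitSystem
variable {V κ : Type*} {H : SimpleGraph V} {I : Finset V} (S : UnitSystem H I κ)

-- Let `i₁` and `i₂` be the first and the last index of the chain on unit `s`. The stretch of the
-- unit between these vertices has length at least `i₂ - i₁`, and the rest of the cycle, of length
-- `i₁ + l + (n - i₂)`, bypasses it. The excess is at most `n + l - 2 (i₂ - i₁)`, and `i₂ - i₁` is
-- at least the number of visits to `s` minus 1, whence the `+ 2` in `hd`. The block lies inside of
-- the stretch, so `heavy_detour` applies.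
open Classical in
theorem Chain.heavy_distortion {S : UnitSystem H I κ} {l n : ℕ} {f : ℕ → V} (hc : S.Chain l n f)
    {s : κ ⊕ ℕ} {k : ℕ}
    (hfree : S.FreeBlock l s k) (hs : s.isLeft)
    (hgeo : ∀ i j, i ≤ j → j ≤ n → S.unit (f i) = S.unit (f j) →
      S.pos (f i) + (j - i) ≤ S.pos (f j) ∨ S.pos (f j) + (j - i) ≤ S.pos (f i))
    {i : ℕ} (hi : i ≤ n) (hfi : f i ∈ S.block l s k) {d : ℕ}
    (hd : n + l + 2 ≤ d + 2 * ((Finset.range (n + 1)).filter fun j => S.unit (f j) = s).card)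
    (u v : V) (hu : u ∉ I) (hv : v ∉ I) : Near H (S.block l s k) (H.dist u v + d) u v := by
  set e := S.block l s k with he
  have hRe : ∀ r ∈ S.R, r ∉ (e : Set V) := fun r hr hre => hr.2 (S.mem_block.1 hre).1
  have hfi' := S.mem_block.1 hfi
  set J := (Finset.range (n + 1)).filter fun j => S.unit (f j) = s with hJdef
  have hJ : J.Nonempty := ⟨i, by simp [J, hfi'.2.1]; omega⟩
  obtain ⟨i₁, hi₁, hmin⟩ := J.exists_min_image id hJ
  obtain ⟨i₂, hi₂, hmax⟩ := J.exists_max_image id hJ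
  have hJsub : J ⊆ Finset.Icc i₁ i₂ := fun j hj => Finset.mem_Icc.2 ⟨hmin j hj, hmax j hj⟩
  have hJcard := Finset.card_le_card hJsub
  rw [Nat.card_Icc] at hJcard
  simp only [hJdef, Finset.mem_filter, Finset.mem_range, id] at hi₁ hi₂ hmin hmax
  have h1i := hmin i ⟨by omega, hfi'.2.1⟩
  have h2i := hmax i ⟨by omega, hfi'.2.1⟩
  have hue : ∀ j ≤ n, (j < i₁ ∨ i₂ < j) → f j ∉ (e : Set V) := by
    intro j hj hj' h
    have hu := (S.mem_block.1 (by simpa using h : f j ∈ e)).2.1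
    have h1 := hmin j ⟨by omega, hu⟩
    have h2 := hmax j ⟨by omega, hu⟩
    omega
  have hw : f i₁ ∉ (e : Set V) := by
    intro h
    have h : f i₁ ∈ e := by simpa using h
    by_cases h0 : i₁ = 0
    · exact hc.not_mem_left hfree (h0 ▸ h)
    · obtain ⟨j, rfl⟩ : ∃ j, i₁ = j + 1 := ⟨i₁ - 1, by omega⟩
      refine hfree _ h (f j) (hc.mem j (by omega)) (fun hu => ?_)
        (.inl ⟨(hc.adj j (by omega)).symm, hc.one_le⟩)
      have := hmin j ⟨by omega, hu⟩
      omega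
  have hw' : f i₂ ∉ (e : Set V) := by
    intro h
    have h : f i₂ ∈ e := by simpa using h
    by_cases h0 : i₂ = n
    · exact hc.not_mem_right hfree (h0 ▸ h)
    · refine hfree _ h (f (i₂ + 1)) (hc.mem _ (by omega)) (fun hu => ?_)
        (.inl ⟨hc.adj i₂ (by omega), hc.one_le⟩)
      have := hmax (i₂ + 1) ⟨by omega, hu⟩
      omega
  have n1 : Near H e i₁ (f 0) (f i₁) := by
    have := Near.of_seq_segment (H := H) (Z := (e : Set V)) (f := f) (i := 0) (n := i₁)
      (fun i _ hi => hc.adj i (by omega)) (fun i _ hi => by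
        rcases (show i < i₁ ∨ i = i₁ by omega) with h | rfl
        · exact hue i (by omega) (.inl h)
        · exact hw)
    simpa using this
  have n2 : Near H e (n - i₂) (f i₂) (f n) := by
    have := Near.of_seq_segment (H := H) (Z := (e : Set V)) (f := f) (i := i₂) (n := n - i₂)
      (fun i _ hi => hc.adj i (by omega)) (fun i h1 hi => by
        rcases (show i₂ < i ∨ i = i₂ by omega) with h | rfl
        · exact hue i (by omega) (.inr h)
        · exact hw')
    rwa [show i₂ + (n - i₂) = n by omega] at this
  have n3 : Near H e l (f 0) (f n) := hc.link.near (by simpa using hc.not_mem_left hfree)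
    (by simpa using hc.not_mem_right hfree) hRe
  have n4 : Near H e (i₁ + l + (n - i₂)) (f i₁) (f i₂) :=
    ((n1.symm.trans n3).trans n2.symm).mono (by omega)
  have hseg : ∀ j j', j ≤ j' → j' ≤ n → H.dist (f j) (f j') ≤ j' - j := fun j j' hjj hj' => by
    have := (Near.of_seq_segment (H := H) (Z := ∅) (f := f) (i := j) (n := j' - j)
      (fun i _ hi => hc.adj i (by omega)) (fun i h1 hi => by simp)).dist_le
    rwa [show j + (j' - j) = j' by omega] at this
  have hg : ∀ j j', j ≤ j' → j' ≤ n → S.unit (f j) = s → S.unit (f j') = s →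
      S.pos (f j') ≤ S.pos (f j) + (j' - j) ∧ S.pos (f j) ≤ S.pos (f j') + (j' - j) := by
    intro j j' hjj hj' hu hu'
    have h1 := S.heavy_geodesic _ (hc.mem j (by omega)) _ (hc.mem j' hj') (hu.trans hu'.symm)
      (by rw [hu]; exact hs)
    have h2 := S.heavy_geodesic _ (hc.mem j' hj') _ (hc.mem j (by omega)) (hu'.trans hu.symm)
      (by rw [hu']; exact hs)
    have h3 := hseg j j' hjj hj'
    have h4 := H.dist_comm (u := f j) (v := f j')
    omega
  -- The positions at `i₁`, `i`, `i₂` differ by at most the differences of the indices, but between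
  -- `i₁` and `i₂` by at least that much. So `f i` lies between the two others, and its block with
  -- it.
  have g1 := hg i₁ i h1i hi hi₁.2 hfi'.2.1
  have g2 := hg i i₂ h2i (by omega) hfi'.2.1 hi₂.2
  have g3 := hgeo i₁ i₂ (by omega) (by omega) (hi₁.2.trans hi₂.2.symm)
  have hwC := hc.mem i₁ (by omega)
  have hwC' := hc.mem i₂ (by omega)
  have hbetween : ∀ z ∈ e, ∀ w ∈ S.C, S.unit w = s → w ∉ (e : Set V) →
      (S.pos w < S.pos z ∧ S.pos w < S.pos (f i)) ∨
      (S.pos z < S.pos w ∧ S.pos (f i) < S.pos w) := by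
    intro z hz w hw hwu hwe
    have hwe : w ∉ e := by simpa using hwe
    by_contra hcon
    apply hwe
    rcases le_total (S.pos z) (S.pos w) with h | h
    · by_cases h' : S.pos w ≤ S.pos (f i)
      · exact S.block_convex hz hfi hw hwu h h'
      · have : S.pos z = S.pos w := by omega
        exact S.block_convex hz hz hw hwu h this.ge
    · by_cases h' : S.pos (f i) ≤ S.pos w
      · exact S.block_convex hfi hz hw hwu h' h
      · have : S.pos z = S.pos w := by omega
        exact S.block_convex hz hz hw hwu this.le h
  have hfw : S.pos (f i) ≠ S.pos (f i₁) := fun h => hw (by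
    rw [← S.inj _ hfi'.1 _ hwC (hfi'.2.1.trans hi₁.2.symm) h]; simpa using hfi)
  have hfw' : S.pos (f i) ≠ S.pos (f i₂) := fun h => hw' (by
    rw [← S.inj _ hfi'.1 _ hwC' (hfi'.2.1.trans hi₂.2.symm) h]; simpa using hfi)
  rcases le_total (S.pos (f i₁)) (S.pos (f i₂)) with hle | hle
  · refine S.heavy_detour _ hwC _ hwC' (hi₁.2.trans hi₂.2.symm) (by rw [hi₁.2]; exact hs) hle e
      (fun z hz => ?_) d (n4.mono (by omega)) u v hu hv
    have hz' := S.mem_block.1 hz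
    have b1 := hbetween z hz _ hwC hi₁.2 hw
    have b2 := hbetween z hz _ hwC' hi₂.2 hw'
    exact ⟨hz'.1, hz'.2.1.trans hi₁.2.symm, by omega, by omega⟩
  · refine S.heavy_detour _ hwC' _ hwC (hi₂.2.trans hi₁.2.symm) (by rw [hi₂.2]; exact hs) hle e
      (fun z hz => ?_) d (n4.symm.mono (by omega)) u v hu hv
    have hz' := S.mem_block.1 hz
    have b1 := hbetween z hz _ hwC hi₁.2 hw
    have b2 := hbetween z hz _ hwC' hi₂.2 hw'
    exact ⟨hz'.1, hz'.2.1.trans hi₂.2.symm, by omega, by omega⟩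

/-- The arithmetic for `not_reachable_zone`: `n` is the length of the path, `lam` the number of its
light vertices, `r` the number of its vertices on one heavy unit, `E` the number of those in one
block, `hb` the bound for hulls and `B` the bound for light blocks. The size of `M` forces `4 lam ≤
n` and then `n ≤ 12 U E`, which makes `E` exceed both `hb` and the cost of removing the block. -/
theorem cycle_arith {M K U ξ n lam r E hb B : ℕ} (hK : 1 ≤ K) (hU : 1 ≤ U) (hξ : 1 ≤ ξ)
    (hM : 2000 * (K ^ 2 * U ^ 4) ≤ M) (hn : M * ξ ≤ n) (hhb : hb = 7 * K * (2 * U + 1) * (ξ + 1))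
    (hB : M * B ≤ M * hb + 2 * n) (hlam : lam ≤ U * (2 * U + (2 * U + 1) * B))
    (hr : n + 1 ≤ lam + 2 * r) (hE : r ≤ 2 * U + (2 * U + 1) * E) :
    hb < E ∧ M * K * (ξ + 2 + lam) + 2 * n < M * E := by
  have hMpos : 0 < M := lt_of_lt_of_le (by positivity) hM
  have h1 : hb ≤ 42 * (K * U * ξ) := by
    rw [hhb]
    calc 7 * K * (2 * U + 1) * (ξ + 1) ≤ 7 * K * (3 * U) * (2 * ξ) := by gcongr <;> omega
      _ = 42 * (K * U * ξ) := by ring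
  have hMn : M ≤ n := (Nat.le_mul_of_pos_right M hξ).trans hn
  have h2 : M * hb ≤ 42 * (K * U) * n := by
    calc M * hb ≤ M * (42 * (K * U * ξ)) := by gcongr
      _ = 42 * (K * U) * (M * ξ) := by ring
      _ ≤ 42 * (K * U) * n := by gcongr
  have hKU : 1 ≤ K * U := Nat.mul_pos hK hU
  have h3 : M * B ≤ 44 * (K * U) * n := by nlinarith
  have h4 : M * lam ≤ 134 * (K * U ^ 3) * n := by
    have e1 : M * lam ≤ M * (U * (2 * U + (2 * U + 1) * B)) := Nat.mul_le_mul_left _ hlam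
    have e2 : M * (U * (2 * U + (2 * U + 1) * B)) ≤ M * (U * (2 * U + (3 * U) * B)) := by
      gcongr; omega
    have e3 : M * (U * (2 * U + (3 * U) * B)) = 2 * U ^ 2 * M + 3 * U ^ 2 * (M * B) := by ring
    have e4 : 3 * U ^ 2 * (M * B) ≤ 3 * U ^ 2 * (44 * (K * U) * n) := by gcongr
    have e5 : 2 * U ^ 2 * M ≤ 2 * (K * U ^ 3) * n := by
      have : U ^ 2 ≤ K * U ^ 3 := by
        calc U ^ 2 = 1 * U ^ 2 * 1 := by ring
          _ ≤ K * U ^ 2 * U := by gcongr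
          _ = K * U ^ 3 := by ring
      calc 2 * U ^ 2 * M ≤ 2 * (K * U ^ 3) * n := by gcongr
      _ = _ := rfl
    have e6 : 3 * U ^ 2 * (44 * (K * U) * n) = 132 * (K * U ^ 3) * n := by ring
    linarith
  have hKU3 : K * U ^ 3 ≤ K ^ 2 * U ^ 4 := by
    calc K * U ^ 3 = 1 * 1 * (K * U ^ 3) := by ring
      _ ≤ K * U * (K * U ^ 3) := by gcongr
      _ = K ^ 2 * U ^ 4 := by ring
  have h5 : 4 * lam ≤ n := by
    refine Nat.le_of_mul_le_mul_left ?_ hMpos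
    calc M * (4 * lam) = 4 * (M * lam) := by ring
      _ ≤ 4 * (134 * (K * U ^ 3) * n) := by gcongr
      _ = 536 * (K * U ^ 3) * n := by ring
      _ ≤ M * n := by gcongr; omega
  have hU16 : 16 * U ≤ n := by
    refine le_trans ?_ hMn
    refine le_trans ?_ hM
    have : U ≤ K ^ 2 * U ^ 4 := by
      calc U = 1 * (1 * U) := by ring
        _ ≤ K ^ 2 * (U ^ 3 * U) := by
          gcongr
          · exact Nat.one_le_pow _ _ hK
          · exact Nat.one_le_pow _ _ hU
        _ = K ^ 2 * U ^ 4 := by ring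
    omega
  have h6 : (2 * U + 1) * E ≤ 3 * (U * E) := by
    calc (2 * U + 1) * E ≤ (3 * U) * E := by gcongr; omega
      _ = 3 * (U * E) := by ring
  have h7 : n ≤ 12 * (U * E) := by omega
  have hn0 : 0 < n := by omega
  refine ⟨?_, ?_⟩
  · by_contra! hcon
    have e1 : n ≤ 12 * (U * (42 * (K * U * ξ))) :=
      h7.trans (by gcongr; exact hcon.trans h1)
    have e2 : 12 * (U * (42 * (K * U * ξ))) = 504 * (K * U ^ 2) * ξ := by ring
    have e3 : K * U ^ 2 ≤ K ^ 2 * U ^ 4 := by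
      calc K * U ^ 2 = 1 * 1 * (K * U ^ 2) := by ring
        _ ≤ K * U ^ 2 * (K * U ^ 2) := by gcongr; exact Nat.one_le_pow _ _ hU
        _ = K ^ 2 * U ^ 4 := by ring
    have e4 : 505 * (K * U ^ 2) * ξ ≤ M * ξ := by gcongr; omega
    have e5 : 0 < (K * U ^ 2) * ξ := by positivity
    nlinarith
  · by_contra! hcon
    have e1 : M * n ≤ 12 * U * (M * E) := by
      calc M * n ≤ M * (12 * (U * E)) := by gcongr
        _ = 12 * U * (M * E) := by ring
    have e2 : M * K * (ξ + 2 + lam) + 2 * n ≤ 139 * (K ^ 2 * U ^ 3) * n := by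
      have f1 : M * K * (ξ + 2 + lam) = K * (M * ξ) + 2 * K * M + K * (M * lam) := by ring
      have f2 : K * (M * ξ) ≤ K * n := by gcongr
      have f3 : 2 * K * M ≤ 2 * K * n := by gcongr
      have f4 : K * (M * lam) ≤ K * (134 * (K * U ^ 3) * n) := by gcongr
      have f5 : K * (134 * (K * U ^ 3) * n) = 134 * (K ^ 2 * U ^ 3) * n := by ring
      have f6 : K ≤ K ^ 2 * U ^ 3 := by
        calc K = 1 * K * 1 := by ring
          _ ≤ K * K * U ^ 3 := by gcongr; exact Nat.one_le_pow _ _ hU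
          _ = K ^ 2 * U ^ 3 := by ring
      have f7 : K * n ≤ K ^ 2 * U ^ 3 * n := by gcongr
      have f8 : 1 * n ≤ K ^ 2 * U ^ 3 * n := by gcongr; omega
      nlinarith
    have e3 : M * n ≤ 12 * U * (139 * (K ^ 2 * U ^ 3) * n) :=
      e1.trans (Nat.mul_le_mul_left _ (hcon.trans e2))
    have e4 : 12 * U * (139 * (K ^ 2 * U ^ 3) * n) = 1668 * (K ^ 2 * U ^ 4) * n := by ring
    have e5 : 2000 * (K ^ 2 * U ^ 4) * n ≤ M * n := by gcongr
    have e6 : 0 < (K ^ 2 * U ^ 4) * n := by positivity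
    nlinarith

end UnitSystem
end MinWiener

/-! ### Far neighbours of a component are not connected in a zone -/

namespace MinWiener
namespace UnitSystem
variable {V κ : Type*} {H : SimpleGraph V} {I : Finset V} (S : UnitSystem H I κ)

/-- The vertices of the light units and of two given units. -/
def zone (A C : κ ⊕ ℕ) : Set V :=
  {v | v ∈ S.C ∧ ((S.unit v).isRight ∨ S.unit v = A ∨ S.unit v = C)}

theorem bd_comp_mem [Fintype V] {r a : V} (hr : r ∈ S.R) (ha : Bd H (comp H S.R r) a) :
    a ∈ S.C ∧ ∃ z ∈ comp H S.R r, H.Adj a z := by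
  obtain ⟨ha, z, hz, hadj⟩ := ha
  have hz' : z ∈ comp H S.R r := by simpa using hz
  have hzR := comp_subset hr hz'
  refine ⟨?_, z, hz', hadj⟩
  rcases S.adj_mem hzR.1 hadj.symm with haC | haR
  · exact haC
  · exact absurd (mem_comp_of_adj hz' hzR haR hadj.symm) (by simpa using ha)

/-- A shortest path from `a` to `b` in the zone has length at least `M ξ`, as the two are far from
each other off the component, and it is closed to a cycle by a link through the component. Light
blocks on it are short, being either linked, hence inside of a hull, or free, hence removable at no
outer cost. So the heavy units `A` and `C` carry most of the path. The one with more vertices on it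
contains a large free block that can be bypassed along the other half of the cycle, against
tightness. -/
theorem not_reachable_zone [Fintype V] (hH : H.Connected) {M K : ℕ} (hT : Tight H I M K)
    (hK : 1 ≤ K) (hM : 2000 * (K ^ 2 * S.units.card ^ 4) ≤ M) {r₀ : V} (hr₀ : r₀ ∈ S.R)
    (hξ : ∀ r ∈ S.R, (comp H S.R r).card ≤ (comp H S.R r₀).card) {a b : V}
    (ha : Bd H (comp H S.R r₀) a) (hb : Bd H (comp H S.R r₀) b)
    (hfar : ¬ Near H (comp H S.R r₀) (M * (comp H S.R r₀).card - 1) a b) (A C : κ ⊕ ℕ) :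
    ¬ (avoid H (S.zone A C)ᶜ).Reachable a b := by
  classical
  intro hreach
  obtain ⟨haC, za, hza, hadja⟩ := S.bd_comp_mem hr₀ ha
  obtain ⟨hbC, zb, hzb, hadjb⟩ := S.bd_comp_mem hr₀ hb
  set Z := comp H S.R r₀ with hZ
  set ξ := Z.card with hξdef
  set U := S.units.card with hU
  have hUpos : 1 ≤ U := Finset.card_pos.2 ⟨_, S.unit_mem haC⟩
  have hξpos : 1 ≤ ξ := Finset.card_pos.2 ⟨_, hza⟩
  have hU4 : U ≤ K ^ 2 * U ^ 4 := by
    calc U = 1 * (1 * U) := by ring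
      _ ≤ K ^ 2 * (U ^ 3 * U) := by
        gcongr
        · exact Nat.one_le_pow _ _ hK
        · exact Nat.one_le_pow _ _ hUpos
      _ = K ^ 2 * U ^ 4 := by ring
  have hM3 : 3 ≤ M := by omega
  have hhull := S.hullLe hH hT hK (by omega) hξ
  set hb' := hullBound K U ξ with hhb
  have hZC : ∀ z ∈ S.C, z ∉ (Z : Set V) := fun z hz hz' =>
    (comp_subset hr₀ (by simpa using hz' : z ∈ comp H S.R r₀)).2 hz
  -- the shortest path in the zone
  set N := avoid H (S.zone A C)ᶜ with hN
  obtain ⟨f, hf0, hfn, hfadj, hflev⟩ := exists_geodesic hreach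
  set n := N.dist a b with hn
  have hab : a ≠ b := fun h => hfar (h ▸ Near.refl _ _ _ _)
  have hn0 : n ≠ 0 := fun h => hab (hreach.dist_eq_zero_iff.1 h)
  have hzone : ∀ i ≤ n, f i ∈ S.zone A C := by
    intro i hi
    rcases Nat.lt_or_ge i n with h | h
    · simpa using (hfadj i h).2.1
    · obtain ⟨j, rfl⟩ : ∃ j, i = j + 1 := ⟨i - 1, by omega⟩
      simpa using (hfadj j (by omega)).2.2
  have hMn : M * ξ ≤ n := by
    by_contra! hlt
    apply hfar
    have := near_of_seq (H := H) (Z := (Z : Set V)) f n (fun i hi => (hfadj i hi).1)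
      (fun i hi => hZC _ (hzone i hi).1)
    rw [hf0, hfn] at this
    exact this.mono (by omega)
  have hinj : ∀ i ≤ n, ∀ j ≤ n, f i = f j → i = j := fun i hi j hj h => by
    rw [← (hflev i hi).2.1, ← (hflev j hj).2.1, h]
  have hlinked : ∀ c z, c ∈ S.C → z ∈ Z → H.Adj c z →
      ∃ y ∈ S.C, S.unit y ≠ S.unit c ∧ LinkLe H S.R (ξ + 1) c y := by
    intro c z _ hz hcz
    obtain ⟨r', hr', y, hy, hyu, hyr⟩ := S.exists_other_unit hH hT hM3 hr₀ (S.unit c)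
    exact ⟨y, hy, hyu, comp_linkLe hr₀ hz hr' hcz hyr.symm⟩
  have hchain : S.Chain (ξ + 1) n f := ⟨hinj, fun i hi => (hfadj i hi).1, fun i hi => (hzone i hi).1,
    by rw [hf0]; exact hlinked a za haC hza hadja, by rw [hfn]; exact hlinked b zb hbC hzb hadjb,
    by rw [hf0, hfn]; exact comp_linkLe hr₀ hza hzb hadja hadjb.symm, by omega⟩
  -- The zone contains whole units, so a shortest path in the zone cannot take longer between two
  -- vertices of a unit than the unit itself.
  have hgeo : ∀ i j, i ≤ j → j ≤ n → S.unit (f i) = S.unit (f j) →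
      S.pos (f i) + (j - i) ≤ S.pos (f j) ∨ S.pos (f j) + (j - i) ≤ S.pos (f i) := by
    intro i j hij hj hu
    have hzone' : ∀ z ∈ S.C, S.unit z = S.unit (f i) → z ∉ (S.zone A C)ᶜ := by
      intro z hz hzu hz'
      apply hz'
      have := (hzone i (by omega)).2
      exact ⟨hz, by rw [hzu]; exact this⟩
    by_contra! hcon
    have hnear : Near H (S.zone A C)ᶜ (j - i - 1) (f i) (f j) :=
      S.unit_near' (hzone i (by omega)).1 (hzone j hj).1 hu (by omega) (by omega)
        fun z hz hzu _ => hzone' z hz hzu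
    have h1 := hnear.dist_avoid_le
    have h2 := dist_triangle_of_reachable (hflev i (by omega)).1 hnear.reachable
    have h3 := (hflev i (by omega)).2.1
    have h4 := (hflev j hj).2.1
    rw [← hN] at h1
    rcases Nat.eq_or_lt_of_le hij with rfl | hlt
    · omega
    · omega
  have hξn : ξ + 1 ≤ n := by
    have : 3 * ξ ≤ M * ξ := Nat.mul_le_mul_right _ hM3
    omega
  -- the vertices of the path on a unit
  let X : κ ⊕ ℕ → Finset V := fun s =>
    ((Finset.range (n + 1)).filter fun j => S.unit (f j) = s).image f
  have hXcard : ∀ s, (X s).card = ((Finset.range (n + 1)).filter fun j => S.unit (f j) = s).card := by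
    intro s
    refine Finset.card_image_of_injOn fun i hi j hj h => ?_
    simp only [Finset.coe_filter, Finset.mem_range, Set.mem_ofPred_eq] at hi hj
    exact hinj i (by omega) j (by omega) h
  have hXmem : ∀ s, ∀ x ∈ X s, ∃ i ≤ n, f i = x ∧ x ∈ S.C ∧ S.unit x = s := by
    intro s x hx
    simp only [X, Finset.mem_image, Finset.mem_filter, Finset.mem_range] at hx
    obtain ⟨i, ⟨hi, hu⟩, rfl⟩ := hx
    exact ⟨i, by omega, rfl, (hzone i (by omega)).1, hu⟩
  have hblock : ∀ s, ∃ k, (X s).card ≤ 2 * U + (2 * U + 1) *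
      ((X s).filter fun x => x ∈ S.block (ξ + 1) s k).card := fun s =>
    S.card_le_of_blocks (ξ + 1) s (X s) fun x hx => by
      obtain ⟨i, hi, rfl, h1, h2⟩ := hXmem s x hx
      exact ⟨h1, h2⟩
  have hfilter : ∀ s k, ((X s).filter fun x => x ∈ S.block (ξ + 1) s k).card ≤
      (S.block (ξ + 1) s k).card := fun s k => Finset.card_le_card fun x hx =>
    (Finset.mem_filter.1 hx).2
  -- light units
  set B := hb' + 2 * n / M with hB
  have hlight : ∀ s : κ ⊕ ℕ, s.isRight → (X s).card ≤ 2 * U + (2 * U + 1) * B := by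
    intro s hs
    obtain ⟨k, hk⟩ := hblock s
    refine hk.trans (Nat.add_le_add_left (Nat.mul_le_mul_left _ ?_) _)
    by_cases hfree : S.FreeBlock (ξ + 1) s k
    · rcases Finset.eq_empty_or_nonempty ((X s).filter fun x => x ∈ S.block (ξ + 1) s k) with h0 | h0
      · rw [h0]; simp
      · obtain ⟨x, hx⟩ := h0
        obtain ⟨hx, hxb⟩ := Finset.mem_filter.1 hx
        obtain ⟨i, hi, rfl, -, -⟩ := hXmem s x hx
        have hsub := hchain.block_subset hfree hi hxb
        have h1 := hT _ hsub 0 (n + (ξ + 1)) (fun u v hu hv => S.light_free _ hsub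
          (fun z hz _ => by rw [(S.mem_block.1 hz).2.1]; exact hs) u v hu hv)
          (fun u v hu hv => hchain.block_distortion hfree hH hT hM3 hξ rfl hi hxb hu hv)
        refine (hfilter s k).trans ?_
        have h2 : (S.block (ξ + 1) s k).card ≤ 2 * n / M := by
          rw [Nat.le_div_iff_mul_le (by omega), mul_comm]
          omega
        omega
    · exact ((hfilter s k).trans (S.card_block_of_not_free hhull hfree)).trans (Nat.le_add_right _ _)
  set L := (Finset.range (n + 1)).filter fun j => (S.unit (f j)).isRight with hL
  have hLcard : L.card ≤ U * (2 * U + (2 * U + 1) * B) := by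
    have h1 := Finset.card_le_mul_card_image (f := fun j => S.unit (f j)) L
      (2 * U + (2 * U + 1) * B) (by
        intro s hs
        obtain ⟨j, hj, rfl⟩ := Finset.mem_image.1 hs
        have hj' := Finset.mem_filter.1 hj
        refine le_trans ?_ (hlight _ hj'.2)
        rw [hXcard]
        exact Finset.card_le_card fun i hi => by
          have hi' := Finset.mem_filter.1 hi
          exact Finset.mem_filter.2 ⟨(Finset.mem_filter.1 hi'.1).1, hi'.2⟩)
    have h2 : (L.image fun j => S.unit (f j)).card ≤ U := Finset.card_le_card fun s hs => by
      obtain ⟨j, hj, rfl⟩ := Finset.mem_image.1 hs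
      have hj' := Finset.mem_range.1 (Finset.mem_filter.1 hj).1
      exact S.unit_mem (hzone j (by omega)).1
    calc L.card ≤ _ := h1
      _ ≤ (2 * U + (2 * U + 1) * B) * U := Nat.mul_le_mul_left _ h2
      _ = _ := mul_comm _ _
  -- heavy units
  have hheavy : ∀ s : κ ⊕ ℕ, ¬ (n + 1 ≤ L.card + 2 * (X s).card ∧ s.isLeft) := by
    rintro s ⟨hs, hleft⟩
    obtain ⟨k, hk⟩ := hblock s
    have hdiv : M * (2 * n / M) ≤ 2 * n := Nat.mul_div_le _ _
    have har := cycle_arith hK hUpos hξpos hM hMn (hb := hb') (B := B) rfl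
      (by rw [hB, mul_add]; omega) hLcard hs hk
    have hE := hfilter s k
    -- The block has more than `hb'` vertices, too many for a linked one.
    have hfree : S.FreeBlock (ξ + 1) s k := by
      by_contra hfree
      have := S.card_block_of_not_free hhull hfree
      omega
    obtain ⟨x, hx⟩ : ((X s).filter fun x => x ∈ S.block (ξ + 1) s k).Nonempty :=
      Finset.card_pos.1 (by omega)
    obtain ⟨hx, hxb⟩ := Finset.mem_filter.1 hx
    obtain ⟨i, hi, rfl, -, -⟩ := hXmem s x hx
    have hsub := hchain.block_subset hfree hi hxb
    have h1 := hT _ hsub (ξ + 2 + L.card) (n + (ξ + 1))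
      (hchain.heavy_distortion hfree hleft hgeo hi hxb (by rw [← hXcard]; omega))
      (fun u v hu hv => hchain.block_distortion hfree hH hT hM3 hξ rfl hi hxb hu hv)
    have h2 : M * ((X s).filter fun x => x ∈ S.block (ξ + 1) s k).card ≤
        M * (S.block (ξ + 1) s k).card := Nat.mul_le_mul_left _ hE
    omega
  have hcover : n + 1 ≤ L.card + ((if A.isLeft then (X A).card else 0) +
      (if C.isLeft then (X C).card else 0)) := by
    have hsub : Finset.range (n + 1) ⊆ L ∪
        ((if A.isLeft then (Finset.range (n + 1)).filter fun j => S.unit (f j) = A else ∅) ∪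
         (if C.isLeft then (Finset.range (n + 1)).filter fun j => S.unit (f j) = C else ∅)) := by
      intro j hj
      have hj' := Finset.mem_range.1 hj
      by_cases hright : (S.unit (f j)).isRight
      · exact Finset.mem_union_left _ (Finset.mem_filter.2 ⟨hj, hright⟩)
      · have hl : (S.unit (f j)).isLeft := by simpa using hright
        rcases (hzone j (by omega)).2 with h | h | h
        · exact absurd h hright
        · rw [← h, if_pos hl]
          simp [hj']
        · rw [← h, if_pos hl]
          simp [hj']
    have h1 := (Finset.card_le_card hsub).trans ((Finset.card_union_le _ _).trans
      (Nat.add_le_add_left (Finset.card_union_le _ _) _))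
    rw [Finset.card_range] at h1
    refine h1.trans (Nat.add_le_add_left (Nat.add_le_add ?_ ?_) _) <;> split_ifs <;> simp [hXcard]
  have hA := hheavy A
  have hC := hheavy C
  have hdiv : M * (2 * n / M) ≤ 2 * n := Nat.mul_div_le _ _
  by_cases h1 : A.isLeft <;> by_cases h2 : C.isLeft <;>
    simp only [h1, h2, if_true, if_false, and_true, Bool.false_eq_true] at hcover hA hC <;> try omega
  -- If neither `A` nor `C` is heavy, all vertices of the path are light, and `r = E = 0` gives the
  -- absurd `hb' < 0`.
  have har := cycle_arith (r := 0) (E := 0) hK hUpos hξpos hM hMn (hb := hb') (B := B) rfl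
      (by rw [hB, mul_add]; omega) hLcard (by omega) (by omega)
  omega

end UnitSystem
end MinWiener

/-! ### Covering the rest by ears -/

namespace MinWiener
namespace UnitSystem
variable {V κ : Type*} {H : SimpleGraph V} {I : Finset V} (S : UnitSystem H I κ)

/-- A shortest path `f` of length `n` in `H[R]`. -/
structure IsEar (n : ℕ) (f : ℕ → V) : Prop where
  mem : ∀ i ≤ n, f i ∈ S.R
  adj : ∀ i < n, H.Adj (f i) (f (i + 1))
  reach : ∀ i ≤ n, (avoid H S.Rᶜ).Reachable (f 0) (f i)
  level : ∀ i ≤ n, (avoid H S.Rᶜ).dist (f 0) (f i) = i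

open Classical in
/-- Add a shortest path in the uncovered part as a new light unit. -/
noncomputable def extend (n : ℕ) (f : ℕ → V) (hf : S.IsEar n f) (t : ℕ)
    (ht : ∀ x ∈ S.C, S.unit x ≠ .inr t) : UnitSystem H I κ := by
  have hP : ∀ x, x ∈ (Finset.range (n + 1)).image f ↔ ∃ i ≤ n, f i = x := fun x => by
    simp
  have hPR : ∀ x, x ∈ (Finset.range (n + 1)).image f → x ∈ S.R := fun x hx => by
    obtain ⟨i, hi, rfl⟩ := (hP x).1 hx
    exact hf.mem i hi
  have hPC : ∀ x ∈ S.C, x ∉ (Finset.range (n + 1)).image f := fun x hx hx' => (hPR x hx').2 hx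
  refine
    { C := S.C ∪ (Finset.range (n + 1)).image f
      unit := fun v => if v ∈ (Finset.range (n + 1)).image f then .inr t else S.unit v
      pos := fun v => if v ∈ (Finset.range (n + 1)).image f then (avoid H S.Rᶜ).dist (f 0) v
        else S.pos v
      bd_mem := fun a ha => Finset.mem_union_left _ (S.bd_mem a ha)
      singleton := ?_
      inj := ?_
      step := ?_
      link := ?_
      heavy_geodesic := ?_
      heavy_detour := ?_
      light_free := ?_ }
  all_goals generalize hPP : (Finset.range (n + 1)).image f = P at *
  · intro x hx hxI y hy hxy
    have hxP : x ∉ P := fun h => hxI (hPR x h).1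
    have hxC : x ∈ S.C := (Finset.mem_union.1 hx).resolve_right hxP
    by_cases hyP : y ∈ P
    · simp only [hxP, hyP, if_true, if_false] at hxy
      exact absurd hxy.symm (ht x hxC)
    · simp only [hxP, hyP, if_false] at hxy
      exact S.singleton x hxC hxI y ((Finset.mem_union.1 hy).resolve_right hyP) hxy
  · intro x hx y hy hu hp
    by_cases hxP : x ∈ P <;> by_cases hyP : y ∈ P <;>
      simp only [hxP, hyP, if_true, if_false] at hu hp
    · obtain ⟨i, hi, rfl⟩ := (hP x).1 hxP
      obtain ⟨j, hj, rfl⟩ := (hP y).1 hyP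
      rw [hf.level i hi, hf.level j hj] at hp
      rw [hp]
    · exact absurd hu.symm (ht y ((Finset.mem_union.1 hy).resolve_right hyP))
    · exact absurd hu (ht x ((Finset.mem_union.1 hx).resolve_right hxP))
    · exact S.inj x ((Finset.mem_union.1 hx).resolve_right hxP) y
        ((Finset.mem_union.1 hy).resolve_right hyP) hu hp
  · intro x hx y hy hu hp
    by_cases hxP : x ∈ P <;> by_cases hyP : y ∈ P <;>
      simp only [hxP, hyP, if_true, if_false] at hu hp ⊢
    · obtain ⟨i, hi, rfl⟩ := (hP x).1 hxP
      obtain ⟨j, hj, rfl⟩ := (hP y).1 hyP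
      rw [hf.level i hi, hf.level j hj] at hp
      have hz : f (i + 1) ∈ P := (hP _).2 ⟨i + 1, by omega, rfl⟩
      refine ⟨f (i + 1), Finset.mem_union_right _ hz, by rw [if_pos hz], ?_, hf.adj i (by omega)⟩
      rw [if_pos hz, hf.level i hi, hf.level (i + 1) (by omega)]
    · exact absurd hu.symm (ht y ((Finset.mem_union.1 hy).resolve_right hyP))
    · exact absurd hu (ht x ((Finset.mem_union.1 hx).resolve_right hxP))
    · obtain ⟨z, hz, h1, h2, h3⟩ := S.step x ((Finset.mem_union.1 hx).resolve_right hxP) y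
        ((Finset.mem_union.1 hy).resolve_right hyP) hu hp
      exact ⟨z, Finset.mem_union_left _ hz, by simp [hPC z hz, h1], by simp [hPC z hz, h2], h3⟩
  · intro x hx y hy hu l hl
    have hl' : LinkLe H S.R l x y := hl.mono_set fun v hv =>
      ⟨hv.1, fun h => hv.2 (Finset.mem_union_left _ h)⟩
    by_cases hxP : x ∈ P <;> by_cases hyP : y ∈ P <;>
      simp only [hxP, hyP, if_true, if_false] at hu ⊢
    -- A link between two vertices of the ear through the remaining part is a walk in the old
    -- uncovered part, where the ear is geodesic.
    · have hn : Near H S.Rᶜ l x y := hl'.near (by simpa using hPR x hxP) (by simpa using hPR y hyP)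
        (by simp)
      obtain ⟨i, hi, hix⟩ := (hP x).1 hxP
      have h1 := dist_triangle_of_reachable (hix ▸ hf.reach i hi) hn.reachable
      have h2 := hn.dist_avoid_le
      omega
    · exact absurd hu.symm (ht y ((Finset.mem_union.1 hy).resolve_right hyP))
    · exact absurd hu (ht x ((Finset.mem_union.1 hx).resolve_right hxP))
    · exact S.link x ((Finset.mem_union.1 hx).resolve_right hxP) y
        ((Finset.mem_union.1 hy).resolve_right hyP) hu l hl'
  · intro x hx y hy hu hl
    by_cases hxP : x ∈ P
    · simp [hxP] at hl
    by_cases hyP : y ∈ P <;> simp only [hxP, hyP, if_true, if_false] at hu hl ⊢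
    · exact absurd hu (ht x ((Finset.mem_union.1 hx).resolve_right hxP))
    · exact S.heavy_geodesic x ((Finset.mem_union.1 hx).resolve_right hxP) y
        ((Finset.mem_union.1 hy).resolve_right hyP) hu hl
  · intro x hx y hy hu hl hp Z hZ
    by_cases hxP : x ∈ P
    · simp [hxP] at hl
    have hxC := (Finset.mem_union.1 hx).resolve_right hxP
    by_cases hyP : y ∈ P <;> simp only [hxP, hyP, if_true, if_false] at hu hl hp hZ ⊢
    · exact absurd hu (ht x hxC)
    · refine S.heavy_detour x hxC y ((Finset.mem_union.1 hy).resolve_right hyP) hu hl hp Z ?_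
      intro z hz
      obtain ⟨h1, h2, h3, h4⟩ := hZ z hz
      have hzP : z ∉ P := fun h => by
        rw [if_pos h] at h2
        exact ht x hxC h2.symm
      rw [if_neg hzP] at h2 h3 h4
      exact ⟨(Finset.mem_union.1 h1).resolve_right hzP, h2, h3, h4⟩
  · intro Z hZ hZl
    refine S.light_free Z hZ fun z hz hzC => ?_
    have := hZl z hz (Finset.mem_union_left _ hzC)
    simpa [hPC z hzC] using this

section extend
variable {S} {n : ℕ} {f : ℕ → V} {hf : S.IsEar n f} {t : ℕ} {ht : ∀ x ∈ S.C, S.unit x ≠ .inr t}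

theorem mem_extend_C {x : V} : x ∈ (S.extend n f hf t ht).C ↔ x ∈ S.C ∨ ∃ i ≤ n, f i = x := by
  simp [extend]

theorem extend_unit_of_mem {x : V} (hx : x ∈ S.C) : (S.extend n f hf t ht).unit x = S.unit x := by
  have : ∀ i ≤ n, f i ≠ x := by
    rintro i hi rfl
    exact (hf.mem i hi).2 hx
  simp +contextual [extend, this]

theorem extend_unit_ear {i : ℕ} (hi : i ≤ n) : (S.extend n f hf t ht).unit (f i) = .inr t := by
  have : ∃ j ≤ n, f j = f i := ⟨i, hi, rfl⟩
  simp [extend, this]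

theorem zone_subset_extend (A C : κ ⊕ ℕ) : S.zone A C ⊆ (S.extend n f hf t ht).zone A C := by
  rintro x ⟨hx, h⟩
  refine ⟨mem_extend_C.2 (.inl hx), ?_⟩
  rwa [extend_unit_of_mem hx]

end extend

theorem zone_subset_left (A C : κ ⊕ ℕ) : S.zone A A ⊆ S.zone A C := by
  rintro x ⟨hx, h⟩
  exact ⟨hx, by tauto⟩

theorem zone_comm (A C : κ ⊕ ℕ) : S.zone A C = S.zone C A := by
  ext x
  simp only [zone, Set.mem_ofPred_eq]
  tauto

theorem reachable_zone_of_unit {A C : κ ⊕ ℕ} {x y : V} (hx : x ∈ S.C) (hy : y ∈ S.C)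
    (hxA : S.unit x = A) (hyA : S.unit y = A) : (avoid H (S.zone A C)ᶜ).Reachable x y :=
  (S.unit_near' (Z := (S.zone A C)ᶜ) (n := S.pos x + S.pos y) hx hy (hxA.trans hyA.symm) (by omega) (by omega)
    fun z hz hzu _ hz' => hz' ⟨hz, .inr (.inl (hzu.trans hxA))⟩).reachable

open Classical in
/-- The labels of heavy units. -/
noncomputable def heavyUnits : Finset (κ ⊕ ℕ) := S.units.filter fun s => s.isLeft

open Classical in
/-- The pairs of heavy units that are connected by light units. -/
noncomputable def joined : Finset ((κ ⊕ ℕ) × (κ ⊕ ℕ)) :=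
  (S.heavyUnits ×ˢ S.heavyUnits).filter fun p => ∃ v ∈ S.C, ∃ w ∈ S.C, S.unit v = p.1 ∧
    S.unit w = p.2 ∧ (avoid H (S.zone p.1 p.2)ᶜ).Reachable v w

/-- A unit system with `t` light units, obtained by adding light units one by one. -/
structure Grown (t : ℕ) : Prop where
  lt : ∀ x ∈ S.C, ∀ i, S.unit x = .inr i → i < t
  rooted : ∀ x ∈ S.C, ∃ w ∈ S.C, (S.unit w).isLeft ∧
    (avoid H (S.zone (S.unit w) (S.unit w))ᶜ).Reachable x w
  -- The potential argument: every ear must join a further pair of heavy units, so the number of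
  -- pairs bounds the number of ears.
  le_joined : t ≤ S.joined.card

theorem card_joined_le : S.joined.card ≤ S.heavyUnits.card ^ 2 := by
  classical
  refine (Finset.card_filter_le _ _).trans ?_
  rw [Finset.card_product, sq]

theorem card_units_le {t : ℕ} (h : ∀ x ∈ S.C, ∀ i, S.unit x = .inr i → i < t) :
    S.units.card ≤ S.heavyUnits.card + t := by
  classical
  have hsub : S.units ⊆ S.heavyUnits ∪ (Finset.range t).image Sum.inr := by
    intro s hs
    obtain ⟨x, hx, rfl⟩ := Finset.mem_image.1 hs
    rw [Finset.mem_union]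
    rcases hu : S.unit x with k | i
    · exact .inl (Finset.mem_filter.2 ⟨hu ▸ S.unit_mem hx, rfl⟩)
    · exact .inr (Finset.mem_image.2 ⟨i, by simpa using h x hx i hu, rfl⟩)
  refine (Finset.card_le_card hsub).trans ((Finset.card_union_le _ _).trans ?_)
  have : ((Finset.range t).image (Sum.inr : ℕ → κ ⊕ ℕ)).card ≤ t := by
    simpa using Finset.card_image_le (s := Finset.range t) (f := (Sum.inr : ℕ → κ ⊕ ℕ))
  omega

variable {S} in
-- The ear is a shortest path through a largest uncovered component, with ends at two neighbours `a`
-- and `b` of the component that are far apart off it. Both are connected by light units to heavy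
-- units, those of `wa` and `wb`. The ear joins these two, and `not_reachable_zone` says that they
-- were not joined before.
theorem Grown.exists_extend [Fintype V] {t : ℕ} (hS : S.Grown t) (hH : H.Connected) {M K : ℕ}
    (hT : Tight H I M K) (hK : 1 ≤ K) (hM : 2000 * (K ^ 2 * S.units.card ^ 4) ≤ M) (hM1 : 1 ≤ M)
    (hR : S.R.Nonempty) : ∃ S' : UnitSystem H I κ, S'.Grown (t + 1) ∧
      S.C.card < S'.C.card ∧ S'.heavyUnits = S.heavyUnits := by
  classical
  obtain ⟨r₀, hr₀, hξ⟩ : ∃ r₀ ∈ S.R, ∀ r ∈ S.R, (comp H S.R r).card ≤ (comp H S.R r₀).card := by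
    have := Set.exists_max_image S.R (fun r => (comp H S.R r).card) S.R.toFinite hR
    simpa using this
  obtain ⟨a, b, ha, hb, hfar⟩ : ∃ a b, Bd H (comp H S.R r₀) a ∧ Bd H (comp H S.R r₀) b ∧
      ¬ Near H (comp H S.R r₀) (M * (comp H S.R r₀).card - 1) a b := by
    by_contra! hcon
    -- Otherwise removing the component has outer distortion 0 and total distortion `M |Z| - 1`,
    -- against `M |Z| ≤ M |Z| - 1`.
    have h := hT (comp H S.R r₀) (fun z hz => (comp_subset hr₀ hz).1) 0 _
      (fun u v hu hv => S.light_free _ (fun z hz => (comp_subset hr₀ hz).1)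
        (fun z hz hzC => absurd hzC (comp_subset hr₀ hz).2) u v hu hv)
      (fun u v hu hv => near_of_boundary hH hcon (by simpa using hu) (by simpa using hv))
    have h1 : 0 < M * (comp H S.R r₀).card :=
      Nat.mul_pos hM1 (Finset.card_pos.2 ⟨r₀, self_mem_comp⟩)
    omega
  have hstar := S.not_reachable_zone hH hT hK hM hr₀ hξ ha hb hfar
  obtain ⟨haC, za, hza, hadja⟩ := S.bd_comp_mem hr₀ ha
  obtain ⟨hbC, zb, hzb, hadjb⟩ := S.bd_comp_mem hr₀ hb
  have hzab : (avoid H S.Rᶜ).Reachable za zb := (mem_comp.1 hza).symm.trans (mem_comp.1 hzb)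
  obtain ⟨f, hf0, hfn, hfadj, hflev⟩ := exists_geodesic hzab
  set n := (avoid H S.Rᶜ).dist za zb with hn
  have hfR : ∀ i ≤ n, f i ∈ S.R := fun i hi =>
    comp_subset hr₀ (mem_comp.2 ((mem_comp.1 hza).trans (hflev i hi).1))
  have hf : S.IsEar n f := ⟨hfR, fun i hi => (hfadj i hi).1, fun i hi => hf0 ▸ (hflev i hi).1,
    fun i hi => hf0 ▸ (hflev i hi).2.1⟩
  have ht : ∀ x ∈ S.C, S.unit x ≠ .inr t := fun x hx h => by
    have := hS.lt x hx t h
    omega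
  set S' := S.extend n f hf t ht with hS'
  have hCS : ∀ x ∈ S.C, x ∈ S'.C := fun x hx => mem_extend_C.2 (.inl hx)
  have hunit : ∀ x ∈ S.C, S'.unit x = S.unit x := fun x hx => extend_unit_of_mem hx
  have hzmono : ∀ A C, avoid H (S.zone A C)ᶜ ≤ avoid H (S'.zone A C)ᶜ := fun A C =>
    avoid_anti (Set.compl_subset_compl.2 (zone_subset_extend A C))
  have hheavy : S'.heavyUnits = S.heavyUnits := by
    ext s
    simp only [heavyUnits, units, Finset.mem_filter, Finset.mem_image]
    constructor
    · rintro ⟨⟨x, hx, rfl⟩, hs⟩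
      rcases mem_extend_C.1 hx with hx | ⟨i, hi, rfl⟩
      · exact ⟨⟨x, hx, (hunit x hx).symm⟩, hs⟩
      · rw [extend_unit_ear hi] at hs
        simp at hs
    · rintro ⟨⟨x, hx, rfl⟩, hs⟩
      exact ⟨⟨x, hCS x hx, hunit x hx⟩, hs⟩
  -- the new path in a zone
  have hpath : ∀ A C i, i ≤ n → (avoid H (S'.zone A C)ᶜ).Reachable (f 0) (f i) := by
    intro A C i hi
    refine (near_of_seq (Z := (S'.zone A C)ᶜ) f i (fun j hj => (hfadj j (by omega)).1) fun j hj h => h ?_).reachable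
    exact ⟨mem_extend_C.2 (.inr ⟨j, by omega, rfl⟩), .inl (by rw [extend_unit_ear (by omega)]; rfl)⟩
  have hmemP : ∀ A C i, i ≤ n → f i ∈ S'.zone A C := fun A C i hi =>
    ⟨mem_extend_C.2 (.inr ⟨i, hi, rfl⟩), .inl (by rw [extend_unit_ear hi]; rfl)⟩
  obtain ⟨wa, hwa, hwal, hwar⟩ := hS.rooted a haC
  obtain ⟨wb, hwb, hwbl, hwbr⟩ := hS.rooted b hbC
  have hazone : ∀ c ∈ S.C, ∀ w ∈ S.C, (avoid H (S.zone (S.unit w) (S.unit w))ᶜ).Reachable c w →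
      c ∈ S'.zone (S.unit w) (S.unit w) := by
    intro c hc w hw hr
    apply zone_subset_extend
    by_cases hcw : c = w
    · exact ⟨hc, .inr (.inl (by rw [hcw]))⟩
    · simpa using (near_of_reachable hr).notMem_left hcw
  have hfa : (avoid H (S'.zone (S.unit wa) (S.unit wa))ᶜ).Reachable (f 0) wa := by
    refine SimpleGraph.Reachable.trans (SimpleGraph.Adj.reachable ⟨?_, ?_, ?_⟩) (hwar.mono (hzmono _ _))
    · rw [hf0]; exact hadja.symm
    · simpa using hmemP _ _ 0 (by omega)
    · simpa using hazone a haC wa hwa hwar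
  have hfb : (avoid H (S'.zone (S.unit wb) (S.unit wb))ᶜ).Reachable (f n) wb := by
    refine SimpleGraph.Reachable.trans (SimpleGraph.Adj.reachable ⟨?_, ?_, ?_⟩) (hwbr.mono (hzmono _ _))
    · rw [hfn]; exact hadjb.symm
    · simpa using hmemP _ _ n le_rfl
    · simpa using hazone b hbC wb hwb hwbr
  have hmono1 : ∀ A C, avoid H (S'.zone A A)ᶜ ≤ avoid H (S'.zone A C)ᶜ := fun A C =>
    avoid_anti (Set.compl_subset_compl.2 (S'.zone_subset_left A C))
  have hmono2 : ∀ A C, avoid H (S'.zone C C)ᶜ ≤ avoid H (S'.zone A C)ᶜ := fun A C => by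
    rw [S'.zone_comm A C]
    exact hmono1 C A
  refine ⟨S', ⟨?_, ?_, ?_⟩, ?_, hheavy⟩
  · intro x hx i hi
    rcases mem_extend_C.1 hx with hx | ⟨j, hj, rfl⟩
    · have := hS.lt x hx i (by rw [← hunit x hx, hi])
      omega
    · rw [extend_unit_ear hj, Sum.inr.injEq] at hi
      omega
  · intro x hx
    rcases mem_extend_C.1 hx with hx | ⟨j, hj, rfl⟩
    · obtain ⟨w, hw, hwl, hwr⟩ := hS.rooted x hx
      exact ⟨w, hCS w hw, by rwa [hunit w hw], by rw [hunit w hw]; exact hwr.mono (hzmono _ _)⟩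
    · refine ⟨wa, hCS wa hwa, by rwa [hunit wa hwa], ?_⟩
      rw [hunit wa hwa]
      exact (hpath _ _ j hj).symm.trans hfa
  · have hsub : S.joined ⊂ S'.joined := by
      refine Finset.ssubset_iff_of_subset ?_ |>.2 ⟨(S.unit wa, S.unit wb), ?_, ?_⟩
      · intro p hp
        simp only [joined, hheavy, Finset.mem_filter] at hp ⊢
        obtain ⟨h0, v, hv, w, hw, h1, h2, h3⟩ := hp
        exact ⟨h0, v, hCS v hv, w, hCS w hw, by rw [hunit v hv, h1], by rw [hunit w hw, h2],
          h3.mono (hzmono _ _)⟩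
      · rw [joined, hheavy]
        simp only [Finset.mem_filter, Finset.mem_product, heavyUnits]
        refine ⟨⟨⟨S.unit_mem hwa, hwal⟩, S.unit_mem hwb, hwbl⟩, wa, hCS wa hwa, wb, hCS wb hwb,
          hunit wa hwa, hunit wb hwb, ?_⟩
        exact ((hfa.symm.mono (hmono1 _ _)).trans (hpath _ _ n le_rfl)).trans
          (hfb.mono (hmono2 _ _))
      -- If `v` and `w` had witnessed this pair earlier, then `a`, `wa`, `v`, `w`, `wb`, `b` would
      -- be successively connected in the old zone.
      · intro hp
        simp only [joined, Finset.mem_filter] at hp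
        obtain ⟨-, v, hv, w, hw, h1, h2, h3⟩ := hp
        apply hstar (S.unit wa) (S.unit wb)
        have e1 := hwar.mono (avoid_anti (Set.compl_subset_compl.2
          (S.zone_subset_left (S.unit wa) (S.unit wb))))
        have e2 := S.reachable_zone_of_unit (C := S.unit wb) hwa hv rfl h1
        have e3 := S.reachable_zone_of_unit (C := S.unit wa) hw hwb h2 rfl
        have e4 := hwbr.mono (avoid_anti (Set.compl_subset_compl.2
          (S.zone_subset_left (S.unit wb) (S.unit wa))))
        rw [S.zone_comm] at e3 e4
        exact (((e1.trans e2).trans h3).trans e3).trans e4.symm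
    have := Finset.card_lt_card hsub
    have := hS.le_joined
    omega
  · apply Finset.card_lt_card
    refine Finset.ssubset_iff_of_subset hCS |>.2 ⟨f 0, mem_extend_C.2 (.inr ⟨0, by omega, rfl⟩), ?_⟩
    exact (hfR 0 (by omega)).2

variable {S} in
/-- Light units can be added until everything is covered. -/
theorem Grown.exists_covering [Fintype V] {t : ℕ} (hS : S.Grown t) (hH : H.Connected) {M K : ℕ}
    (hT : Tight H I M K) (hK : 1 ≤ K) {g : ℕ} (hg : S.heavyUnits.card ≤ g)
    (hM : 2000 * (K ^ 2 * (g + g ^ 2) ^ 4) ≤ M) (hM1 : 1 ≤ M) :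
    ∃ S' : UnitSystem H I κ, S'.R = ∅ ∧ S'.units.card ≤ g + g ^ 2 := by
  have hU : ∀ (S : UnitSystem H I κ) (t : ℕ), S.Grown t → S.heavyUnits.card ≤ g →
      S.units.card ≤ g + g ^ 2 := by
    intro S t hS hg
    have h1 := S.card_units_le hS.lt
    have h2 := hS.le_joined
    have h3 := S.card_joined_le
    have h4 : S.heavyUnits.card ^ 2 ≤ g ^ 2 := Nat.pow_le_pow_left hg 2
    omega
  induction hd : Fintype.card V - S.C.card using Nat.strong_induction_on generalizing S t with
  | _ d ih =>
    rcases S.R.eq_empty_or_nonempty with hR | hR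
    · exact ⟨S, hR, hU S t hS hg⟩
    · have hM' : 2000 * (K ^ 2 * S.units.card ^ 4) ≤ M := le_trans (by
        gcongr
        exact hU S t hS hg) hM
      obtain ⟨S', hS', hC, hh⟩ := hS.exists_extend hH hT hK hM' hM1 hR
      have := Finset.card_le_univ S'.C
      exact ih _ (by omega) hS' (by rw [hh]; exact hg) rfl

/-- The number of branching vertices in a completely covered part. -/
theorem card_branch_le [Fintype V] (hH : H.Connected) {M K : ℕ} (hT : Tight H I M K) (hK : 1 ≤ K)
    (hR : S.R = ∅) {U : ℕ} (hU : S.units.card ≤ U) (hM : 8 * (2 * U + 1) ≤ M) (B : Finset V)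
    (hBI : B ⊆ I) (hB : ∀ v ∈ B, ∃ A : Finset V, 3 ≤ A.card ∧ ∀ a ∈ A, H.Adj v a) :
    B.card ≤ U ^ 2 * (hullBound K U 0 + 1) := by
  classical
  have hull : S.HullLe 1 (hullBound K U 0) := by
    intro x₀ x₁ y₀ y₁ h
    have := S.hullLe hH hT hK (by omega) (ξ := 0) (by simp [hR]) x₀ x₁ y₀ y₁ h
    refine this.trans (Nat.add_le_add_left ?_ _)
    unfold hullBound
    gcongr
  have hBC : ∀ v ∈ B, v ∈ S.C := fun v hv => by
    by_contra h
    have : v ∈ S.R := ⟨hBI hv, h⟩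
    simp [hR] at this
  -- The neighbours of `v` on its own unit occupy only the two adjacent positions, so a third
  -- neighbour is on another unit.
  have hother : ∀ v ∈ B, ∃ c ∈ S.units, c ≠ S.unit v ∧ ∃ y ∈ S.C, S.unit y = c ∧ LinkLe H S.R 1 v y := by
    intro v hv
    obtain ⟨A, hA, hadj⟩ := hB v hv
    have hAC : ∀ a ∈ A, a ∈ S.C := fun a ha => by
      rcases S.adj_mem (hBI hv) (hadj a ha) with h | h
      · exact h
      · simp [hR] at h
    by_contra! hcon
    have hsame : ∀ a ∈ A, S.unit a = S.unit v := fun a ha => by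
      by_contra hne
      exact hcon _ (S.unit_mem (hAC a ha)) hne a (hAC a ha) rfl (.inl ⟨hadj a ha, le_rfl⟩)
    have hpos : ∀ a ∈ A, S.pos a ∈ ({S.pos v - 1, S.pos v + 1} : Finset ℕ) := by
      intro a ha
      have h1 := S.link_self (hBC v hv) (hAC a ha) (hsame a ha).symm (l := 1) (.inl ⟨hadj a ha, le_rfl⟩)
      have h2 : S.pos v ≠ S.pos a := fun h => (hadj a ha).ne
        (S.inj v (hBC v hv) a (hAC a ha) (hsame a ha).symm h)
      simp only [Finset.mem_insert, Finset.mem_singleton]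
      omega
    have h1 := Finset.card_le_card_of_injOn S.pos hpos fun a ha a' ha' h =>
      S.inj a (hAC a ha) a' (hAC a' ha') ((hsame a ha).trans (hsame a' ha').symm) h
    have h2 := Finset.card_le_two (a := S.pos v - 1) (b := S.pos v + 1)
    omega
  choose! c hc hcv y hy hyc hyl using hother
  -- The vertices of one unit with a chosen link to one other unit lie in one hull, which bounds the
  -- fibres.
  have hfib := Finset.card_le_mul_card_image (f := fun v => (S.unit v, c v)) B
    (hullBound K U 0 + 1) (by
      intro p hp
      obtain ⟨v, hv, rfl⟩ := Finset.mem_image.1 hp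
      obtain ⟨x₀, x₁, y₀, y₁, hh, -, -, -, -, -, -, hall⟩ := S.exists_cuts (hBC v hv) (hy v hv)
        (by rw [hyc v hv]; exact hcv v hv) (hyl v hv)
      have hx := hull x₀ x₁ y₀ y₁ hh
      refine (Finset.card_le_card_of_injOn (t := Finset.Icc (S.pos x₀) (S.pos x₁)) S.pos ?_ ?_).trans ?_
      · intro w hw
        obtain ⟨hw, he⟩ := Finset.mem_filter.1 hw
        rw [Prod.mk.injEq] at he
        have := hall w (hBC w hw) (y w) (hy w hw) he.1 (by rw [hyc w hw, hyc v hv, he.2]) (hyl w hw)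
        simpa using this
      · intro w hw w' hw' h
        obtain ⟨hw, he⟩ := Finset.mem_filter.1 hw
        obtain ⟨hw', he'⟩ := Finset.mem_filter.1 hw'
        rw [Prod.mk.injEq] at he he'
        exact S.inj w (hBC w hw) w' (hBC w' hw') (he.1.trans he'.1.symm) h
      · rw [Nat.card_Icc]
        omega)
  have himg : (B.image fun v => (S.unit v, c v)).card ≤ U ^ 2 := by
    have hsub : (B.image fun v => (S.unit v, c v)) ⊆ S.units ×ˢ S.units := by
      intro p hp
      obtain ⟨v, hv, rfl⟩ := Finset.mem_image.1 hp
      exact Finset.mem_product.2 ⟨S.unit_mem (hBC v hv), hc v hv⟩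
    refine (Finset.card_le_card hsub).trans ?_
    rw [Finset.card_product, sq]
    exact Nat.mul_le_mul hU hU
  calc B.card ≤ _ := hfib
    _ ≤ (hullBound K U 0 + 1) * U ^ 2 := Nat.mul_le_mul_left _ himg
    _ = _ := mul_comm _ _

end UnitSystem
end MinWiener

/-! ### Canonical shortest paths -/

namespace MinWiener

section Geodesics
variable {V : Type*} {H : SimpleGraph V} {u v x y z w : V}

open Classical in
/-- `P` is the vertex set of a shortest path from `u` to `v`. -/
def IsGeo (H : SimpleGraph V) (u v : V) (P : Finset V) : Prop :=
  ∃ f : ℕ → V, f 0 = u ∧ f (H.dist u v) = v ∧ (∀ i < H.dist u v, H.Adj (f i) (f (i + 1))) ∧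
    P = (Finset.range (H.dist u v + 1)).image f

theorem IsGeo.symm {P : Finset V} (h : IsGeo H u v P) : IsGeo H v u P := by
  classical
  obtain ⟨f, h0, h1, hadj, rfl⟩ := h
  rw [IsGeo, H.dist_comm (u := v)]
  refine ⟨fun i => f (H.dist u v - i), by simpa using h1, by simpa using h0, fun i hi => ?_, ?_⟩
  · have := hadj (H.dist u v - (i + 1)) (by omega)
    rw [show H.dist u v - (i + 1) + 1 = H.dist u v - i by omega] at this
    exact this.symm
  · ext x
    simp only [Finset.mem_image, Finset.mem_range]
    constructor
    · rintro ⟨i, hi, rfl⟩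
      exact ⟨H.dist u v - i, by omega, by congr 1; omega⟩
    · rintro ⟨i, hi, rfl⟩
      exact ⟨H.dist u v - i, by omega, rfl⟩

/-- No part of the path is longer than its number of steps, and the distances of the three parts add
up to at least the distance of the ends. -/
theorem seq_dist (hH : H.Connected) {f : ℕ → V} (h0 : f 0 = u) (h1 : f (H.dist u v) = v)
    (hadj : ∀ i < H.dist u v, H.Adj (f i) (f (i + 1))) :
    ∀ i j, i ≤ j → j ≤ H.dist u v → H.dist (f i) (f j) = j - i := by
  have hle : ∀ i j, i ≤ j → j ≤ H.dist u v → H.dist (f i) (f j) ≤ j - i := by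
    intro i j hij
    induction j, hij using Nat.le_induction with
    | base => simp
    | succ j hij ih =>
      intro hj
      have h2 := ih (by omega)
      have h3 := hH.dist_triangle (u := f i) (v := f j) (w := f (j + 1))
      have h4 : H.dist (f j) (f (j + 1)) = 1 := SimpleGraph.dist_eq_one_iff_adj.2 (hadj j (by omega))
      omega
  intro i j hij hj
  have e1 := hle 0 i (by omega) (by omega)
  have e2 := hle i j hij hj
  have e3 := hle j _ hj le_rfl
  rw [h0] at e1
  rw [h1] at e3
  have t1 := hH.dist_triangle (u := u) (v := f i) (w := v)
  have t2 := hH.dist_triangle (u := f i) (v := f j) (w := v)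
  omega

theorem exists_isGeo (hH : H.Connected) (u v : V) : ∃ P, IsGeo H u v P := by
  obtain ⟨f, h0, h1, h2, -⟩ := exists_geodesic (hH u v)
  exact ⟨_, f, h0, h1, h2, rfl⟩

variable [Fintype V]

/-- A weight of vertex sets that distinguishes all of them. -/
noncomputable def weight (P : Finset V) : ℕ := ∑ x ∈ P, 2 ^ (Fintype.equivFin V x : ℕ)

/-- The weight is the number whose binary digits are the indicator vector of the set. -/
theorem weight_injective : Function.Injective (weight (V := V)) := by
  classical
  intro P P' h
  have key : ∀ P : Finset V, weight P = ∑ i ∈ P.image (fun x => (Fintype.equivFin V x : ℕ)), 2 ^ i :=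
    fun P => by
      rw [Finset.sum_image fun x _ y _ h => (Fintype.equivFin V).injective (Fin.ext h)]
      rfl
  rw [key, key] at h
  have h' := Finset.geomSum_injective le_rfl h
  exact Finset.image_injective (fun x y h => (Fintype.equivFin V).injective (Fin.ext h)) h'

theorem exists_min_geo (hH : H.Connected) (u v : V) :
    ∃ P, IsGeo H u v P ∧ ∀ P', IsGeo H u v P' → weight P ≤ weight P' := by
  classical
  obtain ⟨P, hP, hmin⟩ := Finset.exists_min_image (Finset.univ.filter (IsGeo H u v)) weight
    (by obtain ⟨P, hP⟩ := exists_isGeo hH u v; exact ⟨P, by simpa using hP⟩)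
  exact ⟨P, by simpa using hP, fun P' hP' => hmin P' (by simpa using hP')⟩

open Classical in
/-- The shortest path from `u` to `v` of least weight. -/
noncomputable def geo (H : SimpleGraph V) (u v : V) : Finset V :=
  if h : ∃ P, IsGeo H u v P ∧ ∀ P', IsGeo H u v P' → weight P ≤ weight P' then h.choose else ∅

theorem geo_isGeo (hH : H.Connected) (u v : V) : IsGeo H u v (geo H u v) := by
  rw [geo, dif_pos (exists_min_geo hH u v)]
  exact (exists_min_geo hH u v).choose_spec.1

theorem weight_geo_le (hH : H.Connected) {P : Finset V} (hP : IsGeo H u v P) :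
    weight (geo H u v) ≤ weight P := by
  rw [geo, dif_pos (exists_min_geo hH u v)]
  exact (exists_min_geo hH u v).choose_spec.2 P hP

theorem eq_geo (hH : H.Connected) {P : Finset V} (hP : IsGeo H u v P)
    (h : weight P ≤ weight (geo H u v)) : P = geo H u v :=
  weight_injective (le_antisymm h (weight_geo_le hH hP))

/-- Shortest paths in the two directions have the same vertex sets, and the minimum depends on the
set only. -/
theorem geo_comm (hH : H.Connected) (u v : V) : geo H u v = geo H v u :=
  eq_geo hH (geo_isGeo hH u v).symm (weight_geo_le hH (geo_isGeo hH v u).symm)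

/-- The path `geo H u v` as a sequence. -/
theorem exists_seq_geo (hH : H.Connected) (u v : V) : ∃ f : ℕ → V, f 0 = u ∧ f (H.dist u v) = v ∧
    (∀ i < H.dist u v, H.Adj (f i) (f (i + 1))) ∧
    (∀ i j, i ≤ j → j ≤ H.dist u v → H.dist (f i) (f j) = j - i) ∧
    ∀ x, x ∈ geo H u v ↔ ∃ i ≤ H.dist u v, f i = x := by
  classical
  obtain ⟨f, h0, h1, h2, h3⟩ := geo_isGeo hH u v
  refine ⟨f, h0, h1, h2, seq_dist hH h0 h1 h2, fun x => ?_⟩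
  rw [h3]
  simp

theorem left_mem_geo (hH : H.Connected) (u v : V) : u ∈ geo H u v := by
  obtain ⟨f, h0, -, -, -, h⟩ := exists_seq_geo hH u v
  exact (h u).2 ⟨0, by omega, h0⟩

theorem right_mem_geo (hH : H.Connected) (u v : V) : v ∈ geo H u v :=
  geo_comm hH v u ▸ left_mem_geo hH v u

theorem dist_of_mem_geo (hH : H.Connected) (hx : x ∈ geo H u v) (hy : y ∈ geo H u v)
    (h : H.dist u x ≤ H.dist u y) :
    H.dist u y = H.dist u x + H.dist x y ∧ H.dist u y + H.dist y v = H.dist u v := by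
  obtain ⟨f, h0, h1, -, hd, hm⟩ := exists_seq_geo hH u v
  obtain ⟨i, hi, rfl⟩ := (hm x).1 hx
  obtain ⟨j, hj, rfl⟩ := (hm y).1 hy
  have e1 := hd 0 i (by omega) hi
  have e2 := hd 0 j (by omega) hj
  have e4 := hd j _ hj le_rfl
  rw [h0] at e1 e2
  rw [h1] at e4
  have e3 := hd i j (by omega) hj
  omega

theorem eq_of_mem_geo (hH : H.Connected) (hx : x ∈ geo H u v) (hy : y ∈ geo H u v)
    (h : H.dist u x = H.dist u y) : x = y := by
  have := (dist_of_mem_geo hH hx hy h.le).1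
  exact (hH x y).dist_eq_zero_iff.1 (by omega)

/-- A part of a canonical shortest path is a canonical shortest path. -/
theorem mem_geo_of_mem (hH : H.Connected) (hx : x ∈ geo H u v) (hy : y ∈ geo H u v)
    (hxy : H.dist u x ≤ H.dist u y) :
    z ∈ geo H x y ↔ z ∈ geo H u v ∧ H.dist u x ≤ H.dist u z ∧ H.dist u z ≤ H.dist u y := by
  classical
  obtain ⟨f, h0, h1, hadj, hd, hm⟩ := exists_seq_geo hH u v
  obtain ⟨i, hi, rfl⟩ := (hm x).1 hx
  obtain ⟨j, hj, rfl⟩ := (hm y).1 hy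
  have hlev : ∀ k ≤ H.dist u v, H.dist u (f k) = k := fun k hk => by
    have := hd 0 k (by omega) hk
    rw [h0] at this
    omega
  rw [hlev i hi, hlev j hj] at hxy
  have hdij := hd i j hxy hj
  obtain ⟨g, g0, g1, gadj, gd, gm⟩ := exists_seq_geo hH (f i) (f j)
  rw [hdij] at g1 gadj gd gm
  -- the middle part
  set B : Finset V := (Finset.range (j - i + 1)).image fun k => f (i + k) with hB
  have hBgeo : IsGeo H (f i) (f j) B := by
    refine ⟨fun k => f (i + k), by simp, ?_, fun k hk => ?_, ?_⟩
    · rw [hdij]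
      show f (i + (j - i)) = f j
      congr 1
      omega
    · exact hadj (i + k) (by omega)
    · rw [hdij]
  -- the exchanged path
  set f' : ℕ → V := fun k => if k < i then f k else if k ≤ j then g (k - i) else f k with hf'
  have hf'adj : ∀ k < H.dist u v, H.Adj (f' k) (f' (k + 1)) := by
    intro k hk
    rcases Nat.lt_trichotomy (k + 1) i with h | h | h
    · simp only [hf', if_pos h, if_pos (show k < i by omega)]
      exact hadj k hk
    · simp only [hf', if_pos (show k < i by omega), h, lt_irrefl, if_false, hxy, if_true, Nat.sub_self, g0]
      rw [← h]
      exact hadj k hk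
    · rcases Nat.lt_trichotomy k j with h' | h' | h'
      · simp only [hf', if_neg (show ¬ k < i by omega), if_neg (show ¬ k + 1 < i by omega),
          if_pos (show k ≤ j by omega), if_pos (show k + 1 ≤ j by omega)]
        have := gadj (k - i) (by omega)
        rwa [show k - i + 1 = k + 1 - i by omega] at this
      · simp only [hf', if_neg (show ¬ k < i by omega), if_neg (show ¬ k + 1 < i by omega),
          if_pos (show k ≤ j by omega), if_neg (show ¬ k + 1 ≤ j by omega)]
        rw [h', g1, ← h']
        exact hadj k hk
      · simp only [hf', if_neg (show ¬ k < i by omega), if_neg (show ¬ k + 1 < i by omega),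
          if_neg (show ¬ k ≤ j by omega), if_neg (show ¬ k + 1 ≤ j by omega)]
        exact hadj k hk
  have hf'0 : f' 0 = u := by
    rcases Nat.eq_zero_or_pos i with h | h
    · subst h
      simp [hf', g0, h0]
    · simp [hf', h, h0]
  have hf'1 : f' (H.dist u v) = v := by
    rcases Nat.lt_or_ge j (H.dist u v) with h | h
    · simp only [hf', if_neg (show ¬ H.dist u v < i by omega), if_neg (show ¬ H.dist u v ≤ j by omega)]
      exact h1
    · have hje : j = H.dist u v := by omega
      simp only [hf', if_neg (show ¬ H.dist u v < i by omega), if_pos (show H.dist u v ≤ j by omega)]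
      rw [← hje, g1, hje, h1]
  have hP'geo : IsGeo H u v ((Finset.range (H.dist u v + 1)).image f') :=
    ⟨f', hf'0, hf'1, hf'adj, rfl⟩
  have hf'd := seq_dist hH hf'0 hf'1 hf'adj
  -- weights as sums over indices
  have hw : ∀ (F : ℕ → V) (s : Finset ℕ), (∀ a ∈ s, ∀ b ∈ s, F a = F b → a = b) →
      weight (s.image F) = ∑ k ∈ s, 2 ^ (Fintype.equivFin V (F k) : ℕ) := fun F s hF => by
    rw [weight, Finset.sum_image hF]
  have hinj : ∀ (F : ℕ → V) (n : ℕ), (∀ a b, a ≤ b → b ≤ n → H.dist (F a) (F b) = b - a) →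
      ∀ a ≤ n, ∀ b ≤ n, F a = F b → a = b := by
    intro F n hF a ha b hb hab
    rcases le_total a b with h | h
    · have := hF a b h hb
      rw [hab, SimpleGraph.dist_self] at this
      omega
    · have := hF b a h ha
      rw [hab, SimpleGraph.dist_self] at this
      omega
  have hfinj := hinj f _ hd
  have hf'inj := hinj f' _ hf'd
  have hginj := hinj g _ gd
  have hgeoeq : geo H u v = (Finset.range (H.dist u v + 1)).image f := by
    ext x; rw [hm]; simp
  have hgeoeq' : geo H (f i) (f j) = (Finset.range (j - i + 1)).image g := by
    ext x; rw [gm]; simp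
  -- Minimality of the whole path against the exchanged one. The outer parts cancel, so the middle
  -- part of `f` is no heavier than `g` and therefore equal to it.
  have hle := weight_geo_le hH hP'geo
  rw [hgeoeq, hw _ _ fun a ha b hb => hfinj a (by simpa using ha) b (by simpa using hb),
    hw _ _ fun a ha b hb => hf'inj a (by simpa using ha) b (by simpa using hb)] at hle
  have hsplit : ∀ F : ℕ → ℕ, ∑ k ∈ Finset.range (H.dist u v + 1), F k =
      ∑ k ∈ Finset.range i, F k + ∑ k ∈ Finset.range (j - i + 1), F (i + k) +
        ∑ k ∈ Finset.range (H.dist u v - j), F (j + 1 + k) := by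
    intro F
    rw [show H.dist u v + 1 = (i + (j - i + 1)) + (H.dist u v - j) by omega, Finset.sum_range_add,
      Finset.sum_range_add, show i + (j - i + 1) = j + 1 by omega]
  rw [hsplit, hsplit] at hle
  have s1 : ∑ k ∈ Finset.range i, 2 ^ (Fintype.equivFin V (f' k) : ℕ) =
      ∑ k ∈ Finset.range i, 2 ^ (Fintype.equivFin V (f k) : ℕ) :=
    Finset.sum_congr rfl fun k hk => by simp only [hf', if_pos (Finset.mem_range.1 hk)]
  have s2 : ∑ k ∈ Finset.range (j - i + 1), 2 ^ (Fintype.equivFin V (f' (i + k)) : ℕ) =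
      ∑ k ∈ Finset.range (j - i + 1), 2 ^ (Fintype.equivFin V (g k) : ℕ) :=
    Finset.sum_congr rfl fun k hk => by
      have := Finset.mem_range.1 hk
      simp only [hf', if_neg (show ¬ i + k < i by omega), if_pos (show i + k ≤ j by omega),
        Nat.add_sub_cancel_left]
  have s3 : ∑ k ∈ Finset.range (H.dist u v - j), 2 ^ (Fintype.equivFin V (f' (j + 1 + k)) : ℕ) =
      ∑ k ∈ Finset.range (H.dist u v - j), 2 ^ (Fintype.equivFin V (f (j + 1 + k)) : ℕ) :=
    Finset.sum_congr rfl fun k hk => by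
      simp only [hf', if_neg (show ¬ j + 1 + k < i by omega), if_neg (show ¬ j + 1 + k ≤ j by omega)]
  rw [s1, s2, s3] at hle
  have hBeq : B = geo H (f i) (f j) := by
    refine eq_geo hH hBgeo ?_
    rw [hgeoeq', hB, hw _ _ fun a ha b hb => hginj a (by simpa using ha) b (by simpa using hb),
      hw _ _ fun a ha b hb h => ?_]
    · omega
    · have ha' := Finset.mem_range.1 ha
      have hb' := Finset.mem_range.1 hb
      have := hfinj (i + a) (by omega) (i + b) (by omega) h
      omega
  rw [← hBeq, hB, hlev i hi, hlev j hj, hm]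
  simp only [Finset.mem_image, Finset.mem_range]
  constructor
  · rintro ⟨k, hk, rfl⟩
    exact ⟨⟨i + k, by omega, rfl⟩, by rw [hlev _ (by omega)]; omega, by rw [hlev _ (by omega)]; omega⟩
  · rintro ⟨⟨k, hk, rfl⟩, h2, h3⟩
    rw [hlev k hk] at h2 h3
    exact ⟨k - i, by omega, by congr 1; omega⟩

theorem geo_subset_of_mem (hH : H.Connected) (hx : x ∈ geo H u v) (hy : y ∈ geo H u v) :
    geo H x y ⊆ geo H u v := by
  intro z hz
  rcases le_total (H.dist u x) (H.dist u y) with h | h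
  · exact ((mem_geo_of_mem hH hx hy h).1 hz).1
  · rw [geo_comm hH] at hz
    exact ((mem_geo_of_mem hH hy hx h).1 hz).1

theorem geo_near (hH : H.Connected) {Z : Set V} (hZ : ∀ z ∈ geo H u v, z ∉ Z) :
    Near H Z (H.dist u v) u v := by
  obtain ⟨f, h0, h1, h2, -, h4⟩ := exists_seq_geo hH u v
  have := near_of_seq (Z := Z) f (H.dist u v) h2 fun i hi => hZ _ ((h4 _).2 ⟨i, hi, rfl⟩)
  rwa [h0, h1] at this

/-- A part of a canonical path in `I` is an inner part of a canonical path between boundary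
vertices of `I`. -/
theorem exists_run (hH : H.Connected) {I : Finset V} (hu : u ∉ I) (hv : v ∉ I) (hz : z ∈ geo H u v)
    (hzI : z ∈ I) : ∃ a b, Bd H I a ∧ Bd H I b ∧ (∀ x ∈ geo H a b, x ≠ a → x ≠ b → x ∈ I) ∧
      z ∈ geo H a b ∧ geo H a b ⊆ geo H u v := by
  classical
  obtain ⟨f, h0, h1, hadj, hd, hm⟩ := exists_seq_geo hH u v
  obtain ⟨k, hk, rfl⟩ := (hm z).1 hz
  have hlev : ∀ k ≤ H.dist u v, H.dist u (f k) = k := fun k hk => by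
    have := hd 0 k (by omega) hk
    rw [h0] at this
    omega
  -- The maximal run of the path inside of `I` around `z`: `i` is the last index before it and `j`
  -- the first one after it.
  obtain ⟨i, hi, himax⟩ := Finset.exists_max_image
    ((Finset.range (k + 1)).filter fun i => f i ∉ I) id ⟨0, by simp [h0, hu]⟩
  obtain ⟨j, hj, hjmin⟩ := Finset.exists_min_image
    ((Finset.Icc k (H.dist u v)).filter fun j => f j ∉ I) id ⟨H.dist u v, by simp [h1, hv, hk]⟩
  simp only [Finset.mem_filter, Finset.mem_range, Finset.mem_Icc, id] at hi himax hj hjmin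
  have hik : i ≠ k := fun h => hi.2 (h ▸ hzI)
  have hjk : j ≠ k := fun h => hj.2 (h ▸ hzI)
  have hin : ∀ l, i < l → l < j → f l ∈ I := by
    intro l hl hl'
    by_contra hcon
    rcases le_total l k with h | h
    · have := himax l ⟨by omega, hcon⟩
      omega
    · have := hjmin l ⟨⟨h, by omega⟩, hcon⟩
      omega
  have hfi : f i ∈ geo H u v := (hm _).2 ⟨i, by omega, rfl⟩
  have hfj : f j ∈ geo H u v := (hm _).2 ⟨j, by omega, rfl⟩
  have hle : H.dist u (f i) ≤ H.dist u (f j) := by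
    rw [hlev i (by omega), hlev j (by omega)]
    omega
  have hmem := fun z => mem_geo_of_mem (z := z) hH hfi hfj hle
  refine ⟨f i, f j, ⟨by simpa using hi.2, f (i + 1), by simpa using hin (i + 1) (by omega) (by omega),
    hadj i (by omega)⟩, ⟨by simpa using hj.2, f (j - 1), by simpa using hin (j - 1) (by omega) (by omega),
    ?_⟩, ?_, ?_, geo_subset_of_mem hH hfi hfj⟩
  · have := hadj (j - 1) (by omega)
    rw [show j - 1 + 1 = j by omega] at this
    exact this.symm
  · intro x hx hxi hxj
    obtain ⟨h2, h3, h4⟩ := (hmem x).1 hx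
    obtain ⟨l, hl, rfl⟩ := (hm x).1 h2
    rw [hlev l hl, hlev _ (by omega)] at h3 h4
    have : l ≠ i := fun h => hxi (h ▸ rfl)
    have : l ≠ j := fun h => hxj (h ▸ rfl)
    exact hin l (by omega) (by omega)
  · refine (hmem _).2 ⟨hz, ?_, ?_⟩ <;> rw [hlev _ (by omega), hlev _ (by omega)] <;> omega

end Geodesics
end MinWiener

/-! ### Heavy units from canonical shortest paths -/

namespace MinWiener

theorem UnitSystem.mem_units {V κ : Type*} {H : SimpleGraph V} {I : Finset V}
    (S : UnitSystem H I κ) {s : κ ⊕ ℕ} : s ∈ S.units ↔ ∃ x ∈ S.C, S.unit x = s := by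
  simp [UnitSystem.units]

section Heavy
variable {V : Type*} [Fintype V] {H : SimpleGraph V} {I : Finset V} {u v x y z w : V} {γ : V × V}

open Classical in
/-- The boundary vertices of `I`. -/
noncomputable def bdry (H : SimpleGraph V) (I : Finset V) : Finset V :=
  Finset.univ.filter fun a => Bd H I a

open Classical in
/-- The pairs of boundary vertices whose canonical shortest path runs inside of `I`. -/
noncomputable def inner (H : SimpleGraph V) (I : Finset V) : Finset (V × V) :=
  (bdry H I ×ˢ bdry H I).filter fun γ => ∀ x ∈ geo H γ.1 γ.2, x ≠ γ.1 → x ≠ γ.2 → x ∈ I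

open Classical in
/-- The inner paths through `y`. -/
noncomputable def through (H : SimpleGraph V) (I : Finset V) (y : V) : Finset (V × V) :=
  (inner H I).filter fun γ => y ∈ geo H γ.1 γ.2

/-- `y` is the first or last common vertex of `γ` and `γ'` along `γ`. -/
def IsExtreme (H : SimpleGraph V) (γ γ' : V × V) (y : V) : Prop :=
  y ∈ geo H γ.1 γ.2 ∧ y ∈ geo H γ'.1 γ'.2 ∧
    ((∀ w ∈ geo H γ.1 γ.2, w ∈ geo H γ'.1 γ'.2 → H.dist γ.1 y ≤ H.dist γ.1 w) ∨
      ∀ w ∈ geo H γ.1 γ.2, w ∈ geo H γ'.1 γ'.2 → H.dist γ.1 w ≤ H.dist γ.1 y)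

open Classical in
/-- The first and last common vertices of inner paths. -/
noncomputable def nodes (H : SimpleGraph V) (I : Finset V) : Finset V :=
  (inner H I ×ˢ inner H I).biUnion fun q => Finset.univ.filter (IsExtreme H q.1 q.2)

theorem mem_bdry : x ∈ bdry H I ↔ Bd H I x := by simp [bdry]

theorem notMem_of_mem_bdry (h : x ∈ bdry H I) : x ∉ I := by
  simpa using (mem_bdry.1 h).1

theorem mem_inner : γ ∈ inner H I ↔ γ.1 ∈ bdry H I ∧ γ.2 ∈ bdry H I ∧
    ∀ x ∈ geo H γ.1 γ.2, x ≠ γ.1 → x ≠ γ.2 → x ∈ I := by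
  simp [inner, and_assoc]

theorem mem_through : γ ∈ through H I y ↔ γ ∈ inner H I ∧ y ∈ geo H γ.1 γ.2 := by
  simp [through]

theorem card_inner_le : (inner H I).card ≤ (bdry H I).card ^ 2 := by
  classical
  refine (Finset.card_filter_le _ _).trans ?_
  rw [Finset.card_product, sq]

/-- An ordered pair of inner paths has one first and one last common vertex, as positions on a
canonical path determine its vertices; there are at most `p ^ 4` such pairs for `p` boundary
vertices. -/
theorem card_nodes_le (hH : H.Connected) : (nodes H I).card ≤ 2 * (bdry H I).card ^ 4 := by
  classical
  have h1 : (nodes H I).card ≤ (inner H I ×ˢ inner H I).card * 2 := by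
    refine Finset.card_biUnion_le_card_mul _ _ 2 fun q _ => ?_
    by_contra! hcon
    obtain ⟨a, b, c, ha, hb, hc, hab, hac, hbc⟩ := Finset.two_lt_card_iff.1 hcon
    simp only [Finset.mem_filter, Finset.mem_univ, true_and] at ha hb hc
    obtain ⟨a1, a2, a3⟩ := ha
    obtain ⟨b1, b2, b3⟩ := hb
    obtain ⟨c1, c2, c3⟩ := hc
    have e1 : H.dist q.1.1 a ≠ H.dist q.1.1 b := fun h => hab (eq_of_mem_geo hH a1 b1 h)
    have e2 : H.dist q.1.1 a ≠ H.dist q.1.1 c := fun h => hac (eq_of_mem_geo hH a1 c1 h)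
    have e3 : H.dist q.1.1 b ≠ H.dist q.1.1 c := fun h => hbc (eq_of_mem_geo hH b1 c1 h)
    rcases a3 with a3 | a3 <;> rcases b3 with b3 | b3 <;> rcases c3 with c3 | c3 <;>
      have t1 := a3 b b1 b2 <;> have t2 := a3 c c1 c2 <;> have t3 := b3 a a1 a2 <;>
      have t4 := b3 c c1 c2 <;> have t5 := c3 a a1 a2 <;> have t6 := c3 b b1 b2 <;> omega
  rw [Finset.card_product] at h1
  have h2 := Nat.mul_le_mul (card_inner_le (H := H) (I := I)) (card_inner_le (H := H) (I := I))
  have h3 : (bdry H I).card ^ 2 * (bdry H I).card ^ 2 = (bdry H I).card ^ 4 := by ring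
  omega

/-- The inner paths through a vertex do not change between nodes. -/
theorem through_eq (hH : H.Connected) (hγ : γ ∈ inner H I) (hx : x ∈ geo H γ.1 γ.2)
    (hy : y ∈ geo H γ.1 γ.2) (hxy : H.dist γ.1 x ≤ H.dist γ.1 y)
    (hno : ∀ w ∈ nodes H I, w ∈ geo H γ.1 γ.2 → H.dist γ.1 x ≤ H.dist γ.1 w →
      H.dist γ.1 y < H.dist γ.1 w) : through H I x = through H I y := by
  classical
  have hnode : ∀ γ' ∈ inner H I, ∀ w, IsExtreme H γ γ' w → w ∈ nodes H I := fun γ' hγ' w hw =>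
    Finset.mem_biUnion.2 ⟨(γ, γ'), by simp [hγ, hγ'], by simpa using hw⟩
  ext γ'
  simp only [mem_through]
  refine and_congr_right fun hγ' => ⟨fun hx' => ?_, fun hy' => ?_⟩
  -- The last common vertex of `γ` and `γ'` is a node at or after `x`, hence beyond `y`. Canonical
  -- paths agree between common vertices, so `γ'` contains `y`. The converse uses the first common
  -- vertex.
  · obtain ⟨w, hw, hmax⟩ := Finset.exists_max_image
      ((geo H γ.1 γ.2).filter fun w => w ∈ geo H γ'.1 γ'.2) (H.dist γ.1)
      ⟨x, by simp [hx, hx']⟩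
    simp only [Finset.mem_filter] at hw hmax
    have hn := hnode γ' hγ' w ⟨hw.1, hw.2, .inr fun w' h1 h2 => hmax w' ⟨h1, h2⟩⟩
    have h1 := hmax x ⟨hx, hx'⟩
    have h2 := hno w hn hw.1 h1
    exact geo_subset_of_mem hH hx' hw.2 ((mem_geo_of_mem hH hx hw.1 h1).2 ⟨hy, hxy, h2.le⟩)
  · obtain ⟨w, hw, hmin⟩ := Finset.exists_min_image
      ((geo H γ.1 γ.2).filter fun w => w ∈ geo H γ'.1 γ'.2) (H.dist γ.1)
      ⟨y, by simp [hy, hy']⟩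
    simp only [Finset.mem_filter] at hw hmin
    have hn := hnode γ' hγ' w ⟨hw.1, hw.2, .inl fun w' h1 h2 => hmin w' ⟨h1, h2⟩⟩
    have h1 := hmin y ⟨hy, hy'⟩
    have h2 : H.dist γ.1 w ≤ H.dist γ.1 x := by
      by_contra! hcon
      have := hno w hn hw.1 hcon.le
      omega
    exact geo_subset_of_mem hH hw.2 hy' ((mem_geo_of_mem hH hw.1 hy h1).2 ⟨hx, h2, hxy⟩)

open Classical in
/-- A selected inner path through `y`. -/
noncomputable def rep (H : SimpleGraph V) (I : Finset V) (y : V) : V × V :=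
  if h : (through H I y).Nonempty then h.choose else (y, y)

open Classical in
/-- The number of nodes on the selected path before `y`. -/
noncomputable def nodesBefore (H : SimpleGraph V) (I : Finset V) (γ : V × V) (y : V) : ℕ :=
  ((nodes H I).filter fun w => w ∈ geo H γ.1 γ.2 ∧ H.dist γ.1 w < H.dist γ.1 y).card

theorem rep_mem_through (h : (through H I y).Nonempty) : rep H I y ∈ through H I y := by
  rw [rep, dif_pos h]
  exact h.choose_spec

theorem rep_congr (h : (through H I y).Nonempty) (hxy : through H I x = through H I y) :
    rep H I x = rep H I y := by
  have hx : (through H I x).Nonempty := hxy ▸ h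
  rw [rep, rep, dif_pos h, dif_pos hx]
  congr 1
  rw [hxy]

/-- Between vertices with the same number of nodes before them there are no nodes. -/
theorem no_node_between (hxN : y ∉ nodes H I) (hH : H.Connected) (hy : y ∈ geo H γ.1 γ.2)
    (h : nodesBefore H I γ y ≤ nodesBefore H I γ x) (hxy : H.dist γ.1 x ≤ H.dist γ.1 y) :
    ∀ w ∈ nodes H I, w ∈ geo H γ.1 γ.2 → H.dist γ.1 x ≤ H.dist γ.1 w →
      H.dist γ.1 y < H.dist γ.1 w := by
  classical
  intro w hw hwγ hxw
  by_contra! hcon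
  rcases hcon.lt_or_eq with hlt | heq
  · have hsub : nodesBefore H I γ x < nodesBefore H I γ y := by
      apply Finset.card_lt_card
      refine Finset.ssubset_iff_of_subset ?_ |>.2 ⟨w, by simp [hw, hwγ, hlt], by simp [hxw]⟩
      intro w' hw'
      simp only [Finset.mem_filter] at hw' ⊢
      exact ⟨hw'.1, hw'.2.1, by omega⟩
    omega
  · exact hxN (eq_of_mem_geo hH hwγ hy heq ▸ hw)

open Classical in
/-- The label of a vertex in the heavy part. -/
noncomputable def heavyLabel (H : SimpleGraph V) (I : Finset V) (y : V) :
    (V ⊕ ((V × V) × ℕ)) ⊕ ℕ :=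
  .inl (if y ∈ I ∧ y ∉ nodes H I then .inr (rep H I y, nodesBefore H I (rep H I y) y) else .inl y)

open Classical in
/-- The boundary of `I` and the inner paths. -/
noncomputable def heavyPart (H : SimpleGraph V) (I : Finset V) : Finset V :=
  bdry H I ∪ Finset.univ.filter fun y => y ∈ I ∧ (through H I y).Nonempty

theorem heavyLabel_eq (h : heavyLabel H I y = heavyLabel H I x) (hx : x ∈ heavyPart H I)
    (hy : y ∈ heavyPart H I) :
    y = x ∨ (x ∈ I ∧ y ∈ I ∧ x ∉ nodes H I ∧ y ∉ nodes H I ∧ rep H I y = rep H I x ∧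
      nodesBefore H I (rep H I x) y = nodesBefore H I (rep H I x) x ∧
      rep H I x ∈ inner H I ∧ x ∈ geo H (rep H I x).1 (rep H I x).2 ∧
      y ∈ geo H (rep H I x).1 (rep H I x).2) := by
  have hthr : ∀ x ∈ heavyPart H I, x ∈ I → rep H I x ∈ through H I x := by
    intro x hx hxI
    simp only [heavyPart, Finset.mem_union, Finset.mem_filter, Finset.mem_univ, true_and] at hx
    rcases hx with hx | hx
    · exact absurd hxI (notMem_of_mem_bdry hx)
    · exact rep_mem_through hx.2
  unfold heavyLabel at h
  split_ifs at h with h1 h2 h2 <;>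
    simp only [Sum.inl.injEq, Sum.inr.injEq, Prod.mk.injEq, reduceCtorEq] at h
  · obtain ⟨h3, h4⟩ := h
    have h5 := mem_through.1 (hthr x hx h2.1)
    have h6 := mem_through.1 (hthr y hy h1.1)
    rw [h3] at h4 h6
    exact .inr ⟨h2.1, h1.1, h2.2, h1.2, h3, h4, h5.1, h5.2, h6.2⟩
  · exact .inl h

theorem nodesBefore_mono (h : H.dist γ.1 x ≤ H.dist γ.1 y) :
    nodesBefore H I γ x ≤ nodesBefore H I γ y := by
  classical
  refine Finset.card_le_card fun w hw => ?_
  simp only [Finset.mem_filter] at hw ⊢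
  exact ⟨hw.1, hw.2.1, by omega⟩

/-- Vertices of one unit have the same selected path, and the position is the distance from its
start: the triangle inequality. -/
theorem heavy_geodesic (hH : H.Connected) : ∀ x ∈ heavyPart H I, ∀ y ∈ heavyPart H I,
    heavyLabel H I x = heavyLabel H I y →
    H.dist (rep H I y).1 y ≤ H.dist (rep H I x).1 x + H.dist x y := by
  intro x hx y hy h
  rcases heavyLabel_eq h hy hx with h | ⟨-, -, -, -, h, -⟩
  · subst h; simp
  · rw [h]
    exact hH.dist_triangle

/-- The next vertex of the selected path is still in `I`, where all inner vertices of the path are,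
and is not a node, since none lies between `x` and `y`. So the same inner paths run through it, and
its selected path and label are those of `x`. -/
theorem heavy_step (hH : H.Connected) : ∀ x ∈ heavyPart H I, ∀ y ∈ heavyPart H I,
    heavyLabel H I x = heavyLabel H I y → H.dist (rep H I x).1 x < H.dist (rep H I y).1 y →
    ∃ z ∈ heavyPart H I, heavyLabel H I z = heavyLabel H I x ∧
      H.dist (rep H I z).1 z = H.dist (rep H I x).1 x + 1 ∧ H.Adj x z := by
  classical
  intro x hx y hy h hp
  rcases heavyLabel_eq h.symm hx hy with h | ⟨hxI, hyI, hxN, hyN, hr, hn, hγ, hx', hy'⟩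
  · subst h; omega
  · rw [hr] at hp
    generalize hγe : rep H I x = γ at *
    obtain ⟨f, h0, h1, hadj, hd, hm⟩ := exists_seq_geo hH γ.1 γ.2
    have hlev : ∀ k ≤ H.dist γ.1 γ.2, H.dist γ.1 (f k) = k := fun k hk => by
      have := hd 0 k (by omega) hk
      rw [h0] at this
      omega
    obtain ⟨i, hi, rfl⟩ := (hm x).1 hx'
    obtain ⟨j, hj, rfl⟩ := (hm y).1 hy'
    rw [hlev i hi, hlev j hj] at hp
    have hγ' := mem_inner.1 hγ
    have hzγ : f (i + 1) ∈ geo H γ.1 γ.2 := (hm _).2 ⟨i + 1, by omega, rfl⟩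
    have hjne : j ≠ H.dist γ.1 γ.2 := fun h => by
      rw [h, h1] at hyI
      exact notMem_of_mem_bdry hγ'.2.1 hyI
    have hzI : f (i + 1) ∈ I := by
      refine hγ'.2.2 _ hzγ (fun h => ?_) (fun h => ?_)
      · have := hlev (i + 1) (by omega)
        rw [h, SimpleGraph.dist_self] at this
        omega
      · have := hlev (i + 1) (by omega)
        rw [h] at this
        omega
    have hno := no_node_between hyN hH hy' hn.le (by rw [hlev i hi, hlev j hj]; omega)
    have hzN : f (i + 1) ∉ nodes H I := fun h => by
      have := hno _ h hzγ
      rw [hlev i hi, hlev j hj, hlev (i + 1) (by omega)] at this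
      omega
    have hthr : through H I (f i) = through H I (f (i + 1)) := by
      refine through_eq hH hγ hx' hzγ (by rw [hlev i hi, hlev _ (by omega)]; omega)
        fun w hw hwγ h => ?_
      have := hno w hw hwγ h
      rw [hlev j hj] at this
      rw [hlev _ (by omega)]
      omega
    have hne : (through H I (f (i + 1))).Nonempty := ⟨γ, mem_through.2 ⟨hγ, hzγ⟩⟩
    have hrep : rep H I (f (i + 1)) = γ := by rw [← rep_congr hne hthr, hγe]
    refine ⟨f (i + 1), ?_, ?_, ?_, hadj i (by omega)⟩
    · simp [heavyPart, hzI, hne]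
    · have hn' : nodesBefore H I γ (f (i + 1)) = nodesBefore H I γ (f i) := by
        refine le_antisymm (le_trans (nodesBefore_mono ?_) hn.le) (nodesBefore_mono ?_)
        · rw [hlev j hj, hlev _ (by omega)]; omega
        · rw [hlev i hi, hlev _ (by omega)]; omega
      rw [heavyLabel, heavyLabel, if_pos ⟨hzI, hzN⟩, if_pos ⟨hxI, hxN⟩, hrep, hγe, hn']
    · rw [hrep, hlev i hi, hlev _ (by omega)]

/-- If the canonical path from `u` to `v` meets `Z` in `z`, its run in `I` around `z` is part of an
inner path through `z`. There is no node between `x` and `y`, so this inner path contains both of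
them, and the canonical path contains the stretch from `x` to `y`, which the detour replaces. -/
theorem heavy_detour (hH : H.Connected) : ∀ x ∈ heavyPart H I, ∀ y ∈ heavyPart H I,
    heavyLabel H I x = heavyLabel H I y → H.dist (rep H I x).1 x ≤ H.dist (rep H I y).1 y →
    ∀ Z : Finset V, (∀ z ∈ Z, z ∈ heavyPart H I ∧ heavyLabel H I z = heavyLabel H I x ∧
      H.dist (rep H I x).1 x < H.dist (rep H I z).1 z ∧
      H.dist (rep H I z).1 z < H.dist (rep H I y).1 y) →
    ∀ d, Near H Z (H.dist (rep H I y).1 y - H.dist (rep H I x).1 x + d) x y →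
    ∀ u v, u ∉ I → v ∉ I → Near H Z (H.dist u v + d) u v := by
  classical
  intro x hx y hy h hp Z hZ d hd u v hu hv
  rcases heavyLabel_eq h.symm hx hy with h | ⟨hxI, hyI, hxN, hyN, hr, hn, hγ, hx', hy'⟩
  · subst h
    have : Z = ∅ := Finset.eq_empty_of_forall_notMem fun z hz => by
      have := hZ z hz
      omega
    rw [this]
    exact ((near_empty_of_connected hH u v).anti (by simp)).mono (by omega)
  · rw [hr] at hp hZ hd
    have hzp : ∀ z ∈ Z, z ∈ I ∧ z ∉ nodes H I ∧ z ∈ geo H (rep H I x).1 (rep H I x).2 ∧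
        H.dist (rep H I x).1 x < H.dist (rep H I x).1 z ∧
        H.dist (rep H I x).1 z < H.dist (rep H I x).1 y ∧
        through H I x = through H I z := by
      intro z hz
      obtain ⟨h1, h2, h3, h4⟩ := hZ z hz
      rcases heavyLabel_eq h2 hx h1 with h | ⟨-, hzI, -, hzN, hr', hn', -, -, hz'⟩
      · subst h; omega
      · rw [hr'] at h3 h4
        exact ⟨hzI, hzN, hz', h3, h4, through_eq hH hγ hx' hz' h3.le
          (no_node_between hzN hH hz' hn'.le h3.le)⟩
    have hthr : through H I x = through H I y :=
      through_eq hH hγ hx' hy' hp (no_node_between hyN hH hy' hn.le hp)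
    generalize rep H I x = γ at *
    by_cases hcap : ∀ z ∈ geo H u v, z ∉ Z
    · exact (geo_near hH (Z := (Z : Set V)) (by simpa using hcap)).mono (by omega)
    · push Not at hcap
      obtain ⟨z, hzuv, hzZ⟩ := hcap
      obtain ⟨hzI, -, hzγ, hz1, hz2, hzt⟩ := hzp z hzZ
      obtain ⟨a, b, ha, hb, hab, hzab, hsub⟩ := exists_run hH hu hv hzuv hzI
      have hmem : (a, b) ∈ through H I z :=
        mem_through.2 ⟨mem_inner.2 ⟨mem_bdry.2 ha, mem_bdry.2 hb, hab⟩, hzab⟩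
      have hxuv : x ∈ geo H u v := hsub (mem_through.1 (by rw [hzt]; exact hmem : (a, b) ∈ through H I x)).2
      have hyuv : y ∈ geo H u v := hsub (mem_through.1 (by rw [← hthr, hzt]; exact hmem : (a, b) ∈ through H I y)).2
      have hxyd := (dist_of_mem_geo hH hx' hy' hp).1
      have hbetween : ∀ z ∈ Z, z ∈ geo H x y ∧ z ≠ x ∧ z ≠ y := by
        intro z hz
        obtain ⟨-, -, h1, h2, h3, -⟩ := hzp z hz
        exact ⟨(mem_geo_of_mem hH hx' hy' hp).2 ⟨h1, h2.le, h3.le⟩,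
          fun h => by rw [h] at h2; omega, fun h => by rw [h] at h3; omega⟩
      -- Stated for arbitrary `x` and `y`, as the path from `u` to `v` may run through the unit in
      -- either direction.
      have key : ∀ x y, x ∈ geo H u v → y ∈ geo H u v → H.dist u x ≤ H.dist u y →
          (∀ z ∈ Z, z ∈ geo H x y ∧ z ≠ x ∧ z ≠ y) → Near H Z (H.dist x y + d) x y →
          Near H Z (H.dist u v + d) u v := by
        intro x y hx hy hxy hb hd
        have e1 := dist_of_mem_geo hH hx hy hxy
        have hu' := left_mem_geo hH u v
        have hv' := right_mem_geo hH u v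
        have e3 := dist_of_mem_geo hH hy hv' (by omega)
        have hzl : ∀ z ∈ Z, H.dist u x < H.dist u z ∧ H.dist u z < H.dist u y := by
          intro z hz
          obtain ⟨h1, h2, h3⟩ := hb z hz
          obtain ⟨h4, h5, h6⟩ := (mem_geo_of_mem hH hx hy hxy).1 h1
          have n1 : H.dist u x ≠ H.dist u z := fun h => h2 (eq_of_mem_geo hH hx h4 h).symm
          have n2 : H.dist u z ≠ H.dist u y := fun h => h3 (eq_of_mem_geo hH h4 hy h)
          omega
        have p1 : Near H Z (H.dist u x) u x := geo_near hH fun z hz hz' => by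
          have h1 := hzl z (by simpa using hz')
          have := ((mem_geo_of_mem hH hu' hx (by simp)).1 hz).2.2
          omega
        have p2 : Near H Z (H.dist y v) y v := geo_near hH fun z hz hz' => by
          have h1 := hzl z (by simpa using hz')
          have := ((mem_geo_of_mem hH hy hv' (by omega)).1 hz).2.1
          omega
        exact ((p1.trans hd).trans p2).mono (by omega)
      have hd' : Near H Z (H.dist x y + d) x y := hd.mono (by omega)
      rcases le_total (H.dist u x) (H.dist u y) with h | h
      · exact key x y hxuv hyuv h hbetween hd'
      · refine key y x hyuv hxuv h (fun z hz => ?_) (by rw [H.dist_comm]; exact hd'.symm)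
        rw [geo_comm hH]
        exact ⟨(hbetween z hz).1, (hbetween z hz).2.2, (hbetween z hz).2.1⟩

/-- Canonical paths between vertices outside of `I` meet `I` in inner paths only, and all of these
are heavy. -/
theorem heavy_light_free (hH : H.Connected) : ∀ Z : Finset V, Z ⊆ I →
    (∀ z ∈ Z, z ∈ heavyPart H I → (heavyLabel H I z).isRight) →
    ∀ u v, u ∉ I → v ∉ I → Near H Z (H.dist u v) u v := by
  intro Z hZ hZl u v hu hv
  refine geo_near hH fun z hz hz' => ?_
  have hz' : z ∈ Z := by simpa using hz'
  obtain ⟨a, b, ha, hb, hab, hzab, -⟩ := exists_run hH hu hv hz (hZ hz')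
  have hmem : (a, b) ∈ through H I z :=
    mem_through.2 ⟨mem_inner.2 ⟨mem_bdry.2 ha, mem_bdry.2 hb, hab⟩, hzab⟩
  have := hZl z hz' (by simp only [heavyPart, Finset.mem_union, Finset.mem_filter,
    Finset.mem_univ, true_and]; exact .inr ⟨hZ hz', _, hmem⟩)
  simp [heavyLabel] at this

open Classical in
/-- The system of heavy units. -/
noncomputable def heavySystem (hH : H.Connected) (I : Finset V) :
    UnitSystem H I (V ⊕ ((V × V) × ℕ)) := by
  refine
    { C := heavyPart H I
      unit := heavyLabel H I
      pos := fun y => H.dist (rep H I y).1 y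
      bd_mem := fun a ha => Finset.mem_union_left _ (mem_bdry.2 ha)
      singleton := ?_
      inj := ?_
      step := heavy_step hH
      link := fun x hx y hy h l hl => (heavy_geodesic hH x hx y hy h).trans (Nat.add_le_add_left hl.dist_le _)
      heavy_geodesic := fun x hx y hy h _ => heavy_geodesic hH x hx y hy h
      heavy_detour := fun x hx y hy h _ => heavy_detour hH x hx y hy h
      light_free := heavy_light_free hH }
  · intro x hx hxI y hy h
    rcases heavyLabel_eq h hx hy with h | h
    · exact h
    · exact absurd h.1 hxI
  · intro x hx y hy h hp
    rcases heavyLabel_eq h hy hx with h | ⟨-, -, -, -, h, -, -, h1, h2⟩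
    · exact h
    · rw [h] at hp
      exact eq_of_mem_geo hH h2 h1 hp

theorem heavySystem_isLeft (hH : H.Connected) (x : V) : ((heavySystem hH I).unit x).isLeft := rfl

theorem heavySystem_grown (hH : H.Connected) : (heavySystem hH I).Grown 0 where
  lt x _ i h := by
    have := heavySystem_isLeft (I := I) hH x
    rw [h] at this
    simp at this
  rooted x hx := ⟨x, hx, rfl, .rfl⟩
  le_joined := Nat.zero_le _

/-- A bound for the number of heavy units. -/
def heavyBound (p : ℕ) : ℕ := p + 2 * p ^ 4 + p ^ 2 * (2 * p ^ 4 + 1)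

/-- Boundary vertices and nodes are units by themselves, `p + 2 p ^ 4` in number. Any other unit is
determined by one of at most `p ^ 2` inner paths and a number of nodes between `0` and `2 p ^ 4`. -/
theorem card_heavyUnits_le (hH : H.Connected) :
    (heavySystem hH I).heavyUnits.card ≤ heavyBound (bdry H I).card := by
  classical
  set N := 2 * (bdry H I).card ^ 4 with hN
  have hsub : (heavySystem hH I).heavyUnits ⊆
      ((bdry H I ∪ nodes H I).image fun x => Sum.inl (Sum.inl x)) ∪
      ((inner H I ×ˢ Finset.range (N + 1)).image fun x => Sum.inl (Sum.inr x)) := by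
    intro s hs
    obtain ⟨x, hx, rfl⟩ := (UnitSystem.mem_units _).1 (Finset.mem_filter.1 hs).1
    have hx' : x ∈ heavyPart H I := hx
    show heavyLabel H I x ∈ _
    rw [heavyLabel, Finset.mem_union]
    simp only [heavyPart, Finset.mem_union, Finset.mem_filter, Finset.mem_univ, true_and] at hx'
    split_ifs with h
    · right
      refine Finset.mem_image.2 ⟨_, ?_, rfl⟩
      rcases hx' with hx' | hx'
      · exact absurd h.1 (notMem_of_mem_bdry hx')
      · refine Finset.mem_product.2 ⟨(mem_through.1 (rep_mem_through hx'.2)).1, ?_⟩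
        have h1 := card_nodes_le (I := I) hH
        have h2 : nodesBefore H I (rep H I x) x ≤ (nodes H I).card := Finset.card_filter_le _ _
        simp only [Finset.mem_range]
        omega
    · left
      refine Finset.mem_image.2 ⟨x, ?_, rfl⟩
      rw [Finset.mem_union]
      rcases hx' with hx' | hx'
      · exact .inl hx'
      · right
        by_contra hn
        exact h ⟨hx'.1, hn⟩
  refine (Finset.card_le_card hsub).trans ((Finset.card_union_le _ _).trans ?_)
  have h1 := (Finset.card_image_le (s := bdry H I ∪ nodes H I)
    (f := fun x => (Sum.inl (Sum.inl x) : (V ⊕ ((V × V) × ℕ)) ⊕ ℕ))).trans (Finset.card_union_le _ _)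
  have h2 := Finset.card_image_le (s := inner H I ×ˢ Finset.range (N + 1))
    (f := fun x => (Sum.inl (Sum.inr x) : (V ⊕ ((V × V) × ℕ)) ⊕ ℕ))
  rw [Finset.card_product, Finset.card_range] at h2
  have h3 := card_nodes_le (I := I) hH
  have h4 : (inner H I).card * (N + 1) ≤ (bdry H I).card ^ 2 * (N + 1) :=
    Nat.mul_le_mul_right _ card_inner_le
  show _ ≤ (bdry H I).card + N + (bdry H I).card ^ 2 * (N + 1)
  omega

/-- A bound for the number of units. -/
def unitBound (p : ℕ) : ℕ := heavyBound p + heavyBound p ^ 2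

/-- A tight part with few boundary vertices has few branching vertices. -/
theorem card_branch_le_of_tight (hH : H.Connected) {M K p : ℕ} (hT : Tight H I M K) (hK : 1 ≤ K)
    (hp1 : 1 ≤ p) (hp : (bdry H I).card ≤ p) (hM : 2000 * (K ^ 2 * unitBound p ^ 4) ≤ M)
    (B : Finset V) (hBI : B ⊆ I)
    (hB : ∀ v ∈ B, ∃ A : Finset V, 3 ≤ A.card ∧ ∀ a ∈ A, H.Adj v a) :
    B.card ≤ unitBound p ^ 2 * (UnitSystem.hullBound K (unitBound p) 0 + 1) := by
  have hg : (heavySystem hH I).heavyUnits.card ≤ heavyBound p := by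
    refine (card_heavyUnits_le hH).trans ?_
    unfold heavyBound
    gcongr
  have hU : 1 ≤ unitBound p := by
    have : 1 ≤ heavyBound p := by unfold heavyBound; omega
    unfold unitBound
    omega
  have hU' : unitBound p ≤ K ^ 2 * unitBound p ^ 4 := by
    calc unitBound p = 1 * unitBound p ^ 1 := by ring
      _ ≤ K ^ 2 * unitBound p ^ 4 := by
        gcongr
        · exact Nat.one_le_pow _ _ hK
        · norm_num
  obtain ⟨S, hR, hSU⟩ := (heavySystem_grown hH).exists_covering hH hT hK hg hM (by omega)
  exact S.card_branch_le hH hT hK hR hSU (by unfold unitBound at hU hU' hM; omega) B hBI hB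

end Heavy
end MinWiener

/-! ### Lean graphs: size, tight parts and balls -/

namespace MinWiener

section Global
variable {V : Type*} [Fintype V] {H : SimpleGraph V} {Q : Finset V}

open Classical in
/-- Removing vertices outside of `Q` does not decrease the sum of all distances. -/
def IsLean (H : SimpleGraph V) (Q : Finset V) : Prop :=
  ∀ Z : Finset V, Disjoint Z Q → Zᶜ.Nonempty →
    (∀ u v, u ∉ Z → v ∉ Z → (avoid H Z).Reachable u v) →
    ∑ u, ∑ v, H.dist u v ≤ ∑ u ∈ Zᶜ, ∑ v ∈ Zᶜ, (avoid H Z).dist u v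

/-- Removing `Z` saves at least the distances from `Z` to all vertices. It adds at most `x` to every
remaining ordered pair, and a further `y` to the at most `2 |I| |V|` of them that meet `I`; leanness
says that the loss is no less than the saving. -/
theorem IsLean.sum_removed_le (hL : IsLean H Q) {Z I : Finset V} (hZQ : Disjoint Z Q)
    (hZ : ∃ v, v ∉ Z) {x y : ℕ}
    (hx : ∀ u v, u ∉ I → v ∉ I → u ∉ Z → v ∉ Z → Near H Z (H.dist u v + x) u v)
    (hy : ∀ u v, u ∉ Z → v ∉ Z → Near H Z (H.dist u v + y) u v) :
    ∑ z ∈ Z, ∑ v, H.dist z v ≤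
      Fintype.card V ^ 2 * x + 2 * I.card * Fintype.card V * y := by
  classical
  have h := hL Z hZQ (by simpa [Finset.Nonempty] using hZ) fun u v hu hv => (hy u v hu hv).reachable
  have hterm : ∀ u ∈ Zᶜ, ∀ v ∈ Zᶜ, (avoid H Z).dist u v ≤
      H.dist u v + (x + (if u ∈ I then y else 0) + (if v ∈ I then y else 0)) := by
    intro u hu v hv
    rw [Finset.mem_compl] at hu hv
    have h1 := (hy u v hu hv).dist_avoid_le
    by_cases huI : u ∈ I
    · simp only [huI, if_true]; omega
    by_cases hvI : v ∈ I
    · simp only [hvI, if_true]; omega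
    have h2 := (hx u v huI hvI hu hv).dist_avoid_le
    omega
  have h1 : ∑ u ∈ Zᶜ, ∑ v ∈ Zᶜ, (avoid H Z).dist u v ≤ ∑ u ∈ Zᶜ, ∑ v ∈ Zᶜ, H.dist u v +
      (Fintype.card V ^ 2 * x + 2 * I.card * Fintype.card V * y) := by
    refine (Finset.sum_le_sum fun u hu => Finset.sum_le_sum fun v hv => hterm u hu v hv).trans ?_
    simp only [Finset.sum_add_distrib]
    refine Nat.add_le_add_left ?_ _
    have e1 : ∑ u ∈ Zᶜ, ∑ v ∈ Zᶜ, x ≤ Fintype.card V ^ 2 * x := by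
      simp only [Finset.sum_const, smul_eq_mul]
      rw [← mul_assoc, ← sq]
      exact Nat.mul_le_mul_right _ (Nat.pow_le_pow_left (Finset.card_le_univ _) 2)
    have e0 : ∑ u ∈ Zᶜ, (if u ∈ I then y else 0) ≤ I.card * y := by
      rw [← Finset.sum_filter, Finset.sum_const, smul_eq_mul]
      exact Nat.mul_le_mul_right _ (Finset.card_le_card fun v hv => (Finset.mem_filter.1 hv).2)
    have e2 : ∑ u ∈ Zᶜ, ∑ v ∈ Zᶜ, (if u ∈ I then y else 0) ≤ I.card * Fintype.card V * y := by
      rw [Finset.sum_comm, Finset.sum_const, smul_eq_mul]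
      calc _ ≤ Fintype.card V * (I.card * y) := Nat.mul_le_mul (Finset.card_le_univ _) e0
        _ = _ := by ring
    have e3 : ∑ u ∈ Zᶜ, ∑ v ∈ Zᶜ, (if v ∈ I then y else 0) ≤ I.card * Fintype.card V * y := by
      rw [Finset.sum_const, smul_eq_mul]
      calc _ ≤ Fintype.card V * (I.card * y) := Nat.mul_le_mul (Finset.card_le_univ _) e0
        _ = _ := by ring
    have e4 : 2 * I.card * Fintype.card V * y = I.card * Fintype.card V * y + I.card * Fintype.card V * y := by
      ring
    omega
  have h2 : ∑ z ∈ Z, ∑ v, H.dist z v + ∑ u ∈ Zᶜ, ∑ v ∈ Zᶜ, H.dist u v ≤ ∑ u, ∑ v, H.dist u v := by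
    rw [← Finset.sum_add_sum_compl Z]
    refine Nat.add_le_add_left (Finset.sum_le_sum fun u _ => ?_) _
    exact Finset.sum_le_sum_of_subset (Finset.subset_univ _)
  omega

/-- The summand is the absolute value of `a - i`. Pairing `i` with `D - i` shows that the sum is
smallest at the centre, where `h1` evaluates it by induction in steps of two. -/
theorem sq_le_sum_dist_center (D a : ℕ) :
    D ^ 2 ≤ 4 * ∑ i ∈ Finset.range (D + 1), ((a - i) + (i - a)) := by
  have h1 : ∀ D : ℕ, D ^ 2 ≤ 2 * ∑ i ∈ Finset.range (D + 1), ((D - 2 * i) + (2 * i - D)) := by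
    intro D
    induction D using Nat.twoStepInduction with
    | zero => simp
    | one => simp [Finset.sum_range_succ]
    | more D ih _ =>
      rw [Finset.sum_range_succ', show D + 1 + 1 = (D + 1) + 1 from rfl, Finset.sum_range_succ]
      have : ∑ i ∈ Finset.range (D + 1), ((D + 2 - 2 * (i + 1)) + (2 * (i + 1) - (D + 2))) =
          ∑ i ∈ Finset.range (D + 1), ((D - 2 * i) + (2 * i - D)) :=
        Finset.sum_congr rfl fun i _ => by omega
      rw [this]
      have h3 : (D + 2 - 2 * (D + 1 + 1)) + (2 * (D + 1 + 1) - (D + 2)) = D + 2 := by omega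
      have h4 : (D + 2) ^ 2 = D ^ 2 + 4 * D + 4 := by ring
      rw [h3, h4]
      omega
  have h2 := Finset.sum_range_reflect (fun i => (a - i) + (i - a)) (D + 1)
  have h3 : ∑ i ∈ Finset.range (D + 1), ((D - 2 * i) + (2 * i - D)) ≤
      ∑ i ∈ Finset.range (D + 1), (((a - i) + (i - a)) + ((a - (D + 1 - 1 - i)) + (D + 1 - 1 - i - a))) :=
    Finset.sum_le_sum fun i hi => by
      have := Finset.mem_range.1 hi
      omega
  have h4 := Finset.sum_add_distrib (s := Finset.range (D + 1)) (f := fun i => (a - i) + (i - a))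
    (g := fun i => (a - (D + 1 - 1 - i)) + (D + 1 - 1 - i - a))
  rw [h2] at h4
  have := (h1 D).trans (Nat.mul_le_mul_left 2 (h3.trans_eq h4))
  omega

/-- The distances from a vertex have a large sum if there are two distant vertices. -/
theorem sq_le_sum_dist (hH : H.Connected) (q q' v : V) :
    H.dist q q' ^ 2 ≤ 4 * ∑ u, H.dist v u := by
  classical
  obtain ⟨f, h0, h1, -, hd, -⟩ := exists_seq_geo hH q q'
  set D := H.dist q q'
  have hinj : Set.InjOn f (Finset.range (D + 1) : Set ℕ) := by
    intro i hi j hj hij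
    simp only [Finset.coe_range, Set.mem_Iio] at hi hj
    rcases le_total i j with h | h
    · have := hd i j h (by omega)
      rw [hij, SimpleGraph.dist_self] at this
      omega
    · have := hd j i h (by omega)
      rw [hij, SimpleGraph.dist_self] at this
      omega
  refine (sq_le_sum_dist_center D (H.dist q v)).trans (Nat.mul_le_mul_left _ ?_)
  calc ∑ i ∈ Finset.range (D + 1), ((H.dist q v - i) + (i - H.dist q v))
      ≤ ∑ i ∈ Finset.range (D + 1), H.dist v (f i) := Finset.sum_le_sum fun i hi => by
        have hi' := Finset.mem_range.1 hi
        have e := hd 0 i (by omega) (by omega)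
        rw [h0] at e
        have t1 := hH.dist_triangle (u := q) (v := v) (w := f i)
        have t2 := hH.dist_triangle (u := q) (v := f i) (w := v)
        rw [H.dist_comm (u := f i)] at t2
        omega
    _ = ∑ u ∈ (Finset.range (D + 1)).image f, H.dist v u := (Finset.sum_image hinj).symm
    _ ≤ ∑ u, H.dist v u := Finset.sum_le_sum_of_subset (Finset.subset_univ _)

theorem IsLean.card_mul_sq_le (hL : IsLean H Q) (hH : H.Connected) (q q' : V) {Z I : Finset V}
    (hZQ : Disjoint Z Q)
    (hZ : ∃ v, v ∉ Z) {x y : ℕ}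
    (hx : ∀ u v, u ∉ I → v ∉ I → u ∉ Z → v ∉ Z → Near H Z (H.dist u v + x) u v)
    (hy : ∀ u v, u ∉ Z → v ∉ Z → Near H Z (H.dist u v + y) u v) :
    Z.card * H.dist q q' ^ 2 ≤
      4 * (Fintype.card V ^ 2 * x + 2 * I.card * Fintype.card V * y) := by
  have h := hL.sum_removed_le hZQ hZ hx hy
  have h1 : Z.card * H.dist q q' ^ 2 ≤ ∑ z ∈ Z, 4 * ∑ v, H.dist z v := by
    rw [← smul_eq_mul, ← Finset.sum_const]
    exact Finset.sum_le_sum fun z _ => sq_le_sum_dist hH q q' z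
  rw [← Finset.mul_sum] at h1
  omega

theorem card_geo (hH : H.Connected) (u v : V) : (geo H u v).card ≤ H.dist u v + 1 := by
  classical
  obtain ⟨f, -, -, -, -, hm⟩ := exists_seq_geo hH u v
  have : geo H u v ⊆ (Finset.range (H.dist u v + 1)).image f := fun x hx => by
    simpa [Nat.lt_succ_iff] using (hm x).1 hx
  exact (Finset.card_le_card this).trans (Finset.card_image_le.trans (by simp))

theorem dist_le_of_mem_geo (hH : H.Connected) {u v x : V} (hx : x ∈ geo H u v) :
    H.dist u x ≤ H.dist u v := by
  have := (dist_of_mem_geo hH (left_mem_geo hH u v) hx (by simp)).2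
  omega

/-- A lean graph has few vertices. -/
theorem IsLean.card_le (hL : IsLean H Q) (hH : H.Connected) {q q' : V} (hq : q ∈ Q)
    (hmax : ∀ a ∈ Q, ∀ b ∈ Q, H.dist a b ≤ H.dist q q') (hD : 1 ≤ H.dist q q') :
    Fintype.card V ≤ 32 * Q.card ^ 2 * H.dist q q' := by
  classical
  set D := H.dist q q' with hDdef
  -- Deleting all but the canonical paths from `q` to `Q` leaves at most `2 |Q| D` vertices with
  -- mutual distances at most `2D`, so a distance sum of at most `8 |Q|² D³`. The whole graph has
  -- distance sum at least `|V| D² / 4`.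
  set P := Q.biUnion fun a => geo H q a with hP
  have hPcard : P.card ≤ 2 * Q.card * D := by
    calc P.card ≤ Q.card * (D + 1) := Finset.card_biUnion_le_card_mul _ _ _ fun a ha =>
          (card_geo hH q a).trans (by have := hmax q hq a ha; omega)
      _ ≤ Q.card * (2 * D) := Nat.mul_le_mul_left _ (by omega)
      _ = _ := by ring
  have hnear : ∀ p ∈ P, Near H (Pᶜ : Finset V) D q p := by
    intro p hp
    obtain ⟨a, ha, hpa⟩ := Finset.mem_biUnion.1 hp
    refine (geo_near hH fun z hz hz' => ?_).mono ((dist_le_of_mem_geo hH hpa).trans (hmax q hq a ha))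
    have : z ∈ P := Finset.mem_biUnion.2 ⟨a, ha, geo_subset_of_mem hH (left_mem_geo hH q a) hpa hz⟩
    simp [this] at hz'
  have hqP : q ∈ P := Finset.mem_biUnion.2 ⟨q, hq, left_mem_geo hH q q⟩
  have hnear2 : ∀ u v, u ∉ Pᶜ → v ∉ Pᶜ → Near H (Pᶜ : Finset V) (2 * D) u v := fun u v hu hv =>
    ((hnear u (by simpa using hu)).symm.trans (hnear v (by simpa using hv))).mono (by omega)
  have h := hL Pᶜ (by
    rw [Finset.disjoint_left]
    intro a ha haQ
    exact (Finset.mem_compl.1 ha) (Finset.mem_biUnion.2 ⟨a, haQ, right_mem_geo hH q a⟩))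
    ⟨q, by simpa using hqP⟩ fun u v hu hv => (hnear2 u v hu hv).reachable
  rw [compl_compl] at h
  have h1 : ∑ u ∈ P, ∑ v ∈ P, (avoid H (Pᶜ : Finset V)).dist u v ≤ P.card * (P.card * (2 * D)) := by
    rw [← smul_eq_mul, ← smul_eq_mul, ← Finset.sum_const, ← Finset.sum_const]
    exact Finset.sum_le_sum fun u hu => Finset.sum_le_sum fun v hv =>
      (hnear2 u v (by simpa using hu) (by simpa using hv)).dist_avoid_le
  have h2 : Fintype.card V * D ^ 2 ≤ 4 * ∑ u, ∑ v, H.dist u v := by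
    rw [Finset.mul_sum, ← smul_eq_mul, ← Finset.card_univ, ← Finset.sum_const]
    exact Finset.sum_le_sum fun u _ => sq_le_sum_dist hH q q' u
  have h3 : P.card * (P.card * (2 * D)) ≤ 2 * Q.card * D * (2 * Q.card * D * (2 * D)) := by gcongr
  have h4 : Fintype.card V * D ^ 2 ≤ 32 * Q.card ^ 2 * D * D ^ 2 := by
    calc _ ≤ 4 * (2 * Q.card * D * (2 * Q.card * D * (2 * D))) := by omega
      _ = _ := by ring
  exact Nat.le_of_mul_le_mul_right h4 (by positivity)

/-- The degenerate case. -/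
theorem IsLean.card_le_one (hL : IsLean H Q) (hH : H.Connected)
    (hQ : Q.card ≤ 1) : Fintype.card V ≤ 1 := by
  classical
  obtain ⟨q, hq⟩ : ∃ q, Q ⊆ {q} := by
    rcases Q.eq_empty_or_nonempty with h | ⟨q, hq⟩
    · obtain ⟨q⟩ := hH.nonempty
      exact ⟨q, by simp [h]⟩
    · exact ⟨q, fun a ha => by simpa using Finset.card_le_one.1 hQ a ha q hq⟩
  have h := hL ({q}ᶜ : Finset V) (by
    rw [Finset.disjoint_left]
    intro a ha haQ
    exact (Finset.mem_compl.1 ha) (hq haQ)) ⟨q, by simp⟩ fun u v hu hv => by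
      simp only [Finset.mem_compl, Finset.mem_singleton, not_not] at hu hv
      rw [hu, hv]
  simp only [compl_compl, Finset.sum_singleton, SimpleGraph.dist_self, nonpos_iff_eq_zero,
    Finset.sum_eq_zero_iff, Finset.mem_univ, true_imp_iff] at h
  rw [Fintype.card_le_one_iff]
  exact fun a b => (hH a b).dist_eq_zero_iff.1 (h a b)

/-- Parts of a lean graph are tight. -/
theorem IsLean.tight (hL : IsLean H Q) (hH : H.Connected) {q q' : V} (hq : q ∈ Q) {C M : ℕ}
    (hD : 1 ≤ H.dist q q') (hm : Fintype.card V ≤ C * H.dist q q') {I : Finset V}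
    (hI : Disjoint I Q) (hM : 8 * C * I.card * M ≤ H.dist q q') : Tight H I M (4 * C ^ 2) := by
  intro Z hZ x y hx hy
  have hqZ : q ∉ Z := fun h => Finset.disjoint_left.1 hI (hZ h) hq
  have h := hL.card_mul_sq_le hH q q' (Finset.disjoint_of_subset_left hZ hI) ⟨q, hqZ⟩
    (fun u v hu hv _ _ => hx u v hu hv) hy
  set D := H.dist q q'
  -- With `|V| ≤ C D`, the smallness of `I` turns the second error term into at most `D² y`, and
  -- `D²` cancels.
  have h1 : M * Z.card * D ^ 2 ≤ (M * (4 * C ^ 2) * x + y) * D ^ 2 := by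
    calc M * Z.card * D ^ 2 = M * (Z.card * D ^ 2) := by ring
      _ ≤ M * (4 * (Fintype.card V ^ 2 * x + 2 * I.card * Fintype.card V * y)) :=
        Nat.mul_le_mul_left _ h
      _ ≤ M * (4 * ((C * D) ^ 2 * x + 2 * I.card * (C * D) * y)) := by gcongr
      _ = M * (4 * C ^ 2) * x * D ^ 2 + (8 * C * I.card * M) * D * y := by ring
      _ ≤ M * (4 * C ^ 2) * x * D ^ 2 + D * D * y := by gcongr
      _ = _ := by ring
  exact Nat.le_of_mul_le_mul_right h1 (by positivity)

/-! ### Balls -/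

open Classical in
/-- The ball of radius `r` around `z`. -/
noncomputable def ball (H : SimpleGraph V) (z : V) (r : ℕ) : Finset V :=
  Finset.univ.filter fun v => H.dist z v ≤ r

open Classical in
/-- The sphere of radius `r` around `z`. -/
noncomputable def sphere (H : SimpleGraph V) (z : V) (r : ℕ) : Finset V :=
  Finset.univ.filter fun v => H.dist z v = r

theorem mem_ball {z v : V} {r : ℕ} : v ∈ ball H z r ↔ H.dist z v ≤ r := by simp [ball]

theorem mem_sphere {z v : V} {r : ℕ} : v ∈ sphere H z r ↔ H.dist z v = r := by simp [sphere]

theorem ball_mono (H : SimpleGraph V) (z : V) {r s : ℕ} (h : r ≤ s) : ball H z r ⊆ ball H z s :=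
  fun _ hv => mem_ball.2 ((mem_ball.1 hv).trans h)

theorem card_ball_succ (H : SimpleGraph V) (z : V) (r : ℕ) :
    (ball H z (r + 1)).card = (ball H z r).card + (sphere H z (r + 1)).card := by
  classical
  rw [← Finset.card_union_of_disjoint]
  · congr 1
    ext v
    simp only [mem_ball, mem_sphere, Finset.mem_union]
    omega
  · rw [Finset.disjoint_left]
    intro v hv hv'
    rw [mem_ball] at hv
    rw [mem_sphere] at hv'
    omega

/-- One step of the comparison of the sizes of balls. -/
theorem IsLean.card_ball_step (hL : IsLean H Q) (hH : H.Connected) {q q' : V} (hq : q ∈ Q) {C : ℕ}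
    (hD : 1 ≤ H.dist q q') (hm : Fintype.card V ≤ C * H.dist q q') (z : V) (r : ℕ) :
    (r + 1) * (ball H z r).card ≤
      r * (ball H z (r + 1)).card + (Q.card + 1 + 8 * C ^ 2) * (r + 1) := by
  classical
  -- Of the ball only the canonical paths from `z` to the next sphere and to `Q` are kept, at most
  -- `r` vertices for each target besides `z`. The deleted set `Z` is small, since every boundary
  -- vertex of `Z` still reaches `z` along such a path in at most `r + 1` steps.
  set T := sphere H z (r + 1) ∪ Q with hT
  set P := T.biUnion fun a => geo H z a with hP
  set Z := ball H z r \ P with hZ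
  have hZQ : Disjoint Z Q := by
    rw [Finset.disjoint_left]
    intro a ha haQ
    exact (Finset.mem_sdiff.1 ha).2 (Finset.mem_biUnion.2 ⟨a, by simp [hT, haQ], right_mem_geo hH z a⟩)
  have hbd : ∀ a, Bd H Z a → Near H Z (r + 1) a z := by
    rintro a ⟨ha, b, hb, hab⟩
    have hb' : b ∈ Z := by simpa using hb
    have ha' : a ∉ Z := by simpa using ha
    have hbr := mem_ball.1 (Finset.mem_sdiff.1 hb').1
    have hdist : H.dist z a ≤ r + 1 := by
      have h1 := hH.dist_triangle (u := z) (v := b) (w := a)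
      have h2 : H.dist b a = 1 := SimpleGraph.dist_eq_one_iff_adj.2 hab.symm
      omega
    have hex : ∃ t ∈ T, a ∈ geo H z t := by
      rcases Nat.lt_or_ge r (H.dist z a) with h | h
      · exact ⟨a, Finset.mem_union_left _ (mem_sphere.2 (by omega)), right_mem_geo hH z a⟩
      · have : a ∈ P := by
          by_contra hP
          exact ha' (Finset.mem_sdiff.2 ⟨mem_ball.2 h, hP⟩)
        exact Finset.mem_biUnion.1 this
    obtain ⟨t, ht, hat⟩ := hex
    refine Near.symm ((geo_near hH fun c hc hc' => ?_).mono hdist)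
    have hc2 : c ∈ Z := by simpa using hc'
    exact (Finset.mem_sdiff.1 hc2).2 (Finset.mem_biUnion.2
      ⟨t, ht, geo_subset_of_mem hH (left_mem_geo hH z t) hat hc⟩)
  have hnear : ∀ u v, u ∉ Z → v ∉ Z → Near H Z (H.dist u v + 2 * (r + 1)) u v := fun u v hu hv =>
    near_of_boundary hH (near_of_boundary_center z hbd) (by simpa using hu) (by simpa using hv)
  have h := hL.card_mul_sq_le hH q q' (I := ∅) hZQ
    ⟨q, fun h => Finset.disjoint_left.1 hZQ h hq⟩ (fun u v _ _ => hnear u v) hnear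
  set D := H.dist q q'
  have h1 : Z.card ≤ 8 * C ^ 2 * (r + 1) := by
    have : Z.card * D ^ 2 ≤ 8 * C ^ 2 * (r + 1) * D ^ 2 := by
      calc _ ≤ _ := h
        _ = 4 * (Fintype.card V ^ 2 * (2 * (r + 1))) := by simp
        _ ≤ 4 * ((C * D) ^ 2 * (2 * (r + 1))) := by gcongr
        _ = _ := by ring
    exact Nat.le_of_mul_le_mul_right this (by positivity)
  have h2 : (ball H z r ∩ P).card ≤ 1 + T.card * r := by
    have hsub : ball H z r ∩ P ⊆ {z} ∪ T.biUnion fun a => (geo H z a).filter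
        fun v => 1 ≤ H.dist z v ∧ H.dist z v ≤ r := by
      intro v hv
      obtain ⟨hv1, hv2⟩ := Finset.mem_inter.1 hv
      obtain ⟨a, ha, hva⟩ := Finset.mem_biUnion.1 hv2
      rw [Finset.mem_union]
      by_cases hvz : v = z
      · simp [hvz]
      · right
        refine Finset.mem_biUnion.2 ⟨a, ha, Finset.mem_filter.2 ⟨hva, ?_, mem_ball.1 hv1⟩⟩
        exact Nat.one_le_iff_ne_zero.2 fun h => hvz ((hH z v).dist_eq_zero_iff.1 h).symm
    refine (Finset.card_le_card hsub).trans ((Finset.card_union_le _ _).trans ?_)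
    refine Nat.add_le_add (by simp) (Finset.card_biUnion_le_card_mul _ _ _ fun a _ => ?_)
    refine (Finset.card_le_card_of_injOn (t := Finset.Icc 1 r) (H.dist z) (fun v hv => ?_) ?_).trans ?_
    · have := (Finset.mem_filter.1 hv).2
      simpa using this
    · intro _ hv _ hw h
      exact eq_of_mem_geo hH (Finset.mem_filter.1 hv).1 (Finset.mem_filter.1 hw).1 h
    · simp
  have h3 : (ball H z r).card = Z.card + (ball H z r ∩ P).card := by
    rw [hZ, Finset.card_sdiff_add_card_inter]
  have h4 : T.card ≤ (sphere H z (r + 1)).card + Q.card := Finset.card_union_le _ _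
  have h5 := card_ball_succ H z r
  have h6 : T.card * r ≤ ((sphere H z (r + 1)).card + Q.card) * r := Nat.mul_le_mul_right _ h4
  rw [h5]
  nlinarith

/-- By the single step, the ratio of the size of a ball to its radius does not drop by more than `K'
/ r` from one radius to the next; add this up over the radii from `r` to `2r`. -/
theorem IsLean.card_ball_double (hL : IsLean H Q) (hH : H.Connected) {q q' : V} (hq : q ∈ Q) {C : ℕ}
    (hD : 1 ≤ H.dist q q') (hm : Fintype.card V ≤ C * H.dist q q') (z : V) {r : ℕ} (hr : 1 ≤ r) :
    2 * (ball H z r).card ≤ (ball H z (2 * r)).card + (Q.card + 1 + 8 * C ^ 2) * (2 * r) := by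
  set K' := Q.card + 1 + 8 * C ^ 2 with hK'
  have hstep := hL.card_ball_step hH hq hD hm z
  rw [← hK'] at hstep
  have hrq : (0 : ℚ) < r := by exact_mod_cast hr
  have key : ∀ i, ((ball H z r).card : ℚ) / r ≤
      ((ball H z (r + i)).card : ℚ) / ((r + i : ℕ) : ℚ) + i * K' / r := by
    intro i
    induction i with
    | zero => simp
    | succ i ih =>
      refine ih.trans ?_
      have h1 : ((r + i : ℕ) + 1 : ℚ) * ((ball H z (r + i)).card : ℚ) ≤
          ((r + i : ℕ) : ℚ) * ((ball H z (r + i + 1)).card : ℚ) + K' * ((r + i : ℕ) + 1 : ℚ) := by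
        exact_mod_cast hstep (r + i)
      have hpos : (0 : ℚ) < ((r + i : ℕ) : ℚ) := by
        have : 0 < r + i := by omega
        exact_mod_cast this
      have h2 : ((ball H z (r + i)).card : ℚ) / ((r + i : ℕ) : ℚ) ≤
          ((ball H z (r + i + 1)).card : ℚ) / ((r + i : ℕ) + 1 : ℚ) + K' / ((r + i : ℕ) : ℚ) := by
        rw [div_add_div _ _ (by positivity) (by positivity), div_le_div_iff₀ hpos (by positivity)]
        nlinarith
      have h3 : (K' : ℚ) / ((r + i : ℕ) : ℚ) ≤ K' / r := by
        apply div_le_div_of_nonneg_left (by positivity) hrq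
        exact_mod_cast Nat.le_add_right r i
      have h4 : ((r + (i + 1) : ℕ) : ℚ) = ((r + i : ℕ) : ℚ) + 1 := by push_cast; ring
      rw [← add_assoc r i 1, show (((r + i + 1 : ℕ)) : ℚ) = ((r + i : ℕ) : ℚ) + 1 by push_cast; ring]
      have h5 : ((i + 1 : ℕ) : ℚ) * K' / r = i * K' / r + K' / r := by push_cast; ring
      rw [h5]
      linarith
  have h := key r
  rw [← two_mul] at h
  have h6 : ((2 * r : ℕ) : ℚ) = 2 * r := by push_cast; ring
  rw [h6, mul_div_assoc, mul_div_cancel₀ _ hrq.ne'] at h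
  rw [div_add' _ _ _ (by positivity), div_le_div_iff₀ hrq (by positivity)] at h
  have h7 : (2 * ((ball H z r).card : ℚ)) * r ≤ (((ball H z (2 * r)).card : ℚ) + K' * (2 * r)) * r := by
    linarith
  have h8 := le_of_mul_le_mul_right h7 hrq
  exact_mod_cast h8

/-- Balls in a lean graph have at most linear size. -/
theorem IsLean.card_ball_le (hL : IsLean H Q) (hH : H.Connected) {q q' : V} (hq : q ∈ Q) {C : ℕ}
    (hD : 1 ≤ H.dist q q') (hm : Fintype.card V ≤ C * H.dist q q') (z : V) {r : ℕ} (hr : 1 ≤ r)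
    (j : ℕ) (hj : H.dist q q' ≤ 2 * (2 ^ j * r)) :
    (ball H z r).card ≤ (2 * C + (Q.card + 1 + 8 * C ^ 2) * j) * r := by
  -- Double the radius until it reaches half of the diameter of `Q`, where `|V| ≤ C D` takes over.
  -- Each doubling adds the same error relative to the radius, which produces the factor `j`.
  have key : ∀ i, 2 ^ i * (ball H z r).card ≤
      (ball H z (2 ^ i * r)).card + (Q.card + 1 + 8 * C ^ 2) * i * (2 ^ i * r) := by
    intro i
    induction i with
    | zero => simp
    | succ i ih =>
      have h := hL.card_ball_double hH hq hD hm z (r := 2 ^ i * r)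
        (Nat.mul_pos (by positivity) hr)
      have e : 2 ^ (i + 1) * r = 2 * (2 ^ i * r) := by ring
      rw [e]
      generalize Q.card + 1 + 8 * C ^ 2 = K' at *
      calc 2 ^ (i + 1) * (ball H z r).card = 2 * (2 ^ i * (ball H z r).card) := by ring
        _ ≤ 2 * ((ball H z (2 ^ i * r)).card + K' * i * (2 ^ i * r)) := by omega
        _ = 2 * (ball H z (2 ^ i * r)).card + 2 * (K' * i * (2 ^ i * r)) := by ring
        _ ≤ ((ball H z (2 * (2 ^ i * r))).card + K' * (2 * (2 ^ i * r))) + 2 * (K' * i * (2 ^ i * r)) := by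
          omega
        _ = _ := by ring
  have h := key j
  have h1 : (ball H z (2 ^ j * r)).card ≤ C * (2 * (2 ^ j * r)) :=
    (Finset.card_le_univ _).trans (hm.trans (Nat.mul_le_mul_left _ hj))
  have h2 : 2 ^ j * (ball H z r).card ≤ 2 ^ j * ((2 * C + (Q.card + 1 + 8 * C ^ 2) * j) * r) := by
    calc _ ≤ C * (2 * (2 ^ j * r)) + (Q.card + 1 + 8 * C ^ 2) * j * (2 ^ j * r) := by omega
      _ = _ := by ring
  exact Nat.le_of_mul_le_mul_left h2 (by positivity)

end Global
end MinWiener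

/-! ### Counting branching vertices in a lean graph -/

namespace MinWiener

/-- Functions with a polynomial bound. -/
def PolyBdd (f : ℕ → ℕ) : Prop := ∃ e, ∀ j ≥ 2, f j ≤ j ^ e

theorem PolyBdd.const (c : ℕ) : PolyBdd fun _ => c :=
  ⟨c, fun _ hj => Nat.lt_two_pow_self.le.trans (Nat.pow_le_pow_left hj c)⟩

theorem PolyBdd.id : PolyBdd fun j => j := ⟨1, fun j _ => by simp⟩

theorem PolyBdd.mul {f g : ℕ → ℕ} (hf : PolyBdd f) (hg : PolyBdd g) : PolyBdd fun j => f j * g j := by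
  obtain ⟨e, he⟩ := hf
  obtain ⟨d, hd⟩ := hg
  exact ⟨e + d, fun j hj => (Nat.mul_le_mul (he j hj) (hd j hj)).trans (by rw [pow_add])⟩

theorem PolyBdd.add {f g : ℕ → ℕ} (hf : PolyBdd f) (hg : PolyBdd g) : PolyBdd fun j => f j + g j := by
  obtain ⟨e, he⟩ := hf
  obtain ⟨d, hd⟩ := hg
  refine ⟨e + d + 1, fun j hj => (Nat.add_le_add (he j hj) (hd j hj)).trans ?_⟩
  have h1 : j ^ e ≤ j ^ (e + d) := Nat.pow_le_pow_right (by omega) (by omega)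
  have h2 : j ^ d ≤ j ^ (e + d) := Nat.pow_le_pow_right (by omega) (by omega)
  calc j ^ e + j ^ d ≤ j ^ (e + d) * 2 := by omega
    _ ≤ j ^ (e + d) * j := Nat.mul_le_mul_left _ hj
    _ = _ := (pow_succ _ _).symm

theorem PolyBdd.pow {f : ℕ → ℕ} (hf : PolyBdd f) (n : ℕ) : PolyBdd fun j => f j ^ n := by
  induction n with
  | zero => simpa using PolyBdd.const 1
  | succ n ih => simpa only [pow_succ] using ih.mul hf

theorem PolyBdd.eventually_le {f : ℕ → ℕ} (hf : PolyBdd f) : ∃ j₀ ≥ 2, ∀ j ≥ j₀, f j ≤ 2 ^ j := by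
  obtain ⟨e, he⟩ := hf
  have h := tendsto_pow_const_div_const_pow_of_one_lt e (r := (2 : ℝ)) (by norm_num)
  have h1 := h.eventually (gt_mem_nhds (show (0 : ℝ) < 1 by norm_num))
  obtain ⟨j₁, hj₁⟩ := Filter.eventually_atTop.1 h1
  refine ⟨max j₁ 2, le_max_right _ _, fun j hj => (he j (by omega)).trans ?_⟩
  have h2 := hj₁ j (by omega)
  rw [div_lt_one (by positivity)] at h2
  exact_mod_cast h2.le

section Branch
variable {V : Type*} [Fintype V] {H : SimpleGraph V} {Q : Finset V}

/-- `v` has at least three neighbours. -/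
def IsBranch (H : SimpleGraph V) (v : V) : Prop := ∃ A : Finset V, 3 ≤ A.card ∧ ∀ a ∈ A, H.Adj v a

/-- The bound for the number of branching vertices in a ball. -/
def branchBound (C p : ℕ) : ℕ :=
  unitBound p ^ 2 * (UnitSystem.hullBound (4 * C ^ 2) (unitBound p) 0 + 1)

/-- The ball of radius `2r` has at most `2 A r` vertices, so one of the spheres with radii from `r +
1` to `2r` has at most `2A`. The ball inside of this sphere, without `Q`, is a tight part whose
boundary is contained in the sphere and `Q`. -/
theorem IsLean.card_branch_ball (hL : IsLean H Q) (hH : H.Connected) {q q' : V} (hq : q ∈ Q) {C : ℕ}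
    (hC : 1 ≤ C) (hD : 1 ≤ H.dist q q') (hm : Fintype.card V ≤ C * H.dist q q') {r j A p M : ℕ}
    (hr : 1 ≤ r) (hj : H.dist q q' ≤ 2 * (2 ^ j * r)) (hj' : 2 ^ j * r ≤ H.dist q q')
    (hA : 2 * C + (Q.card + 1 + 8 * C ^ 2) * j ≤ A) (hp : 2 * A + Q.card ≤ p)
    (hM : 2000 * ((4 * C ^ 2) ^ 2 * unitBound p ^ 4) ≤ M) (hMj : 16 * C * A * M ≤ 2 ^ j)
    (z : V) (B : Finset V) (hB : ∀ v ∈ B, IsBranch H v) (hBz : B ⊆ ball H z r) (hBQ : Disjoint B Q) :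
    B.card ≤ branchBound C p := by
  classical
  have hball : (ball H z (2 * r)).card ≤ A * (2 * r) := by
    refine (hL.card_ball_le hH hq hD hm z (r := 2 * r) (by omega) j (hj.trans ?_)).trans
      (Nat.mul_le_mul_right _ hA)
    gcongr
    omega
  obtain ⟨i, hi, hsphere⟩ : ∃ i < r, (sphere H z (r + i + 1)).card ≤ 2 * A := by
    by_contra! hcon
    have hsum : ∀ i, (ball H z (r + i)).card =
        (ball H z r).card + ∑ l ∈ Finset.range i, (sphere H z (r + l + 1)).card := by
      intro i
      induction i with
      | zero => simp
      | succ i ih => rw [Finset.sum_range_succ, ← add_assoc, card_ball_succ, ih]; omega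
    have h1 : ∑ l ∈ Finset.range r, (2 * A + 1) ≤
        ∑ l ∈ Finset.range r, (sphere H z (r + l + 1)).card :=
      Finset.sum_le_sum fun l hl => hcon l (Finset.mem_range.1 hl)
    have h2 := hsum r
    rw [← two_mul] at h2
    simp only [Finset.sum_const, Finset.card_range, smul_eq_mul] at h1
    have h3 : r * (2 * A + 1) = A * (2 * r) + r := by ring
    omega
  set I := ball H z (r + i) \ Q with hI
  have hIQ : Disjoint I Q := Finset.sdiff_disjoint
  have hIcard : I.card ≤ A * (2 * r) :=
    (Finset.card_le_card (Finset.sdiff_subset.trans (ball_mono H z (by omega)))).trans hball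
  have hbd : (bdry H I).card ≤ p := by
    have hsub : bdry H I ⊆ sphere H z (r + i + 1) ∪ Q := by
      intro a ha
      obtain ⟨ha, b, hb, hab⟩ := mem_bdry.1 ha
      have hb' : b ∈ ball H z (r + i) := (Finset.mem_sdiff.1 (by simpa using hb : b ∈ I)).1
      have ha' : a ∉ I := by simpa using ha
      rw [Finset.mem_union]
      by_contra! hcon
      apply ha'
      refine Finset.mem_sdiff.2 ⟨mem_ball.2 ?_, hcon.2⟩
      have h1 := hH.dist_triangle (u := z) (v := b) (w := a)
      have h2 : H.dist b a = 1 := SimpleGraph.dist_eq_one_iff_adj.2 hab.symm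
      have h3 := mem_ball.1 hb'
      have h4 : H.dist z a ≠ r + i + 1 := fun h => hcon.1 (mem_sphere.2 h)
      omega
    refine (Finset.card_le_card hsub).trans ((Finset.card_union_le _ _).trans ?_)
    omega
  have hT : Tight H I M (4 * C ^ 2) := by
    refine hL.tight hH hq hD hm hIQ ?_
    calc 8 * C * I.card * M ≤ 8 * C * (A * (2 * r)) * M := by gcongr
      _ = 16 * C * A * M * r := by ring
      _ ≤ 2 ^ j * r := Nat.mul_le_mul_right _ hMj
      _ ≤ _ := hj'
  refine card_branch_le_of_tight hH hT (by nlinarith) (by omega) hbd hM B (fun v hv => ?_) hB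
  exact Finset.mem_sdiff.2 ⟨ball_mono H z (by omega) (hBz hv), Finset.disjoint_left.1 hBQ hv⟩

/-- Some vertex has distance at least `r` from `v`, else `q` and `q'` would be too close to each
other. A shortest path to it contributes `r` vertices to the ball. -/
theorem le_card_ball (hH : H.Connected) {q q' v : V} {r : ℕ} (hr : 2 * r ≤ H.dist q q') :
    r ≤ (ball H v r).card := by
  classical
  obtain ⟨w, hw⟩ : ∃ w, r ≤ H.dist v w := by
    by_contra! hcon
    have h1 := hcon q
    have h2 := hcon q'
    have h3 := hH.dist_triangle (u := q) (v := v) (w := q')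
    rw [H.dist_comm (u := q) (v := v)] at h3
    omega
  obtain ⟨f, h0, -, -, hd, -⟩ := exists_seq_geo hH v w
  have hlev : ∀ k ≤ H.dist v w, H.dist v (f k) = k := fun k hk => by
    have := hd 0 k (by omega) hk
    rw [h0] at this
    omega
  have h := Finset.card_le_card_of_injOn (s := Finset.range r) (t := ball H v r) f (fun i hi => by
    have := Finset.mem_range.1 hi
    rw [Finset.mem_coe, mem_ball, hlev i (by omega)]
    omega) (fun i hi i' hi' h => by
    simp only [Finset.coe_range, Set.mem_Iio] at hi hi'
    rw [← hlev i (by omega), ← hlev i' (by omega), h])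
  simpa using h

-- Count the pairs of a vertex of `B` and a vertex at distance at most `r` in two ways: every ball
-- has at least `r` vertices and at most `branchBound C p` elements of `B`.
open Classical in
theorem IsLean.card_branch (hL : IsLean H Q) (hH : H.Connected) {q q' : V} (hq : q ∈ Q) {C : ℕ}
    (hC : 1 ≤ C) (hD : 1 ≤ H.dist q q') (hm : Fintype.card V ≤ C * H.dist q q') {r j A p M : ℕ}
    (hr : 1 ≤ r) (hj1 : 1 ≤ j) (hj : H.dist q q' ≤ 2 * (2 ^ j * r)) (hj' : 2 ^ j * r ≤ H.dist q q')
    (hA : 2 * C + (Q.card + 1 + 8 * C ^ 2) * j ≤ A) (hp : 2 * A + Q.card ≤ p)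
    (hM : 2000 * ((4 * C ^ 2) ^ 2 * unitBound p ^ 4) ≤ M) (hMj : 16 * C * A * M ≤ 2 ^ j)
    (B : Finset V) (hB : ∀ v ∈ B, IsBranch H v) (hBQ : Disjoint B Q) :
    B.card ≤ 2 ^ j * (2 * C * branchBound C p) := by
  have h2r : 2 * r ≤ H.dist q q' := by
    refine le_trans ?_ hj'
    exact Nat.mul_le_mul_right _ (by simpa using Nat.pow_le_pow_right (show 0 < 2 by norm_num) hj1)
  have h1 : B.card * r ≤ ∑ v ∈ B, (ball H v r).card := by
    rw [← smul_eq_mul, ← Finset.sum_const]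
    exact Finset.sum_le_sum fun v _ => le_card_ball hH h2r
  have h2 : ∑ v ∈ B, (ball H v r).card = ∑ z, (B.filter fun v => v ∈ ball H z r).card := by
    have e : ∀ v, (ball H v r).card = ∑ z, if v ∈ ball H z r then 1 else 0 := fun v => by
      rw [← Finset.card_filter]
      congr 1
      ext z
      simp [mem_ball, H.dist_comm]
    simp only [e]
    rw [Finset.sum_comm]
    exact Finset.sum_congr rfl fun z _ => (Finset.card_filter _ _).symm
  have h3 : ∑ z, (B.filter fun v => v ∈ ball H z r).card ≤ Fintype.card V * branchBound C p := by
    rw [← smul_eq_mul, ← Finset.card_univ, ← Finset.sum_const]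
    exact Finset.sum_le_sum fun z _ => hL.card_branch_ball hH hq hC hD hm hr hj hj' hA hp hM hMj z _
      (fun v hv => hB v (Finset.mem_filter.1 hv).1) (fun v hv => (Finset.mem_filter.1 hv).2)
      (Finset.disjoint_of_subset_left (Finset.filter_subset _ _) hBQ)
  have h4 : B.card * r ≤ 2 ^ j * (2 * C * branchBound C p) * r := by
    calc B.card * r ≤ Fintype.card V * branchBound C p := by omega
      _ ≤ C * (2 * (2 ^ j * r)) * branchBound C p := by
        gcongr
        exact hm.trans (Nat.mul_le_mul_left _ hj)
      _ = _ := by ring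
  exact Nat.le_of_mul_le_mul_right h4 hr

open Classical in
/-- The required and the branching vertices. -/
noncomputable def hubs (H : SimpleGraph V) (Q : Finset V) : Finset V :=
  Finset.univ.filter fun v => v ∈ Q ∨ IsBranch H v

theorem mem_hubs {v : V} : v ∈ hubs H Q ↔ v ∈ Q ∨ IsBranch H v := by simp [hubs]

end Branch

/-- Lean graphs have few branching vertices. -/
theorem exists_card_hubs_le : ∃ c : ℕ, ∀ (V : Type) [Fintype V] (H : SimpleGraph V) (Q : Finset V),
    H.Connected → IsLean H Q → (hubs H Q).card ≤ 2 ^ (c * (Q.card + 1)) := by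
  classical
  -- All quantities are written as polynomials in one number `j ≥ |Q|`, so that `2 ^ j` exceeds them
  -- as soon as `j` is large. The choice `j = j₀ (|Q| + 1)` ensures this with an exponent linear in
  -- `|Q|`.
  let C : ℕ → ℕ := fun j => 32 * j ^ 2
  let A : ℕ → ℕ := fun j => 2 * C j + (j + 1 + 8 * C j ^ 2) * j
  let p : ℕ → ℕ := fun j => 2 * A j + j
  let hB : ℕ → ℕ := fun j => p j + 2 * p j ^ 4 + p j ^ 2 * (2 * p j ^ 4 + 1)
  let U : ℕ → ℕ := fun j => hB j + hB j ^ 2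
  let M : ℕ → ℕ := fun j => 2000 * ((4 * C j ^ 2) ^ 2 * U j ^ 4)
  -- This is `branchBound (C j) (p j)` written out, to exhibit it as a polynomial.
  let F : ℕ → ℕ := fun j => U j ^ 2 * (7 * (4 * C j ^ 2) * (2 * U j + 1) * (0 + 1) + 1)
  have pC : PolyBdd C := (PolyBdd.const _).mul (PolyBdd.id.pow 2)
  have pA : PolyBdd A := ((PolyBdd.const _).mul pC).add
    (((PolyBdd.id.add (.const _)).add ((PolyBdd.const _).mul (pC.pow 2))).mul .id)
  have pp : PolyBdd p := ((PolyBdd.const _).mul pA).add .id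
  have phB : PolyBdd hB := (pp.add ((PolyBdd.const _).mul (pp.pow 4))).add
    ((pp.pow 2).mul (((PolyBdd.const _).mul (pp.pow 4)).add (.const _)))
  have pU : PolyBdd U := phB.add (phB.pow 2)
  have pM : PolyBdd M := (PolyBdd.const _).mul ((((PolyBdd.const _).mul (pC.pow 2)).pow 2).mul (pU.pow 4))
  have pF : PolyBdd F := (pU.pow 2).mul ((((((PolyBdd.const _).mul ((PolyBdd.const _).mul (pC.pow 2))).mul
    (((PolyBdd.const _).mul pU).add (.const _))).mul (.const _))).add (.const _))
  obtain ⟨j₀, hj₀, hev⟩ := (((((PolyBdd.const 16).mul pC).mul pA).mul pM).add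
    ((PolyBdd.id.add pC).add (((PolyBdd.const 2).mul pC).mul pF))).eventually_le
  refine ⟨2 * j₀, fun V _ H Q hH hL => ?_⟩
  set k := Q.card with hk
  set j := j₀ * (k + 1) with hj
  have hjk : k + 1 ≤ j := Nat.le_mul_of_pos_left _ (by omega)
  have hjj : j₀ ≤ j := Nat.le_mul_of_pos_right _ (by omega)
  have hevj : 16 * C j * A j * M j + (j + C j + 2 * C j * F j) ≤ 2 ^ j := hev j hjj
  have hevF : 2 * C j * F j + j ≤ 2 ^ j := by omega
  have hevM : 16 * C j * A j * M j ≤ 2 ^ j := by omega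
  have hevC : C j ≤ 2 ^ j := by omega
  have htwo : 2 ^ (2 * j₀ * (k + 1)) = 2 ^ j * 2 ^ j := by
    rw [← pow_add, hj]
    congr 1
    ring
  rw [htwo]
  have hpos : 1 ≤ 2 ^ j := Nat.one_le_two_pow
  have huniv : (hubs H Q).card ≤ Fintype.card V := Finset.card_le_univ _
  by_cases hk1 : k ≤ 1
  · have := hL.card_le_one hH hk1
    nlinarith
  · obtain ⟨a, ha, b, hb, hab⟩ := Finset.one_lt_card.1 (by omega : 1 < Q.card)
    obtain ⟨⟨q, q'⟩, hqq, hmax⟩ := Finset.exists_max_image (Q ×ˢ Q) (fun x => H.dist x.1 x.2)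
      ⟨(a, b), Finset.mem_product.2 ⟨ha, hb⟩⟩
    obtain ⟨hq, hq'⟩ := Finset.mem_product.1 hqq
    have hmax' : ∀ a ∈ Q, ∀ b ∈ Q, H.dist a b ≤ H.dist q q' := fun a ha b hb =>
      hmax (a, b) (Finset.mem_product.2 ⟨ha, hb⟩)
    have hD : 1 ≤ H.dist q q' := le_trans ((hH a b).pos_dist_of_ne hab) (hmax' a ha b hb)
    have hm0 := hL.card_le hH hq hmax' hD
    have hm : Fintype.card V ≤ C j * H.dist q q' := by
      refine hm0.trans (Nat.mul_le_mul_right _ (Nat.mul_le_mul_left _ (Nat.pow_le_pow_left ?_ 2)))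
      omega
    have hC1 : 1 ≤ C j := by
      show 1 ≤ 32 * j ^ 2
      have : 0 < j ^ 2 := by positivity
      omega
    -- For `D < 2 ^ j` the whole graph is small enough. Otherwise `D / 2 ^ j` is a positive radius
    -- for the balls.
    rcases Nat.lt_or_ge (H.dist q q') (2 ^ j) with hlt | hge
    · calc (hubs H Q).card ≤ C j * H.dist q q' := huniv.trans hm
        _ ≤ 2 ^ j * 2 ^ j := Nat.mul_le_mul hevC hlt.le
    · set r := H.dist q q' / 2 ^ j with hr
      have hr1 : 1 ≤ r := (Nat.one_le_div_iff (by positivity)).2 hge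
      have hj' : 2 ^ j * r ≤ H.dist q q' := Nat.mul_div_le _ _
      have hjle : H.dist q q' ≤ 2 * (2 ^ j * r) := by
        have h1 := Nat.lt_mul_div_succ (H.dist q q') (show 0 < 2 ^ j by positivity)
        rw [← hr, mul_add, mul_one] at h1
        have h2 : 2 ^ j ≤ 2 ^ j * r := Nat.le_mul_of_pos_right _ hr1
        omega
      have hAj : 2 * C j + (Q.card + 1 + 8 * C j ^ 2) * j ≤ A j := by
        show _ ≤ 2 * C j + (j + 1 + 8 * C j ^ 2) * j
        have : Q.card ≤ j := by omega
        gcongr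
      have hbr := hL.card_branch hH hq hC1 hD hm hr1 (by omega) hjle hj' hAj (p := p j)
        (M := M j) (by show _ ≤ 2 * A j + j; omega) le_rfl hevM
        ((hubs H Q) \ Q) (fun v hv => by
          obtain ⟨h1, h2⟩ := Finset.mem_sdiff.1 hv
          exact (mem_hubs.1 h1).resolve_left h2) Finset.sdiff_disjoint
      have hFe : branchBound (C j) (p j) = F j := rfl
      rw [hFe] at hbr
      have h1 : (hubs H Q).card ≤ ((hubs H Q) \ Q).card + Q.card := by
        have := Finset.card_le_card_sdiff_add_card (s := hubs H Q) (t := Q)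
        omega
      have h2 : Q.card ≤ 2 ^ j * j := by
        have : j ≤ 2 ^ j * j := Nat.le_mul_of_pos_left _ hpos
        omega
      calc (hubs H Q).card ≤ 2 ^ j * (2 * C j * F j) + 2 ^ j * j := by omega
        _ = 2 ^ j * (2 * C j * F j + j) := (mul_add _ _ _).symm
        _ ≤ 2 ^ j * 2 ^ j := Nat.mul_le_mul_left _ hevF

end MinWiener

/-! ### Folding a graph onto few shortest paths -/

namespace MinWiener

section Fold
variable {V : Type*} {H : SimpleGraph V} {B K : Finset V}

open Classical in
/-- The edges from `K` to `B`. -/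
noncomputable def edgesTo (H : SimpleGraph V) (B K : Finset V) : Finset (V × V) :=
  (K ×ˢ B).filter fun e => H.Adj e.1 e.2

theorem mem_edgesTo {e : V × V} : e ∈ edgesTo H B K ↔ e.1 ∈ K ∧ e.2 ∈ B ∧ H.Adj e.1 e.2 := by
  simp [edgesTo, and_assoc]

variable [Fintype V]

/-- A component of `H - B` without branching vertices has at most two edges to `B`. -/
theorem card_edgesTo_le (hB : ∀ v, v ∉ B → ¬ IsBranch H v) {r : V} (hr : r ∉ B) :
    (edgesTo H B (comp H ((B : Set V)ᶜ) r)).card ≤ 2 := by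
  classical
  set R : Set V := (B : Set V)ᶜ with hR
  set K := comp H R r with hK
  set N := avoid H Rᶜ with hN
  have hKR : ∀ x ∈ K, x ∉ B := fun x hx => by
    have := comp_subset (show r ∈ R by simpa [hR] using hr) hx
    simpa [hR] using this
  -- Parents in a breadth-first tree of the component with root `r`.
  have hpar : ∀ x ∈ K.erase r, ∃ y ∈ K, H.Adj x y ∧ N.dist r x = N.dist r y + 1 := by
    intro x hx
    obtain ⟨hxr, hxK⟩ := Finset.mem_erase.1 hx
    have hreach : N.Reachable r x := mem_comp.1 hxK
    obtain ⟨f, h0, h1, h2, h3⟩ := exists_geodesic hreach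
    have hd : N.dist r x ≠ 0 := fun h => hxr (hreach.dist_eq_zero_iff.1 h).symm
    have h4 := h2 (N.dist r x - 1) (by omega)
    have h5 := h3 (N.dist r x - 1) (by omega)
    rw [show N.dist r x - 1 + 1 = N.dist r x by omega, h1] at h4
    exact ⟨f (N.dist r x - 1), mem_comp.2 h5.1, h4.1.symm, by rw [h5.2.1]; omega⟩
  choose! p hpK hpadj hpd using hpar
  -- The oriented edges that start in the component: at most two for each vertex. The tree uses `2
  -- (|K| - 1)` of them, which leaves two for `B`.
  set A := Finset.univ.filter fun e : V × V => e.1 ∈ K ∧ H.Adj e.1 e.2 with hA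
  have hAcard : A.card ≤ 2 * K.card := by
    have h1 := Finset.card_le_mul_card_image (f := Prod.fst) A 2 (by
      intro x hx
      obtain ⟨e, he, rfl⟩ := Finset.mem_image.1 hx
      have he' := (Finset.mem_filter.1 he).2
      by_contra! hcon
      refine hB e.1 (hKR _ he'.1) ⟨(A.filter fun e' => e'.1 = e.1).image Prod.snd, ?_, ?_⟩
      · rw [Finset.card_image_of_injOn]
        · exact hcon
        · intro a ha b hb hab
          simp only [Finset.coe_filter, Set.mem_ofPred_eq] at ha hb
          exact Prod.ext (ha.2.trans hb.2.symm) hab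
      · intro a ha
        obtain ⟨e', he', rfl⟩ := Finset.mem_image.1 ha
        obtain ⟨h1, h2⟩ := Finset.mem_filter.1 he'
        rw [← h2]
        exact (Finset.mem_filter.1 h1).2.2)
    refine h1.trans (Nat.mul_le_mul_left _ (Finset.card_le_card fun x hx => ?_))
    obtain ⟨e, he, rfl⟩ := Finset.mem_image.1 hx
    exact (Finset.mem_filter.1 he).2.1
  set A₁ := (K.erase r).image fun x => (x, p x) with hA₁
  set A₂ := (K.erase r).image fun x => (p x, x) with hA₂
  have hA₁c : A₁.card = K.card - 1 := by
    rw [hA₁, Finset.card_image_of_injective _ fun x y h => (Prod.mk.inj h).1,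
      Finset.card_erase_of_mem self_mem_comp]
  have hA₂c : A₂.card = K.card - 1 := by
    rw [hA₂, Finset.card_image_of_injective _ fun x y h => (Prod.mk.inj h).2,
      Finset.card_erase_of_mem self_mem_comp]
  have hdis : Disjoint A₁ A₂ := by
    rw [Finset.disjoint_left]
    intro e h1 h2
    obtain ⟨x, hx, rfl⟩ := Finset.mem_image.1 h1
    obtain ⟨y, hy, h⟩ := Finset.mem_image.1 h2
    obtain ⟨e1, e2⟩ := Prod.mk.inj h
    have d1 := hpd x hx
    have d2 := hpd y hy
    rw [e1] at d2
    rw [← e2] at d1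
    omega
  have hdis' : Disjoint (A₁ ∪ A₂) (edgesTo H B K) := by
    rw [Finset.disjoint_left]
    intro e h1 h2
    have h3 := (mem_edgesTo.1 h2).2.1
    rcases Finset.mem_union.1 h1 with h | h
    · obtain ⟨x, hx, rfl⟩ := Finset.mem_image.1 h
      exact hKR _ (hpK x hx) h3
    · obtain ⟨x, hx, rfl⟩ := Finset.mem_image.1 h
      exact hKR _ (Finset.mem_erase.1 hx).2 h3
  have hsub : (A₁ ∪ A₂) ∪ edgesTo H B K ⊆ A := by
    intro e he
    rw [hA, Finset.mem_filter]
    refine ⟨Finset.mem_univ _, ?_⟩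
    rcases Finset.mem_union.1 he with h | h
    · rcases Finset.mem_union.1 h with h | h
      · obtain ⟨x, hx, rfl⟩ := Finset.mem_image.1 h
        exact ⟨(Finset.mem_erase.1 hx).2, hpadj x hx⟩
      · obtain ⟨x, hx, rfl⟩ := Finset.mem_image.1 h
        exact ⟨hpK x hx, (hpadj x hx).symm⟩
    · have := mem_edgesTo.1 h
      exact ⟨this.1, this.2.2⟩
  have h := Finset.card_le_card hsub
  rw [Finset.card_union_of_disjoint hdis', Finset.card_union_of_disjoint hdis] at h
  have hK0 : 0 < K.card := Finset.card_pos.2 ⟨r, self_mem_comp⟩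
  omega

/-- `S` induces a connected subgraph. -/
def IsConnectedOn {W : Type*} (G : SimpleGraph W) (S : Finset W) : Prop :=
  S.Nonempty ∧ ∀ u ∈ S, ∀ v ∈ S, (avoid G (S : Set W)ᶜ).Reachable u v

/-- The sum of the distances between all ordered pairs of `S` in the subgraph induced by `S`. -/
noncomputable def distSum {W : Type*} (G : SimpleGraph W) (S : Finset W) : ℕ :=
  ∑ u ∈ S, ∑ v ∈ S, (avoid G (S : Set W)ᶜ).dist u v

open Classical in
/-- A connected graph `H` in `G` can be replaced by a union of shortest paths of `G`. -/
theorem exists_fold {W : Type*} {G : SimpleGraph W} (hH : H.Connected)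
    (ι : H →g G) (path : W → W → Finset W) (hpath : ∀ x y, IsGeo G x y (path x y))
    (hB : ∀ v, v ∉ B → ¬ IsBranch H v) (hB0 : B.Nonempty) :
    ∃ T : Finset (W × W), T.card ≤ B.card ^ 2 ∧
      (∀ b ∈ B, ι b ∈ T.biUnion fun e => path e.1 e.2) ∧
      IsConnectedOn G (T.biUnion fun e => path e.1 e.2) ∧
      distSum G (T.biUnion fun e => path e.1 e.2) ≤ ∑ u, ∑ v, H.dist u v := by
  have : Nonempty V := hH.nonempty
  choose π π0 π1 πadj πmem using hpath
  replace πmem : ∀ x y s, s ∈ path x y ↔ ∃ i ≤ G.dist x y, π x y i = s := fun x y s => by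
    rw [πmem]
    simp
  set R : Set V := (B : Set V)ᶜ with hR
  have hmemR : ∀ v, v ∈ R ↔ v ∉ B := fun v => by simp [hR]
  set N := avoid H Rᶜ with hN
  obtain ⟨b₀, hb₀⟩ := hB0
  -- The one or two edges from the component of `v` to `B`. There is one by connectedness, and a
  -- single edge is listed twice.
  have hends : ∀ v, v ∉ B → ∃ q : (V × V) × (V × V), q.1 ∈ edgesTo H B (comp H R v) ∧
      q.2 ∈ edgesTo H B (comp H R v) ∧ ∀ e ∈ edgesTo H B (comp H R v), e = q.1 ∨ e = q.2 := by
    intro v hv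
    have hne : (edgesTo H B (comp H R v)).Nonempty := by
      obtain ⟨p⟩ := hH v b₀
      have hb₀K : b₀ ∉ (comp H R v : Set V) := fun h =>
        (hmemR b₀).1 (comp_subset ((hmemR v).2 hv) (by simpa using h)) hb₀
      rcases last_exit p hb₀K with ⟨h, -⟩ | ⟨b, -, ⟨hb, z, hz, hbz⟩, -, -⟩
      · exact absurd (by simpa using self_mem_comp) h
      · have hz' : z ∈ comp H R v := by simpa using hz
        have hzR := comp_subset ((hmemR v).2 hv) hz'
        refine ⟨(z, b), mem_edgesTo.2 ⟨hz', ?_, hbz.symm⟩⟩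
        by_contra hbB
        exact hb (by simpa using mem_comp_of_adj hz' hzR ((hmemR b).2 hbB) hbz.symm)
    have hc : (edgesTo H B (comp H R v)).card ≤ 2 := card_edgesTo_le hB hv
    rcases Nat.lt_or_ge (edgesTo H B (comp H R v)).card 2 with h | h
    · obtain ⟨e, he⟩ := hne
      exact ⟨(e, e), he, he, fun e' he' => .inl (Finset.card_le_one.1 (by omega) e' he' e he)⟩
    · obtain ⟨e, e', -, h'⟩ := Finset.card_eq_two.1 (le_antisymm hc h)
      exact ⟨(e, e'), by simp [h'], by simp [h'], by simp [h']⟩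
  -- The pair is chosen as a function of the component, so that all its vertices are folded onto the
  -- same path.
  obtain ⟨g, hg⟩ : ∃ g : Finset V → (V × V) × (V × V), ∀ v, v ∉ B →
      (g (comp H R v)).1 ∈ edgesTo H B (comp H R v) ∧
      (g (comp H R v)).2 ∈ edgesTo H B (comp H R v) ∧
      ∀ e ∈ edgesTo H B (comp H R v), e = (g (comp H R v)).1 ∨ e = (g (comp H R v)).2 := by
    have : ∀ K : Finset V, ∃ q : (V × V) × (V × V), ∀ v, v ∉ B → K = comp H R v →
        q.1 ∈ edgesTo H B K ∧ q.2 ∈ edgesTo H B K ∧ ∀ e ∈ edgesTo H B K, e = q.1 ∨ e = q.2 := by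
      intro K
      by_cases hK : ∃ v, v ∉ B ∧ K = comp H R v
      · obtain ⟨v, hv, rfl⟩ := hK
        obtain ⟨q, hq⟩ := hends v hv
        exact ⟨q, fun _ _ _ => hq⟩
      · exact ⟨((b₀, b₀), (b₀, b₀)), fun v hv h => absurd ⟨v, hv, h⟩ hK⟩
    choose g hg using this
    exact ⟨g, fun v hv => hg _ v hv rfl⟩
  set ends : V → W × W := fun v => (ι (g (comp H R v)).1.2, ι (g (comp H R v)).2.2) with hends'
  set T : Finset (W × W) := (B.image fun b => (ι b, ι b)) ∪ (Bᶜ.image ends) with hT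
  set S := T.biUnion fun e => path e.1 e.2 with hS
  have hTcard : T.card ≤ B.card ^ 2 := by
    have hsub : T ⊆ B.image ι ×ˢ B.image ι := by
      intro e he
      rw [Finset.mem_product]
      rcases Finset.mem_union.1 he with h | h
      · obtain ⟨b, hb, rfl⟩ := Finset.mem_image.1 h
        exact ⟨Finset.mem_image_of_mem _ hb, Finset.mem_image_of_mem _ hb⟩
      · obtain ⟨v, hv, rfl⟩ := Finset.mem_image.1 h
        have hgv := hg v (by simpa using hv)
        exact ⟨Finset.mem_image_of_mem _ (mem_edgesTo.1 hgv.1).2.1,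
          Finset.mem_image_of_mem _ (mem_edgesTo.1 hgv.2.1).2.1⟩
    refine (Finset.card_le_card hsub).trans ?_
    rw [Finset.card_product, sq]
    exact Nat.mul_le_mul Finset.card_image_le Finset.card_image_le
  -- A vertex at distance `i` inside of the component from the first attachment vertex goes to
  -- position `i + 1` of the path; position `0` is the end in `B`. The position is capped, as the
  -- path of `G` may be shorter than the component is long.
  set φ : V → W := fun v => if v ∈ B then ι v else
    π (ends v).1 (ends v).2 (min (N.dist (g (comp H R v)).1.1 v + 1) (G.dist (ends v).1 (ends v).2))
    with hφ
  have hφB : ∀ v ∈ B, φ v = ι v := fun v hv => by simp [hφ, hv]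
  have hφS : ∀ v, φ v ∈ S := by
    intro v
    by_cases hv : v ∈ B
    · rw [hφB v hv]
      refine Finset.mem_biUnion.2 ⟨(ι v, ι v), Finset.mem_union_left _
        (Finset.mem_image.2 ⟨v, hv, rfl⟩), (πmem _ _ _).2 ⟨0, by omega, π0 _ _⟩⟩
    · have e : φ v = π (ends v).1 (ends v).2 (min (N.dist (g (comp H R v)).1.1 v + 1)
          (G.dist (ends v).1 (ends v).2)) := by simp only [hφ, if_neg hv]
      exact Finset.mem_biUnion.2 ⟨ends v, Finset.mem_union_right _
        (Finset.mem_image.2 ⟨v, by simpa using hv, rfl⟩), (πmem _ _ _).2 ⟨_, min_le_right _ _, e.symm⟩⟩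
  have hone : ∀ a ∈ S, ∀ b ∈ S, a = b ∨ G.Adj a b → Near G (S : Set W)ᶜ 1 a b := by
    rintro a ha b hb (rfl | h)
    · exact Near.refl _ _ _ _
    · exact Near.of_adj h (by simpa using ha) (by simpa using hb)
  have hπstep : ∀ x y i i', i ≤ i' + 1 → i' ≤ i + 1 →
      π x y (min i (G.dist x y)) = π x y (min i' (G.dist x y)) ∨
      G.Adj (π x y (min i (G.dist x y))) (π x y (min i' (G.dist x y))) := by
    intro x y i i' h1 h2
    rcases Nat.lt_trichotomy (min i (G.dist x y)) (min i' (G.dist x y)) with h | h | h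
    · right
      rw [show min i' (G.dist x y) = min i (G.dist x y) + 1 by omega]
      exact πadj _ _ _ (by omega)
    · left
      rw [h]
    · right
      rw [show min i (G.dist x y) = min i' (G.dist x y) + 1 by omega]
      exact (πadj _ _ _ (by omega)).symm
  -- the ends of a component are joined by a walk
  have hdistends : ∀ v, v ∉ B → G.dist (ends v).1 (ends v).2 ≤
      N.dist (g (comp H R v)).1.1 (g (comp H R v)).2.1 + 2 := by
    intro v hv
    obtain ⟨h1, h2, -⟩ := hg v hv
    obtain ⟨k1, -, a1⟩ := mem_edgesTo.1 h1
    obtain ⟨k2, -, a2⟩ := mem_edgesTo.1 h2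
    have hr : N.Reachable (g (comp H R v)).1.1 (g (comp H R v)).2.1 :=
      (mem_comp.1 k1).symm.trans (mem_comp.1 k2)
    have hnear : Near H ∅ (1 + N.dist (g (comp H R v)).1.1 (g (comp H R v)).2.1 + 1)
        (g (comp H R v)).1.2 (g (comp H R v)).2.2 :=
      ((Near.of_adj a1.symm (by simp) (by simp)).trans
        ((near_of_reachable hr).anti (by simp))).trans (Near.of_adj a2 (by simp) (by simp))
    obtain ⟨p, hp⟩ := hnear
    have := SimpleGraph.dist_le ((p.mapLe (avoid_le H ∅)).map ι)
    rw [SimpleGraph.Walk.length_map] at this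
    refine this.trans ?_
    have e : (p.mapLe (avoid_le H ∅)).length = p.length := by simp
    omega
  -- edges between a component and B
  have hcross : ∀ u v, u ∉ B → v ∈ B → H.Adj u v → φ u = φ v ∨ G.Adj (φ u) (φ v) := by
    intro u v hu hv huv
    rw [hφB v hv]
    obtain ⟨h1, h2, h3⟩ := hg u hu
    have he : (u, v) ∈ edgesTo H B (comp H R u) := mem_edgesTo.2 ⟨self_mem_comp, hv, huv⟩
    simp only [hφ, if_neg hu]
    rcases h3 _ he with h | h
    · have e1 : (g (comp H R u)).1.1 = u := by rw [← h]
      have e2 : (ends u).1 = ι v := by simp only [hends']; rw [← h]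
      have := hπstep (ends u).1 (ends u).2 (N.dist (g (comp H R u)).1.1 u + 1) 0
        (by rw [e1, SimpleGraph.dist_self]) (by omega)
      rw [Nat.zero_min, π0] at this
      rwa [e2] at this ⊢
    · have e1 : (g (comp H R u)).2.1 = u := by rw [← h]
      have e2 : (ends u).2 = ι v := by simp only [hends']; rw [← h]
      have hd := hdistends u hu
      rw [e1] at hd
      have := hπstep (ends u).1 (ends u).2
        (min (N.dist (g (comp H R u)).1.1 u + 1) (G.dist (ends u).1 (ends u).2))
        (G.dist (ends u).1 (ends u).2) (by omega) (by omega)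
      rw [min_self, π1, min_assoc, min_self] at this
      rwa [e2] at this ⊢
  have hstep : ∀ u v, H.Adj u v → Near G (S : Set W)ᶜ 1 (φ u) (φ v) := by
    intro u v huv
    refine hone _ (hφS u) _ (hφS v) ?_
    by_cases hu : u ∈ B <;> by_cases hv : v ∈ B
    · rw [hφB u hu, hφB v hv]
      exact .inr (ι.map_adj huv)
    · rcases hcross v u hv hu huv.symm with h | h
      · exact .inl h.symm
      · exact .inr h.symm
    · exact hcross u v hu hv huv
    · have hNuv : N.Adj u v := ⟨huv, by simpa [hR] using hu, by simpa [hR] using hv⟩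
      have hK : comp H R v = comp H R u := comp_eq_of_mem (mem_comp.2 hNuv.reachable)
      simp only [hφ, if_neg hu, if_neg hv]
      have hends2 : ends v = ends u := by simp only [hends', hK]
      rw [hends2, hK]
      have hru : N.Reachable (g (comp H R u)).1.1 u :=
        (mem_comp.1 (mem_edgesTo.1 (hg u hu).1).1).symm
      have t1 := dist_triangle_of_reachable hru hNuv.reachable
      have t2 := dist_triangle_of_reachable (hru.trans hNuv.reachable) hNuv.symm.reachable
      have t3 : N.dist u v = 1 := SimpleGraph.dist_eq_one_iff_adj.2 hNuv
      rw [N.dist_comm (u := v) (v := u)] at t2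
      exact hπstep _ _ _ _ (by omega) (by omega)
  have hwalk : ∀ u v (p : H.Walk u v), Near G (S : Set W)ᶜ p.length (φ u) (φ v) := by
    intro u v p
    induction p with
    | nil => exact Near.refl _ _ _ _
    | cons h p ih => exact ((hstep _ _ h).trans ih).mono (by simp; omega)
  have hlip : ∀ u v, Near G (S : Set W)ᶜ (H.dist u v) (φ u) (φ v) := fun u v => by
    obtain ⟨p, hp⟩ := hH.exists_walk_length_eq_dist u v
    rw [← hp]
    exact hwalk u v p
  have hsurj : ∀ s ∈ S, ∃ v, φ v = s := by
    intro s hs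
    obtain ⟨e, he, hse⟩ := Finset.mem_biUnion.1 hs
    rcases Finset.mem_union.1 he with h | h
    · obtain ⟨b, hb, rfl⟩ := Finset.mem_image.1 h
      obtain ⟨i, hi, rfl⟩ := (πmem _ _ _).1 hse
      rw [SimpleGraph.dist_self, nonpos_iff_eq_zero] at hi
      exact ⟨b, by rw [hφB b hb, hi, π0]⟩
    · obtain ⟨v, hv, rfl⟩ := Finset.mem_image.1 h
      have hv' : v ∉ B := by simpa using hv
      obtain ⟨i, hi, rfl⟩ := (πmem _ _ _).1 hse
      obtain ⟨h1, h2, -⟩ := hg v hv'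
      obtain ⟨k1, b1, -⟩ := mem_edgesTo.1 h1
      obtain ⟨k2, b2, -⟩ := mem_edgesTo.1 h2
      have hd := hdistends v hv'
      rcases Nat.eq_zero_or_pos i with h0 | h0
      · exact ⟨(g (comp H R v)).1.2, by rw [hφB _ b1, h0, π0]⟩
      rcases hi.lt_or_eq with hlt | heq
      -- A position `i` strictly inside of the path comes from the vertex at distance `i - 1` on a
      -- shortest path between the attachment vertices. It exists because the path of `G` is at most
      -- 2 longer than that one.
      · have hr : N.Reachable (g (comp H R v)).1.1 (g (comp H R v)).2.1 :=
          (mem_comp.1 k1).symm.trans (mem_comp.1 k2)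
        obtain ⟨f, f0, f1, f2, f3⟩ := exists_geodesic hr
        obtain ⟨h3, h4, -⟩ := f3 (i - 1) (by omega)
        have hwK : f (i - 1) ∈ comp H R v := mem_comp.2 ((mem_comp.1 k1).trans h3)
        have hK : comp H R (f (i - 1)) = comp H R v := comp_eq_of_mem hwK
        have hwB : f (i - 1) ∉ B := (hmemR _).1 (comp_subset ((hmemR v).2 hv') hwK)
        refine ⟨f (i - 1), ?_⟩
        have hends2 : ends (f (i - 1)) = ends v := by simp only [hends', hK]
        simp only [hφ, if_neg hwB]
        rw [hends2, hK, h4, show min (i - 1 + 1) (G.dist (ends v).1 (ends v).2) = i by omega]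
      · exact ⟨(g (comp H R v)).2.2, by rw [hφB _ b2, heq, π1]⟩
  refine ⟨T, hTcard, fun b hb => hφB b hb ▸ hφS b, ⟨⟨φ b₀, hφS b₀⟩, ?_⟩, ?_⟩
  · intro s hs t ht
    obtain ⟨u, rfl⟩ := hsurj s hs
    obtain ⟨v, rfl⟩ := hsurj t ht
    exact (hlip u v).reachable
  -- One preimage for each vertex of `S`: these are distinct, and `φ` increases no distance.
  · choose! ψ hψ using hsurj
    have hψinj : Set.InjOn ψ (S : Set W) := fun s hs t ht h => by
      rw [← hψ s hs, h, hψ t ht]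
    calc distSum G S ≤ ∑ s ∈ S, ∑ t ∈ S, H.dist (ψ s) (ψ t) :=
          Finset.sum_le_sum fun s hs => Finset.sum_le_sum fun t ht => by
            have := (hlip (ψ s) (ψ t)).dist_avoid_le
            rwa [hψ s hs, hψ t ht] at this
      _ = ∑ u ∈ S.image ψ, ∑ v ∈ S.image ψ, H.dist u v := by
        rw [Finset.sum_image hψinj]
        exact Finset.sum_congr rfl fun s _ => (Finset.sum_image hψinj).symm
      _ ≤ ∑ u, ∑ v, H.dist u v :=
        (Finset.sum_le_sum fun u _ => Finset.sum_le_sum_of_subset (Finset.subset_univ _)).trans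
          (Finset.sum_le_sum_of_subset (Finset.subset_univ _))

end Fold
end MinWiener

/-! ### Connectors, distance sums and optimal sets -/

namespace MinWiener

section Transfer
variable {V' V : Type*} {G' : SimpleGraph V'} {N : SimpleGraph V} {ι : V' → V}

theorem exists_walk_lift (hι : ∀ a w, N.Adj (ι a) w → ∃ b, ι b = w ∧ G'.Adj a b) {u w : V}
    (p : N.Walk u w) : ∀ a, ι a = u → ∃ b, ι b = w ∧ ∃ q : G'.Walk a b, q.length = p.length := by
  induction p with
  | nil => exact fun a ha => ⟨a, ha, .nil, rfl⟩
  | cons h p ih =>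
    rintro a rfl
    obtain ⟨b, rfl, hab⟩ := hι _ _ h
    obtain ⟨c, hc, q, hq⟩ := ih b rfl
    exact ⟨c, hc, .cons hab q, by simp [hq]⟩

theorem dist_map_le (hι : ∀ a b, G'.Adj a b → N.Adj (ι a) (ι b)) {a b : V'}
    (h : G'.Reachable a b) : N.Reachable (ι a) (ι b) ∧ N.dist (ι a) (ι b) ≤ G'.dist a b := by
  obtain ⟨p, hp⟩ := h.exists_walk_length_eq_dist
  let f : G' →g N := ⟨ι, fun h => hι _ _ h⟩
  refine ⟨⟨p.map f⟩, ?_⟩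
  rw [← hp, ← SimpleGraph.Walk.length_map f p]
  exact SimpleGraph.dist_le _

/-- The image of `ι` is closed under adjacency in `N`, so walks between images lift and distances
agree. It is applied to induced subgraphs, on a subtype and, as `avoid`, on all vertices. -/
theorem dist_lift (hinj : Function.Injective ι) (hι : ∀ a b, G'.Adj a b → N.Adj (ι a) (ι b))
    (hι' : ∀ a w, N.Adj (ι a) w → ∃ b, ι b = w ∧ G'.Adj a b) {a b : V'}
    (h : N.Reachable (ι a) (ι b)) : G'.Reachable a b ∧ G'.dist a b = N.dist (ι a) (ι b) := by
  obtain ⟨p, hp⟩ := h.exists_walk_length_eq_dist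
  obtain ⟨c, hc, q, hq⟩ := exists_walk_lift hι' p a rfl
  obtain rfl := hinj hc
  refine ⟨⟨q⟩, le_antisymm ?_ (dist_map_le hι ⟨q⟩).2⟩
  rw [← hp, ← hq]
  exact SimpleGraph.dist_le q

end Transfer

/-- Every unordered pair comes from two ordered ones, except for the diagonal, which contributes
`0`. -/
theorem two_mul_wienerIndex {V : Type*} [Fintype V] (G : SimpleGraph V) :
    2 * wienerIndex G = ∑ u, ∑ v, G.dist u v := by
  classical
  set F : Sym2 V → ℕ := Sym2.lift ⟨fun u v => G.dist u v, fun _ _ => SimpleGraph.dist_comm⟩ with hF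
  have h1 : ∑ u, ∑ v, G.dist u v = ∑ p : V × V, F s(p.1, p.2) := by
    rw [Fintype.sum_prod_type]
    rfl
  have h2 : ∑ p : V × V, F s(p.1, p.2) =
      ∑ e, ∑ p ∈ Finset.univ.filter fun p : V × V => s(p.1, p.2) = e, F s(p.1, p.2) :=
    (Finset.sum_fiberwise Finset.univ (fun p : V × V => s(p.1, p.2)) _).symm
  have h3 : wienerIndex G = ∑ e, F e := by
    unfold wienerIndex
    congr!
  rw [h1, h2, h3, Finset.mul_sum]
  refine Finset.sum_congr rfl fun e _ => ?_
  induction e using Sym2.ind with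
  | _ a b =>
    by_cases hab : a = b
    · subst hab
      have h0 : F s(a, a) = 0 := by simp [hF]
      rw [h0, mul_zero]
      refine (Finset.sum_eq_zero fun p hp => ?_).symm
      rw [(Finset.mem_filter.1 hp).2, h0]
    · have hfib : (Finset.univ.filter fun p : V × V => s(p.1, p.2) = s(a, b)) = {(a, b), (b, a)} := by
        ext ⟨x, y⟩
        simp
      rw [hfib, Finset.sum_pair (by simp [hab])]
      have : F s(b, a) = F s(a, b) := by rw [Sym2.eq_swap]
      simp only [this]
      omega

theorem sum_sum_subtype {V : Type*} {p : V → Prop} [Fintype {v // p v}] (S : Finset V)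
    (h : ∀ v, v ∈ S ↔ p v) (f : V → V → ℕ) :
    ∑ u : {v // p v}, ∑ v : {v // p v}, f u v = ∑ u ∈ S, ∑ v ∈ S, f u v := by
  rw [Finset.sum_subtype S h]
  exact Finset.sum_congr rfl fun u _ => (Finset.sum_subtype S h _).symm

section Optimal
variable {V : Type*} {G : SimpleGraph V} {Q S : Finset V}

/-- A connector need not be induced, but adding the missing edges can only shorten distances. -/
theorem distSum_le_of_connector [Fintype V] {H : G.Subgraph} (hH : H.Connected) (hS : ∀ v, v ∈ S ↔ v ∈ H.verts) :
    IsConnectedOn G S ∧ distSum G S ≤ 2 * subgraphWienerIndex H := by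
  classical
  have hadj : ∀ a b : H.verts, H.coe.Adj a b → (avoid G (S : Set V)ᶜ).Adj a b := fun a b h =>
    ⟨H.adj_sub h, by simp [hS], by simp [hS]⟩
  have hc : H.coe.Connected := hH.coe
  constructor
  · obtain ⟨v⟩ := hc.nonempty
    refine ⟨⟨v, (hS _).2 v.2⟩, fun u hu v hv => ?_⟩
    exact (dist_map_le hadj (hc ⟨u, (hS u).1 hu⟩ ⟨v, (hS v).1 hv⟩)).1
  · rw [subgraphWienerIndex, two_mul_wienerIndex, distSum,
      ← sum_sum_subtype S hS fun u v => (avoid G (S : Set V)ᶜ).dist u v]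
    exact Finset.sum_le_sum fun u _ => Finset.sum_le_sum fun v _ => (dist_map_le hadj (hc u v)).2

theorem isMinWienerConnector_induce [Fintype V] (hS : IsConnectedOn G S) (hQ : Q ⊆ S)
    (hmin : ∀ S', IsConnectedOn G S' → Q ⊆ S' → distSum G S ≤ distSum G S') :
    IsMinWienerConnector Q ((⊤ : G.Subgraph).induce (S : Set V)) := by
  classical
  set H := (⊤ : G.Subgraph).induce (S : Set V) with hHdef
  have hverts : ∀ v, v ∈ S ↔ v ∈ H.verts := fun v => by simp [hHdef]
  have hadj : ∀ a b : H.verts, H.coe.Adj a b → (avoid G (S : Set V)ᶜ).Adj a b := fun a b h =>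
    ⟨H.adj_sub h, by simp [hverts], by simp [hverts]⟩
  have hadj' : ∀ (a : H.verts) (w : V), (avoid G (S : Set V)ᶜ).Adj a w →
      ∃ b : H.verts, (b : V) = w ∧ H.coe.Adj a b := by
    rintro a w ⟨h1, h2, h3⟩
    have ha : (a : V) ∈ S := by simpa using h2
    have hw : w ∈ S := by simpa using h3
    exact ⟨⟨w, (hverts w).1 hw⟩, rfl, by simp [hHdef, ha, hw, h1]⟩
  have hlift : ∀ a b : H.verts, H.coe.Reachable a b ∧
      H.coe.dist a b = (avoid G (S : Set V)ᶜ).dist a b := fun a b =>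
    dist_lift Subtype.val_injective hadj hadj' (hS.2 a ((hverts _).2 a.2) b ((hverts _).2 b.2))
  have hconn : H.Connected := by
    refine SimpleGraph.Subgraph.connected_iff'.2 ?_
    obtain ⟨v, hv⟩ := hS.1
    exact { preconnected := fun a b => (hlift a b).1, nonempty := ⟨⟨v, (hverts v).1 hv⟩⟩ }
  refine ⟨⟨fun v hv => (hverts v).1 (hQ (by simpa using hv)), hconn⟩, fun H' hH' => ?_⟩
  have e1 : 2 * subgraphWienerIndex H = distSum G S := by
    rw [subgraphWienerIndex, two_mul_wienerIndex, distSum,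
      ← sum_sum_subtype S hverts fun u v => (avoid G (S : Set V)ᶜ).dist u v]
    exact Finset.sum_congr rfl fun u _ => Finset.sum_congr rfl fun v _ => (hlift u v).2
  obtain ⟨h1, h2⟩ := distSum_le_of_connector (S := H'.verts.toFinset) hH'.2 (by simp)
  have h3 := hmin _ h1 fun v hv => by simpa using hH'.1 (by simpa using hv)
  omega

/-- The subgraph induced by an optimal set is lean. -/
theorem isLean_induce (hS : IsConnectedOn G S) (hQ : Q ⊆ S)
    (hmin : ∀ S', IsConnectedOn G S' → Q ⊆ S' → distSum G S ≤ distSum G S') :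
    (G.induce {v | v ∈ S}).Connected ∧
      ∑ u, ∑ v, (G.induce {v | v ∈ S}).dist u v = distSum G S ∧
      ∀ Q' : Finset {v | v ∈ S}, (∀ v, v ∈ Q' ↔ (v : V) ∈ Q) → IsLean (G.induce {v | v ∈ S}) Q' := by
  classical
  set H := G.induce {v | v ∈ S} with hHdef
  have hval : ∀ v : {v | v ∈ S}, (v : V) ∈ S := fun v => v.2
  have hlift : ∀ a b : {v | v ∈ S}, H.Reachable a b ∧
      H.dist a b = (avoid G (S : Set V)ᶜ).dist a b := by
    intro a b
    refine dist_lift Subtype.val_injective (fun a b h => (⟨h, by simp, by simp⟩ :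
      (avoid G (S : Set V)ᶜ).Adj a b)) ?_ (hS.2 a (hval a) b (hval b))
    rintro a w ⟨h1, h2, h3⟩
    exact ⟨⟨w, by simpa using h3⟩, rfl, h1⟩
  have hsum : ∑ u, ∑ v, H.dist u v = distSum G S := by
    rw [distSum, ← sum_sum_subtype (p := fun v => v ∈ S) S (by simp) fun u v => (avoid G (S : Set V)ᶜ).dist u v]
    exact Finset.sum_congr rfl fun u _ => Finset.sum_congr rfl fun v _ => (hlift u v).2
  refine ⟨?_, hsum, ?_⟩
  · obtain ⟨v, hv⟩ := hS.1
    exact { preconnected := fun a b => (hlift a b).1, nonempty := ⟨⟨v, hv⟩⟩ }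
  · intro Q' hQ' Z hZQ hZ hreach
    set S' : Finset V := Zᶜ.map ⟨Subtype.val, Subtype.val_injective⟩ with hS'
    have hmemS' : ∀ v, v ∈ S' ↔ ∃ h : v ∈ S, (⟨v, h⟩ : {v | v ∈ S}) ∉ Z := fun v => by
      simp [hS']
    have hmemZ : ∀ v : {v | v ∈ S}, (v : V) ∈ S' ↔ v ∉ Z := fun v => by
      rw [hmemS']
      exact ⟨fun ⟨_, h⟩ => h, fun h => ⟨v.2, h⟩⟩
    have hadj : ∀ a b : {v | v ∈ S}, (avoid H Z).Adj a b → (avoid G (S' : Set V)ᶜ).Adj a b := by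
      rintro a b ⟨h1, h2, h3⟩
      refine ⟨h1, ?_, ?_⟩
      · simpa [-Finset.coe_map] using (hmemZ a).2 (by simpa using h2)
      · simpa [-Finset.coe_map] using (hmemZ b).2 (by simpa using h3)
    have hadj' : ∀ (a : {v | v ∈ S}) (w : V), (avoid G (S' : Set V)ᶜ).Adj a w →
        ∃ b : {v | v ∈ S}, (b : V) = w ∧ (avoid H Z).Adj a b := by
      rintro a w ⟨h1, h2, h3⟩
      have ha : (a : V) ∈ S' := by
        rw [Set.mem_compl_iff, not_not, Finset.mem_coe] at h2
        exact h2
      have hw : w ∈ S' := by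
        rw [Set.mem_compl_iff, not_not, Finset.mem_coe] at h3
        exact h3
      obtain ⟨hwS, hwZ⟩ := (hmemS' w).1 hw
      exact ⟨⟨w, hwS⟩, rfl, h1, by simpa using (hmemZ a).1 ha, by simpa using hwZ⟩
    have hreach' : ∀ u v : {v | v ∈ S}, u ∉ Z → v ∉ Z →
        (avoid G (S' : Set V)ᶜ).Reachable u v := fun u v hu hv => (dist_map_le hadj (hreach u v hu hv)).1
    have hS'conn : IsConnectedOn G S' := by
      obtain ⟨z, hz⟩ := hZ
      refine ⟨⟨z, (hmemZ z).2 (by simpa using hz)⟩, fun u hu v hv => ?_⟩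
      obtain ⟨hu1, hu2⟩ := (hmemS' u).1 hu
      obtain ⟨hv1, hv2⟩ := (hmemS' v).1 hv
      exact hreach' ⟨u, hu1⟩ ⟨v, hv1⟩ hu2 hv2
    have hQS' : Q ⊆ S' := fun v hv => (hmemS' v).2 ⟨hQ hv, fun h =>
      Finset.disjoint_left.1 hZQ h ((hQ' ⟨v, hQ hv⟩).2 hv)⟩
    have h := hmin S' hS'conn hQS'
    rw [hsum]
    refine h.trans (le_of_eq ?_)
    have hsum' : distSum G S' = ∑ u ∈ Zᶜ, ∑ v ∈ Zᶜ, (avoid G (S' : Set V)ᶜ).dist u v := by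
      unfold distSum
      generalize (fun u v => (avoid G (S' : Set V)ᶜ).dist u v) = f
      rw [hS', Finset.sum_map]
      exact Finset.sum_congr rfl fun u _ => by rw [Finset.sum_map]; rfl
    rw [hsum']
    exact Finset.sum_congr (by ext; simp) fun u hu => Finset.sum_congr (by ext; simp) fun v hv =>
      ((dist_lift Subtype.val_injective hadj hadj'
        (hreach' u v (by simpa using hu) (by simpa using hv))).2).symm

end Optimal

open Classical in
/-- Some optimal set is a union of few shortest paths. -/
theorem exists_optimal_union : ∃ c : ℕ, ∀ (V : Type) [Fintype V] (G : SimpleGraph V) (Q : Finset V)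
    (path : V → V → Finset V), G.Connected → (∀ x y, IsGeo G x y (path x y)) →
    ∃ T : Finset (V × V), T.card ≤ 2 ^ (c * (Q.card + 1)) ∧
      Q ⊆ T.biUnion (fun e => path e.1 e.2) ∧ IsConnectedOn G (T.biUnion fun e => path e.1 e.2) ∧
      ∀ S', IsConnectedOn G S' → Q ⊆ S' → distSum G (T.biUnion fun e => path e.1 e.2) ≤ distSum G S' := by
  obtain ⟨c, hc⟩ := exists_card_hubs_le
  refine ⟨2 * (c + 1), fun V _ G Q path hG hpath => ?_⟩
  have huniv : IsConnectedOn G (Finset.univ : Finset V) := by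
    obtain ⟨v⟩ := hG.nonempty
    refine ⟨⟨v, by simp⟩, fun u _ v _ => ?_⟩
    rw [Finset.coe_univ, Set.compl_univ]
    exact (near_empty_of_connected hG u v).reachable
  obtain ⟨S, hS, hmin⟩ := Finset.exists_min_image
    (Finset.univ.filter fun S => IsConnectedOn G S ∧ Q ⊆ S) (distSum G) ⟨Finset.univ, by simp [huniv]⟩
  simp only [Finset.mem_filter, Finset.mem_univ, true_and] at hS hmin
  obtain ⟨hconn, hsum, hlean⟩ := isLean_induce hS.1 hS.2 fun S' h1 h2 => hmin S' ⟨h1, h2⟩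
  set H := G.induce {v | v ∈ S}
  set Q' : Finset {v | v ∈ S} := Finset.univ.filter fun v => (v : V) ∈ Q with hQ'
  have hQ'mem : ∀ v, v ∈ Q' ↔ (v : V) ∈ Q := fun v => by simp [hQ']
  have hL := hlean Q' hQ'mem
  have hQ'card : Q'.card ≤ Q.card := Finset.card_le_card_of_injOn Subtype.val
    (fun v hv => (hQ'mem v).1 hv) Subtype.val_injective.injOn
  have hhubs := hc _ H Q' hconn hL
  obtain ⟨v₀⟩ := hconn.nonempty
  -- The additional vertex makes `B` nonempty even if there are no hubs, as may happen for empty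
  -- `Q`.
  set B := insert v₀ (hubs H Q') with hB
  have hBcard : B.card ≤ 2 ^ ((c + 1) * (Q.card + 1)) := by
    have h1 : B.card ≤ (hubs H Q').card + 1 := Finset.card_insert_le _ _
    have h2 : 2 ^ (c * (Q'.card + 1)) ≤ 2 ^ (c * (Q.card + 1)) :=
      Nat.pow_le_pow_right (by norm_num) (Nat.mul_le_mul_left _ (by omega))
    have h3 : 2 ^ ((c + 1) * (Q.card + 1)) = 2 ^ (c * (Q.card + 1)) * 2 ^ (Q.card + 1) := by
      rw [← pow_add]; congr 1; ring
    have h4 : 2 ≤ 2 ^ (Q.card + 1) := by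
      calc 2 = 2 ^ 1 := rfl
        _ ≤ _ := Nat.pow_le_pow_right (by norm_num) (by omega)
    have h5 : 1 ≤ 2 ^ (c * (Q.card + 1)) := Nat.one_le_two_pow
    rw [h3]
    nlinarith
  let ι : H →g G := ⟨Subtype.val, fun h => h⟩
  obtain ⟨T, hT, hTB, hTc, hTs⟩ := exists_fold (B := B) hconn ι path hpath (fun v hv hbr => hv
    (Finset.mem_insert_of_mem (mem_hubs.2 (.inr hbr))))
    ⟨v₀, Finset.mem_insert_self _ _⟩
  refine ⟨T, hT.trans ?_, ?_, hTc, fun S' h1 h2 => ?_⟩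
  · calc B.card ^ 2 ≤ (2 ^ ((c + 1) * (Q.card + 1))) ^ 2 := Nat.pow_le_pow_left hBcard 2
      _ = _ := by rw [← pow_mul]; congr 1; ring
  · intro q hq
    exact hTB ⟨q, hS.2 hq⟩ (Finset.mem_insert_of_mem (mem_hubs.2 (.inl ((hQ'mem _).2 hq))))
  · exact (hTs.trans (le_of_eq hsum)).trans (hmin S' ⟨h1, h2⟩)

end MinWiener

namespace MinWiener

/-! ### A small imperative language -/

/-- Expressions: literals, variables, parameters, sums, truncated differences, array entries and
input cells. -/
inductive Expr where
  | lit (c : ℕ) : Expr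
  | var (x : ℕ) : Expr
  | par (p : ℕ) : Expr
  | add (e f : Expr) : Expr
  | sub (e f : Expr) : Expr
  | arr (j : Fin 8) (e : Expr) : Expr
  | raw (e : Expr) : Expr

/-- Commands. The loop `rep x p c` runs `c` for all values of `x` below the parameter `p`. -/
inductive Cmd where
  | skip : Cmd
  | set (x : ℕ) (e : Expr) : Cmd
  | put (j : Fin 8) (e f : Expr) : Cmd
  | out (e f : Expr) : Cmd
  | seq (c d : Cmd) : Cmd
  | ite (e : Expr) (c d : Cmd) : Cmd
  | rep (x p : ℕ) (c : Cmd) : Cmd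

/-- The values of the variables, the arrays and the input cells. -/
structure Store where
  var : ℕ → ℕ
  arr : Fin 8 → ℕ → ℕ
  raw : ℕ → ℕ

namespace Store

/-- Assign a variable. -/
def setVar (σ : Store) (x v : ℕ) : Store := { σ with var := Function.update σ.var x v }

/-- Assign an array entry. -/
def setArr (σ : Store) (j : Fin 8) (i v : ℕ) : Store :=
  { σ with arr := Function.update σ.arr j (Function.update (σ.arr j) i v) }

/-- Assign an input cell. -/
def setRaw (σ : Store) (a v : ℕ) : Store := { σ with raw := Function.update σ.raw a v }

end Store

/-- The value of an expression. The parameter `0` is the number of input cells. -/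
def Expr.eval (par : ℕ → ℕ) (σ : Store) : Expr → ℕ
  | lit c => c
  | var x => σ.var x
  | .par p => par p
  | add e f => e.eval par σ + f.eval par σ
  | sub e f => e.eval par σ - f.eval par σ
  | arr j e => σ.arr j (e.eval par σ)
  | raw e => if e.eval par σ < par 0 then σ.raw (e.eval par σ) else 0

/-- `f (m - 1) (… (f 1 (f 0 σ)))` -/
def iter {α : Type*} (f : ℕ → α → α) : ℕ → α → α
  | 0, σ => σ
  | m + 1, σ => f m (iter f m σ)

/-- The effect of a command. -/
def Cmd.den (par : ℕ → ℕ) : Cmd → Store → Store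
  | skip, σ => σ
  | set x e, σ => σ.setVar x (e.eval par σ)
  | put j e f, σ => σ.setArr j (e.eval par σ) (f.eval par σ)
  | out e f, σ => if e.eval par σ < par 0 then σ.setRaw (e.eval par σ) (f.eval par σ) else σ
  | seq c d, σ => d.den par (c.den par σ)
  | ite e c d, σ => if e.eval par σ ≠ 0 then c.den par σ else d.den par σ
  | rep x p c, σ => iter (fun i σ => c.den par (σ.setVar x i)) (par p) σ

/-- The time to evaluate an expression. -/
def Expr.cost : Expr → ℕ
  | lit _ => 1
  | var _ => 2
  | par _ => 2
  | add e f => e.cost + f.cost + 1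
  | sub e f => e.cost + f.cost + 1
  | arr _ e => e.cost + 7
  | raw e => e.cost + 3

/-- A time bound for a command. -/
def Cmd.cost (par : ℕ → ℕ) : Cmd → ℕ
  | skip => 1
  | set _ e => e.cost + 2
  | put _ e f => e.cost + f.cost + 7
  | out e f => e.cost + f.cost + 3
  | seq c d => c.cost par + d.cost par
  | ite e c d => e.cost + c.cost par + d.cost par + 1
  | rep _ p c => par p * (c.cost par + 6) + 4

/-- The code of an expression. The result is stored in register `3 * k + 2`. -/
def Expr.compile (k : ℕ) : Expr → Prog
  | lit c => .const (3 * k + 2) c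
  -- The machine has no instruction to copy a register; a sum with `0` does it.
  | var x => .seq (.const (3 * k + 2) 0) (.add (3 * k + 2) (3 * x) (3 * k + 2))
  | par p => .seq (.const (3 * k + 2) 0) (.add (3 * k + 2) (3 * p + 1) (3 * k + 2))
  | add e f => .seq (e.compile k) (.seq (f.compile (k + 1))
      (.add (3 * k + 2) (3 * k + 2) (3 * (k + 1) + 2)))
  | sub e f => .seq (e.compile k) (.seq (f.compile (k + 1))
      (.sub (3 * k + 2) (3 * k + 2) (3 * (k + 1) + 2)))
  -- The eight arrays are interleaved behind the input cells. Three doublings multiply the index by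
  -- 8, and register 1 holds parameter `0`, the address at which the arrays begin.
  | arr j e => .seq (e.compile k) (.seq (.add (3 * k + 2) (3 * k + 2) (3 * k + 2))
      (.seq (.add (3 * k + 2) (3 * k + 2) (3 * k + 2))
      (.seq (.add (3 * k + 2) (3 * k + 2) (3 * k + 2))
      (.seq (.const (3 * k + 5) j) (.seq (.add (3 * k + 2) (3 * k + 2) (3 * k + 5))
      (.seq (.add (3 * k + 2) (3 * k + 2) 1) (.load (3 * k + 2) (3 * k + 2))))))))
  | raw e => .seq (e.compile k) (.seq (.sub (3 * k + 5) 1 (3 * k + 2))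
      (.ite (3 * k + 5) (.load (3 * k + 2) (3 * k + 2)) (.const (3 * k + 2) 0)))

/-- The code of a command. It uses the registers `3 * i + 2` with `k ≤ i` as temporaries. -/
def Cmd.compile (k : ℕ) : Cmd → Prog
  | skip => .skip
  | set x e => .seq (e.compile k) (.seq (.const (3 * k + 5) 0) (.add (3 * x) (3 * k + 2) (3 * k + 5)))
  | put j e f => .seq (e.compile k) (.seq (.add (3 * k + 2) (3 * k + 2) (3 * k + 2))
      (.seq (.add (3 * k + 2) (3 * k + 2) (3 * k + 2))
      (.seq (.add (3 * k + 2) (3 * k + 2) (3 * k + 2))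
      (.seq (.const (3 * k + 5) j) (.seq (.add (3 * k + 2) (3 * k + 2) (3 * k + 5))
      (.seq (.add (3 * k + 2) (3 * k + 2) 1) (.seq (f.compile (k + 1))
      (.store (3 * k + 2) (3 * (k + 1) + 2)))))))))
  | out e f => .seq (e.compile k) (.seq (f.compile (k + 1)) (.seq (.sub (3 * k + 8) 1 (3 * k + 2))
      (.ite (3 * k + 8) (.store (3 * k + 2) (3 * (k + 1) + 2)) .skip)))
  | seq c d => .seq (c.compile k) (d.compile k)
  | ite e c d => .seq (e.compile k) (.ite (3 * k + 2) (c.compile k) (d.compile k))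
  | rep x p c => .seq (.const (3 * k + 5) 0) (.seq (.add (3 * k + 2) (3 * p + 1) (3 * k + 5))
      (.seq (.skip) (.loop (3 * k + 2) (.seq (.const (3 * k + 8) 0)
      (.seq (.add (3 * x) (3 * k + 5) (3 * k + 8)) (.seq (c.compile (k + 2))
      (.seq (.const (3 * k + 8) 1) (.seq (.sub (3 * k + 2) (3 * k + 2) (3 * k + 8))
      (.add (3 * k + 5) (3 * k + 5) (3 * k + 8))))))))))

/-- The machine state `s` represents the store `σ` and the parameters `par`. -/
structure Rel (par : ℕ → ℕ) (σ : Store) (s : State) : Prop where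
  varEq : ∀ x, s.reg (3 * x) = σ.var x
  parEq : ∀ p, s.reg (3 * p + 1) = par p
  arrEq : ∀ (j : Fin 8) i, s.mem (par 0 + 8 * i + j) = σ.arr j i
  rawEq : ∀ a < par 0, s.mem a = σ.raw a

variable {par : ℕ → ℕ} {σ : Store} {s : State}

theorem Rel.of_temp {s' : State} (h : Rel par σ s) (hm : s'.mem = s.mem)
    (hr : ∀ r, r % 3 ≠ 2 → s'.reg r = s.reg r) : Rel par σ s' where
  varEq x := by rw [hr _ (by omega), h.varEq]
  parEq p := by rw [hr _ (by omega), h.parEq]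
  arrEq j i := by rw [hm, h.arrEq]
  rawEq a ha := by rw [hm, h.rawEq a ha]

/-- The last clause says that temporaries with smaller index survive; this protects the left operand
while the right one is evaluated with `k + 1`. -/
theorem Expr.runs (e : Expr) : ∀ (k : ℕ) (s : State), Rel par σ s → ∃ t s',
    Runs (e.compile k) s t s' ∧ t ≤ e.cost ∧ s'.mem = s.mem ∧ s'.reg (3 * k + 2) = e.eval par σ ∧
      ∀ r, r % 3 ≠ 2 ∨ r < 3 * k + 2 → s'.reg r = s.reg r := by
  have hupd : ∀ (s : State) (r v x : ℕ), (s.setReg r v).reg x = if x = r then v else s.reg x :=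
    fun s r v x => by simp [State.setReg, Function.update_apply]
  have hmem : ∀ (s : State) (r v : ℕ), (s.setReg r v).mem = s.mem := fun _ _ _ => rfl
  induction e with
  | lit c =>
    intro k s _
    refine ⟨_, _, .const _ _ _, le_rfl, rfl, by simp [hupd, Expr.eval], fun r hr => ?_⟩
    rw [hupd, if_neg (by omega)]
  | var x =>
    intro k s hs
    refine ⟨_, _, .seq (.const _ _ _) (.add _ _ _ _), le_rfl, rfl, ?_, fun r hr => ?_⟩
    · simp only [hupd, if_true, if_neg (show ¬ 3 * x = 3 * k + 2 by omega), hs.varEq, Expr.eval]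
      omega
    · rw [hupd, if_neg (by omega), hupd, if_neg (by omega)]
  | par p =>
    intro k s hs
    refine ⟨_, _, .seq (.const _ _ _) (.add _ _ _ _), le_rfl, rfl, ?_, fun r hr => ?_⟩
    · simp only [hupd, if_true, if_neg (show ¬ 3 * p + 1 = 3 * k + 2 by omega), hs.parEq, Expr.eval]
      omega
    · rw [hupd, if_neg (by omega), hupd, if_neg (by omega)]
  | add e f ihe ihf =>
    intro k s hs
    obtain ⟨t, s1, r1, c1, m1, v1, p1⟩ := ihe k s hs
    obtain ⟨t', s2, r2, c2, m2, v2, p2⟩ := ihf (k + 1) s1 (hs.of_temp m1 fun r hr => p1 r (.inl hr))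
    refine ⟨_, _, .seq r1 (.seq r2 (.add _ _ _ _)), by simp only [Expr.cost]; omega, by rw [hmem, m2, m1], ?_,
      fun r hr => ?_⟩
    · rw [hupd, if_pos rfl, v2, p2 _ (by omega), v1]; rfl
    · rw [hupd, if_neg (by omega), p2 _ (by omega), p1 _ (by omega)]
  | sub e f ihe ihf =>
    intro k s hs
    obtain ⟨t, s1, r1, c1, m1, v1, p1⟩ := ihe k s hs
    obtain ⟨t', s2, r2, c2, m2, v2, p2⟩ := ihf (k + 1) s1 (hs.of_temp m1 fun r hr => p1 r (.inl hr))
    refine ⟨_, _, .seq r1 (.seq r2 (.sub _ _ _ _)), by simp only [Expr.cost]; omega, by rw [hmem, m2, m1], ?_,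
      fun r hr => ?_⟩
    · rw [hupd, if_pos rfl, v2, p2 _ (by omega), v1]; rfl
    · rw [hupd, if_neg (by omega), p2 _ (by omega), p1 _ (by omega)]
  | arr j e ihe =>
    intro k s hs
    obtain ⟨t, s1, r1, c1, m1, v1, p1⟩ := ihe k s hs
    refine ⟨_, _, .seq r1 (.seq (.add _ _ _ _) (.seq (.add _ _ _ _) (.seq (.add _ _ _ _)
      (.seq (.const _ _ _) (.seq (.add _ _ _ _) (.seq (.add _ _ _ _) (.load _ _ _))))))),
      by simp only [Expr.cost]; omega, by simp only [hmem, m1], ?_, fun r hr => ?_⟩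
    · have h1 : s1.reg 1 = par 0 := by rw [p1 1 (by omega)]; exact hs.parEq 0
      simp only [hupd, hmem, if_true, if_neg (show ¬ 3 * k + 2 = 3 * k + 5 by omega),
        if_neg (show ¬ 1 = 3 * k + 2 by omega), if_neg (show ¬ 1 = 3 * k + 5 by omega), h1, v1, m1,
        Expr.eval]
      rw [← hs.arrEq]
      congr 1
      omega
    · simp only [hupd, if_neg (show ¬ r = 3 * k + 2 by omega), if_neg (show ¬ r = 3 * k + 5 by omega)]
      exact p1 _ (by omega)
  | raw e ihe =>
    intro k s hs
    obtain ⟨t, s1, r1, c1, m1, v1, p1⟩ := ihe k s hs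
    have h1 : s1.reg 1 = par 0 := by rw [p1 1 (by omega)]; exact hs.parEq 0
    have h2 : (s1.setReg (3 * k + 5) (s1.reg 1 - s1.reg (3 * k + 2))).reg (3 * k + 5) =
        par 0 - e.eval par σ := by rw [hupd, if_pos rfl, h1, v1]
    by_cases hlt : e.eval par σ < par 0
    · refine ⟨_, _, .seq r1 (.seq (.sub _ _ _ _) (.ite_true (by rw [h2]; omega) (.load _ _ _))),
        by simp only [Expr.cost]; omega, by simp only [hmem, m1], ?_, fun r hr => ?_⟩
      · simp only [hupd, hmem, if_true, if_neg (show ¬ 3 * k + 2 = 3 * k + 5 by omega), v1, m1,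
          Expr.eval, if_pos hlt]
        exact hs.rawEq _ hlt
      · rw [hupd, if_neg (by omega), hupd, if_neg (by omega), p1 _ (by omega)]
    · refine ⟨_, _, .seq r1 (.seq (.sub _ _ _ _) (.ite_false (by rw [h2]; omega) (.const _ _ _))),
        by simp only [Expr.cost]; omega, by simp only [hmem, m1], ?_, fun r hr => ?_⟩
      · simp only [hupd, if_true, Expr.eval, if_neg hlt]
      · rw [hupd, if_neg (by omega), hupd, if_neg (by omega), p1 _ (by omega)]

theorem Rel.setVar (h : Rel par σ s) (x v : ℕ) : Rel par (σ.setVar x v) (s.setReg (3 * x) v) where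
  varEq y := by
    simp only [State.setReg, Store.setVar, Function.update_apply]
    by_cases hxy : y = x
    · simp [hxy]
    · rw [if_neg (by omega), if_neg hxy, h.varEq]
  parEq p := by
    simp only [State.setReg, Function.update_apply]
    rw [if_neg (by omega), h.parEq]
  arrEq := h.arrEq
  rawEq := h.rawEq

theorem Rel.setArr (h : Rel par σ s) (j : Fin 8) (i v : ℕ) :
    Rel par (σ.setArr j i v) (s.setMem (par 0 + 8 * i + j) v) where
  varEq := h.varEq
  parEq := h.parEq
  arrEq j' i' := by
    simp only [State.setMem, Store.setArr, Function.update_apply]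
    by_cases hj : j' = j
    · subst hj
      simp only [if_true, Function.update_apply]
      by_cases hi : i' = i
      · simp [hi]
      · rw [if_neg (by omega), if_neg hi, h.arrEq]
    · rw [if_neg (by omega), if_neg hj, h.arrEq]
  rawEq a ha := by
    simp only [State.setMem, Store.setArr, Function.update_apply]
    rw [if_neg (by omega), h.rawEq a ha]

theorem Rel.setRaw (h : Rel par σ s) {a : ℕ} (ha : a < par 0) (v : ℕ) :
    Rel par (σ.setRaw a v) (s.setMem a v) where
  varEq := h.varEq
  parEq := h.parEq
  arrEq j i := by
    simp only [State.setMem, Store.setRaw, Function.update_apply]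
    rw [if_neg (by omega), h.arrEq]
  rawEq b hb := by
    simp only [State.setMem, Store.setRaw, Function.update_apply, h.rawEq b hb]

/-- The code of a command does what it should, in the time it should take. -/
theorem Cmd.runs (c : Cmd) : ∀ (k : ℕ) (σ : Store) (s : State), Rel par σ s → ∃ t s',
    Runs (c.compile k) s t s' ∧ t ≤ c.cost par ∧ Rel par (c.den par σ) s' ∧
      ∀ i < k, s'.reg (3 * i + 2) = s.reg (3 * i + 2) := by
  have hupd : ∀ (s : State) (r v x : ℕ), (s.setReg r v).reg x = if x = r then v else s.reg x :=
    fun s r v x => by simp [State.setReg, Function.update_apply]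
  have hmem : ∀ (s : State) (r v : ℕ), (s.setReg r v).mem = s.mem := fun _ _ _ => rfl
  have hreg : ∀ (s : State) (a v : ℕ), (s.setMem a v).reg = s.reg := fun _ _ _ => rfl
  have htmp : ∀ {par : ℕ → ℕ} {σ : Store} {s : State} (r v : ℕ), Rel par σ s → r % 3 = 2 →
      Rel par σ (s.setReg r v) := fun r v h hr => h.of_temp rfl fun x hx => by
    rw [hupd, if_neg (by omega)]
  induction c with
  | skip => exact fun k σ s hs => ⟨_, _, .skip _, le_rfl, hs, fun _ _ => rfl⟩
  | set x e =>
    intro k σ s hs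
    obtain ⟨t, s1, r1, c1, m1, v1, p1⟩ := e.runs k s hs
    refine ⟨_, _, .seq r1 (.seq (.const _ _ _) (.add _ _ _ _)), by simp only [Cmd.cost]; omega, ?_,
      fun i hi => ?_⟩
    · have h1 := htmp (3 * k + 5) 0 (hs.of_temp m1 fun r hr => p1 r (.inl hr)) (by omega)
      have h2 := h1.setVar x (e.eval par σ)
      simp only [hupd, if_true, if_neg (show ¬ 3 * k + 2 = 3 * k + 5 by omega), v1, add_zero]
      exact h2
    · rw [hupd, if_neg (by omega), hupd, if_neg (by omega), p1 _ (by omega)]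
  | put j e f =>
    intro k σ s hs
    obtain ⟨t, s1, r1, c1, m1, v1, p1⟩ := e.runs k s hs
    have hs1 := hs.of_temp m1 fun r hr => p1 r (.inl hr)
    have h1 : s1.reg 1 = par 0 := by rw [p1 1 (by omega)]; exact hs.parEq 0
    -- The state after the computation of the address, in closed form.
    obtain ⟨s2, hs2⟩ : ∃ s2, s2 = (((((s1.setReg (3 * k + 2) (s1.reg (3 * k + 2) + s1.reg (3 * k + 2))).setReg
        (3 * k + 2) (2 * e.eval par σ + 2 * e.eval par σ)).setReg (3 * k + 2)
        (4 * e.eval par σ + 4 * e.eval par σ)).setReg (3 * k + 5) j).setReg (3 * k + 2)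
        (8 * e.eval par σ + j)).setReg (3 * k + 2) (8 * e.eval par σ + j + par 0) := ⟨_, rfl⟩
    have hrel2 : Rel par σ s2 := by
      rw [hs2]
      repeat' apply htmp
      exact hs1
      all_goals omega
    obtain ⟨t', s3, r3, c3, m3, v3, p3⟩ := f.runs (k + 1) s2 hrel2
    have hrel3 := hrel2.of_temp m3 fun r hr => p3 r (.inl hr)
    refine ⟨_, _, .seq r1 (.seq (.add _ _ _ _) (.seq (.add _ _ _ _) (.seq (.add _ _ _ _)
      (.seq (.const _ _ _) (.seq (.add _ _ _ _) (.seq (.add _ _ _ _)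
      (.seq (s₂ := s3) (t₁ := t') ?_ (.store _ _ _)))))))), by simp only [Cmd.cost]; omega, ?_, fun i hi => ?_⟩
    · convert r3 using 1
      rw [hs2]
      simp only [hupd, if_true, if_neg (show ¬ 3 * k + 2 = 3 * k + 5 by omega),
        if_neg (show ¬ 1 = 3 * k + 2 by omega), if_neg (show ¬ 1 = 3 * k + 5 by omega), h1, v1]
      congr 2 <;> congr 1 <;> first | omega | (congr 1 <;> first | omega | (congr 1; omega))
    · have := hrel3.setArr j (e.eval par σ) (f.eval par σ)
      rw [v3, p3 _ (by omega), hs2, hupd, if_pos rfl,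
        show 8 * e.eval par σ + (j : ℕ) + par 0 = par 0 + 8 * e.eval par σ + j by omega]
      exact this
    · rw [hreg, p3 _ (by omega), hs2]
      simp only [hupd, if_neg (show ¬ 3 * i + 2 = 3 * k + 2 by omega),
        if_neg (show ¬ 3 * i + 2 = 3 * k + 5 by omega)]
      exact p1 _ (by omega)
  | out e f =>
    intro k σ s hs
    obtain ⟨t, s1, r1, c1, m1, v1, p1⟩ := e.runs k s hs
    have hs1 := hs.of_temp m1 fun r hr => p1 r (.inl hr)
    obtain ⟨t', s2, r2, c2, m2, v2, p2⟩ := f.runs (k + 1) s1 hs1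
    have hs2 := hs1.of_temp m2 fun r hr => p2 r (.inl hr)
    have v3 : s2.reg (3 * k + 2) = e.eval par σ := by rw [p2 _ (by omega), v1]
    have h2 : (s2.setReg (3 * k + 8) (s2.reg 1 - s2.reg (3 * k + 2))).reg (3 * k + 8) =
        par 0 - e.eval par σ := by
      rw [hupd, if_pos rfl, v3]
      exact congrArg (· - _) (hs2.parEq 0)
    by_cases hlt : e.eval par σ < par 0
    · refine ⟨_, _, .seq r1 (.seq r2 (.seq (.sub _ _ _ _) (.ite_true (by rw [h2]; omega)
        (.store _ _ _)))), by simp only [Cmd.cost]; omega, ?_, fun i hi => ?_⟩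
      · simp only [Cmd.den, if_pos hlt]
        rw [hupd, hupd, if_neg (by omega), if_neg (by omega), v3, v2]
        exact (htmp _ _ hs2 (by omega)).setRaw hlt _
      · rw [hreg, hupd, if_neg (by omega), p2 _ (by omega), p1 _ (by omega)]
    · refine ⟨_, _, .seq r1 (.seq r2 (.seq (.sub _ _ _ _) (.ite_false (by rw [h2]; omega)
        (.skip _)))), by simp only [Cmd.cost]; omega, ?_, fun i hi => ?_⟩
      · simp only [Cmd.den, if_neg hlt]
        exact htmp _ _ hs2 (by omega)
      · rw [hupd, if_neg (by omega), p2 _ (by omega), p1 _ (by omega)]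
  | seq c d ihc ihd =>
    intro k σ s hs
    obtain ⟨t, s1, r1, c1, h1, p1⟩ := ihc k σ s hs
    obtain ⟨t', s2, r2, c2, h2, p2⟩ := ihd k _ s1 h1
    exact ⟨_, _, .seq r1 r2, Nat.add_le_add c1 c2, h2, fun i hi => by rw [p2 i hi, p1 i hi]⟩
  | ite e c d ihc ihd =>
    intro k σ s hs
    obtain ⟨t, s1, r1, c1, m1, v1, p1⟩ := e.runs k s hs
    have hs1 := hs.of_temp m1 fun r hr => p1 r (.inl hr)
    by_cases he : e.eval par σ = 0
    · obtain ⟨t', s2, r2, c2, h2, p2⟩ := ihd k σ s1 hs1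
      refine ⟨_, _, .seq r1 (.ite_false (by rw [v1, he]) r2), by simp only [Cmd.cost]; omega, ?_,
        fun i hi => by rw [p2 i hi, p1 _ (by omega)]⟩
      simpa only [Cmd.den, he, ne_eq, not_true, if_false] using h2
    · obtain ⟨t', s2, r2, c2, h2, p2⟩ := ihc k σ s1 hs1
      refine ⟨_, _, .seq r1 (.ite_true (by rw [v1]; exact he) r2), by simp only [Cmd.cost]; omega, ?_,
        fun i hi => by rw [p2 i hi, p1 _ (by omega)]⟩
      simpa only [Cmd.den, ne_eq, he, not_false_iff, if_true] using h2
  | rep x p c ih =>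
    intro k σ s hs
    set f : ℕ → Store → Store := fun i σ => c.den par (σ.setVar x i) with hf
    -- With `m` rounds left and `i` rounds done, register `3k + 2` counts down and `3k + 5` counts
    -- up. The body is compiled with `k + 2` and leaves both of them alone.
    have hloop : ∀ m i (σ' : Store) (s : State), Rel par σ' s → s.reg (3 * k + 2) = m →
        s.reg (3 * k + 5) = i → σ' = iter f i σ → ∃ t s', Runs (.loop (3 * k + 2)
        (.seq (.const (3 * k + 8) 0)
        (.seq (.add (3 * x) (3 * k + 5) (3 * k + 8)) (.seq (c.compile (k + 2))
        (.seq (.const (3 * k + 8) 1) (.seq (.sub (3 * k + 2) (3 * k + 2) (3 * k + 8))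
        (.add (3 * k + 5) (3 * k + 5) (3 * k + 8)))))))) s t s' ∧ t ≤ m * (c.cost par + 6) + 1 ∧
        Rel par (iter f (i + m) σ) s' ∧ ∀ i < k, s'.reg (3 * i + 2) = s.reg (3 * i + 2) := by
      intro m
      induction m with
      | zero =>
        intro i σ' s hs h1 h2 h3
        exact ⟨_, _, .loop_done h1, by omega, by rw [add_zero, ← h3]; exact hs, fun _ _ => rfl⟩
      | succ m ihm =>
        intro i σ' s hs h1 h2 h3
        have hs1 : Rel par (σ'.setVar x i) ((s.setReg (3 * k + 8) 0).setReg (3 * x) i) :=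
          (htmp (3 * k + 8) 0 hs (by omega)).setVar x i
        obtain ⟨t, s2, r2, c2, hs2, p2⟩ := ih (k + 2) _ _ hs1
        have e1 : s2.reg (3 * k + 2) = m + 1 := by
          rw [p2 k (by omega), hupd, if_neg (by omega), hupd, if_neg (by omega), h1]
        have e2 : s2.reg (3 * k + 5) = i := by
          rw [show 3 * k + 5 = 3 * (k + 1) + 2 by omega, p2 (k + 1) (by omega), hupd, if_neg (by omega),
            hupd, if_neg (by omega), ← h2]
          congr 1
        obtain ⟨t', s3, r3, c3, hs3, p3⟩ := ihm (i + 1) _ (((s2.setReg (3 * k + 8) 1).setReg (3 * k + 2) m).setReg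
          (3 * k + 5) (i + 1)) (htmp _ _ (htmp _ _ (htmp _ _ hs2 (by omega)) (by omega)) (by omega))
          (by simp [hupd]) (by simp [hupd]) (by rw [h3]; rfl)
        refine ⟨_, s3, .loop_step (s₂ := ((s2.setReg (3 * k + 8) 1).setReg (3 * k + 2) m).setReg
          (3 * k + 5) (i + 1)) (by rw [h1]; omega) (.seq (.const _ _ _)
          (.seq (s₂ := (s.setReg (3 * k + 8) 0).setReg (3 * x) i) (t₁ := 1) ?_ (.seq r2 (.seq (.const _ _ _)
          (.seq (s₂ := (s2.setReg (3 * k + 8) 1).setReg (3 * k + 2) m) (t₁ := 1) ?_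
          (s₃ := ((s2.setReg (3 * k + 8) 1).setReg (3 * k + 2) m).setReg
          (3 * k + 5) (i + 1)) (t₂ := 1) ?_))))) r3, ?_, ?_, fun l hl => ?_⟩
        · convert Runs.add _ _ _ _ using 2
          simp [hupd, h2]
        · convert Runs.sub _ _ _ _ using 2
          simp [hupd, e1]
        · convert Runs.add _ _ _ _ using 2
          simp [hupd, e2]
        · rw [add_mul]
          omega
        · rw [show i + (m + 1) = i + 1 + m by omega]
          exact hs3
        · rw [p3 l hl]
          simp only [hupd, if_neg (show ¬ 3 * l + 2 = 3 * k + 5 by omega),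
            if_neg (show ¬ 3 * l + 2 = 3 * k + 2 by omega), if_neg (show ¬ 3 * l + 2 = 3 * k + 8 by omega)]
          rw [p2 l (by omega), hupd, if_neg (by omega), hupd, if_neg (by omega)]
    obtain ⟨t, s', r, hc, hr, hp⟩ := hloop (par p) 0 σ ((s.setReg (3 * k + 5) 0).setReg (3 * k + 2) (par p))
      (htmp _ _ (htmp _ _ hs (by omega)) (by omega)) (by simp [hupd]) (by simp [hupd]) rfl
    refine ⟨_, s', .seq (.const _ _ _) (.seq (s₂ := (s.setReg (3 * k + 5) 0).setReg (3 * k + 2) (par p))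
      (t₁ := 1) ?_ (.seq (.skip _) r)), ?_, ?_, fun l hl => ?_⟩
    · convert Runs.add _ _ _ _ using 2
      simp only [hupd, if_true, if_neg (show ¬ 3 * p + 1 = 3 * k + 5 by omega), hs.parEq, add_zero]
    · simp only [Cmd.cost]
      omega
    · simpa [Cmd.den] using hr
    · rw [hp l hl, hupd, if_neg (by omega), hupd, if_neg (by omega)]

end MinWiener

namespace MinWiener

/-! ### Frames, time bounds and loops -/

/-- The variables that a command may change. -/
def Cmd.vars : Cmd → List ℕ
  | set x _ => [x]
  | seq c d => c.vars ++ d.vars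
  | ite _ c d => c.vars ++ d.vars
  | rep x _ c => x :: c.vars
  | _ => []

/-- The arrays that a command may change. -/
def Cmd.arrs : Cmd → List (Fin 8)
  | put j _ _ => [j]
  | seq c d => c.arrs ++ d.arrs
  | ite _ c d => c.arrs ++ d.arrs
  | rep _ _ c => c.arrs
  | _ => []

/-- The command does not change input cells. -/
def Cmd.pure : Cmd → Bool
  | out _ _ => false
  | seq c d => c.pure && d.pure
  | ite _ c d => c.pure && d.pure
  | rep _ _ c => c.pure
  | _ => true

theorem iter_inv {α : Type*} {f : ℕ → α → α} {P : ℕ → α → Prop} {σ : α} (m : ℕ) (h0 : P 0 σ)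
    (hs : ∀ i < m, ∀ τ, P i τ → P (i + 1) (f i τ)) : P m (iter f m σ) := by
  induction m with
  | zero => exact h0
  | succ m ih => exact hs m (by omega) _ (ih fun i hi => hs i (by omega))

theorem Cmd.den_var (par : ℕ → ℕ) (c : Cmd) {x : ℕ} (h : x ∉ c.vars) (σ : Store) :
    (c.den par σ).var x = σ.var x := by
  induction c generalizing σ with
  | skip => rfl
  | set y e =>
    have : x ≠ y := by simpa [Cmd.vars] using h
    simp [Cmd.den, Store.setVar, this]
  | put j e f => rfl
  | out e f => simp only [Cmd.den]; split_ifs <;> rfl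
  | seq c d ihc ihd =>
    simp only [Cmd.vars, List.mem_append, not_or] at h
    rw [Cmd.den, ihd h.2, ihc h.1]
  | ite e c d ihc ihd =>
    simp only [Cmd.vars, List.mem_append, not_or] at h
    rw [Cmd.den]
    split_ifs
    exacts [ihc h.1 σ, ihd h.2 σ]
  | rep y p c ih =>
    simp only [Cmd.vars, List.mem_cons, not_or] at h
    refine iter_inv (P := fun _ (τ : Store) => τ.var x = σ.var x) _ rfl fun i _ τ hτ => ?_
    rw [ih h.2, ← hτ]
    simp [Store.setVar, h.1]

theorem Cmd.den_arr (par : ℕ → ℕ) (c : Cmd) {j : Fin 8} (h : j ∉ c.arrs) (σ : Store) :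
    (c.den par σ).arr j = σ.arr j := by
  induction c generalizing σ with
  | skip => rfl
  | set y e => rfl
  | put i e f =>
    have : j ≠ i := by simpa [Cmd.arrs] using h
    simp [Cmd.den, Store.setArr, this]
  | out e f => simp only [Cmd.den]; split_ifs <;> rfl
  | seq c d ihc ihd =>
    simp only [Cmd.arrs, List.mem_append, not_or] at h
    rw [Cmd.den, ihd h.2, ihc h.1]
  | ite e c d ihc ihd =>
    simp only [Cmd.arrs, List.mem_append, not_or] at h
    rw [Cmd.den]
    split_ifs
    exacts [ihc h.1 σ, ihd h.2 σ]
  | rep y p c ih =>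
    exact iter_inv (P := fun _ (τ : Store) => τ.arr j = σ.arr j) _ rfl fun i _ τ hτ => (ih h _).trans hτ

theorem Cmd.den_raw (par : ℕ → ℕ) (c : Cmd) (h : c.pure = true) (σ : Store) :
    (c.den par σ).raw = σ.raw := by
  induction c generalizing σ with
  | skip => rfl
  | set y e => rfl
  | put i e f => rfl
  | out e f => simp [Cmd.pure] at h
  | seq c d ihc ihd =>
    simp only [Cmd.pure, Bool.and_eq_true] at h
    rw [Cmd.den, ihd h.2, ihc h.1]
  | ite e c d ihc ihd =>
    simp only [Cmd.pure, Bool.and_eq_true] at h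
    rw [Cmd.den]
    split_ifs
    exacts [ihc h.1 σ, ihd h.2 σ]
  | rep y p c ih =>
    exact iter_inv (P := fun _ (τ : Store) => τ.raw = σ.raw) _ rfl fun i _ τ hτ => (ih h _).trans hτ

/-- Commands run in polynomial time. -/
theorem Cmd.cost_le (c : Cmd) : ∃ e, ∀ (par : ℕ → ℕ) (B : ℕ), 2 ≤ B → (∀ p, par p ≤ B) →
    c.cost par ≤ B ^ e := by
  have hconst : ∀ a B, 2 ≤ B → a ≤ B ^ a := fun a B hB =>
    Nat.lt_two_pow_self.le.trans (Nat.pow_le_pow_left hB a)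
  have hadd : ∀ B x y d e, 2 ≤ B → x ≤ B ^ d → y ≤ B ^ e → x + y ≤ B ^ (d + e + 1) := by
    intro B x y d e hB hx hy
    have h1 : B ^ d ≤ B ^ (d + e) := Nat.pow_le_pow_right (by omega) (by omega)
    have h2 : B ^ e ≤ B ^ (d + e) := Nat.pow_le_pow_right (by omega) (by omega)
    calc x + y ≤ B ^ (d + e) * 2 := by omega
      _ ≤ B ^ (d + e) * B := Nat.mul_le_mul_left _ hB
      _ = _ := (pow_succ _ _).symm
  induction c with
  | skip => exact ⟨1, fun par B hB _ => hconst 1 B hB⟩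
  | set x e => exact ⟨_, fun par B hB _ => hconst _ B hB⟩
  | put j e f => exact ⟨_, fun par B hB _ => hconst _ B hB⟩
  | out e f => exact ⟨_, fun par B hB _ => hconst _ B hB⟩
  | seq c d ihc ihd =>
    obtain ⟨a, ha⟩ := ihc
    obtain ⟨b, hb⟩ := ihd
    exact ⟨_, fun par B hB hp => hadd B _ _ _ _ hB (ha par B hB hp) (hb par B hB hp)⟩
  | ite e c d ihc ihd =>
    obtain ⟨a, ha⟩ := ihc
    obtain ⟨b, hb⟩ := ihd
    exact ⟨_, fun par B hB hp => hadd B _ _ _ _ hB (hadd B _ _ _ _ hB (hadd B _ _ _ _ hB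
      (hconst _ B hB) (ha par B hB hp)) (hb par B hB hp)) (hconst 1 B hB)⟩
  | rep x p c ih =>
    obtain ⟨a, ha⟩ := ih
    refine ⟨_, fun par B hB hp => hadd B _ _ (a + 6 + 1 + 1) _ hB ?_ (hconst 4 B hB)⟩
    calc par p * (c.cost par + 6) ≤ B * B ^ (a + 6 + 1) :=
          Nat.mul_le_mul (hp p) (hadd B _ _ _ _ hB (ha par B hB hp) (hconst 6 B hB))
      _ = _ := by rw [pow_succ B (a + 6 + 1), mul_comm]

@[simp] theorem Store.setVar_var (σ : Store) (x v y : ℕ) :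
    (σ.setVar x v).var y = if y = x then v else σ.var y := Function.update_apply _ _ _ _

@[simp] theorem Store.setVar_arr (σ : Store) (x v : ℕ) : (σ.setVar x v).arr = σ.arr := rfl

@[simp] theorem Store.setVar_raw (σ : Store) (x v : ℕ) : (σ.setVar x v).raw = σ.raw := rfl

@[simp] theorem Store.setArr_var (σ : Store) (j : Fin 8) (i v : ℕ) :
    (σ.setArr j i v).var = σ.var := rfl

theorem Store.setArr_arr_self (σ : Store) (j : Fin 8) (i v : ℕ) :
    (σ.setArr j i v).arr j = Function.update (σ.arr j) i v := by simp [Store.setArr]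

theorem Store.setArr_arr_ne (σ : Store) {j j' : Fin 8} (h : j' ≠ j) (i v : ℕ) :
    (σ.setArr j i v).arr j' = σ.arr j' := by simp [Store.setArr, h]

/-! ### Shortest path distances -/

/-- The command reads the parameter `1` as the number of vertices, and the array `0` as the addresses
of the rows of the adjacency matrix of `G`. -/
structure Env (par : ℕ → ℕ) (σ : Store) {n : ℕ} (G : SimpleGraph (Fin n)) : Prop where
  par_one : par 1 = n
  adj : ∀ a b : Fin n, (if σ.arr 0 a + b < par 0 then σ.raw (σ.arr 0 a + b) else 0) ≠ 0 ↔ G.Adj a b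

theorem Env.congr {par : ℕ → ℕ} {σ τ : Store} {n : ℕ} {G : SimpleGraph (Fin n)} (h : Env par σ G)
    (h0 : τ.arr 0 = σ.arr 0) (hr : τ.raw = σ.raw) : Env par τ G :=
  ⟨h.par_one, fun a b => by rw [h0, hr]; exact h.adj a b⟩

/-- The array `m` represents the set `S`. -/
def Mask (σ : Store) (m : Fin 8) {n : ℕ} (S : Finset (Fin n)) : Prop :=
  ∀ a : Fin n, σ.arr m a ≠ 0 ↔ a ∈ S

/-- Shorten the distance in array `3` of the vertex in variable `4` via the one in variable `3`. -/
def relax (m : Fin 8) : Cmd :=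
  .ite (.arr m (.var 3)) (.ite (.arr m (.var 4)) (.ite (.raw (.add (.arr 0 (.var 3)) (.var 4)))
    (.ite (.sub (.arr 3 (.var 4)) (.add (.arr 3 (.var 3)) (.lit 1)))
      (.put 3 (.var 4) (.add (.arr 3 (.var 3)) (.lit 1))) .skip) .skip) .skip) .skip

/-- Compute the distances from the vertex in variable `0` in the subgraph induced by the set in
array `m`. -/
def bellmanFord (m : Fin 8) : Cmd :=
  .seq (.rep 1 1 (.put 3 (.var 1) (.par 1))) (.seq (.put 3 (.var 0) (.lit 0))
    (.rep 2 1 (.rep 3 1 (.rep 4 1 (relax m)))))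

open Classical in
/-- The distance in the subgraph induced by `S`, or `n` if there is none. -/
noncomputable def maskDist {n : ℕ} (G : SimpleGraph (Fin n)) (S : Finset (Fin n)) (u v : Fin n) : ℕ :=
  if (avoid G (S : Set (Fin n))ᶜ).Reachable u v then (avoid G (S : Set (Fin n))ᶜ).dist u v else n

section BellmanFord
variable {par : ℕ → ℕ} {n : ℕ} {G : SimpleGraph (Fin n)} {S : Finset (Fin n)} {m : Fin 8}
  {u : Fin n} {σ : Store}

/-- The invariant of the algorithm. -/
structure BFInv (par : ℕ → ℕ) (G : SimpleGraph (Fin n)) (S : Finset (Fin n)) (m : Fin 8)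
    (u : Fin n) (σ : Store) : Prop where
  env : Env par σ G
  mask : Mask σ m S
  source : σ.var 0 = u
  le : ∀ v : Fin n, σ.arr 3 v ≤ n
  near : ∀ v : Fin n, σ.arr 3 v < n → Near G (S : Set (Fin n))ᶜ (σ.arr 3 v) u v

theorem BFInv.setVar (h : BFInv par G S m u σ) {x : ℕ} (hx : x ≠ 0) (v : ℕ) :
    BFInv par G S m u (σ.setVar x v) :=
  ⟨h.env.congr rfl rfl, h.mask, by simp [h.source, hx.symm], h.le, h.near⟩

theorem relax_spec (hm : m ≠ 3) (h : BFInv par G S m u σ) {a b : Fin n} (ha : σ.var 3 = a)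
    (hb : σ.var 4 = b) : BFInv par G S m u ((relax m).den par σ) ∧
    (∀ v : Fin n, ((relax m).den par σ).arr 3 v ≤ σ.arr 3 v) ∧
    ((avoid G (S : Set (Fin n))ᶜ).Adj a b → ((relax m).den par σ).arr 3 b ≤ σ.arr 3 a + 1) := by
  have hadj : (avoid G (S : Set (Fin n))ᶜ).Adj a b ↔ G.Adj a b ∧ a ∈ S ∧ b ∈ S := by
    simp [avoid]
  by_cases hc : (avoid G (S : Set (Fin n))ᶜ).Adj a b ∧ σ.arr 3 a + 1 < σ.arr 3 b
  · obtain ⟨hab, hlt⟩ := hc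
    obtain ⟨h1, h2, h3⟩ := hadj.1 hab
    have hden : (relax m).den par σ = σ.setArr 3 b (σ.arr 3 a + 1) := by
      have e1 := (h.mask a).2 h2
      have e2 := (h.mask b).2 h3
      have e3 := (h.env.adj a b).2 h1
      have e4 : σ.arr 3 b - (σ.arr 3 a + 1) ≠ 0 := by omega
      simp only [relax, Cmd.den, Expr.eval, ha, hb]
      rw [if_pos e1, if_pos e2, if_pos e3, if_pos e4]
    rw [hden]
    have harr : (σ.setArr 3 b (σ.arr 3 a + 1)).arr 3 =
        Function.update (σ.arr 3) b (σ.arr 3 a + 1) := σ.setArr_arr_self _ _ _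
    have hle : ∀ v : Fin n, (σ.setArr 3 b (σ.arr 3 a + 1)).arr 3 v ≤ σ.arr 3 v := by
      intro v
      rw [harr, Function.update_apply]
      split_ifs with hv
      · rw [hv]; omega
      · exact le_rfl
    refine ⟨⟨h.env.congr (σ.setArr_arr_ne (by decide) _ _) rfl, fun v => ?_, h.source,
      fun v => (hle v).trans (h.le v), fun v hv => ?_⟩, hle, fun _ => ?_⟩
    · rw [σ.setArr_arr_ne hm]
      exact h.mask v
    · rw [harr, Function.update_apply] at hv ⊢
      split_ifs at hv ⊢ with hvb
      · have : v = b := Fin.ext hvb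
        subst this
        -- The entry `n` stands for no known walk; the improved entry was at most `n`, so that of
        -- `a` is less than `n` and belongs to a walk.
        exact (h.near a (by omega)).trans (Near.of_adj h1 hab.2.1 hab.2.2)
      · exact h.near v hv
    · rw [harr]
      simp
  · have hden : (relax m).den par σ = σ := by
      have hG := h.env.adj a b
      simp only [relax, Cmd.den, Expr.eval, ha, hb]
      generalize (if σ.arr 0 a + b < par 0 then σ.raw (σ.arr 0 a + b) else 0) = w at hG ⊢
      split_ifs with h1 h2 h3 h4
      · exact absurd ⟨hadj.2 ⟨hG.1 h3, (h.mask a).1 h1, (h.mask b).1 h2⟩, by omega⟩ hc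
      all_goals rfl
    rw [hden]
    refine ⟨h, fun _ => le_rfl, fun hab => ?_⟩
    by_contra! hlt
    exact hc ⟨hab, hlt⟩

theorem relax_row_spec (hm : m ≠ 3) (h : BFInv par G S m u σ) {a : Fin n} (ha : σ.var 3 = a) :
    BFInv par G S m u ((Cmd.rep 4 1 (relax m)).den par σ) ∧
    (∀ v : Fin n, ((Cmd.rep 4 1 (relax m)).den par σ).arr 3 v ≤ σ.arr 3 v) ∧
    (∀ b : Fin n, (avoid G (S : Set (Fin n))ᶜ).Adj a b →
      ((Cmd.rep 4 1 (relax m)).den par σ).arr 3 b ≤ σ.arr 3 a + 1) := by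
  have key := iter_inv (f := fun i σ => (relax m).den par (σ.setVar 4 i)) (σ := σ)
    (P := fun i τ => BFInv par G S m u τ ∧ τ.var 3 = a ∧ (∀ v : Fin n, τ.arr 3 v ≤ σ.arr 3 v) ∧
      ∀ b : Fin n, (b : ℕ) < i → (avoid G (S : Set (Fin n))ᶜ).Adj a b → τ.arr 3 b ≤ σ.arr 3 a + 1)
    (par 1) ⟨h, ha, fun _ => le_rfl, fun b hb => absurd hb (by omega)⟩ (by
      rintro i hi τ ⟨h1, h2, h3, h4⟩
      rw [h.env.par_one] at hi
      obtain ⟨e1, e2, e3⟩ := relax_spec hm (h1.setVar (x := 4) (by decide) i) (a := a) (b := ⟨i, hi⟩)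
        (by simpa using h2) (by simp)
      refine ⟨e1, ?_, fun v => (e2 v).trans (h3 v), fun b hb hab => ?_⟩
      · rw [Cmd.den_var par (relax m) (by simp [relax, Cmd.vars])]
        simpa using h2
      · rcases Nat.lt_succ_iff_lt_or_eq.1 hb with hb | hb
        · exact (e2 b).trans (h4 b hb hab)
        · have : b = ⟨i, hi⟩ := Fin.ext hb
          subst this
          exact (e3 hab).trans (Nat.add_le_add_right (h3 a) 1))
  obtain ⟨h1, -, h3, h4⟩ := key
  refine ⟨h1, h3, fun b hab => h4 b ?_ hab⟩
  rw [h.env.par_one]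
  exact b.2

theorem relax_all_spec (hm : m ≠ 3) (h : BFInv par G S m u σ) :
    BFInv par G S m u ((Cmd.rep 3 1 (.rep 4 1 (relax m))).den par σ) ∧
    (∀ v : Fin n, ((Cmd.rep 3 1 (.rep 4 1 (relax m))).den par σ).arr 3 v ≤ σ.arr 3 v) ∧
    (∀ a b : Fin n, (avoid G (S : Set (Fin n))ᶜ).Adj a b →
      ((Cmd.rep 3 1 (.rep 4 1 (relax m))).den par σ).arr 3 b ≤ σ.arr 3 a + 1) := by
  have key := iter_inv (f := fun i σ => (Cmd.rep 4 1 (relax m)).den par (σ.setVar 3 i)) (σ := σ)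
    (P := fun i τ => BFInv par G S m u τ ∧ (∀ v : Fin n, τ.arr 3 v ≤ σ.arr 3 v) ∧
      ∀ a : Fin n, (a : ℕ) < i → ∀ b : Fin n, (avoid G (S : Set (Fin n))ᶜ).Adj a b →
      τ.arr 3 b ≤ σ.arr 3 a + 1)
    (par 1) ⟨h, fun _ => le_rfl, fun b hb => absurd hb (by omega)⟩ (by
      rintro i hi τ ⟨h1, h3, h4⟩
      rw [h.env.par_one] at hi
      obtain ⟨e1, e2, e3⟩ := relax_row_spec hm (h1.setVar (x := 3) (by decide) i) (a := ⟨i, hi⟩)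
        (by simp)
      refine ⟨e1, fun v => (e2 v).trans (h3 v), fun a ha b hab => ?_⟩
      rcases Nat.lt_succ_iff_lt_or_eq.1 ha with ha | ha
      · exact (e2 b).trans (h4 a ha b hab)
      · have : a = ⟨i, hi⟩ := Fin.ext ha
        subst this
        exact (e3 b hab).trans (Nat.add_le_add_right (h3 _) 1))
  obtain ⟨h1, h3, h4⟩ := key
  refine ⟨h1, h3, fun a b hab => h4 a ?_ b hab⟩
  rw [h.env.par_one]
  exact a.2

theorem dist_lt_of_reachable {N : SimpleGraph (Fin n)} {u v : Fin n} (h : N.Reachable u v) :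
    N.dist u v < n := by
  obtain ⟨p, hp⟩ := h.exists_isPath
  have := hp.length_lt
  rw [Fintype.card_fin] at this
  exact (SimpleGraph.dist_le p).trans_lt this

theorem near_succ {Z : Set (Fin n)} {l : ℕ} {v : Fin n} (h : Near G Z (l + 1) u v) :
    Near G Z l u v ∨ ∃ a, Near G Z l u a ∧ (avoid G Z).Adj a v := by
  obtain ⟨p, hp⟩ := h.symm
  cases p with
  | nil => exact .inl (Near.refl _ _ _ _)
  | cons hadj p =>
    refine .inr ⟨_, Near.symm ⟨p, ?_⟩, hadj.symm⟩
    rw [SimpleGraph.Walk.length_cons] at hp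
    omega

/-- After `i` rounds, the entry of every vertex with a walk of length `l ≤ i` from the source is at
most `l`, and `n` rounds suffice as distances are less than `n`. Conversely, every entry below `n`
is the length bound of an actual walk. -/
theorem bellmanFord_spec (hm : m ≠ 3) (henv : Env par σ G) (hmask : Mask σ m S)
    (hu : σ.var 0 = u) (v : Fin n) :
    ((bellmanFord m).den par σ).arr 3 v = maskDist G S u v := by
  have h1 := iter_inv (f := fun i σ => (Cmd.put 3 (.var 1) (.par 1)).den par (σ.setVar 1 i)) (σ := σ)
    (P := fun i τ => Env par τ G ∧ Mask τ m S ∧ τ.var 0 = u ∧ ∀ v : Fin n, (v : ℕ) < i → τ.arr 3 v = n)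
    (par 1) ⟨henv, hmask, hu, fun b hb => absurd hb (by omega)⟩ (by
      rintro i hi τ ⟨h1, h2, h3, h4⟩
      simp only [Cmd.den, Expr.eval, Store.setVar_var, if_true]
      refine ⟨h1.congr (Store.setArr_arr_ne _ (by decide) _ _) rfl, fun v => ?_, by simp [h3],
        fun v hv => ?_⟩
      · rw [Store.setArr_arr_ne _ hm]
        exact h2 v
      · rw [Store.setArr_arr_self, Function.update_apply, henv.par_one]
        split_ifs with hvi
        · rfl
        · exact h4 v (by omega))
  set τ₁ := iter (fun i σ => (Cmd.put 3 (.var 1) (.par 1)).den par (σ.setVar 1 i)) (par 1) σ with hτ₁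
  obtain ⟨e1, e2, e3, e4⟩ := h1
  rw [henv.par_one] at e4
  set τ₂ := τ₁.setArr 3 u 0 with hτ₂
  have harr : τ₂.arr 3 = Function.update (τ₁.arr 3) u 0 := Store.setArr_arr_self _ _ _ _
  have h2 : BFInv par G S m u τ₂ := by
    refine ⟨e1.congr (Store.setArr_arr_ne _ (by decide) _ _) rfl, fun v => ?_, e3, fun v => ?_,
      fun v hv => ?_⟩
    · rw [hτ₂, Store.setArr_arr_ne _ hm]
      exact e2 v
    · rw [harr, Function.update_apply]
      split_ifs
      · omega
      · rw [e4 v v.2]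
    · rw [harr, Function.update_apply] at hv ⊢
      split_ifs at hv ⊢ with hvu
      · rw [Fin.ext hvu]
        exact Near.refl _ _ _ _
      · rw [e4 v v.2] at hv
        omega
  have h3 := iter_inv (f := fun i σ => (Cmd.rep 3 1 (.rep 4 1 (relax m))).den par (σ.setVar 2 i))
    (σ := τ₂) (P := fun i τ => BFInv par G S m u τ ∧ ∀ l ≤ i, ∀ v : Fin n,
      Near G (S : Set (Fin n))ᶜ l u v → τ.arr 3 v ≤ l)
    (par 1) ⟨h2, fun l hl v hv => by
      obtain rfl : l = 0 := by omega
      rw [← hv.eq_of_zero, harr]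
      simp⟩ (by
      rintro i hi τ ⟨h4, h5⟩
      obtain ⟨e1, e2, e3⟩ := relax_all_spec hm (h4.setVar (x := 2) (by decide) i)
      refine ⟨e1, fun l hl v hv => ?_⟩
      rcases Nat.lt_succ_iff_lt_or_eq.1 (Nat.lt_succ_of_le hl) with hl | rfl
      · exact (e2 v).trans (h5 l (by omega) v hv)
      · rcases near_succ hv with hv | ⟨a, ha, hav⟩
        · exact ((e2 v).trans (h5 i le_rfl v hv)).trans (by omega)
        · exact (e3 a v hav).trans (Nat.add_le_add_right (h5 i le_rfl a ha) 1))
  have hden : (bellmanFord m).den par σ = iter (fun i σ => (Cmd.rep 3 1 (.rep 4 1 (relax m))).den par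
      (σ.setVar 2 i)) (par 1) τ₂ := by
    simp only [bellmanFord, Cmd.den, Expr.eval]
    rw [hτ₂, ← e3]
    rfl
  rw [hden]
  obtain ⟨h4, h5⟩ := h3
  rw [maskDist]
  split_ifs with hr
  · have hlt := dist_lt_of_reachable hr
    have h6 := h5 _ (by rw [henv.par_one]; exact hlt.le) v (near_of_reachable hr)
    exact le_antisymm h6 (h4.near v (by omega)).dist_avoid_le
  · refine le_antisymm (h4.le v) ?_
    by_contra! hlt
    exact hr (h4.near v hlt).reachable

end BellmanFord
end MinWiener

namespace MinWiener

/-! ### Shortest paths -/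

section Walk
variable {n : ℕ} {G : SimpleGraph (Fin n)}

open Classical in
/-- The last neighbour of `v` that is closer to `x`, or `v` if there is none. -/
noncomputable def stepG (G : SimpleGraph (Fin n)) (x v : Fin n) : Fin n :=
  iter (fun b w => if h : b < n then
    if G.Adj v ⟨b, h⟩ ∧ G.dist x ⟨b, h⟩ + 1 = G.dist x v then ⟨b, h⟩ else w else w) n v

/-- The vertices of a shortest path from `y` to `x`. -/
noncomputable def pathG (G : SimpleGraph (Fin n)) (x y : Fin n) : Finset (Fin n) :=
  (Finset.range (n + 1)).image fun i => (stepG G x)^[i] y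

theorem stepG_cases (x v : Fin n) :
    (G.Adj v (stepG G x v) ∧ G.dist x (stepG G x v) + 1 = G.dist x v) ∨
      (stepG G x v = v ∧ ∀ b, G.Adj v b → G.dist x b + 1 ≠ G.dist x v) := by
  classical
  have key := iter_inv (σ := v) (f := fun b w => if h : b < n then
    if G.Adj v ⟨b, h⟩ ∧ G.dist x ⟨b, h⟩ + 1 = G.dist x v then ⟨b, h⟩ else w else w)
    (P := fun i w => (G.Adj v w ∧ G.dist x w + 1 = G.dist x v) ∨
      (w = v ∧ ∀ b : Fin n, (b : ℕ) < i → G.Adj v b → G.dist x b + 1 ≠ G.dist x v)) n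
    (.inr ⟨rfl, fun b hb => absurd hb (by omega)⟩) (fun i hi w hw => by
      simp only [dif_pos hi]
      split_ifs with hc
      · exact .inl hc
      · refine hw.imp id fun ⟨h1, h2⟩ => ⟨h1, fun b hb hadj heq => ?_⟩
        rcases Nat.lt_succ_iff_lt_or_eq.1 hb with hb | hb
        · exact h2 b hb hadj heq
        · have : b = ⟨i, hi⟩ := Fin.ext hb
          subst this
          exact hc ⟨hadj, heq⟩)
  unfold stepG
  convert key using 2
  simp

theorem stepG_self (x : Fin n) : stepG G x x = x := by
  rcases stepG_cases (G := G) x x with h | h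
  · simp at h
  · exact h.1

theorem stepG_spec (hG : G.Connected) {x v : Fin n} (hv : v ≠ x) :
    G.Adj v (stepG G x v) ∧ G.dist x (stepG G x v) + 1 = G.dist x v := by
  refine (stepG_cases (G := G) x v).resolve_right fun ⟨_, h⟩ => ?_
  obtain ⟨p, hp⟩ := hG.exists_walk_length_eq_dist v x
  cases p with
  | nil => exact hv rfl
  | @cons _ b _ hadj p =>
    refine h b hadj ?_
    rw [SimpleGraph.Walk.length_cons, G.dist_comm] at hp
    have h1 := SimpleGraph.dist_le p
    have h2 := hG.dist_triangle (u := x) (v := b) (w := v)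
    have h3 : G.dist b v = 1 := SimpleGraph.dist_eq_one_iff_adj.2 hadj.symm
    rw [G.dist_comm] at h1
    omega

/-- Each step lowers the distance to `x` by one, and `x` itself is fixed. So `n` steps from `y`
trace a shortest path and then stay at its end. -/
theorem pathG_isGeo (hG : G.Connected) (x y : Fin n) : IsGeo G x y (pathG G x y) := by
  classical
  refine IsGeo.symm ?_
  have hd : ∀ i ≤ G.dist x y, G.dist x ((stepG G x)^[i] y) = G.dist x y - i := by
    intro i
    induction i with
    | zero => intro _; simp
    | succ i ih =>
      intro hi
      have h1 := ih (by omega)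
      have h2 : (stepG G x)^[i] y ≠ x := by
        intro h
        rw [h, SimpleGraph.dist_self] at h1
        omega
      have h3 := (stepG_spec hG h2).2
      rw [Function.iterate_succ_apply']
      omega
  have hend : (stepG G x)^[G.dist x y] y = x := by
    have h := hd _ le_rfl
    rw [Nat.sub_self] at h
    exact ((hG.preconnected _ _).dist_eq_zero_iff.1 h).symm
  refine ⟨fun i => (stepG G x)^[i] y, rfl, by rw [G.dist_comm]; exact hend, fun i hi => ?_, ?_⟩
  · change G.Adj ((stepG G x)^[i] y) ((stepG G x)^[i + 1] y)
    rw [Function.iterate_succ_apply']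
    refine (stepG_spec hG fun h => ?_).1
    rw [G.dist_comm] at hi
    have h1 := hd i hi.le
    rw [h, SimpleGraph.dist_self] at h1
    omega
  · rw [G.dist_comm]
    ext v
    simp only [pathG, Finset.mem_image, Finset.mem_range]
    constructor
    · rintro ⟨i, -, rfl⟩
      rcases le_or_gt i (G.dist x y) with hi | hi
      · exact ⟨i, by omega, rfl⟩
      · refine ⟨G.dist x y, by omega, ?_⟩
        obtain ⟨j, rfl⟩ := Nat.exists_eq_add_of_lt hi
        rw [add_assoc, add_comm, Function.iterate_add_apply, hend]
        exact (Function.iterate_fixed (stepG_self x) _).symm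
    · rintro ⟨i, hi, rfl⟩
      have := dist_lt_of_reachable (hG.preconnected x y)
      exact ⟨i, by omega, rfl⟩

theorem Mask.put {σ : Store} {m : Fin 8} {S : Finset (Fin n)} (h : Mask σ m S) (v : Fin n) {w : ℕ}
    (hw : w ≠ 0) : Mask (σ.setArr m v w) m (insert v S) := by
  intro a
  rw [Store.setArr_arr_self, Function.update_apply, Finset.mem_insert, ← h a]
  split_ifs with hav
  · simp [Fin.ext hav, hw]
  · have : a ≠ v := fun h => hav (congrArg _ h)
    simp [this]

/-- Set variable `7` to the vertex in variable `9` if this is a neighbour of the vertex in variable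
`6` that is closer to the source. -/
def tryStep : Cmd :=
  .ite (.raw (.add (.arr 0 (.var 6)) (.var 9)))
    (.ite (.sub (.add (.arr 3 (.var 9)) (.lit 1)) (.arr 3 (.var 6))) .skip
      (.ite (.sub (.arr 3 (.var 6)) (.add (.arr 3 (.var 9)) (.lit 1))) .skip (.set 7 (.var 9)))) .skip

/-- Add the vertices of a shortest path to the vertex in variable `5` to array `2`. -/
def walk : Cmd :=
  .seq (.set 6 (.var 5)) (.seq (.put 2 (.var 6) (.lit 1)) (.rep 8 1 (.seq (.set 7 (.var 6))
    (.seq (.rep 9 1 tryStep) (.seq (.set 6 (.var 7)) (.put 2 (.var 6) (.lit 1)))))))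

variable {par : ℕ → ℕ} {σ : Store} {S : Finset (Fin n)} {x y : Fin n}

-- The equality of the two distances is tested by the vanishing of both truncated differences.
open Classical in
theorem tryStep_spec (henv : Env par σ G) (hD : ∀ v : Fin n, σ.arr 3 v = G.dist x v)
    {v b w : Fin n} (h6 : σ.var 6 = v) (h9 : σ.var 9 = b) (h7 : σ.var 7 = w) :
    (tryStep.den par σ).var 7 =
      (if G.Adj v b ∧ G.dist x b + 1 = G.dist x v then b else w : Fin n) := by
  have hG := henv.adj v b
  simp only [tryStep, Cmd.den, Expr.eval, h6, h9, hD]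
  generalize (if σ.arr 0 v + b < par 0 then σ.raw (σ.arr 0 v + b) else 0) = r at hG ⊢
  rw [← hG]
  by_cases h1 : r ≠ 0
  · rw [if_pos h1]
    by_cases h2 : G.dist x b + 1 - G.dist x v ≠ 0
    · rw [if_pos h2, h7, if_neg (by omega)]
    · rw [if_neg h2]
      by_cases h3 : G.dist x v - (G.dist x b + 1) ≠ 0
      · rw [if_pos h3, h7, if_neg (by omega)]
      · rw [if_neg h3, if_pos ⟨h1, by omega⟩]
        simp
  · rw [if_neg h1, h7, if_neg (by tauto)]

theorem step_spec (henv : Env par σ G) (hD : ∀ v : Fin n, σ.arr 3 v = G.dist x v)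
    {v : Fin n} (h6 : σ.var 6 = v) (h7 : σ.var 7 = v) :
    ((Cmd.rep 9 1 tryStep).den par σ).var 7 = stepG G x v := by
  classical
  have key := iter_inv (f := fun i σ => tryStep.den par (σ.setVar 9 i)) (σ := σ)
    (P := fun i τ => Env par τ G ∧ (∀ v : Fin n, τ.arr 3 v = G.dist x v) ∧ τ.var 6 = v ∧
      τ.var 7 = (iter (fun b w => if h : b < n then
        if G.Adj v ⟨b, h⟩ ∧ G.dist x ⟨b, h⟩ + 1 = G.dist x v then ⟨b, h⟩ else w else w) i v : Fin n))
    (par 1) ⟨henv, hD, h6, h7⟩ (by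
      rintro i hi τ ⟨e1, e2, e3, e4⟩
      rw [henv.par_one] at hi
      refine ⟨e1.congr ?_ ?_, fun v => ?_, ?_, ?_⟩
      · rw [Cmd.den_arr par tryStep (by simp [tryStep, Cmd.arrs])]
        rfl
      · rw [Cmd.den_raw par tryStep (by simp [tryStep, Cmd.pure])]
        rfl
      · rw [Cmd.den_arr par tryStep (by simp [tryStep, Cmd.arrs])]
        exact e2 v
      · rw [Cmd.den_var par tryStep (by simp [tryStep, Cmd.vars])]
        simpa using e3
      · rw [tryStep_spec (σ := τ.setVar 9 i) (b := ⟨i, hi⟩) (x := x) (v := v) (e1.congr rfl rfl) e2 (by simpa using e3)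
          (by simp) (by simpa using e4)]
        conv_rhs => rw [iter, dif_pos hi])
  rw [henv.par_one] at key
  rw [Cmd.den, henv.par_one, key.2.2.2, stepG]

theorem walk_spec (henv : Env par σ G) (hD : ∀ v : Fin n, σ.arr 3 v = G.dist x v)
    (hS : Mask σ 2 S) (hy : σ.var 5 = y) : Mask (walk.den par σ) 2 (S ∪ pathG G x y) := by
  set τ₀ := (σ.setVar 6 y).setArr 2 y 1 with hτ₀
  have h0 : Env par τ₀ G ∧ (∀ v : Fin n, τ₀.arr 3 v = G.dist x v) ∧ τ₀.var 6 = y ∧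
      Mask τ₀ 2 (S ∪ (Finset.range 1).image fun i => (stepG G x)^[i] y) := by
    refine ⟨henv.congr (Store.setArr_arr_ne _ (by decide) _ _) rfl, fun v => ?_, by simp [hτ₀], ?_⟩
    · rw [hτ₀, Store.setArr_arr_ne _ (by decide)]
      exact hD v
    · have : S ∪ (Finset.range 1).image (fun i => (stepG G x)^[i] y) = insert y S := by
        ext; simp
      rw [this]
      exact Mask.put (σ := σ.setVar 6 y) hS y one_ne_zero
  set body : Cmd := .seq (.set 7 (.var 6))
    (.seq (.rep 9 1 tryStep) (.seq (.set 6 (.var 7)) (.put 2 (.var 6) (.lit 1)))) with hbody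
  have key := iter_inv (f := fun i σ => body.den par (σ.setVar 8 i)) (σ := τ₀)
    (P := fun i τ => Env par τ G ∧ (∀ v : Fin n, τ.arr 3 v = G.dist x v) ∧
      τ.var 6 = ((stepG G x)^[i] y : Fin n) ∧
      Mask τ 2 (S ∪ (Finset.range (i + 1)).image fun i => (stepG G x)^[i] y))
    (par 1) h0 (by
      rintro i hi τ ⟨e1, e2, e3, e4⟩
      set τ₁ := (τ.setVar 8 i).setVar 7 (τ.var 6) with hτ₁
      set τ₂ := (Cmd.rep 9 1 tryStep).den par τ₁ with hτ₂
      have h7 : τ₂.var 7 = ((stepG G x)^[i + 1] y : Fin n) := by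
        rw [Function.iterate_succ_apply']
        exact step_spec (σ := τ₁) (e1.congr rfl rfl) e2 (by simpa [hτ₁] using e3) (by simpa [hτ₁] using e3)
      have hden : body.den par (τ.setVar 8 i) = (τ₂.setVar 6 (τ₂.var 7)).setArr 2 (τ₂.var 7) 1 := by
        simp [hbody, Cmd.den, Expr.eval, hτ₂, hτ₁]
      have harr : ∀ j, τ₂.arr j = τ.arr j := fun j =>
        Cmd.den_arr par _ (by simp [tryStep, Cmd.arrs]) τ₁
      have hraw : τ₂.raw = τ.raw := Cmd.den_raw par _ (by simp [tryStep, Cmd.pure]) τ₁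
      rw [hden, h7]
      refine ⟨e1.congr ?_ hraw, fun v => ?_, by simp, ?_⟩
      · rw [Store.setArr_arr_ne _ (by decide)]
        exact harr 0
      · rw [Store.setArr_arr_ne _ (by decide), ← e2 v, ← harr 3]
        rfl
      · rw [Finset.range_add_one, Finset.image_insert, Finset.union_insert]
        refine Mask.put (fun a => ?_) _ one_ne_zero
        rw [← e4 a, Store.setVar_arr, harr])
  have hden : walk.den par σ = iter (fun i σ => body.den par (σ.setVar 8 i)) (par 1) τ₀ := by
    simp [walk, Cmd.den, Expr.eval, hbody, hτ₀, hy]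
  rw [hden]
  rw [henv.par_one] at key ⊢
  exact key.2.2.2

theorem maskDist_univ (hG : G.Connected) (u v : Fin n) : maskDist G Finset.univ u v = G.dist u v := by
  have h : avoid G ((Finset.univ : Finset (Fin n)) : Set (Fin n))ᶜ = G := by
    ext a b
    simp [avoid]
  rw [maskDist, h, if_pos (hG.preconnected u v)]

end Walk
end MinWiener

namespace MinWiener

/-! ### Evaluation of a vertex set -/

section Eval
variable {n : ℕ} {G : SimpleGraph (Fin n)} {par : ℕ → ℕ} {σ : Store} {S Q : Finset (Fin n)}
  {u : Fin n}

/-- The input cells describe the set `Q`. -/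
def InputSet (par : ℕ → ℕ) (σ : Store) (Q : Finset (Fin n)) : Prop :=
  ∀ i : Fin n, (if i + 1 < par 0 then σ.raw (i + 1) else 0) ≠ 0 ↔ i ∈ Q

/-- Add the distance of the vertex in variable `1` to variable `11`, or clear variable `10` if
there is none. -/
def addDist : Cmd :=
  .ite (.arr 2 (.var 1)) (.ite (.sub (.par 1) (.arr 3 (.var 1)))
    (.set 11 (.add (.var 11) (.arr 3 (.var 1)))) (.set 10 (.lit 0))) .skip

/-- Add the distances from the vertex in variable `0` in the subgraph induced by array `2` to
variable `11`, and clear variable `10` if not all vertices are reachable. -/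
def evalRow : Cmd :=
  .ite (.arr 2 (.var 0)) (.seq (bellmanFord 2) (.rep 1 1 addDist)) .skip

/-- Clear variable `10` if the vertex in variable `0` is in the input set but not in array `2`. -/
def checkQ : Cmd :=
  .ite (.raw (.add (.var 0) (.lit 1))) (.ite (.arr 2 (.var 0)) .skip (.set 10 (.lit 0))) .skip

/-- Set variable `10` if array `2` is a connector, and variable `11` to the sum of its distances. -/
def evalSet : Cmd :=
  .seq (.set 10 (.lit 1)) (.seq (.set 11 (.lit 0)) (.seq (.rep 0 1 evalRow) (.rep 0 1 checkQ)))

theorem addDist_spec (hpar : par 1 = n) (hS : Mask σ 2 S)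
    (hD : ∀ v : Fin n, σ.arr 3 v = maskDist G S u v) {v : Fin n} (hv : σ.var 1 = v) :
    ((addDist.den par σ).var 10 ≠ 0 ↔ σ.var 10 ≠ 0 ∧
      (v ∈ S → (avoid G (S : Set (Fin n))ᶜ).Reachable u v)) ∧
    (addDist.den par σ).var 11 =
      σ.var 11 + ∑ w ∈ {v}, if w ∈ S then (avoid G (S : Set (Fin n))ᶜ).dist u w else 0 := by
  have hSv := hS v
  simp only [addDist, Cmd.den, Expr.eval, hv, hD, hpar, Finset.sum_singleton]
  by_cases h : v ∈ S
  · rw [if_pos (hSv.2 h), if_pos h, maskDist]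
    by_cases hr : (avoid G (S : Set (Fin n))ᶜ).Reachable u v
    · have := dist_lt_of_reachable hr
      rw [if_pos hr, if_pos (by omega)]
      simp [hr]
    · rw [if_neg hr, if_neg (by omega)]
      -- `SimpleGraph.dist` is `0` for unreachable vertices, in accordance with nothing being added
      -- in this case.
      simp [hr, h, SimpleGraph.dist_eq_zero_of_not_reachable hr]
  · rw [if_neg (mt hSv.1 h), if_neg h]
    simp [h]

theorem sum_filter_lt_succ (f : Fin n → ℕ) {i : ℕ} (hi : i < n) :
    ∑ w ∈ Finset.univ.filter (fun w : Fin n => (w : ℕ) < i + 1), f w =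
      ∑ w ∈ Finset.univ.filter (fun w : Fin n => (w : ℕ) < i), f w + f ⟨i, hi⟩ := by
  have : Finset.univ.filter (fun w : Fin n => (w : ℕ) < i + 1) =
      insert ⟨i, hi⟩ (Finset.univ.filter fun w : Fin n => (w : ℕ) < i) := by
    ext w
    simp only [Finset.mem_filter, Finset.mem_univ, true_and, Finset.mem_insert, Fin.ext_iff]
    omega
  rw [this, Finset.sum_insert (by simp), add_comm]

theorem filter_lt_self : Finset.univ.filter (fun w : Fin n => (w : ℕ) < n) = Finset.univ :=
  Finset.filter_true_of_mem fun w _ => w.2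

theorem forall_lt_succ {P : Fin n → Prop} {i : ℕ} (hi : i < n) :
    (∀ v : Fin n, (v : ℕ) < i + 1 → P v) ↔ (∀ v : Fin n, (v : ℕ) < i → P v) ∧ P ⟨i, hi⟩ := by
  refine ⟨fun h => ⟨fun v hv => h v (by omega), h _ (by simp)⟩, fun ⟨h1, h2⟩ v hv => ?_⟩
  rcases Nat.lt_succ_iff_lt_or_eq.1 hv with hv | hv
  · exact h1 v hv
  · have : v = ⟨i, hi⟩ := Fin.ext hv
    rwa [this]

theorem evalRow_spec (henv : Env par σ G) (hS : Mask σ 2 S) (hu : σ.var 0 = u) :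
    ((evalRow.den par σ).var 10 ≠ 0 ↔ σ.var 10 ≠ 0 ∧
      (u ∈ S → ∀ v ∈ S, (avoid G (S : Set (Fin n))ᶜ).Reachable u v)) ∧
    (evalRow.den par σ).var 11 =
      σ.var 11 + if u ∈ S then ∑ w ∈ S, (avoid G (S : Set (Fin n))ᶜ).dist u w else 0 := by
  have hSu := hS u
  simp only [evalRow, Cmd.den, Expr.eval, hu]
  by_cases h : u ∈ S
  swap
  · rw [if_neg (mt hSu.1 h), if_neg h]
    simp [h]
  rw [if_pos (hSu.2 h), if_pos h]
  set τ := (bellmanFord 2).den par σ with hτ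
  have hvar : ∀ x, x ∉ (bellmanFord 2).vars → τ.var x = σ.var x := fun x hx => Cmd.den_var par _ hx σ
  have h0 : Mask τ 2 S := fun a => by
    rw [hτ, Cmd.den_arr par _ (by simp [bellmanFord, relax, Cmd.arrs])]
    exact hS a
  have key := iter_inv (f := fun i σ => addDist.den par (σ.setVar 1 i)) (σ := τ)
    (P := fun i τ' => τ'.arr = τ.arr ∧ (τ'.var 10 ≠ 0 ↔ σ.var 10 ≠ 0 ∧ ∀ v : Fin n, (v : ℕ) < i →
        v ∈ S → (avoid G (S : Set (Fin n))ᶜ).Reachable u v) ∧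
      τ'.var 11 = σ.var 11 + ∑ w ∈ Finset.univ.filter (fun w : Fin n => (w : ℕ) < i),
        if w ∈ S then (avoid G (S : Set (Fin n))ᶜ).dist u w else 0)
    (par 1) ⟨rfl, by simp [hvar 10 (by simp [bellmanFord, relax, Cmd.vars])],
      by simp [hvar 11 (by simp [bellmanFord, relax, Cmd.vars])]⟩ (by
      rintro i hi τ' ⟨e1, e2, e3⟩
      rw [henv.par_one] at hi
      have harr : (addDist.den par (τ'.setVar 1 i)).arr = τ'.arr := by
        funext j
        exact Cmd.den_arr par addDist (by simp [addDist, Cmd.arrs]) _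
      obtain ⟨k1, k2⟩ := addDist_spec (σ := τ'.setVar 1 i) (G := G) (S := S) (u := u) (v := ⟨i, hi⟩)
        henv.par_one (fun a => by rw [Store.setVar_arr, e1]; exact h0 a)
        (fun v => by
          rw [Store.setVar_arr, e1]
          exact bellmanFord_spec (by decide) henv hS hu v) (by simp)
      refine ⟨harr.trans e1, ?_, ?_⟩
      · rw [k1, forall_lt_succ hi, Store.setVar_var, if_neg (by decide), e2, and_assoc]
      · rw [k2, sum_filter_lt_succ _ hi, Store.setVar_var, if_neg (by decide), e3, Finset.sum_singleton,
          add_assoc])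
  rw [henv.par_one] at key ⊢
  obtain ⟨-, k2, k3⟩ := key
  refine ⟨k2.trans (and_congr_right fun _ => ⟨fun H _ v hv => H v v.2 hv, fun H v _ hv => H h v hv⟩), ?_⟩
  rw [k3, filter_lt_self, ← Finset.sum_filter]
  simp

theorem checkQ_spec (hQ : InputSet par σ Q) (hS : Mask σ 2 S) (hu : σ.var 0 = u) :
    (checkQ.den par σ).var 10 ≠ 0 ↔ σ.var 10 ≠ 0 ∧ (u ∈ Q → u ∈ S) := by
  have hSu := hS u
  have hQu := hQ u
  simp only [checkQ, Cmd.den, Expr.eval, hu]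
  generalize (if (u : ℕ) + 1 < par 0 then σ.raw (u + 1) else 0) = r at hQu ⊢
  by_cases h : u ∈ Q
  · rw [if_pos (hQu.2 h)]
    by_cases h' : u ∈ S
    · rw [if_pos (hSu.2 h')]
      simp [h']
    · rw [if_neg (mt hSu.1 h')]
      simp [h, h']
  · rw [if_neg (mt hQu.1 h)]
    simp [h]

theorem evalSet_spec (henv : Env par σ G) (hQ : InputSet par σ Q) (hS : Mask σ 2 S) :
    ((evalSet.den par σ).var 10 ≠ 0 ↔
      (∀ u ∈ S, ∀ v ∈ S, (avoid G (S : Set (Fin n))ᶜ).Reachable u v) ∧ Q ⊆ S) ∧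
    (evalSet.den par σ).var 11 = distSum G S := by
  set τ := (σ.setVar 10 1).setVar 11 0 with hτ
  have key := iter_inv (f := fun i σ => evalRow.den par (σ.setVar 0 i)) (σ := τ)
    (P := fun i τ' => τ'.arr 0 = σ.arr 0 ∧ τ'.arr 2 = σ.arr 2 ∧ τ'.raw = σ.raw ∧
      (τ'.var 10 ≠ 0 ↔ ∀ u : Fin n, (u : ℕ) < i →
        u ∈ S → ∀ v ∈ S, (avoid G (S : Set (Fin n))ᶜ).Reachable u v) ∧
      τ'.var 11 = ∑ u ∈ Finset.univ.filter (fun w : Fin n => (w : ℕ) < i),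
        if u ∈ S then ∑ w ∈ S, (avoid G (S : Set (Fin n))ᶜ).dist u w else 0)
    (par 1) ⟨rfl, rfl, rfl, by simp [hτ], by simp [hτ]⟩ (by
      rintro i hi τ' ⟨e1, e2, e3, e4, e5⟩
      rw [henv.par_one] at hi
      obtain ⟨k1, k2⟩ := evalRow_spec (σ := τ'.setVar 0 i) (G := G) (S := S) (u := ⟨i, hi⟩)
        (henv.congr e1 e3) (fun a => by rw [Store.setVar_arr, e2]; exact hS a) (by simp)
      refine ⟨?_, ?_, ?_, ?_, ?_⟩
      · rw [Cmd.den_arr par _ (by simp [evalRow, addDist, bellmanFord, relax, Cmd.arrs])]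
        exact e1
      · rw [Cmd.den_arr par _ (by simp [evalRow, addDist, bellmanFord, relax, Cmd.arrs])]
        exact e2
      · rw [Cmd.den_raw par _ (by simp [evalRow, addDist, bellmanFord, relax, Cmd.pure])]
        exact e3
      · rw [k1, forall_lt_succ hi, Store.setVar_var, if_neg (by decide), e4]
      · rw [k2, sum_filter_lt_succ _ hi, Store.setVar_var, if_neg (by decide), e5])
  set τ₁ := iter (fun i σ => evalRow.den par (σ.setVar 0 i)) (par 1) τ with hτ₁
  obtain ⟨-, e2, e3, e4, e5⟩ := key
  have key := iter_inv (f := fun i σ => checkQ.den par (σ.setVar 0 i)) (σ := τ₁)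
    (P := fun i τ' => τ'.arr 2 = σ.arr 2 ∧ τ'.raw = σ.raw ∧ τ'.var 11 = τ₁.var 11 ∧
      (τ'.var 10 ≠ 0 ↔ τ₁.var 10 ≠ 0 ∧ ∀ u : Fin n, (u : ℕ) < i → u ∈ Q → u ∈ S))
    (par 1) ⟨e2, e3, rfl, by simp⟩ (by
      rintro i hi τ' ⟨d1, d2, d3, d4⟩
      rw [henv.par_one] at hi
      have k1 := checkQ_spec (σ := τ'.setVar 0 i) (par := par) (S := S) (Q := Q) (u := ⟨i, hi⟩)
        (fun a => by rw [Store.setVar_raw, d2]; exact hQ a)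
        (fun a => by rw [Store.setVar_arr, d1]; exact hS a) (by simp)
      refine ⟨?_, ?_, ?_, ?_⟩
      · rw [Cmd.den_arr par _ (by simp [checkQ, Cmd.arrs])]
        exact d1
      · rw [Cmd.den_raw par _ (by simp [checkQ, Cmd.pure])]
        exact d2
      · rw [Cmd.den_var par _ (by simp [checkQ, Cmd.vars])]
        simpa using d3
      · rw [k1, forall_lt_succ hi, Store.setVar_var, if_neg (by decide), d4, and_assoc])
  have hden : evalSet.den par σ = iter (fun i σ => checkQ.den par (σ.setVar 0 i)) (par 1) τ₁ := rfl
  rw [hden]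
  rw [henv.par_one] at key e4 e5 ⊢
  obtain ⟨-, -, d3, d4⟩ := key
  constructor
  · rw [d4, e4]
    exact and_congr ⟨fun H u hu v hv => H u u.2 hu v hv, fun H u _ hu v hv => H u hu v hv⟩
      ⟨fun H u hu => H u u.2 hu, fun H u _ hu => H hu⟩
  · rw [d3, e5, filter_lt_self, ← Finset.sum_filter, distSum]
    simp

end Eval

/-! ### The union of the chosen paths -/

section Build
variable {n : ℕ} {G : SimpleGraph (Fin n)} {par : ℕ → ℕ} {σ : Store}

/-- Store in array `2` the union of the shortest paths between corresponding vertices of the two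
halves of array `1`. -/
def build : Cmd :=
  .seq (.rep 0 1 (.put 2 (.var 0) (.lit 0))) (.rep 12 6 (.seq (.set 0 (.arr 1 (.var 12)))
    (.seq (.set 5 (.arr 1 (.add (.var 12) (.par 6)))) (.seq (bellmanFord 5) walk))))

/-- The union of the shortest paths between `x l` and `x (l + N)`. -/
noncomputable def unionG (G : SimpleGraph (Fin n)) (N : ℕ) (x : ℕ → Fin n) : Finset (Fin n) :=
  (Finset.range N).biUnion fun l => pathG G (x l) (x (l + N))

theorem build_spec (hG : G.Connected) (henv : Env par σ G) (h5 : Mask σ 5 (Finset.univ : Finset (Fin n))) {x : ℕ → Fin n}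
    (hx : ∀ l < par 6 + par 6, σ.arr 1 l = x l) :
    Mask (build.den par σ) 2 (unionG G (par 6) x) := by
  set body : Cmd := .seq (.set 0 (.arr 1 (.var 12)))
    (.seq (.set 5 (.arr 1 (.add (.var 12) (.par 6)))) (.seq (bellmanFord 5) walk)) with hbody
  have key := iter_inv (f := fun i σ => (Cmd.put 2 (.var 0) (.lit 0)).den par (σ.setVar 0 i)) (σ := σ)
    (P := fun i τ => (∀ j : Fin 8, j ≠ 2 → τ.arr j = σ.arr j) ∧ τ.raw = σ.raw ∧
      ∀ v : Fin n, (v : ℕ) < i → τ.arr 2 v = 0) (par 1)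
    ⟨fun _ _ => rfl, rfl, fun v hv => absurd hv (by omega)⟩ (by
      rintro i hi τ ⟨e1, e2, e3⟩
      simp only [Cmd.den, Expr.eval, Store.setVar_var, if_true]
      refine ⟨fun j hj => ?_, e2, fun v hv => ?_⟩
      · rw [Store.setArr_arr_ne _ hj]
        exact e1 j hj
      · rw [Store.setArr_arr_self, Function.update_apply]
        split_ifs with hvi
        · rfl
        · exact e3 v (by omega))
  set τ₁ := iter (fun i σ => (Cmd.put 2 (.var 0) (.lit 0)).den par (σ.setVar 0 i)) (par 1) σ with hτ₁
  obtain ⟨e1, e2, e3⟩ := key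
  rw [henv.par_one] at e3
  have key := iter_inv (f := fun i σ => body.den par (σ.setVar 12 i)) (σ := τ₁)
    (P := fun i τ => (∀ j : Fin 8, j ≠ 2 → j ≠ 3 → τ.arr j = σ.arr j) ∧ τ.raw = σ.raw ∧
      Mask τ 2 ((Finset.range i).biUnion fun l => pathG G (x l) (x (l + par 6)))) (par 6)
    ⟨fun j hj _ => e1 j hj, e2, fun v => by simp [e3 v v.2]⟩ (by
      rintro i hi τ ⟨d1, d2, d3⟩
      set τ₂ := ((τ.setVar 12 i).setVar 0 (x i)).setVar 5 (x (i + par 6)) with hτ₂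
      have hden : body.den par (τ.setVar 12 i) = walk.den par ((bellmanFord 5).den par τ₂) := by
        simp [hbody, Cmd.den, Expr.eval, hτ₂, d1 1 (by decide) (by decide), hx i (by omega),
          hx (i + par 6) (by omega)]
      have henv₂ : Env par τ₂ G := henv.congr (d1 0 (by decide) (by decide)) d2
      have harr : ∀ j : Fin 8, j ≠ 3 → ((bellmanFord 5).den par τ₂).arr j = τ.arr j := fun j hj =>
        Cmd.den_arr par _ (by simp [bellmanFord, relax, Cmd.arrs, hj]) τ₂
      have hraw : ((bellmanFord 5).den par τ₂).raw = τ.raw :=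
        Cmd.den_raw par _ (by simp [bellmanFord, relax, Cmd.pure]) τ₂
      have harr' : ∀ j : Fin 8, j ≠ 2 → (body.den par (τ.setVar 12 i)).arr j =
          ((bellmanFord 5).den par τ₂).arr j := fun j hj => by
        rw [hden, Cmd.den_arr par _ (by simp [walk, tryStep, Cmd.arrs, hj])]
      refine ⟨fun j hj hj' => ?_, ?_, ?_⟩
      · rw [harr' j hj, harr j hj', d1 j hj hj']
      · rw [hden, Cmd.den_raw par _ (by simp [walk, tryStep, Cmd.pure]), hraw, d2]
      · rw [Finset.range_add_one, Finset.biUnion_insert, Finset.union_comm, hden]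
        refine walk_spec (henv₂.congr (harr 0 (by decide)) hraw) (fun v => ?_) (fun a => ?_) ?_
        · rw [← maskDist_univ hG]
          exact bellmanFord_spec (by decide) henv₂
            (fun a => by rw [← h5 a, ← d1 5 (by decide) (by decide)]; rfl) (by simp [hτ₂]) v
        · rw [harr 2 (by decide)]
          exact d3 a
        · rw [Cmd.den_var par _ (by simp [bellmanFord, relax, Cmd.vars])]
          simp [hτ₂])
  exact key.2.2

theorem build_arr {j : Fin 8} (h2 : j ≠ 2) (h3 : j ≠ 3) : (build.den par σ).arr j = σ.arr j :=
  Cmd.den_arr par _ (by simp [build, bellmanFord, relax, walk, tryStep, Cmd.arrs, h2, h3]) σ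

end Build
end MinWiener

namespace MinWiener

/-! ### Exhaustive search -/

/-- Increment the base `n` number stored in array `1`. -/
def increment : Cmd :=
  .seq (.set 15 (.lit 1)) (.rep 12 2 (.ite (.var 15)
    (.ite (.sub (.par 1) (.add (.arr 1 (.var 12)) (.lit 1)))
      (.seq (.put 1 (.var 12) (.add (.arr 1 (.var 12)) (.lit 1))) (.set 15 (.lit 0)))
      (.put 1 (.var 12) (.lit 0))) .skip))

/-- Save array `2` as the best set. -/
def save : Cmd :=
  .seq (.set 13 (.lit 1)) (.seq (.set 14 (.var 11)) (.rep 0 1 (.put 4 (.var 0) (.arr 2 (.var 0)))))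

/-- Save array `2` if it is a connector and better than the best one so far. -/
def compare : Cmd :=
  .ite (.var 10) (.ite (.var 13) (.ite (.sub (.var 14) (.var 11)) save .skip) save) .skip

/-- Find the best connector that is a union of shortest paths. -/
def search : Cmd :=
  .seq (.set 13 (.lit 0)) (.rep 16 3 (.seq build (.seq evalSet (.seq compare increment))))

/-- Any sequence of `L` digits in base `n` is that of some counter value below `n ^ L`, so counting
runs through all choices of end vertices. -/
theorem exists_digits {n : ℕ} (L : ℕ) : ∀ x : ℕ → Fin n, ∃ τ < n ^ L, ∀ l < L, τ / n ^ l % n = x l := by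
  induction L with
  | zero => exact fun x => ⟨0, by simp, fun l hl => absurd hl (by omega)⟩
  | succ L ih =>
    intro x
    obtain ⟨τ, h1, h2⟩ := ih fun l => x (l + 1)
    have hn : 0 < n := (Nat.zero_le _).trans_lt (x 0).2
    refine ⟨n * τ + x 0, ?_, fun l hl => ?_⟩
    · calc n * τ + x 0 < n * τ + n := by have := (x 0).2; omega
        _ = n * (τ + 1) := by ring
        _ ≤ n * n ^ L := Nat.mul_le_mul_left _ h1
        _ = n ^ (L + 1) := by ring
    · cases l with
      | zero => rw [pow_zero, Nat.div_one, Nat.mul_add_mod, Nat.mod_eq_of_lt (x 0).2]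
      | succ l =>
        rw [pow_succ', ← Nat.div_div_eq_div_mul, Nat.mul_add_div hn, Nat.div_eq_of_lt (x 0).2,
          add_zero]
        exact h2 l (by omega)

section Search
variable {n : ℕ} {par : ℕ → ℕ} {σ : Store}

/-- Variable `15` is the carry: it reaches digit `i` exactly if `n ^ i` divides `τ + 1`. By
`Nat.succ_div` this is the condition under which the quotient by `n ^ i` changes. -/
theorem increment_spec (hn : 0 < n) (hpar : par 1 = n) {τ : ℕ}
    (hX : ∀ l < par 2, σ.arr 1 l = τ / n ^ l % n) :
    ∀ l < par 2, (increment.den par σ).arr 1 l = (τ + 1) / n ^ l % n := by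
  set body : Cmd := .ite (.var 15) (.ite (.sub (.par 1) (.add (.arr 1 (.var 12)) (.lit 1)))
      (.seq (.put 1 (.var 12) (.add (.arr 1 (.var 12)) (.lit 1))) (.set 15 (.lit 0)))
      (.put 1 (.var 12) (.lit 0))) .skip with hbody
  have key := iter_inv (f := fun i σ => body.den par (σ.setVar 12 i)) (σ := σ.setVar 15 1)
    (P := fun i ρ => (ρ.var 15 ≠ 0 ↔ n ^ i ∣ τ + 1) ∧ (∀ l < i, ρ.arr 1 l = (τ + 1) / n ^ l % n) ∧
      ∀ l, i ≤ l → l < par 2 → ρ.arr 1 l = τ / n ^ l % n) (par 2)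
    ⟨by simp, fun l hl => absurd hl (by omega), fun l _ hl => hX l hl⟩ (by
      rintro i hi ρ ⟨e1, e2, e3⟩
      have hdig := e3 i le_rfl hi
      have hq : (τ + 1) / n ^ i = τ / n ^ i + if n ^ i ∣ τ + 1 then 1 else 0 := Nat.succ_div
      simp only [hbody, Cmd.den, Expr.eval, Store.setVar_var, Store.setVar_arr, if_true,
        if_neg (show ¬ 15 = 12 by decide), hpar]
      by_cases hc : ρ.var 15 ≠ 0
      · have hdvd := e1.1 hc
        rw [if_pos hdvd] at hq
        have hpow : n ^ (i + 1) ∣ τ + 1 ↔ n ∣ τ / n ^ i + 1 := by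
          rw [← hq, pow_succ]
          exact (Nat.dvd_div_iff_mul_dvd hdvd).symm
        have hmod := Nat.mod_lt (τ / n ^ i) hn
        have hdm := Nat.div_add_mod (τ / n ^ i) n
        rw [if_pos hc]
        by_cases hlt : n - (ρ.arr 1 i + 1) ≠ 0
        · have hnew : (τ / n ^ i + 1) % n = τ / n ^ i % n + 1 := by
            rw [Nat.add_mod_eq_ite, Nat.mod_eq_of_lt (show 1 < n by omega), if_neg (by omega)]
          rw [if_pos hlt]
          simp only [Store.setVar_var, Store.setVar_arr, if_true, Store.setArr_arr_self]
          refine ⟨iff_of_false (by simp) fun h => ?_, fun l hl => ?_, fun l hl hl' => ?_⟩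
          · rw [hpow, Nat.dvd_iff_mod_eq_zero] at h
            omega
          · rcases Nat.lt_succ_iff_lt_or_eq.1 hl with hl | rfl
            · rw [Function.update_of_ne (by omega), e2 l hl]
            · rw [Function.update_self, hq, hnew, hdig]
          · rw [Function.update_of_ne (by omega), e3 l (by omega) hl']
        · have hnew : (τ / n ^ i + 1) % n = 0 := by
            rw [← hdm, show n * (τ / n ^ i / n) + τ / n ^ i % n + 1 = n * (τ / n ^ i / n) + n by omega]
            simp
          rw [if_neg hlt]
          simp only [Store.setArr_var, Store.setVar_var, Store.setVar_arr,
            if_neg (show ¬ 15 = 12 by decide), Store.setArr_arr_self]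
          refine ⟨iff_of_true hc ?_, fun l hl => ?_, fun l hl hl' => ?_⟩
          · rw [hpow, Nat.dvd_iff_mod_eq_zero]
            exact hnew
          · rcases Nat.lt_succ_iff_lt_or_eq.1 hl with hl | rfl
            · rw [Function.update_of_ne (by omega), e2 l hl]
            · rw [Function.update_self, hq, hnew]
          · rw [Function.update_of_ne (by omega), e3 l (by omega) hl']
      · have hdvd := mt e1.2 hc
        rw [if_neg hdvd, add_zero] at hq
        rw [if_neg hc]
        simp only [Store.setVar_var, Store.setVar_arr, if_neg (show ¬ 15 = 12 by decide)]
        refine ⟨iff_of_false hc fun h => hdvd ((pow_dvd_pow n (by omega)).trans h), fun l hl => ?_,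
          fun l hl hl' => e3 l (by omega) hl'⟩
        rcases Nat.lt_succ_iff_lt_or_eq.1 hl with hl | rfl
        · exact e2 l hl
        · rw [hq, hdig])
  exact key.2.1

variable {G : SimpleGraph (Fin n)} {Q S : Finset (Fin n)}

theorem save_spec (hpar : par 1 = n) (hS : Mask σ 2 S) :
    Mask (save.den par σ) 4 S ∧ (save.den par σ).var 13 ≠ 0 ∧
      (save.den par σ).var 14 = σ.var 11 := by
  have key := iter_inv (f := fun i σ => (Cmd.put 4 (.var 0) (.arr 2 (.var 0))).den par (σ.setVar 0 i))
    (σ := (σ.setVar 13 1).setVar 14 (σ.var 11))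
    (P := fun i τ => τ.arr 2 = σ.arr 2 ∧ τ.var 13 = 1 ∧ τ.var 14 = σ.var 11 ∧
      ∀ a < i, τ.arr 4 a = σ.arr 2 a) (par 1)
    ⟨rfl, by simp, by simp, fun a ha => absurd ha (by omega)⟩ (by
      rintro i hi τ ⟨e1, e2, e3, e4⟩
      simp only [Cmd.den, Expr.eval, Store.setVar_var, Store.setVar_arr, if_true]
      refine ⟨?_, by simpa using e2, by simpa using e3, fun a ha => ?_⟩
      · rw [Store.setArr_arr_ne _ (by decide)]
        exact e1
      · rw [Store.setArr_arr_self, Function.update_apply, Store.setVar_arr, e1]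
        split_ifs with hai
        · rw [hai]
        · exact e4 a (by omega))
  have hden : save.den par σ =
      iter (fun i σ => (Cmd.put 4 (.var 0) (.arr 2 (.var 0))).den par (σ.setVar 0 i)) (par 1)
        ((σ.setVar 13 1).setVar 14 (σ.var 11)) := by
    simp [save, Cmd.den, Expr.eval]
  rw [hden]
  obtain ⟨-, e2, e3, e4⟩ := key
  refine ⟨fun a => ?_, by rw [e2]; decide, e3⟩
  rw [e4 a (by rw [hpar]; exact a.2)]
  exact hS a

/-- Variable `13` tells whether one of the sets that satisfy `P` is a connector for `Q`. If so, then
array `4` is a connector, at least as good as all of them. -/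
def Best (σ : Store) (G : SimpleGraph (Fin n)) (Q : Finset (Fin n)) (P : Finset (Fin n) → Prop) : Prop :=
  (σ.var 13 = 0 → ∀ S, P S → IsConnectedOn G S → ¬ Q ⊆ S) ∧
    (σ.var 13 ≠ 0 → ∃ S, Mask σ 4 S ∧ IsConnectedOn G S ∧ Q ⊆ S ∧ σ.var 14 = distSum G S ∧
      ∀ S', P S' → IsConnectedOn G S' → Q ⊆ S' → distSum G S ≤ distSum G S')

theorem compare_spec (hpar : par 1 = n) {P : Finset (Fin n) → Prop} (hB : Best σ G Q P)
    (hS : Mask σ 2 S) (h10 : σ.var 10 ≠ 0 ↔ IsConnectedOn G S ∧ Q ⊆ S) (h11 : σ.var 11 = distSum G S) :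
    Best (compare.den par σ) G Q fun S' => P S' ∨ S' = S := by
  obtain ⟨hB1, hB2⟩ := hB
  obtain ⟨s1, s2, s3⟩ := save_spec (par := par) hpar hS
  have hden : compare.den par σ = if σ.var 10 ≠ 0 then if σ.var 13 ≠ 0 then
      if σ.var 14 - σ.var 11 ≠ 0 then save.den par σ else σ else save.den par σ else σ := rfl
  rw [hden]
  by_cases hc : σ.var 10 ≠ 0
  · rw [if_pos hc]
    obtain ⟨hS1, hS2⟩ := h10.1 hc
    by_cases hf : σ.var 13 ≠ 0
    · rw [if_pos hf]
      obtain ⟨S₀, b1, b2, b3, b4, b5⟩ := hB2 hf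
      by_cases hlt : σ.var 14 - σ.var 11 ≠ 0
      · rw [if_pos hlt]
        refine ⟨fun h => absurd h s2, fun _ => ⟨S, s1, hS1, hS2, s3.trans h11, ?_⟩⟩
        rintro S' (hS' | rfl) h1 h2
        · have := b5 S' hS' h1 h2
          omega
        · exact le_rfl
      · rw [if_neg hlt]
        refine ⟨fun h => absurd h hf, fun _ => ⟨S₀, b1, b2, b3, b4, ?_⟩⟩
        rintro S' (hS' | rfl) h1 h2
        · exact b5 S' hS' h1 h2
        · omega
    · rw [if_neg hf]
      refine ⟨fun h => absurd h s2, fun _ => ⟨S, s1, hS1, hS2, s3.trans h11, ?_⟩⟩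
      rintro S' (hS' | rfl) h1 h2
      · exact absurd h2 (hB1 (not_not.1 hf) S' hS' h1)
      · exact le_rfl
  · rw [if_neg hc]
    have hS0 : IsConnectedOn G S → ¬ Q ⊆ S := fun h1 h2 => hc (h10.2 ⟨h1, h2⟩)
    refine ⟨fun h => ?_, fun h => ?_⟩
    · rintro S' (hS' | rfl) h1
      · exact hB1 h S' hS' h1
      · exact hS0 h1
    · obtain ⟨S₀, b1, b2, b3, b4, b5⟩ := hB2 h
      refine ⟨S₀, b1, b2, b3, b4, ?_⟩
      rintro S' (hS' | rfl) h1 h2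
      · exact b5 S' hS' h1 h2
      · exact absurd h2 (hS0 h1)

theorem Best.congr {τ : Store} {P : Finset (Fin n) → Prop} (h : Best σ G Q P) (h4 : τ.arr 4 = σ.arr 4)
    (h13 : τ.var 13 = σ.var 13) (h14 : τ.var 14 = σ.var 14) : Best τ G Q P := by
  obtain ⟨h1, h2⟩ := h
  refine ⟨fun h => h1 (h13 ▸ h), fun h => ?_⟩
  obtain ⟨S, b1, b2⟩ := h2 (h13 ▸ h)
  exact ⟨S, fun a => by rw [h4]; exact b1 a, by rw [h14]; exact b2⟩

theorem Best.mono {P P' : Finset (Fin n) → Prop} (h : Best σ G Q P) (hP : ∀ S, P' S → P S) :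
    Best σ G Q P' := by
  obtain ⟨h1, h2⟩ := h
  refine ⟨fun h S hS => h1 h S (hP S hS), fun h => ?_⟩
  obtain ⟨S, b1, b2, b3, b4, b5⟩ := h2 h
  exact ⟨S, b1, b2, b3, b4, fun S' hS' => b5 S' (hP S' hS')⟩

/-- The vertex with index `τ / n ^ l % n` -/
def digit (hn : 0 < n) (τ l : ℕ) : Fin n := ⟨τ / n ^ l % n, Nat.mod_lt _ hn⟩

theorem search_spec (hn : 0 < n) (hG : G.Connected) (henv : Env par σ G) (hQ : InputSet par σ Q)
    (h5 : Mask σ 5 (Finset.univ : Finset (Fin n))) (hX : ∀ l < par 2, σ.arr 1 l = 0)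
    (h26 : par 2 = par 6 + par 6) (h6 : 0 < par 6) :
    Best (search.den par σ) G Q fun S => ∃ τ < par 3, S = unionG G (par 6) (digit hn τ) := by
  set body : Cmd := .seq build (.seq evalSet (.seq compare increment)) with hbody
  have key := iter_inv (f := fun i σ => body.den par (σ.setVar 16 i)) (σ := σ.setVar 13 0)
    (P := fun i ρ => (ρ.arr 0 = σ.arr 0 ∧ ρ.arr 5 = σ.arr 5 ∧ ρ.raw = σ.raw) ∧
      (∀ l < par 2, ρ.arr 1 l = i / n ^ l % n) ∧
      Best ρ G Q fun S => ∃ τ < i, S = unionG G (par 6) (digit hn τ)) (par 3)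
    ⟨⟨rfl, rfl, rfl⟩, by simpa using hX, ⟨by simp, by simp⟩⟩ (by
      rintro i hi ρ ⟨⟨e0, e5, er⟩, eX, eB⟩
      set ρ₀ := ρ.setVar 16 i with hρ₀
      set ρ₁ := build.den par ρ₀ with hρ₁
      set ρ₂ := evalSet.den par ρ₁ with hρ₂
      set ρ₃ := compare.den par ρ₂ with hρ₃
      have hden : body.den par ρ₀ = increment.den par ρ₃ := rfl
      set S := unionG G (par 6) (digit hn i) with hS
      -- `evalSet` does not test for nonemptiness; a union of at least one path has it.
      have hS0 : S.Nonempty := by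
        have : pathG G (digit hn i 0) (digit hn i (0 + par 6)) ⊆ S :=
          Finset.subset_biUnion_of_mem (fun l => pathG G (digit hn i l) (digit hn i (l + par 6)))
            (Finset.mem_range.2 h6)
        exact Finset.Nonempty.mono this (by simp [pathG])
      have m1 : Mask ρ₁ 2 S := build_spec (σ := ρ₀) (x := digit hn i) hG (henv.congr e0 er)
        (fun a => by rw [hρ₀, Store.setVar_arr, e5]; exact h5 a) fun l hl => eX l (by omega)
      have a1 : ∀ j : Fin 8, j ≠ 2 → j ≠ 3 → ρ₁.arr j = ρ.arr j := fun j h2 h3 => build_arr h2 h3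
      have r1 : ρ₁.raw = ρ.raw :=
        Cmd.den_raw par _ (by simp [build, bellmanFord, relax, walk, tryStep, Cmd.pure]) _
      have v1 : ∀ x, x ∉ build.vars → x ≠ 16 → ρ₁.var x = ρ.var x := fun x hx hx' =>
        (Cmd.den_var par _ hx _).trans (by simp [hρ₀, hx'])
      have a2 : ∀ j : Fin 8, j ≠ 3 → ρ₂.arr j = ρ₁.arr j := fun j h3 => Cmd.den_arr par _
        (by simp [evalSet, evalRow, checkQ, addDist, bellmanFord, relax, Cmd.arrs, h3]) _
      have r2 : ρ₂.raw = ρ₁.raw := Cmd.den_raw par _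
        (by simp [evalSet, evalRow, checkQ, addDist, bellmanFord, relax, Cmd.pure]) _
      have v2 : ∀ x, x ∉ evalSet.vars → ρ₂.var x = ρ₁.var x := fun x hx => Cmd.den_var par _ hx _
      have a3 : ∀ j : Fin 8, j ≠ 4 → ρ₃.arr j = ρ₂.arr j := fun j h4 => Cmd.den_arr par _
        (by simp [compare, save, Cmd.arrs, h4]) _
      have r3 : ρ₃.raw = ρ₂.raw := Cmd.den_raw par _ (by simp [compare, save, Cmd.pure]) _
      have a4 : ∀ j : Fin 8, j ≠ 1 → (increment.den par ρ₃).arr j = ρ₃.arr j := fun j h1 =>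
        Cmd.den_arr par _ (by simp [increment, Cmd.arrs, h1]) _
      have r4 : (increment.den par ρ₃).raw = ρ₃.raw :=
        Cmd.den_raw par _ (by simp [increment, Cmd.pure]) _
      have v4 : ∀ x, x ∉ increment.vars → (increment.den par ρ₃).var x = ρ₃.var x := fun x hx =>
        Cmd.den_var par _ hx _
      obtain ⟨k1, k2⟩ := evalSet_spec (henv.congr ((a1 0 (by decide) (by decide)).trans e0)
        (r1.trans er)) (Q := Q) (fun a => by rw [r1, er]; exact hQ a) m1
      rw [hden]
      refine ⟨⟨?_, ?_, ?_⟩, ?_, ?_⟩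
      · rw [a4 0 (by decide), a3 0 (by decide), a2 0 (by decide), a1 0 (by decide) (by decide), e0]
      · rw [a4 5 (by decide), a3 5 (by decide), a2 5 (by decide), a1 5 (by decide) (by decide), e5]
      · rw [r4, r3, r2, r1, er]
      · refine increment_spec hn henv.par_one fun l hl => ?_
        rw [a3 1 (by decide), a2 1 (by decide), a1 1 (by decide) (by decide), eX l hl]
      · have hvars : ∀ x, x = 13 ∨ x = 14 → ρ₂.var x = ρ.var x := by
          rintro x (rfl | rfl)
          · rw [v2 _ (by decide), v1 _ (by decide) (by decide)]
          · rw [v2 _ (by decide), v1 _ (by decide) (by decide)]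
        have hB := compare_spec (par := par) henv.par_one (S := S)
          (eB.congr (τ := ρ₂) (by rw [a2 4 (by decide), a1 4 (by decide) (by decide)])
            (hvars 13 (.inl rfl)) (hvars 14 (.inr rfl)))
          (fun a => by rw [a2 2 (by decide)]; exact m1 a)
          (by rw [k1, IsConnectedOn, and_iff_right hS0]) k2
        refine (hB.congr (a4 4 (by decide)) (v4 13 (by decide)) (v4 14 (by decide))).mono ?_
        rintro S' ⟨τ, hτ, rfl⟩
        rcases Nat.lt_succ_iff_lt_or_eq.1 hτ with hτ | rfl
        · exact .inl ⟨τ, hτ, rfl⟩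
        · exact .inr rfl)
  exact key.2.2

end Search
end MinWiener

namespace MinWiener

/-! ### The algorithm -/

/-- Run a command, then copy variable `x` to parameter `p`. -/
def stage (c : Cmd) (p x : ℕ) : Prog :=
  .seq (c.compile 0) (.seq (.const 2 0) (.add (3 * p + 1) (3 * x) 2))

/-- The conclusion lists the registers and cells in the old memory layout, because a new value of
parameter `0` moves the arrays, and `Rel` need not hold for the updated parameters. -/
theorem stage_runs (c : Cmd) (p x : ℕ) : ∃ e, ∀ (par : ℕ → ℕ) (σ : Store) (s : State) (B : ℕ), 2 ≤ B →
    (∀ q, par q ≤ B) → Rel par σ s → ∃ t s', Runs (stage c p x) s t s' ∧ t ≤ B ^ e ∧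
      (∀ y, s'.reg (3 * y) = (c.den par σ).var y) ∧
      (∀ q, s'.reg (3 * q + 1) = Function.update par p ((c.den par σ).var x) q) ∧
      (∀ (j : Fin 8) i, s'.mem (par 0 + 8 * i + j) = (c.den par σ).arr j i) ∧
      ∀ a < par 0, s'.mem a = (c.den par σ).raw a := by
  obtain ⟨e, he⟩ := c.cost_le
  refine ⟨e + 2, fun par σ s B hB hpar hs => ?_⟩
  obtain ⟨t, s', h1, h2, h3, -⟩ := Cmd.runs c 0 σ s hs
  refine ⟨_, _, .seq h1 (.seq (.const _ _ _) (.add _ _ _ _)), ?_, fun y => ?_, fun q => ?_, h3.arrEq,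
    h3.rawEq⟩
  · have h4 := he par B hB hpar
    have h5 : 1 ≤ B ^ e := Nat.one_le_pow _ _ (by omega)
    calc t + (1 + 1) ≤ B ^ e * (2 * 2) := by omega
      _ ≤ B ^ e * (B * B) := Nat.mul_le_mul_left _ (Nat.mul_le_mul hB hB)
      _ = B ^ (e + 2) := by ring
  · simp only [State.setReg, Function.update_apply]
    rw [if_neg (by omega), if_neg (by omega), h3.varEq]
  · simp only [State.setReg, Function.update_apply]
    rw [if_neg (show ¬ 3 * x = 2 by omega), if_pos trivial, h3.varEq, if_neg (show ¬ 3 * q + 1 = 2 by omega), h3.parEq]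
    by_cases hq : q = p
    · simp [hq]
    · rw [if_neg (by omega), if_neg hq]

theorem stage_rel (c : Cmd) {p : ℕ} (hp : p ≠ 0) (x : ℕ) : ∃ e, ∀ (par : ℕ → ℕ) (σ : Store) (s : State)
    (B : ℕ), 2 ≤ B → (∀ q, par q ≤ B) → Rel par σ s → ∃ t s', Runs (stage c p x) s t s' ∧ t ≤ B ^ e ∧
      Rel (Function.update par p ((c.den par σ).var x)) (c.den par σ) s' := by
  obtain ⟨e, he⟩ := stage_runs c p x
  refine ⟨e, fun par σ s B hB hpar hs => ?_⟩
  obtain ⟨t, s', h1, h2, h3, h4, h5, h6⟩ := he par σ s B hB hpar hs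
  have h0 : Function.update par p ((c.den par σ).var x) 0 = par 0 := Function.update_of_ne hp.symm _ _
  exact ⟨t, s', h1, h2, h3, h4, by rw [h0]; exact h5, by rw [h0]; exact h6⟩

theorem update_le {par : ℕ → ℕ} {B v : ℕ} (h : ∀ q, par q ≤ B) (p : ℕ) (hv : v ≤ B) (q : ℕ) :
    Function.update par p v q ≤ B := by
  rw [Function.update_apply]
  split_ifs
  exacts [hv, h q]

section Commands
variable {par : ℕ → ℕ} {σ : Store} {n : ℕ} {G : SimpleGraph (Fin n)} {Q S : Finset (Fin n)}

/-- Compute the number of input cells. -/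
def inputSize : Cmd :=
  .seq (.set 1 (.add (.lit 1) (.par 1))) (.rep 2 1 (.set 1 (.add (.var 1) (.par 1))))

theorem inputSize_spec (hpar : par 1 = n) : (inputSize.den par σ).var 1 = 1 + n + n * n := by
  have key := iter_inv (f := fun i σ => (Cmd.set 1 (.add (.var 1) (.par 1))).den par (σ.setVar 2 i))
    (σ := σ.setVar 1 (1 + n)) (P := fun i (τ : Store) => τ.var 1 = 1 + n + n * i) n (by simp)
    (fun i _ τ hτ => by
      simp only [Cmd.den, Expr.eval, Store.setVar_var, if_true, hpar, if_neg (show ¬ 1 = 2 by decide), hτ]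
      ring)
  simpa [inputSize, Cmd.den, Expr.eval, hpar] using key

/-- Count the elements of the input set. -/
def countQ : Cmd :=
  .seq (.set 3 (.lit 0))
    (.rep 0 1 (.ite (.raw (.add (.var 0) (.lit 1))) (.set 3 (.add (.var 3) (.lit 1))) .skip))

theorem countQ_spec (hpar : par 1 = n) (hQ : InputSet par σ Q) : (countQ.den par σ).var 3 = Q.card := by
  set body : Cmd := .ite (.raw (.add (.var 0) (.lit 1))) (.set 3 (.add (.var 3) (.lit 1))) .skip
    with hbody
  have key := iter_inv (f := fun i σ => body.den par (σ.setVar 0 i))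
    (σ := σ.setVar 3 0) (P := fun i (τ : Store) => τ.raw = σ.raw ∧
      τ.var 3 = ∑ w ∈ Finset.univ.filter (fun w : Fin n => (w : ℕ) < i), if w ∈ Q then 1 else 0)
    n ⟨rfl, by simp⟩ (fun i hi τ ⟨h1, h2⟩ => by
      refine ⟨?_, ?_⟩
      · rw [Cmd.den_raw par _ (by simp [hbody, Cmd.pure])]
        exact h1
      · rw [sum_filter_lt_succ _ hi, ← h2]
        have hQi := hQ ⟨i, hi⟩
        simp only [hbody, Cmd.den, Expr.eval, Store.setVar_var, if_true, Store.setVar_raw, h1]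
        by_cases h : (⟨i, hi⟩ : Fin n) ∈ Q
        · rw [if_pos (hQi.2 h), if_pos h]
          simp
        · rw [if_neg (mt hQi.1 h), if_neg h]
          simp)
  rw [filter_lt_self] at key
  have hden : countQ.den par σ = iter (fun i σ => body.den par (σ.setVar 0 i)) n (σ.setVar 3 0) := by
    simp [countQ, Cmd.den, Expr.eval, hpar, hbody]
  rw [hden, key.2]
  simp

/-- Compute a power of `2`. -/
def powTwo : Cmd :=
  .seq (.set 5 (.lit 1)) (.seq (.rep 6 4 (.rep 7 5 (.set 5 (.add (.var 5) (.var 5)))))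
    (.rep 7 5 (.set 5 (.add (.var 5) (.var 5)))))

theorem powTwo_spec : (powTwo.den par σ).var 5 = 2 ^ (par 5 * (par 4 + 1)) := by
  have hrow : ∀ τ : Store, ((Cmd.rep 7 5 (.set 5 (.add (.var 5) (.var 5)))).den par τ).var 5 =
      2 ^ par 5 * τ.var 5 := fun τ =>
    iter_inv (f := fun i σ => (Cmd.set 5 (.add (.var 5) (.var 5))).den par (σ.setVar 7 i))
      (P := fun i (ρ : Store) => ρ.var 5 = 2 ^ i * τ.var 5) (par 5) (by simp) (fun i _ ρ hρ => by
        simp [Cmd.den, Expr.eval, hρ]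
        ring)
  have key := iter_inv (f := fun i σ => (Cmd.rep 7 5 (.set 5 (.add (.var 5) (.var 5)))).den par
      (σ.setVar 6 i)) (σ := σ.setVar 5 1) (P := fun i (τ : Store) => τ.var 5 = 2 ^ (par 5 * i)) (par 4)
    (by simp) (fun i _ τ hτ => by
      rw [hrow, Store.setVar_var, if_neg (by decide), hτ, ← pow_add]
      congr 1
      ring)
  refine (hrow _).trans ((congrArg _ key).trans ?_)
  rw [← pow_add]
  congr 1
  ring

/-- Compute a power of the number of vertices. -/
def powN : Cmd :=
  .seq (.set 9 (.lit 1)) (.rep 10 2 (.seq (.set 11 (.lit 0))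
    (.seq (.rep 12 1 (.set 11 (.add (.var 11) (.var 9)))) (.set 9 (.var 11)))))

theorem powN_spec : (powN.den par σ).var 9 = par 1 ^ par 2 := by
  have hrow : ∀ τ : Store, ((Cmd.rep 12 1 (.set 11 (.add (.var 11) (.var 9)))).den par τ).var 11 =
      τ.var 11 + par 1 * τ.var 9 := fun τ =>
    (iter_inv (f := fun i σ => (Cmd.set 11 (.add (.var 11) (.var 9))).den par (σ.setVar 12 i))
      (P := fun i (ρ : Store) => ρ.var 9 = τ.var 9 ∧ ρ.var 11 = τ.var 11 + i * τ.var 9) (par 1)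
      (by simp) (fun i _ ρ hρ => by
        simp [Cmd.den, Expr.eval, hρ.1, hρ.2]
        ring)).2
  exact iter_inv (f := fun i σ => (Cmd.seq (.set 11 (.lit 0))
    (.seq (.rep 12 1 (.set 11 (.add (.var 11) (.var 9)))) (.set 9 (.var 11)))).den par (σ.setVar 10 i))
    (σ := σ.setVar 9 1) (P := fun i (τ : Store) => τ.var 9 = par 1 ^ i) (par 2)
    (by simp) (fun i _ τ hτ => by
      refine (Store.setVar_var _ _ _ _).trans ((if_pos rfl).trans ((hrow _).trans ?_))
      simp [Cmd.den, Expr.eval, hτ]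
      ring)

/-- Store the addresses of the rows of the adjacency matrix, and the set of all vertices. -/
def tables : Cmd :=
  .seq (.set 0 (.add (.lit 1) (.par 1))) (.rep 1 1 (.seq (.put 0 (.var 1) (.var 0))
    (.seq (.set 0 (.add (.var 0) (.par 1))) (.put 5 (.var 1) (.lit 1)))))

theorem tables_spec (hpar : par 1 = n) : ∀ a < n, (tables.den par σ).arr 0 a = 1 + n + n * a ∧
    (tables.den par σ).arr 5 a = 1 := by
  have key := iter_inv (f := fun i σ => (Cmd.seq (.put 0 (.var 1) (.var 0))
    (.seq (.set 0 (.add (.var 0) (.par 1))) (.put 5 (.var 1) (.lit 1)))).den par (σ.setVar 1 i))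
    (σ := σ.setVar 0 (1 + n)) (P := fun i (τ : Store) => τ.var 0 = 1 + n + n * i ∧
      ∀ a < i, τ.arr 0 a = 1 + n + n * a ∧ τ.arr 5 a = 1) n ⟨by simp, fun a ha => absurd ha (by omega)⟩
    (fun i _ τ ⟨h1, h2⟩ => by
      refine ⟨by simp [Cmd.den, Expr.eval, hpar, h1]; ring, fun a ha => ?_⟩
      simp only [Cmd.den, Expr.eval, Store.setArr_arr_self, Store.setArr_arr_ne _ (show (0 : Fin 8) ≠ 5 by decide),
        Store.setArr_arr_ne _ (show (5 : Fin 8) ≠ 0 by decide), Store.setVar_arr, Store.setArr_var,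
        Store.setVar_var, Function.update_apply, if_true, if_neg (show ¬ 0 = 1 by decide),
        if_neg (show ¬ 1 = 0 by decide), h1]
      split_ifs with hai
      · rw [hai]
        exact ⟨rfl, rfl⟩
      · exact h2 a (by omega))
  have hden : tables.den par σ = iter (fun i σ => (Cmd.seq (.put 0 (.var 1) (.var 0))
    (.seq (.set 0 (.add (.var 0) (.par 1))) (.put 5 (.var 1) (.lit 1)))).den par (σ.setVar 1 i)) n
      (σ.setVar 0 (1 + n)) := by
    simp [tables, Cmd.den, Expr.eval, hpar]
  rw [hden]
  exact key.2

/-- Write the indicator vector of array `4` into the input cells. -/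
def output : Cmd :=
  .rep 0 1 (.ite (.arr 4 (.var 0)) (.out (.add (.lit 1) (.var 0)) (.lit 1))
    (.out (.add (.lit 1) (.var 0)) (.lit 0)))

theorem output_spec (hpar : par 1 = n) (h0 : n < par 0) (hS : Mask σ 4 S) (v : Fin n) :
    (output.den par σ).raw (1 + v) = if v ∈ S then 1 else 0 := by
  set body : Cmd := .ite (.arr 4 (.var 0)) (.out (.add (.lit 1) (.var 0)) (.lit 1))
    (.out (.add (.lit 1) (.var 0)) (.lit 0)) with hbody
  have key := iter_inv (f := fun i σ => body.den par (σ.setVar 0 i))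
    (σ := σ) (P := fun i (τ : Store) => τ.arr 4 = σ.arr 4 ∧
      ∀ v : Fin n, (v : ℕ) < i → τ.raw (1 + v) = if v ∈ S then 1 else 0) n
    ⟨rfl, fun v hv => absurd hv (by omega)⟩ (fun i hi τ ⟨h1, h2⟩ => by
      refine ⟨?_, (forall_lt_succ hi).2 ?_⟩
      · rw [Cmd.den_arr par _ (by simp [hbody, Cmd.arrs])]
        exact h1
      have hSi := hS ⟨i, hi⟩
      simp only [hbody, Cmd.den, Expr.eval, Store.setVar_var, if_true, Store.setVar_arr, h1,
        if_pos (show 1 + i < par 0 by omega)]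
      have hset : ∀ w (v : Fin n), (v : ℕ) < i → ((τ.setVar 0 i).setRaw (1 + i) w).raw (1 + v) =
          if v ∈ S then 1 else 0 := fun w v hv => by
        simp only [Store.setRaw]
        rw [Function.update_of_ne (by omega)]
        exact h2 v hv
      by_cases h : (⟨i, hi⟩ : Fin n) ∈ S
      · rw [if_pos (hSi.2 h), if_pos h]
        exact ⟨hset 1, by simp [Store.setRaw]⟩
      · rw [if_neg (mt hSi.1 h), if_neg h]
        exact ⟨hset 0, by simp [Store.setRaw]⟩)
  have hden : output.den par σ = iter (fun i σ => body.den par (σ.setVar 0 i)) n σ := by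
    simp [output, Cmd.den, hpar, hbody]
  rw [hden]
  exact key.2 v v.2

theorem inputState_mem_Q (i : Fin n) : (inputState G Q).mem (i + 1) ≠ 0 ↔ i ∈ Q := by
  classical
  simp only [inputState]
  rw [if_neg (by omega)]
  have : ((∃ i' ∈ Q, (i : ℕ) + 1 = 1 + (i' : ℕ)) ∨
      ∃ a b : Fin n, G.Adj a b ∧ (i : ℕ) + 1 = 1 + n + n * (a : ℕ) + b) ↔ i ∈ Q := by
    constructor
    · rintro (⟨i', hi', h⟩ | ⟨a, b, -, h⟩)
      · have : i = i' := Fin.ext (by omega)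
        rwa [this]
      · have := i.2
        omega
    · exact fun h => .inl ⟨i, h, by omega⟩
  rw [← this]
  split_ifs with h <;> simp [h]

/-- Quotient and remainder by `n` recover the row and the column from the address. -/
theorem inputState_mem_adj (a b : Fin n) :
    (inputState G Q).mem (1 + n + n * a + b) ≠ 0 ↔ G.Adj a b := by
  classical
  simp only [inputState]
  rw [if_neg (by omega)]
  have : ((∃ i' ∈ Q, 1 + n + n * (a : ℕ) + b = 1 + (i' : ℕ)) ∨
      ∃ a' b' : Fin n, G.Adj a' b' ∧ 1 + n + n * (a : ℕ) + b = 1 + n + n * (a' : ℕ) + b') ↔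
      G.Adj a b := by
    constructor
    · rintro (⟨i', -, h⟩ | ⟨a', b', hadj, h⟩)
      · have := i'.2
        omega
      · have h1 : n * (a : ℕ) + b = n * a' + b' := by omega
        have hn : 0 < n := (Nat.zero_le _).trans_lt a.2
        have h2 := congrArg (· / n) h1
        have h3 := congrArg (· % n) h1
        simp only [Nat.mul_add_div hn, Nat.div_eq_of_lt b.2,
          Nat.div_eq_of_lt b'.2, add_zero] at h2
        simp only [Nat.mul_add_mod, Nat.mod_eq_of_lt b.2, Nat.mod_eq_of_lt b'.2] at h3
        rwa [Fin.ext h2, Fin.ext h3]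
    · exact fun h => .inr ⟨a, b, h, rfl⟩
  rw [← this]
  split_ifs with h <;> simp [h]

theorem inputState_mem_eq_zero {x : ℕ} (hx : 1 + n + n * n ≤ x) : (inputState G Q).mem x = 0 := by
  classical
  simp only [inputState]
  rw [if_neg (by omega), if_neg]
  rintro (⟨i, -, h⟩ | ⟨a, b, -, h⟩)
  · have := i.2
    omega
  · have h1 : n * (a + 1) ≤ n * n := Nat.mul_le_mul_left _ a.2
    have := b.2
    rw [mul_add] at h1
    omega

end Commands
end MinWiener

/-! ### The complete algorithm and its running time -/

namespace MinWiener

/-- The last stage of the algorithm. -/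
def solve : Cmd := .seq tables (.seq search output)

theorem exists_digit_eq {n : ℕ} (hn : 0 < n) (G : SimpleGraph (Fin n)) (N : ℕ) (x : ℕ → Fin n) :
    ∃ τ < n ^ (N + N), unionG G N (digit hn τ) = unionG G N x := by
  obtain ⟨τ, h1, h2⟩ := exists_digits (N + N) x
  refine ⟨τ, h1, Finset.biUnion_congr rfl fun l hl => ?_⟩
  have hl := Finset.mem_range.1 hl
  have hd : ∀ l < N + N, digit hn τ l = x l := fun l hl => Fin.ext (h2 l hl)
  rw [hd l (by omega), hd (l + N) (by omega)]

theorem solve_spec {n N : ℕ} {G : SimpleGraph (Fin n)} {Q : Finset (Fin n)} {par : ℕ → ℕ} {σ : Store}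
    (hG : G.Connected) (h0 : par 0 = 1 + n + n * n) (h1 : par 1 = n) (h2 : par 2 = N + N)
    (h3 : par 3 = n ^ (N + N)) (h6 : par 6 = N) (hN : 0 < N) (hraw : σ.raw = (inputState G Q).mem)
    (harr : σ.arr 1 = 0) (hex : ∃ x, IsConnectedOn G (unionG G N x) ∧ Q ⊆ unionG G N x) :
    ∃ S, (∀ i : Fin n, (solve.den par σ).raw (1 + i) = if i ∈ S then 1 else 0) ∧
      IsConnectedOn G S ∧ Q ⊆ S ∧ ∀ x, IsConnectedOn G (unionG G N x) → Q ⊆ unionG G N x →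
        distSum G S ≤ distSum G (unionG G N x) := by
  obtain ⟨v₀⟩ := hG.nonempty
  have hn : 0 < n := (Nat.zero_le _).trans_lt v₀.2
  set τ := tables.den par σ with hτ
  have htab := tables_spec (σ := σ) h1
  have hτraw : τ.raw = (inputState G Q).mem :=
    (Cmd.den_raw par _ (by simp [tables, Cmd.pure]) σ).trans hraw
  have henv : Env par τ G := by
    refine ⟨h1, fun a b => ?_⟩
    rw [(htab a a.2).1, hτraw, if_pos, inputState_mem_adj]
    have h4 : n * ((a : ℕ) + 1) ≤ n * n := Nat.mul_le_mul_left _ a.2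
    have := b.2
    rw [mul_add] at h4
    omega
  have hQ : InputSet par τ Q := fun i => by
    rw [hτraw, if_pos, inputState_mem_Q]
    have := i.2
    omega
  have hB := search_spec (σ := τ) (Q := Q) hn hG henv hQ (fun a => by rw [hτ, (htab a a.2).2]; simp)
    (fun l _ => by
      rw [hτ, Cmd.den_arr par _ (by simp [tables, Cmd.arrs]), harr]
      rfl) (by omega) (by omega)
  rw [h3, h6] at hB
  set ρ := search.den par τ with hρ
  have hfound : ρ.var 13 ≠ 0 := fun h => by
    obtain ⟨x, hx1, hx2⟩ := hex
    obtain ⟨t, ht, heq⟩ := exists_digit_eq hn G N x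
    exact hB.1 h _ ⟨t, ht, heq.symm⟩ hx1 hx2
  obtain ⟨S, b1, b2, b3, -, b5⟩ := hB.2 hfound
  refine ⟨S, output_spec (σ := ρ) h1 (by omega) b1, b2, b3, fun x hx1 hx2 => ?_⟩
  obtain ⟨t, ht, heq⟩ := exists_digit_eq hn G N x
  exact b5 _ ⟨t, ht, heq.symm⟩ hx1 hx2

/-- The algorithm. It tries all unions of `2 ^ (c * (Q.card + 1))` shortest paths. -/
def algorithm (c : ℕ) : Prog :=
  .seq (stage (.set 0 (.arr 0 (.lit 0))) 1 0) (.seq (stage inputSize 0 1)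
    (.seq (stage (.set 4 (.lit c)) 5 4) (.seq (stage countQ 4 3) (.seq (stage powTwo 6 5)
    (.seq (stage (.set 8 (.add (.par 6) (.par 6))) 2 8) (.seq (stage powN 3 9) (stage solve 7 17)))))))

/-- The numbers of rounds are computed in stages, each from the previous ones. All parameters stay
below `B`, a power of `max n 2` whose exponent depends on `|Q|` only, so each stage takes at most a
fixed power of `B` steps. -/
theorem algorithm_spec (c : ℕ) : ∃ f : ℕ → ℕ, ∀ (n : ℕ) (G : SimpleGraph (Fin n))
    (Q : Finset (Fin n)), G.Connected →
    (∃ x, IsConnectedOn G (unionG G (2 ^ (c * (Q.card + 1))) x) ∧ Q ⊆ unionG G (2 ^ (c * (Q.card + 1))) x) →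
    ∃ t s S, Runs (algorithm c) (inputState G Q) t s ∧ t ≤ max n 2 ^ f Q.card ∧ IsOutput s S ∧
      IsConnectedOn G S ∧ Q ⊆ S ∧ ∀ x, IsConnectedOn G (unionG G (2 ^ (c * (Q.card + 1))) x) →
        Q ⊆ unionG G (2 ^ (c * (Q.card + 1))) x →
        distSum G S ≤ distSum G (unionG G (2 ^ (c * (Q.card + 1))) x) := by
  obtain ⟨e₁, stage₁⟩ := stage_rel (.set 0 (.arr 0 (.lit 0))) (p := 1) (by decide) 0
  obtain ⟨e₂, stage₂⟩ := stage_runs inputSize 0 1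
  obtain ⟨e₃, stage₃⟩ := stage_rel (.set 4 (.lit c)) (p := 5) (by decide) 4
  obtain ⟨e₄, stage₄⟩ := stage_rel countQ (p := 4) (by decide) 3
  obtain ⟨e₅, stage₅⟩ := stage_rel powTwo (p := 6) (by decide) 5
  obtain ⟨e₆, stage₆⟩ := stage_rel (.set 8 (.add (.par 6) (.par 6))) (p := 2) (by decide) 8
  obtain ⟨e₇, stage₇⟩ := stage_rel powN (p := 3) (by decide) 9
  obtain ⟨e₈, stage₈⟩ := stage_rel solve (p := 7) (by decide) 17
  set N : ℕ → ℕ := fun k => 2 ^ (c * (k + 1)) with hNdef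
  -- Large enough for every parameter: powers with base `n` or `2` are covered by their exponents,
  -- and other numbers `a` by `a ≤ m ^ a`.
  set g : ℕ → ℕ := fun k => N k + N k + c * (k + 1) + c + k + 4 with hg
  refine ⟨fun k => g k * (e₁ + e₂ + e₃ + e₄ + e₅ + e₆ + e₇ + e₈ + 3), fun n G Q hG hex => ?_⟩
  set k := Q.card with hk
  change ∃ x, IsConnectedOn G (unionG G (N k) x) ∧ _ at hex
  set m := max n 2 with hm
  set B := m ^ g k with hB
  have hm2 : 2 ≤ m := le_max_right _ _
  have hgk : g k = N k + N k + c * (k + 1) + c + k + 4 := rfl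
  have hpow : ∀ a, a ≤ g k → m ^ a ≤ B := fun a ha => Nat.pow_le_pow_right (by omega) ha
  have hself : ∀ a, a ≤ m ^ a := fun a => (Nat.lt_two_pow_self).le.trans (Nat.pow_le_pow_left hm2 a)
  have hB2 : 2 ≤ B := hm2.trans ((pow_one m).symm.le.trans (hpow 1 (by omega)))
  have hn : n ≤ B := (le_max_left n 2).trans ((pow_one m).symm.le.trans (hpow 1 (by omega)))
  have hsize : 1 + n + n * n ≤ B := by
    refine le_trans ?_ (hpow 3 (by omega))
    have h1 : n ≤ m := le_max_left _ _
    have h2 : n * n ≤ m * m := Nat.mul_le_mul h1 h1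
    have h3 : 2 * (m * m) ≤ m * (m * m) := Nat.mul_le_mul_right _ hm2
    have h4 : 2 * m ≤ m * m := Nat.mul_le_mul_right _ hm2
    calc 1 + n + n * n ≤ m * (m * m) := by omega
      _ = m ^ 3 := by ring
  have hc : c ≤ B := (hself c).trans (hpow c (by omega))
  have hkB : k ≤ B := (hself k).trans (hpow k (by omega))
  have hNB : N k ≤ B := (Nat.pow_le_pow_left hm2 _).trans (hpow _ (by omega))
  have hNNB : N k + N k ≤ B := (hself _).trans (hpow _ (by omega))
  have htot : n ^ (N k + N k) ≤ B := (Nat.pow_le_pow_left (le_max_left n 2) _).trans (hpow _ (by omega))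
  -- the number of vertices
  set σ₀ : Store := ⟨fun _ => 0, fun j i => (inputState G Q).mem (8 * i + j), fun _ => 0⟩ with hσ₀
  have rel₀ : Rel (fun _ => 0) σ₀ (inputState G Q) :=
    ⟨fun _ => rfl, fun _ => rfl, fun j i => by rw [Nat.zero_add], fun a ha => absurd ha (by omega)⟩
  obtain ⟨t₁, s₁, run₁, time₁, rel₁⟩ := stage₁ _ _ _ B hB2 (fun _ => by omega) rel₀
  set par₁ := Function.update (fun _ => 0 : ℕ → ℕ) 1 n with hpar₁
  have hv₁ : ((Cmd.set 0 (.arr 0 (.lit 0))).den (fun _ => 0) σ₀).var 0 = n := by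
    simp [Cmd.den, Expr.eval, hσ₀, inputState]
  rw [hv₁] at rel₁
  have hle₁ : ∀ q, par₁ q ≤ B := update_le (fun _ => by omega) 1 hn
  -- the number of input cells
  obtain ⟨t₂, s₂, run₂, time₂, reg₂, preg₂, mem₂, -⟩ := stage₂ _ _ _ B hB2 hle₁ rel₁
  set σ₁ := (Cmd.set 0 (.arr 0 (.lit 0))).den (fun _ => 0) σ₀ with hσ₁
  set par₂ := Function.update par₁ 0 (1 + n + n * n) with hpar₂
  rw [inputSize_spec (n := n) (by simp [hpar₁])] at preg₂
  -- The second stage has changed no array, so the memory is still the input. It is now read in the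
  -- new layout: `1 + n + n * n` input cells, followed by arrays filled with zeros.
  have hmem₂ : s₂.mem = (inputState G Q).mem := by
    funext a
    have h := mem₂ ⟨a % 8, Nat.mod_lt _ (by decide)⟩ (a / 8)
    rw [Cmd.den_arr _ _ (by simp [inputSize, Cmd.arrs])] at h
    have h8 : 8 * (a / 8) + a % 8 = a := Nat.div_add_mod a 8
    simpa [hpar₁, hσ₁, hσ₀, Cmd.den, h8] using h
  set σ₂ : Store := ⟨(inputSize.den par₁ σ₁).var, fun _ _ => 0, (inputState G Q).mem⟩ with hσ₂
  have hp0 : par₂ 0 = 1 + n + n * n := by simp [hpar₂]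
  have rel₂ : Rel par₂ σ₂ s₂ :=
    ⟨reg₂, preg₂, fun j i => by rw [hmem₂, hp0, inputState_mem_eq_zero (by omega)],
      fun a _ => by rw [hmem₂]⟩
  have hle₂ : ∀ q, par₂ q ≤ B := update_le hle₁ 0 hsize
  -- the parameters
  obtain ⟨t₃, s₃, run₃, time₃, rel₃⟩ := stage₃ _ _ _ B hB2 hle₂ rel₂
  set σ₃ := (Cmd.set 4 (.lit c)).den par₂ σ₂ with hσ₃
  rw [show σ₃.var 4 = c by simp [hσ₃, Cmd.den, Expr.eval]] at rel₃
  set par₃ := Function.update par₂ 5 c with hpar₃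
  have hle₃ : ∀ q, par₃ q ≤ B := update_le hle₂ 5 hc
  obtain ⟨t₄, s₄, run₄, time₄, rel₄⟩ := stage₄ _ _ _ B hB2 hle₃ rel₃
  rw [countQ_spec (n := n) (Q := Q) (by simp [hpar₃, hpar₂, hpar₁]) fun i => by
    rw [show σ₃.raw = (inputState G Q).mem from rfl, if_pos, inputState_mem_Q]
    have := i.2
    rw [show par₃ 0 = 1 + n + n * n by simp [hpar₃, hp0]]
    omega] at rel₄
  set σ₄ := countQ.den par₃ σ₃ with hσ₄
  set par₄ := Function.update par₃ 4 Q.card with hpar₄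
  have hle₄ : ∀ q, par₄ q ≤ B := update_le hle₃ 4 hkB
  obtain ⟨t₅, s₅, run₅, time₅, rel₅⟩ := stage₅ _ _ _ B hB2 hle₄ rel₄
  rw [powTwo_spec, show par₄ 5 = c by simp [hpar₄, hpar₃], show par₄ 4 = k by simp [hpar₄, hk]] at rel₅
  change Rel (Function.update par₄ 6 (N k)) _ _ at rel₅
  set σ₅ := powTwo.den par₄ σ₄ with hσ₅
  set par₅ := Function.update par₄ 6 (N k) with hpar₅
  have hle₅ : ∀ q, par₅ q ≤ B := update_le hle₄ 6 hNB
  obtain ⟨t₆, s₆, run₆, time₆, rel₆⟩ := stage₆ _ _ _ B hB2 hle₅ rel₅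
  set σ₆ := (Cmd.set 8 (.add (.par 6) (.par 6))).den par₅ σ₅ with hσ₆
  rw [show σ₆.var 8 = N k + N k by simp [hσ₆, Cmd.den, Expr.eval, hpar₅]] at rel₆
  set par₆ := Function.update par₅ 2 (N k + N k) with hpar₆
  have hle₆ : ∀ q, par₆ q ≤ B := update_le hle₅ 2 hNNB
  obtain ⟨t₇, s₇, run₇, time₇, rel₇⟩ := stage₇ _ _ _ B hB2 hle₆ rel₆
  rw [powN_spec, show par₆ 1 = n by simp [hpar₆, hpar₅, hpar₄, hpar₃, hpar₂, hpar₁],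
    show par₆ 2 = N k + N k by simp [hpar₆]] at rel₇
  set σ₇ := powN.den par₆ σ₆ with hσ₇
  set par₇ := Function.update par₆ 3 (n ^ (N k + N k)) with hpar₇
  have hle₇ : ∀ q, par₇ q ≤ B := update_le hle₆ 3 htot
  -- the search
  obtain ⟨t₈, s₈, run₈, time₈, rel₈⟩ := stage₈ _ _ _ B hB2 hle₇ rel₇
  have hraw : σ₇.raw = (inputState G Q).mem := by
    rw [hσ₇, Cmd.den_raw _ _ (by simp [powN, Cmd.pure]), hσ₆, Cmd.den_raw _ _ (by simp [Cmd.pure]), hσ₅,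
      Cmd.den_raw _ _ (by simp [powTwo, Cmd.pure]), hσ₄, Cmd.den_raw _ _ (by simp [countQ, Cmd.pure])]
    rfl
  have harr : σ₇.arr 1 = 0 := by
    rw [hσ₇, Cmd.den_arr _ _ (by simp [powN, Cmd.arrs]), hσ₆, Cmd.den_arr _ _ (by simp [Cmd.arrs]), hσ₅,
      Cmd.den_arr _ _ (by simp [powTwo, Cmd.arrs]), hσ₄, Cmd.den_arr _ _ (by simp [countQ, Cmd.arrs])]
    rfl
  have hp : ∀ q, q ≠ 3 → par₇ q = par₆ q := fun q hq => Function.update_of_ne hq _ _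
  obtain ⟨S, b1, b2, b3, b4⟩ := solve_spec (N := N k) (par := par₇) (σ := σ₇) hG
    (by simp [hpar₇, hpar₆, hpar₅, hpar₄, hpar₃, hpar₂])
    (by simp [hpar₇, hpar₆, hpar₅, hpar₄, hpar₃, hpar₂, hpar₁])
    (by simp [hpar₇, hpar₆]) (by simp [hpar₇]) (by simp [hpar₇, hpar₆, hpar₅]) (by positivity)
    hraw harr hex
  refine ⟨_, s₈, S, .seq run₁ (.seq run₂ (.seq run₃ (.seq run₄ (.seq run₅ (.seq run₆
    (.seq run₇ run₈)))))), ?_, fun i => ?_, b2, b3, b4⟩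
  · have hE : ∀ e, e ≤ e₁ + e₂ + e₃ + e₄ + e₅ + e₆ + e₇ + e₈ →
        B ^ e ≤ B ^ (e₁ + e₂ + e₃ + e₄ + e₅ + e₆ + e₇ + e₈) :=
      fun e he => Nat.pow_le_pow_right (by omega) he
    have h1 := hE e₁ (by omega)
    have h2 := hE e₂ (by omega)
    have h3 := hE e₃ (by omega)
    have h4 := hE e₄ (by omega)
    have h5 := hE e₅ (by omega)
    have h6 := hE e₆ (by omega)
    have h7 := hE e₇ (by omega)
    have h8 := hE e₈ (by omega)
    -- There are eight stages, and this factor is paid for by three more powers of `B`.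
    have h9 : 2 ^ 3 ≤ B ^ 3 := Nat.pow_le_pow_left hB2 3
    rw [pow_mul, ← hB]
    calc _ ≤ B ^ (e₁ + e₂ + e₃ + e₄ + e₅ + e₆ + e₇ + e₈) * 2 ^ 3 := by omega
      _ ≤ B ^ (e₁ + e₂ + e₃ + e₄ + e₅ + e₆ + e₇ + e₈) * B ^ 3 := Nat.mul_le_mul_left _ h9
      _ = _ := (pow_add _ _ _).symm
  · have h7 : Function.update par₇ 7 ((solve.den par₇ σ₇).var 17) 0 = 1 + n + n * n := by
      simp [hpar₇, hpar₆, hpar₅, hpar₄, hpar₃, hpar₂]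
    rw [rel₈.rawEq _ (by rw [h7]; have := i.2; omega)]
    exact b1 i

/-- List the pairs and repeat one of them until there are `N`; the first `N` values of `x` are the
first components, the next `N` the second ones. -/
theorem exists_unionG_eq {n : ℕ} [DecidableEq (Fin n)] (G : SimpleGraph (Fin n)) {T : Finset (Fin n × Fin n)} (hT : T.Nonempty)
    {N : ℕ} (hN : T.card ≤ N) : ∃ x, unionG G N x = T.biUnion fun e => pathG G e.1 e.2 := by
  obtain ⟨d, hd⟩ := hT
  set e : ℕ → Fin n × Fin n := fun l => T.toList.getD l d with he
  have hmem : ∀ l, e l ∈ T := fun l => by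
    rw [he]
    rcases lt_or_ge l T.toList.length with hl | hl
    · simp only [List.getD_eq_getElem _ _ hl]
      exact Finset.mem_toList.1 (List.getElem_mem hl)
    · simpa only [List.getD_eq_default _ _ hl] using hd
  refine ⟨fun l => if l < N then (e l).1 else (e (l - N)).2, ?_⟩
  ext v
  simp only [unionG, Finset.mem_biUnion, Finset.mem_range]
  constructor
  · rintro ⟨l, hl, hv⟩
    rw [if_pos hl, if_neg (by omega), Nat.add_sub_cancel] at hv
    exact ⟨e l, hmem l, hv⟩
  · rintro ⟨p, hp, hv⟩
    obtain ⟨l, hl, rfl⟩ := List.getElem_of_mem (Finset.mem_toList.2 hp)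
    have hlN : l < N := by
      rw [Finset.length_toList] at hl
      omega
    refine ⟨l, hlN, ?_⟩
    rw [if_pos hlN, if_neg (by omega), Nat.add_sub_cancel]
    simpa only [he, List.getD_eq_getElem _ _ hl] using hv

end MinWiener

theorem theorem5 :
    ∃ (P : MinWiener.Prog) (f : ℕ → ℕ),
      ∀ (n : ℕ) (G : SimpleGraph (Fin n)) (Q : Finset (Fin n)), G.Connected →
        ∃ (t : ℕ) (s : MinWiener.State) (S : Finset (Fin n)),
          MinWiener.Runs P (MinWiener.inputState G Q) t s ∧
          t ≤ (max n 2) ^ f Q.card ∧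
          MinWiener.IsOutput s S ∧
          MinWiener.IsMinWienerConnector Q ((⊤ : G.Subgraph).induce (S : Set (Fin n))) := by
  obtain ⟨c, hc⟩ := MinWiener.exists_optimal_union
  obtain ⟨f, hP⟩ := MinWiener.algorithm_spec c
  refine ⟨MinWiener.algorithm c, f, fun n G Q hG => ?_⟩
  obtain ⟨T, hT, hQT, hconn, hmin⟩ := hc (Fin n) G Q (MinWiener.pathG G) hG
    (MinWiener.pathG_isGeo hG)
  -- Padding needs a pair to repeat; `T` has one since its union is nonempty.
  have hT0 : T.Nonempty := by
    rw [Finset.nonempty_iff_ne_empty]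
    rintro rfl
    simpa using hconn.1
  obtain ⟨x, hx⟩ :=
    @MinWiener.exists_unionG_eq n (fun a b => Classical.propDecidable (a = b)) G T hT0 _ hT
  rw [← hx] at hQT hconn hmin
  obtain ⟨t, s, S, h1, h2, h3, h4, h5, h6⟩ := hP n G Q hG ⟨x, hconn, hQT⟩
  exact ⟨t, s, S, h1, h2, h3, MinWiener.isMinWienerConnector_induce h4 h5 fun S' hS' hQS' =>
    (h6 x hconn hQT).trans (hmin S' hS' hQS')⟩
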